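/- **Setting.** Let $m=n-r\ge 0$, and write $U=(u,v)\in\mathbb R^{m}\times\mathbb R^{r}$. Let $G\subset\mathbb R^{n}$ be open and let $F=(f,g)$, $Q=(0,q)$ be smooth on $G$. Consider $$U_t+F(U)_x=Q(U)/\epsilon\quad (x,t\ge 0),\qquad B(U(0,t);t)=0,$$ where $B$ is smooth (up to $t=0$) with $n^+$ components. Put $\mathcal E=\{U\in G:\ q(U)=0\}$ and let $U_0=(u_o,v_o)=U(0,0)$ be the corner state. Subscripts $u,v,U$ denote Jacobians and $^*$ the transpose. A right-stable (right-unstable) matrix of $A$ is a matrix whose columns are a basis of the sum of the generalized eigenspaces of $A$ for eigenvalues of negative (positive) real part; a left-unstable matrix of $A$ is the transpose of a right-unstable matrix of $A^*$. Assume: (I) There is a smooth symmetric positive definite $A_0(U)$ on $G$ with $A_0F_U=F_U^*A_0$ on $G$. On $\mathcal E$ there are invertible matrices $\mathcal P(U)$ ($n\times n$) and $T(U)$ ($r\times r$) with $\mathcal PQ_U=\mathrm{diag}(0,T)\mathcal P$ and $A_0Q_U+Q_U^*A_0\le-\mathcal P^*\mathrm{diag}(0,I_r)\mathcal P$, and moreover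 $A_0Q_U=Q_U^*A_0$. The matrix $q_v$ is invertible on $G$, and $q(u,v)=0$ determines $v=h(u)$ uniquely. (II) $q(U(x,0))=0$ for $x\ge0$, and $B(U_0;0)=0$. (III) $f_u+f_vh_u$ is invertible on $\mathcal E$. The multiplicity $n^o$ of the eigenvalue $0$ of $F_U(U)$ is positive and the same for all $U\in G$. With $P(U)=\begin{pmatrix}I&0\\-h_u(u)&I\end{pmatrix}$ put $$P^{-*}A_0P^{-1}=\begin{pmatrix}A_{01}&A_{012}\\A_{012}^*&A_{02}\end{pmatrix},\quad A_1=P^{-*}A_0F_UP^{-1}=\begin{pmatrix}A_{11}&A_{12}\\A_{12}^*&A_{22}\end{pmatrix},\quad \Sigma=A_{22}-A_{12}^*A_{11}^{-1}A_{12}.$$ The number $n^+$ of boundary conditions equals the number of positive eigenvalues of $A_1(U_0)$; $n_1^+$ denotes that of $A_{11}(U_0)$. Let $k=r-n^o$ and let $(\bar P_2,\bar P_0)$ (of sizes $r\times k$, $r\times n^o$) form an orthogonal matrix with $\Sigma(U_0)\bar P_0=0$ and $\bar P_2^*\Sigma(U_0)\bar P_2=\Lambda_2$ diagonal and invertible.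 (IV) (Modified GKC.) With all coefficients taken at $U_0$, put $S=A_{02}q_v$, $S_{ij}=\bar P_i^*(\eta S-\xi A_{02})\bar P_j$ for $i,j\in\{0,2\}$, and $$N_1=-\xi A_{11}^{-1}A_{12}\bar P_0S_{00}^{-1}\bar P_0^*A_{12}^*A_{11}^{-1}A_{01},\quad N_2=A_{11}^{-1}A_{12}N_5,\quad N_3=\xi\Lambda_2^{-1}(\bar P_2^*-S_{20}S_{00}^{-1}\bar P_0^*)A_{12}^*A_{11}^{-1}A_{01},$$ $$N_4=\Lambda_2^{-1}(S_{22}-S_{20}S_{00}^{-1}S_{02}),\quad N_5=\bar P_2-\bar P_0S_{00}^{-1}S_{02},\quad N_6=-\xi \bar P_0S_{00}^{-1}\bar P_0^*A_{12}^*A_{11}^{-1}A_{01},$$ $$M(\xi,\eta)=\begin{pmatrix}I+N_1&N_2\\0&I\end{pmatrix}^{-1}\begin{pmatrix}-\xi A_{11}^{-1}A_{01}&0\\N_3&N_4\end{pmatrix}.$$ There is $c_K>0$ such that for all $\eta\ge0$, all $\xi\in\mathbb C$ with $\mathrm{Re}\,\xi>0$ and every right-stable matrix $R$ of $M(\xi,\eta)$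 with $n^+$ columns, $$\Big|\det\Big\{B_U(U_0;0)P^{-1}(U_0)\begin{pmatrix}I&0\\N_6&N_5\end{pmatrix}R\Big\}\Big|\ge c_K\sqrt{\det(R^*R)},$$ where $R^*$ is the conjugate transpose. Let $R_1^U$ and $R_1^S$ be a right-unstable and a right-stable matrix of $(f_u+f_vh_u)(U_0)$, and let $u_o=R_1^U\alpha_o+R_1^S\beta_o$. Below, "$y=\psi(x)$ is the local solution of $\Phi(y,x)=0$ at $(y_0,x_0)$" means: $\psi$ is smooth near $x_0$, $\psi(x_0)=y_0$, and for all $(y,x)$ near $(y_0,x_0)$ one has $\Phi(y,x)=0\iff y=\psi(x)$. Write $U_\nu=(\mu+\tilde u_\infty,\ \nu+h(\mu+\tilde u_\infty))$, let $\hat S=\int_0^1q_v(\mu+\tilde u_\infty,\theta\nu+h(\mu+\tilde u_\infty))\,d\theta$, and let $C=A_{02}\hat S-A_{12}^*A_{11}^{-1}A_{012}\hat S$ with the blocks evaluated at $U_\nu$. **Conclusion.** 1. The equation $f(U_\nu)-f(\tilde u_\infty,h(\tilde u_\infty))=0$ has a local solution $\mu=\psi_1(\nu,\tilde u_\infty)$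 at $\mu=0$, $(\nu,\tilde u_\infty)=(0,u_o)$, with $\partial_\nu\psi_1(0,u_o)=-[(f_u+f_vh_u)^{-1}f_v](U_0)$ and $\partial_{\tilde u_\infty}\psi_1(0,u_o)=0$. 2. There are matrices $P_2(U)$, $P_0(U)$, smooth near $U_0$, with $P_j(U_0)=\bar P_j$, $P_0^*\Sigma=0$, $P_2^*\Sigma P_2$ invertible, $P_0^*P_0=I$, $P_2^*P_2=I$, $P_2^*P_0=0$. For any such matrices put $\nu=\bar P_2w_2+\bar P_0w_0$ and $\mu=\psi_1(\nu,\tilde u_\infty)$. Then $P_0(U_\nu)^*C\nu=0$ has a local solution $w_0=\psi_2(w_2,\tilde u_\infty)$ at $w_0=0$, $(w_2,\tilde u_\infty)=(0,u_o)$, with $\partial_{w_2}\psi_2(0,u_o)=-(\bar P_0^*S\bar P_0)^{-1}\bar P_0^*S\bar P_2$ and $\partial_{\tilde u_\infty}\psi_2(0,u_o)=0$. 3. With $w_0=\psi_2(w_2,\tilde u_\infty)$, put $K=\bar P_2^*\Sigma(U_\nu)(\bar P_2+\bar P_0\partial_{w_2}\psi_2)$ and $H(w_2,\tilde u_\infty)=K^{-1}\bar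 P_2^*C\nu$. Near $(0,u_o)$, $K$ is invertible, $H$ is smooth, and $H(0,\tilde u_\infty)=0$. Moreover $\partial_{w_2}H(0,u_o)=\Lambda_2^{-1}G_2$ with $G_2=\bar P_2^*S\bar P_2-\bar P_2^*S\bar P_0(\bar P_0^*S\bar P_0)^{-1}\bar P_0^*S\bar P_2$; this matrix has $n^+-n_1^+$ negative and $r-n^o-n^++n_1^+$ positive eigenvalues. There are neighbourhoods $V$ of $0$ and $N$ of $u_o$ and a smooth $\tilde S:V\times N\to\mathbb R^{\,r-n^o-n^++n_1^+}$ such that for every $\tilde u_\infty\in N$: $\tilde S(0,\tilde u_\infty)=0$; $\partial_{w_2}\tilde S(0,\tilde u_\infty)$ is a left-unstable matrix of $\partial_{w_2}H(0,\tilde u_\infty)$; and $\{w\in V:\tilde S(w,\tilde u_\infty)=0\}$ is the local stable manifold of $w_2'=H(w_2,\tilde u_\infty)$, i.e. the set of initial values of solutions on $\xi\ge0$ which stay in $V$ and tend to $0$. 4. (Reduced boundary condition.) With $\tilde u_\infty=R_1^U\alpha+R_1^S\beta$, $w_0=\psi_2(w_2,\tilde u_\infty)$ and $\mu=\psi_1(\nu,\tilde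 u_\infty)$, the system $$B(U_\nu;t)=0,\qquad \tilde S(w_2,\tilde u_\infty)=0$$ has a local solution $\alpha=\tilde\alpha(\beta,t)$, $w_2=\tilde w_2(\beta,t)$ at $(\alpha,w_2)=(\alpha_o,0)$, $(\beta,t)=(\beta_o,0)$. 5. (Boundary-layer.) There is a neighbourhood $\mathcal V$ of $U_0$ such that for all $(\beta,t)$ near $(\beta_o,0)$, with $\tilde u_\infty=R_1^U\tilde\alpha(\beta,t)+R_1^S\beta$: the equation $w_2'=H(w_2,\tilde u_\infty)$ has a solution on $\xi\ge0$ in $V$ with $w_2(0)=\tilde w_2(\beta,t)$ and $w_2(\xi)\to0$. The function $(\tilde u,\tilde v)=U_\nu$, with $w_0=\psi_2(w_2,\tilde u_\infty)$ and $\mu=\psi_1(\nu,\tilde u_\infty)$, takes values in $\mathcal V$ and is a boundary-layer: it is smooth and $$f(\tilde u,\tilde v)_\xi=0,\quad g(\tilde u,\tilde v)_\xi=q(\tilde u,\tilde v)\ \ (\xi\ge0),\qquad (\tilde u,\tilde v)(\infty)=(\tilde u_\infty,h(\tilde u_\infty))\in\mathcal E,\qquad B((\tilde u,\tilde v)(0);t)=0.$$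 Conversely, for $(\beta,t,\alpha)$ near $(\beta_o,0,\alpha_o)$, if there is a boundary-layer with values in $\mathcal V$ and limit $(\tilde u_\infty,h(\tilde u_\infty))$, $\tilde u_\infty=R_1^U\alpha+R_1^S\beta$, then $\alpha=\tilde\alpha(\beta,t)$. -/

import Mathlib

open Set Filter Topology
open scoped Matrix ContDiff

namespace RelaxationLayer

/-! ### Matrices: eigenvalue counts, stable and unstable matrices -/

/-- Number of positive (real) eigenvalues, counted with multiplicity. -/
noncomputable def numPosEig {ι : Type*} [Fintype ι] [DecidableEq ι] (A : Matrix ι ι ℝ) : ℕ :=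
  (A.charpoly.roots.filter (fun x => 0 < x)).card

/-- Number of negative (real) eigenvalues, counted with multiplicity. -/
noncomputable def numNegEig {ι : Type*} [Fintype ι] [DecidableEq ι] (A : Matrix ι ι ℝ) : ℕ :=
  (A.charpoly.roots.filter (fun x => x < 0)).card

/-- Multiplicity of the eigenvalue zero. -/
noncomputable def numZeroEig {ι : Type*} [Fintype ι] [DecidableEq ι] (A : Matrix ι ι ℝ) : ℕ :=
  A.charpoly.rootMultiplicity 0

/-- Entrywise complexification of a real matrix. -/
noncomputable def toC {ι κ : Type*} (A : Matrix ι κ ℝ) : Matrix ι κ ℂ :=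
  A.map (fun x => (x : ℂ))

/-- `R` is a right-stable matrix of `A`: its columns are a basis of the sum of the generalized
eigenspaces of `A` for the eigenvalues with negative real part. -/
def IsRightStable {ι κ : Type*} [Fintype ι] [DecidableEq ι]
    (A : Matrix ι ι ℂ) (R : Matrix ι κ ℂ) : Prop :=
  LinearIndependent ℂ (fun j : κ => fun i : ι => R i j) ∧
    Submodule.span ℂ (range (fun j : κ => fun i : ι => R i j)) =
      ⨆ z ∈ {z : ℂ | z.re < 0}, Module.End.maxGenEigenspace (Matrix.toLin' A) z

/-- `R` is a right-unstable matrix of `A`: the same with positive real parts. -/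
def IsRightUnstable {ι κ : Type*} [Fintype ι] [DecidableEq ι]
    (A : Matrix ι ι ℂ) (R : Matrix ι κ ℂ) : Prop :=
  LinearIndependent ℂ (fun j : κ => fun i : ι => R i j) ∧
    Submodule.span ℂ (range (fun j : κ => fun i : ι => R i j)) =
      ⨆ z ∈ {z : ℂ | 0 < z.re}, Module.End.maxGenEigenspace (Matrix.toLin' A) z

/-- `L` is a left-unstable matrix of `A`: the transpose of `L` is right-unstable for the
transpose of `A`. -/
def IsLeftUnstable {ι κ : Type*} [Fintype ι] [DecidableEq ι]
    (A : Matrix ι ι ℂ) (L : Matrix κ ι ℂ) : Prop :=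
  IsRightUnstable Aᵀ Lᵀ

/-! ### Partial Jacobian matrices -/

/-- Jacobian matrix of a map between coordinate spaces. -/
noncomputable def jac {a c : ℕ} (F : (Fin a → ℝ) → (Fin c → ℝ)) (x : Fin a → ℝ) :
    Matrix (Fin c) (Fin a) ℝ :=
  LinearMap.toMatrix' (fderiv ℝ F x).toLinearMap

/-- Partial Jacobian matrix in the first variable. -/
noncomputable def jac₁ {a b c : ℕ} (F : (Fin a → ℝ) × (Fin b → ℝ) → (Fin c → ℝ))
    (x : (Fin a → ℝ) × (Fin b → ℝ)) : Matrix (Fin c) (Fin a) ℝ :=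
  LinearMap.toMatrix'
    ((fderiv ℝ F x).comp (ContinuousLinearMap.inl ℝ (Fin a → ℝ) (Fin b → ℝ))).toLinearMap

/-- Partial Jacobian matrix in the second variable. -/
noncomputable def jac₂ {a b c : ℕ} (F : (Fin a → ℝ) × (Fin b → ℝ) → (Fin c → ℝ))
    (x : (Fin a → ℝ) × (Fin b → ℝ)) : Matrix (Fin c) (Fin b) ℝ :=
  LinearMap.toMatrix'
    ((fderiv ℝ F x).comp (ContinuousLinearMap.inr ℝ (Fin a → ℝ) (Fin b → ℝ))).toLinearMap

/-! ### The linear constant-coefficient problem and the modified GKC -/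

/-- Coefficients of the linear problem
`diag(A₀₁, A₀₂) V_t + [[A₁₁, A₁₂], [A₁₂ᵀ, A₂₂]] V_x = diag(0, S) V / ε`, `B V(0,t) = b(t)`. -/
structure LinearProblem (m r p : ℕ) where
  A01 : Matrix (Fin m) (Fin m) ℝ
  A02 : Matrix (Fin r) (Fin r) ℝ
  A11 : Matrix (Fin m) (Fin m) ℝ
  A12 : Matrix (Fin m) (Fin r) ℝ
  A22 : Matrix (Fin r) (Fin r) ℝ
  S : Matrix (Fin r) (Fin r) ℝ
  B : Matrix (Fin p) (Fin m ⊕ Fin r) ℝ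

namespace LinearProblem

variable {m r p k n₀ : ℕ}

/-- The Schur complement `A₂₂ - A₁₂ᵀ A₁₁⁻¹ A₁₂`. -/
noncomputable def schur (L : LinearProblem m r p) : Matrix (Fin r) (Fin r) ℝ :=
  L.A22 - L.A12ᵀ * L.A11⁻¹ * L.A12

/-- `(P₂, P₀)` is an orthogonal matrix which diagonalizes the Schur complement to `diag(Λ₂, 0)`
with an invertible diagonal matrix `Λ₂`. -/
structure IsSpectralFrame (L : LinearProblem m r p)
    (P₂ : Matrix (Fin r) (Fin k) ℝ) (P₀ : Matrix (Fin r) (Fin n₀) ℝ) : Prop where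
  orth₂ : P₂ᵀ * P₂ = 1
  orth₀ : P₀ᵀ * P₀ = 1
  orth₂₀ : P₂ᵀ * P₀ = 0
  complete : P₂ * P₂ᵀ + P₀ * P₀ᵀ = 1
  kernel : L.schur * P₀ = 0
  diag : ∃ d : Fin k → ℝ, (∀ i, d i ≠ 0) ∧ P₂ᵀ * L.schur * P₂ = Matrix.diagonal d

/-- `Λ₂ = P₂ᵀ (A₂₂ - A₁₂ᵀ A₁₁⁻¹ A₁₂) P₂`. -/
noncomputable def Lam2 (L : LinearProblem m r p) (P₂ : Matrix (Fin r) (Fin k) ℝ) :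
    Matrix (Fin k) (Fin k) ℝ :=
  P₂ᵀ * L.schur * P₂

/-- `G₂ = P₂ᵀ S P₂ - P₂ᵀ S P₀ (P₀ᵀ S P₀)⁻¹ P₀ᵀ S P₂`. -/
noncomputable def G2 (L : LinearProblem m r p)
    (P₂ : Matrix (Fin r) (Fin k) ℝ) (P₀ : Matrix (Fin r) (Fin n₀) ℝ) : Matrix (Fin k) (Fin k) ℝ :=
  P₂ᵀ * L.S * P₂ - P₂ᵀ * L.S * P₀ * (P₀ᵀ * L.S * P₀)⁻¹ * (P₀ᵀ * L.S * P₂)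

/-- `S_ij = P_iᵀ (η S - ξ A₀₂) P_j`. -/
noncomputable def Sij (L : LinearProblem m r p) {a b : ℕ}
    (Pi : Matrix (Fin r) (Fin a) ℝ) (Pj : Matrix (Fin r) (Fin b) ℝ) (ξ : ℂ) (η : ℝ) :
    Matrix (Fin a) (Fin b) ℂ :=
  toC Piᵀ * ((η : ℂ) • toC L.S - ξ • toC L.A02) * toC Pj

variable (L : LinearProblem m r p)
  (P₂ : Matrix (Fin r) (Fin k) ℝ) (P₀ : Matrix (Fin r) (Fin n₀) ℝ) (ξ : ℂ) (η : ℝ)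

noncomputable def N1 : Matrix (Fin m) (Fin m) ℂ :=
  -(ξ • (toC (L.A11⁻¹ * L.A12 * P₀) * (L.Sij P₀ P₀ ξ η)⁻¹ *
    toC (P₀ᵀ * L.A12ᵀ * L.A11⁻¹ * L.A01)))

noncomputable def N2 : Matrix (Fin m) (Fin k) ℂ :=
  toC (L.A11⁻¹ * L.A12) * (toC P₂ - toC P₀ * (L.Sij P₀ P₀ ξ η)⁻¹ * L.Sij P₀ P₂ ξ η)

noncomputable def N3 : Matrix (Fin k) (Fin m) ℂ :=
  ξ • (toC (L.Lam2 P₂)⁻¹ * (toC P₂ᵀ - L.Sij P₂ P₀ ξ η * (L.Sij P₀ P₀ ξ η)⁻¹ * toC P₀ᵀ) *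
    toC (L.A12ᵀ * L.A11⁻¹ * L.A01))

noncomputable def N4 : Matrix (Fin k) (Fin k) ℂ :=
  toC (L.Lam2 P₂)⁻¹ *
    (L.Sij P₂ P₂ ξ η - L.Sij P₂ P₀ ξ η * (L.Sij P₀ P₀ ξ η)⁻¹ * L.Sij P₀ P₂ ξ η)

noncomputable def N5 : Matrix (Fin r) (Fin k) ℂ :=
  toC P₂ - toC P₀ * (L.Sij P₀ P₀ ξ η)⁻¹ * L.Sij P₀ P₂ ξ η

noncomputable def N6 : Matrix (Fin r) (Fin m) ℂ :=
  -(ξ • (toC P₀ * (L.Sij P₀ P₀ ξ η)⁻¹ * toC (P₀ᵀ * L.A12ᵀ * L.A11⁻¹ * L.A01)))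

/-- The matrix `M(ξ, η)` of the resolvent ordinary differential equation. -/
noncomputable def M : Matrix (Fin m ⊕ Fin k) (Fin m ⊕ Fin k) ℂ :=
  (Matrix.fromBlocks (1 + L.N1 P₀ ξ η) (L.N2 P₂ P₀ ξ η) 0 1)⁻¹ *
    Matrix.fromBlocks (-(ξ • toC (L.A11⁻¹ * L.A01))) 0 (L.N3 P₂ P₀ ξ η) (L.N4 P₂ P₀ ξ η)

/-- The matrix `[[1, 0], [N₆, N₅]]`. -/
noncomputable def traceMat : Matrix (Fin m ⊕ Fin r) (Fin m ⊕ Fin k) ℂ :=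
  Matrix.fromBlocks 1 0 (L.N6 P₀ ξ η) (L.N5 P₂ P₀ ξ η)

/-- The modified generalized Kreiss condition. Right-stable matrices of `M(ξ, η)` have as many
columns as `B` has rows; the inequality does not depend on which of them is used. -/
def ModifiedGKC : Prop :=
  ∃ cK : ℝ, 0 < cK ∧ ∀ η : ℝ, 0 ≤ η → ∀ ξ : ℂ, 0 < ξ.re →
    ∀ R : Matrix (Fin m ⊕ Fin k) (Fin p) ℂ, IsRightStable (L.M P₂ P₀ ξ η) R →
      cK * Real.sqrt (Rᴴ * R).det.re ≤
        ‖(toC L.B * L.traceMat P₂ P₀ ξ η * R).det‖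

end LinearProblem

/-! ### The nonlinear relaxation problem -/

/-- States `U = (u, v)`. -/
abbrev State (m r : ℕ) : Type := (Fin m → ℝ) × (Fin r → ℝ)

/-- The problem `u_t + f(u,v)_x = 0`, `v_t + g(u,v)_x = q(u,v)/ε` in `x, t ≥ 0` with smooth
`f`, `g`, `q` on an open state space `G`, the boundary condition `B(U(0,t);t) = 0` (with `B` smooth
up to `t = 0`) and initial data `init` on `x ≥ 0`. -/
structure RelaxationProblem (m r p : ℕ) where
  G : Set (State m r)
  f : State m r → (Fin m → ℝ)
  g : State m r → (Fin r → ℝ)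
  q : State m r → (Fin r → ℝ)
  B : State m r × ℝ → (Fin p → ℝ)
  init : ℝ → State m r
  isOpen_G : IsOpen G
  smooth_f : ContDiffOn ℝ ∞ f G
  smooth_g : ContDiffOn ℝ ∞ g G
  smooth_q : ContDiffOn ℝ ∞ q G
  smooth_B : ∃ O : Set (State m r × ℝ), IsOpen O ∧ G ×ˢ Ici (0 : ℝ) ⊆ O ∧ ContDiffOn ℝ ∞ B O
  init_mem : ∀ x, 0 ≤ x → init x ∈ G

namespace RelaxationProblem

variable {m r p k n₀ n₁ mS : ℕ}

/-- The equilibrium manifold. -/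
def equil (S : RelaxationProblem m r p) : Set (State m r) := {U | U ∈ S.G ∧ S.q U = 0}

/-- The state at the corner `(x,t) = (0,0)`. -/
def corner (S : RelaxationProblem m r p) : State m r := S.init 0

/-- The Jacobian matrix of `F = (f, g)`. -/
noncomputable def FU (S : RelaxationProblem m r p) (U : State m r) :
    Matrix (Fin m ⊕ Fin r) (Fin m ⊕ Fin r) ℝ :=
  Matrix.fromBlocks (jac₁ S.f U) (jac₂ S.f U) (jac₁ S.g U) (jac₂ S.g U)

/-- The Jacobian matrix of `Q = (0, q)`. -/
noncomputable def QU (S : RelaxationProblem m r p) (U : State m r) :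
    Matrix (Fin m ⊕ Fin r) (Fin m ⊕ Fin r) ℝ :=
  Matrix.fromBlocks 0 0 (jac₁ S.q U) (jac₂ S.q U)

/-- The structural stability condition, with smooth symmetrizer `A₀`. -/
structure StructuralStability (S : RelaxationProblem m r p)
    (A₀ : State m r → Matrix (Fin m ⊕ Fin r) (Fin m ⊕ Fin r) ℝ) : Prop where
  smooth : ∀ i j, ContDiffOn ℝ ∞ (fun U => A₀ U i j) S.G
  posDef : ∀ U ∈ S.G, (A₀ U).PosDef
  symmetrizer : ∀ U ∈ S.G, A₀ U * S.FU U = (S.FU U)ᵀ * A₀ U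
  coupling : ∃ (P : State m r → Matrix (Fin m ⊕ Fin r) (Fin m ⊕ Fin r) ℝ)
      (T : State m r → Matrix (Fin r) (Fin r) ℝ), ∀ U ∈ S.equil,
    IsUnit (P U) ∧ IsUnit (T U) ∧
    P U * S.QU U = Matrix.fromBlocks 0 0 0 (T U) * P U ∧
    (-((P U)ᵀ * Matrix.fromBlocks 0 0 0 1 * P U) -
      (A₀ U * S.QU U + (S.QU U)ᵀ * A₀ U)).PosSemidef

/-- Structural stability, symmetry of `A₀ Q_U` on the equilibrium manifold, invertibility of `q_v`,
and `q(u,v) = 0` determines `v = h(u)` uniquely (values of `h` at those `u` for which there is no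
equilibrium state `(u,v)` in `G` are irrelevant). -/
structure AssumptionI (S : RelaxationProblem m r p)
    (A₀ : State m r → Matrix (Fin m ⊕ Fin r) (Fin m ⊕ Fin r) ℝ)
    (h : (Fin m → ℝ) → (Fin r → ℝ)) : Prop where
  stability : S.StructuralStability A₀
  symm_source : ∀ U ∈ S.equil, A₀ U * S.QU U = (S.QU U)ᵀ * A₀ U
  qv_invertible : ∀ U ∈ S.G, IsUnit (jac₂ S.q U)
  equil_graph : ∀ U ∈ S.G, S.q U = 0 → U.2 = h U.1

/-- The initial data are in equilibrium and consistent with the boundary condition. -/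
structure AssumptionII (S : RelaxationProblem m r p) : Prop where
  init_equil : ∀ x, 0 ≤ x → S.q (S.init x) = 0
  consistent : S.B (S.corner, 0) = 0

/-- The matrix `f_u + f_v h_u`. -/
noncomputable def fuh (S : RelaxationProblem m r p) (h : (Fin m → ℝ) → (Fin r → ℝ))
    (U : State m r) : Matrix (Fin m) (Fin m) ℝ :=
  jac₁ S.f U + jac₂ S.f U * jac h U.1

/-- The boundary is non-characteristic for the equilibrium system, and it is characteristic of
constant multiplicity `n₀` for the relaxation system. -/
structure AssumptionIII (S : RelaxationProblem m r p) (h : (Fin m → ℝ) → (Fin r → ℝ))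
    (n₀ : ℕ) : Prop where
  noncharacteristic : ∀ U ∈ S.equil, IsUnit (S.fuh h U)
  characteristic : 0 < n₀
  multiplicity : ∀ U ∈ S.G, numZeroEig (S.FU U) = n₀

/-- `P(U) = [[1, 0], [-h_u(u), 1]]`. -/
noncomputable def PU (h : (Fin m → ℝ) → (Fin r → ℝ)) (U : State m r) :
    Matrix (Fin m ⊕ Fin r) (Fin m ⊕ Fin r) ℝ :=
  Matrix.fromBlocks 1 0 (-(jac h U.1)) 1

/-- `P⁻ᵀ A₀ P⁻¹`, with blocks `A₀₁`, `A₀₁₂`, `A₀₁₂ᵀ`, `A₀₂`. -/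
noncomputable def tA0 (A₀ : State m r → Matrix (Fin m ⊕ Fin r) (Fin m ⊕ Fin r) ℝ)
    (h : (Fin m → ℝ) → (Fin r → ℝ)) (U : State m r) :
    Matrix (Fin m ⊕ Fin r) (Fin m ⊕ Fin r) ℝ :=
  ((PU h U)⁻¹)ᵀ * A₀ U * (PU h U)⁻¹

/-- `A₁ = P⁻ᵀ A₀ F_U P⁻¹`, with blocks `A₁₁`, `A₁₂`, `A₁₂ᵀ`, `A₂₂`. -/
noncomputable def A1 (S : RelaxationProblem m r p)
    (A₀ : State m r → Matrix (Fin m ⊕ Fin r) (Fin m ⊕ Fin r) ℝ)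
    (h : (Fin m → ℝ) → (Fin r → ℝ)) (U : State m r) :
    Matrix (Fin m ⊕ Fin r) (Fin m ⊕ Fin r) ℝ :=
  ((PU h U)⁻¹)ᵀ * A₀ U * S.FU U * (PU h U)⁻¹

/-- The Jacobian matrix of `B(·;0)` in the state variables. -/
noncomputable def BU (S : RelaxationProblem m r p) (U : State m r) :
    Matrix (Fin p) (Fin m ⊕ Fin r) ℝ :=
  Matrix.fromCols (jac₁ (fun W => S.B (W, 0)) U) (jac₂ (fun W => S.B (W, 0)) U)

/-- The problem frozen at the state `U` and time `0`, in the variables `V = P(U) U`. -/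
noncomputable def frozen (S : RelaxationProblem m r p)
    (A₀ : State m r → Matrix (Fin m ⊕ Fin r) (Fin m ⊕ Fin r) ℝ)
    (h : (Fin m → ℝ) → (Fin r → ℝ)) (U : State m r) : LinearProblem m r p where
  A01 := (tA0 A₀ h U).toBlocks₁₁
  A02 := (tA0 A₀ h U).toBlocks₂₂
  A11 := (S.A1 A₀ h U).toBlocks₁₁
  A12 := (S.A1 A₀ h U).toBlocks₁₂
  A22 := (S.A1 A₀ h U).toBlocks₂₂
  S := (tA0 A₀ h U).toBlocks₂₂ * jac₂ S.q U
  B := S.BU U * (PU h U)⁻¹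

/-! ### Reduction of the inner equations -/

/-- The state `U_ν = (μ + u∞, ν + h(μ + u∞))`. -/
def layerState (h : (Fin m → ℝ) → (Fin r → ℝ)) (μ : Fin m → ℝ) (ν : Fin r → ℝ)
    (uinf : Fin m → ℝ) : State m r :=
  (μ + uinf, ν + h (μ + uinf))

/-- `φ₁(μ, ν, u∞)`. -/
def phi1 (S : RelaxationProblem m r p) (h : (Fin m → ℝ) → (Fin r → ℝ)) (μ : Fin m → ℝ)
    (x : (Fin r → ℝ) × (Fin m → ℝ)) : Fin m → ℝ :=
  S.f (layerState h μ x.1 x.2) - S.f (x.2, h x.2)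

/-- `Ŝ = ∫₀¹ q_v(μ + u∞, θ ν + h(μ + u∞)) dθ`. -/
noncomputable def hatS (S : RelaxationProblem m r p) (h : (Fin m → ℝ) → (Fin r → ℝ))
    (μ : Fin m → ℝ) (ν : Fin r → ℝ) (uinf : Fin m → ℝ) : Matrix (Fin r) (Fin r) ℝ :=
  Matrix.of fun i j => ∫ θ in (0 : ℝ)..1, jac₂ S.q (layerState h μ (θ • ν) uinf) i j

/-- `A₀₂ Ŝ - A₁₂ᵀ A₁₁⁻¹ A₀₁₂ Ŝ`, with the blocks evaluated at `U_ν`. -/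
noncomputable def rhsCoef (S : RelaxationProblem m r p)
    (A₀ : State m r → Matrix (Fin m ⊕ Fin r) (Fin m ⊕ Fin r) ℝ)
    (h : (Fin m → ℝ) → (Fin r → ℝ))
    (μ : Fin m → ℝ) (ν : Fin r → ℝ) (uinf : Fin m → ℝ) : Matrix (Fin r) (Fin r) ℝ :=
  let U := layerState h μ ν uinf
  (tA0 A₀ h U).toBlocks₂₂ * S.hatS h μ ν uinf -
    ((S.A1 A₀ h U).toBlocks₁₂)ᵀ * ((S.A1 A₀ h U).toBlocks₁₁)⁻¹ * (tA0 A₀ h U).toBlocks₁₂ *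
      S.hatS h μ ν uinf

/-- `Q₀`, `Q₂` are smooth orthonormal frames, near the corner state, of the kernel of the Schur
complement of `A₁(U)` and of its orthogonal complement; they extend `P₀`, `P₂`. -/
def IsLocalFrame (S : RelaxationProblem m r p)
    (A₀ : State m r → Matrix (Fin m ⊕ Fin r) (Fin m ⊕ Fin r) ℝ)
    (h : (Fin m → ℝ) → (Fin r → ℝ))
    (P₂ : Matrix (Fin r) (Fin k) ℝ) (P₀ : Matrix (Fin r) (Fin n₀) ℝ)
    (Q₂ : State m r → Matrix (Fin r) (Fin k) ℝ) (Q₀ : State m r → Matrix (Fin r) (Fin n₀) ℝ) :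
    Prop :=
  Q₂ S.corner = P₂ ∧ Q₀ S.corner = P₀ ∧
  ∃ O : Set (State m r), IsOpen O ∧ S.corner ∈ O ∧ O ⊆ S.G ∧
    (∀ i j, ContDiffOn ℝ ∞ (fun U => Q₂ U i j) O) ∧
    (∀ i j, ContDiffOn ℝ ∞ (fun U => Q₀ U i j) O) ∧
    ∀ U ∈ O, IsUnit (S.A1 A₀ h U).toBlocks₁₁ ∧
      (Q₀ U)ᵀ * (S.frozen A₀ h U).schur = 0 ∧
      IsUnit ((Q₂ U)ᵀ * (S.frozen A₀ h U).schur * Q₂ U) ∧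
      (Q₀ U)ᵀ * Q₀ U = 1 ∧ (Q₂ U)ᵀ * Q₂ U = 1 ∧ (Q₂ U)ᵀ * Q₀ U = 0

/-- `φ₂(w₂, w₀, u∞)`. -/
noncomputable def phi2 (S : RelaxationProblem m r p)
    (A₀ : State m r → Matrix (Fin m ⊕ Fin r) (Fin m ⊕ Fin r) ℝ)
    (h : (Fin m → ℝ) → (Fin r → ℝ))
    (P₂ : Matrix (Fin r) (Fin k) ℝ) (P₀ : Matrix (Fin r) (Fin n₀) ℝ)
    (Q₀ : State m r → Matrix (Fin r) (Fin n₀) ℝ)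
    (ψ₁ : (Fin r → ℝ) × (Fin m → ℝ) → (Fin m → ℝ))
    (w₀ : Fin n₀ → ℝ) (x : (Fin k → ℝ) × (Fin m → ℝ)) : Fin n₀ → ℝ :=
  let ν := P₂ *ᵥ x.1 + P₀ *ᵥ w₀
  let μ := ψ₁ (ν, x.2)
  ((Q₀ (layerState h μ ν x.2))ᵀ * S.rhsCoef A₀ h μ ν x.2) *ᵥ ν

/-- `ν = P₂ w₂ + P₀ ψ₂(w₂, u∞)`. -/
def nuOf (P₂ : Matrix (Fin r) (Fin k) ℝ) (P₀ : Matrix (Fin r) (Fin n₀) ℝ)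
    (ψ₂ : (Fin k → ℝ) × (Fin m → ℝ) → (Fin n₀ → ℝ)) (x : (Fin k → ℝ) × (Fin m → ℝ)) :
    Fin r → ℝ :=
  P₂ *ᵥ x.1 + P₀ *ᵥ ψ₂ x

/-- The state `(μ + u∞, ν + h(μ + u∞))` with `ν` as above and `μ = ψ₁(ν, u∞)`. -/
def profileState (h : (Fin m → ℝ) → (Fin r → ℝ))
    (P₂ : Matrix (Fin r) (Fin k) ℝ) (P₀ : Matrix (Fin r) (Fin n₀) ℝ)
    (ψ₁ : (Fin r → ℝ) × (Fin m → ℝ) → (Fin m → ℝ))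
    (ψ₂ : (Fin k → ℝ) × (Fin m → ℝ) → (Fin n₀ → ℝ)) (x : (Fin k → ℝ) × (Fin m → ℝ)) :
    State m r :=
  layerState h (ψ₁ (nuOf P₂ P₀ ψ₂ x, x.2)) (nuOf P₂ P₀ ψ₂ x) x.2

/-- `K(w₂, u∞) = P₂ᵀ (A₂₂ - A₁₂ᵀ A₁₁⁻¹ A₁₂) [P₂ + P₀ ∂ψ₂/∂w₂]`. -/
noncomputable def Kmat (S : RelaxationProblem m r p)
    (A₀ : State m r → Matrix (Fin m ⊕ Fin r) (Fin m ⊕ Fin r) ℝ)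
    (h : (Fin m → ℝ) → (Fin r → ℝ))
    (P₂ : Matrix (Fin r) (Fin k) ℝ) (P₀ : Matrix (Fin r) (Fin n₀) ℝ)
    (ψ₁ : (Fin r → ℝ) × (Fin m → ℝ) → (Fin m → ℝ))
    (ψ₂ : (Fin k → ℝ) × (Fin m → ℝ) → (Fin n₀ → ℝ)) (x : (Fin k → ℝ) × (Fin m → ℝ)) :
    Matrix (Fin k) (Fin k) ℝ :=
  P₂ᵀ * (S.frozen A₀ h (profileState h P₂ P₀ ψ₁ ψ₂ x)).schur * (P₂ + P₀ * jac₁ ψ₂ x)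

/-- The reduced vector field `H(w₂, u∞)`. -/
noncomputable def Hfield (S : RelaxationProblem m r p)
    (A₀ : State m r → Matrix (Fin m ⊕ Fin r) (Fin m ⊕ Fin r) ℝ)
    (h : (Fin m → ℝ) → (Fin r → ℝ))
    (P₂ : Matrix (Fin r) (Fin k) ℝ) (P₀ : Matrix (Fin r) (Fin n₀) ℝ)
    (ψ₁ : (Fin r → ℝ) × (Fin m → ℝ) → (Fin m → ℝ))
    (ψ₂ : (Fin k → ℝ) × (Fin m → ℝ) → (Fin n₀ → ℝ)) (x : (Fin k → ℝ) × (Fin m → ℝ)) :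
    Fin k → ℝ :=
  let ν := nuOf P₂ P₀ ψ₂ x
  ((S.Kmat A₀ h P₂ P₀ ψ₁ ψ₂ x)⁻¹ * P₂ᵀ * S.rhsCoef A₀ h (ψ₁ (ν, x.2)) ν x.2) *ᵥ ν

/-- `u∞ = R₁ᵁ α + R₁ˢ β`. -/
def uInf (RU : Matrix (Fin m) (Fin n₁) ℝ) (RS : Matrix (Fin m) (Fin mS) ℝ)
    (α : Fin n₁ → ℝ) (β : Fin mS → ℝ) : Fin m → ℝ :=
  RU *ᵥ α + RS *ᵥ β

/-- `U` is a boundary-layer with limit `(u∞, h(u∞))` at time `t`: a smooth solution of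
`f(U)' = 0`, `g(U)' = q(U)` on `ξ ≥ 0` which tends to the equilibrium state `(u∞, h(u∞))` and
satisfies `B(U(0);t) = 0`. -/
structure IsBoundaryLayer (S : RelaxationProblem m r p) (h : (Fin m → ℝ) → (Fin r → ℝ))
    (uinf : Fin m → ℝ) (t : ℝ) (U : ℝ → State m r) : Prop where
  smooth : ContDiffOn ℝ ∞ U (Ici 0)
  mem : ∀ ξ, 0 ≤ ξ → U ξ ∈ S.G
  inner_f : ∀ ξ, 0 ≤ ξ → HasDerivWithinAt (fun s => S.f (U s)) 0 (Ici 0) ξ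
  inner_g : ∀ ξ, 0 ≤ ξ → HasDerivWithinAt (fun s => S.g (U s)) (S.q (U ξ)) (Ici 0) ξ
  limit_equil : (uinf, h uinf) ∈ S.equil
  matching : Tendsto U atTop (𝓝 (uinf, h uinf))
  boundary : S.B (U 0, t) = 0

end RelaxationProblem

/-! ### Implicit functions and local stable manifolds -/

/-- `ψ` is the smooth local solution `y = ψ(x)`, unique near `(y₀, x₀)`, of `Φ(y, x) = 0` with
`ψ(x₀) = y₀`. -/
def IsImplicitSolution {X Y Z : Type*} [NormedAddCommGroup X] [NormedSpace ℝ X]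
    [NormedAddCommGroup Y] [NormedSpace ℝ Y] [Zero Z]
    (Φ : Y → X → Z) (y₀ : Y) (x₀ : X) (ψ : X → Y) : Prop :=
  ψ x₀ = y₀ ∧ ∃ (O : Set X) (V : Set Y), IsOpen O ∧ x₀ ∈ O ∧ IsOpen V ∧ y₀ ∈ V ∧
    ContDiffOn ℝ ∞ ψ O ∧ MapsTo ψ O V ∧ ∀ x ∈ O, ∀ y ∈ V, Φ y x = 0 ↔ y = ψ x

/-- `W` solves `W' = X(W)` on `ξ ≥ 0`, stays in `V` and tends to `0`. -/
def IsDecayingOrbit {k : ℕ} (X : (Fin k → ℝ) → (Fin k → ℝ)) (V : Set (Fin k → ℝ))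
    (W : ℝ → (Fin k → ℝ)) : Prop :=
  (∀ ξ, 0 ≤ ξ → W ξ ∈ V ∧ HasDerivWithinAt W (X (W ξ)) (Ici 0) ξ) ∧ Tendsto W atTop (𝓝 0)

/-- The local stable manifold of the critical point `0` of `X` in the neighbourhood `V`. -/
def localStableSet {k : ℕ} (X : (Fin k → ℝ) → (Fin k → ℝ)) (V : Set (Fin k → ℝ)) :
    Set (Fin k → ℝ) :=
  {w | ∃ W : ℝ → (Fin k → ℝ), W 0 = w ∧ IsDecayingOrbit X V W}

end RelaxationLayer

/-! Write `ν = v - h(u)`. After multiplication by the symmetrizer and elimination of the slow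
derivative through the invertible block `A₁₁`, the layer equations `f(U)' = 0`, `g(U)' = q(U)`
become `Σ ν' = C q`, where `Σ` is the Schur complement and `C` is invertible near the corner
(`IsSmoothState.schur_mulVec`). Constancy of `f` determines `μ`. The constant multiplicity of the
eigenvalue zero forces `Σ` to have an `n₀`-dimensional kernel at every nearby state
(`schur_mul_kernelFrame`). The component along this kernel is therefore an algebraic equation. It
can be solved for `w₀` because `S` is negative definite. The remaining component is the ordinary
differential equation `w₂' = H`. Conversely, local uniqueness of the implicit functions shows that
every layer close to the corner arises in this way (`hasDerivWithinAt_g_profile`,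
`IsBoundaryLayer.exists_orbit`).

The linearization of `H` at the corner is `Λ₂⁻¹ G₂`, with `Λ₂` symmetric invertible and `G₂`
negative definite. It is diagonalizable with nonzero real eigenvalues, and Sylvester's law of
inertia counts their signs. The stable manifold is obtained by the Lyapunov–Perron method: bounded
solutions are the zeros of an integral equation on bounded continuous functions, which is smooth in
the data and in the parameter and is solved by the implicit function theorem (`exists_stable_graph`,
`exists_local_stable_manifold`).

The reduced boundary condition has as many equations as unknowns, so the implicit function theorem
needs only injectivity of the linearization (`exists_reduced_boundary_condition`). A kernel element
pairs an unstable direction `x` of `f_u + f_v h_u` with a decaying fast direction `y`. Both are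
limits of vectors in the stable subspaces of `M(ξ, 1)` as `ξ → 0+` through real values: `x` belongs
to eigenvalues of order `ξ` and `y` to eigenvalues of order one. The symmetrizer of `M(ξ, 1)` yields
real spectrum, stable subspaces of the right dimension, and an estimate of the distance from an
approximate eigenvector to the stable subspace. The uniform determinant bound of the modified Kreiss
condition survives the limit by compactness of orthonormal bases, and excludes a nonzero kernel
element (`ModifiedGKC.injective`). -/

namespace RelaxationLayer

/-! ### The smooth implicit function theorem -/

section ImplicitFunction

variable {X Y Z : Type*} [NormedAddCommGroup X] [NormedSpace ℝ X] [CompleteSpace X]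
  [NormedAddCommGroup Y] [NormedSpace ℝ Y] [CompleteSpace Y]
  [NormedAddCommGroup Z] [NormedSpace ℝ Z] [CompleteSpace Z]

/-- `ContDiffAt ℝ ∞` at one point does not provide a single neighbourhood of smoothness. The theorem
is therefore applied again at every nearby zero, and the function obtained there is identified with
`ψ` by local uniqueness, which gives a common open set. -/
theorem exists_isImplicitSolution {Φ : Y → X → Z} {y₀ : Y} {x₀ : X} {Dy : Y ≃L[ℝ] Z}
    {Dx : X →L[ℝ] Z}
    (hs : ∀ᶠ p : X × Y in 𝓝 (x₀, y₀), ContDiffAt ℝ ∞ (fun p : X × Y => Φ p.2 p.1) p)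
    (h0 : Φ y₀ x₀ = 0)
    (hD : HasFDerivAt (fun p : X × Y => Φ p.2 p.1) (Dx.coprod (Dy : Y →L[ℝ] Z)) (x₀, y₀)) :
    ∃ ψ : X → Y, IsImplicitSolution Φ y₀ x₀ ψ ∧
      HasFDerivAt ψ (-((Dy.symm : Z →L[ℝ] Y) ∘L Dx)) x₀ := by
  set f : X × Y → Z := fun p => Φ p.2 p.1 with hf
  have htop : (∞ : WithTop ℕ∞) ≠ 0 := by simp
  have cdf : ContDiffAt ℝ ∞ f (x₀, y₀) := hs.self_of_nhds
  have hDy : fderiv ℝ f (x₀, y₀) ∘L .inr ℝ X Y = (Dy : Y →L[ℝ] Z) := by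
    rw [hD.fderiv]; simp
  have hDx : fderiv ℝ f (x₀, y₀) ∘L .inl ℝ X Y = Dx := by
    rw [hD.fderiv]; simp
  have hinv : (fderiv ℝ f (x₀, y₀) ∘L .inr ℝ X Y).IsInvertible := by
    rw [hDy]; exact ContinuousLinearMap.isInvertible_equiv
  set ψ := cdf.implicitFunction htop hinv with hψ
  have hψ0 : ψ x₀ = y₀ := cdf.implicitFunction_apply_self htop hinv
  have hψd : HasFDerivAt ψ (-((Dy.symm : Z →L[ℝ] Y) ∘L Dx)) x₀ := by
    have := (cdf.hasStrictFDerivAt_implicitFunction htop hinv).hasFDerivAt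
    rw [hDx, hDy, ContinuousLinearMap.inverse_equiv] at this
    simpa using this
  have e1 : ∀ᶠ v in 𝓝 (x₀, y₀), f v = 0 ↔ ψ v.1 = v.2 := by
    have := cdf.eventually_apply_eq_iff_implicitFunction htop hinv
    have h0' : f (x₀, y₀) = 0 := h0
    rwa [h0'] at this
  have e2 : ∀ᶠ v in 𝓝 (x₀, y₀), (fderiv ℝ f v ∘L .inr ℝ X Y).IsInvertible := by
    have hc : ContinuousAt (fun v => fderiv ℝ f v ∘L .inr ℝ X Y) (x₀, y₀) :=
      (cdf.continuousAt_fderiv (by simp)).clm_comp continuousAt_const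
    -- Invertible operators form an open set, so invertibility of the partial derivative persists
    -- near the base point.
    have := hc.eventually (p := fun A => A ∈ range ((↑) : (Y ≃L[ℝ] Z) → (Y →L[ℝ] Z))) (by
      beta_reduce; rw [hDy]; exact ContinuousLinearEquiv.nhds Dy)
    exact this
  have e3 : ∀ᶠ v in 𝓝 (x₀, y₀), f v = 0 → ContDiffAt ℝ ∞ ψ v.1 := by
    filter_upwards [e1.eventually_nhds, e2, hs] with v h1 h2 h3 hv
    have hc := h3.contDiffAt_implicitFunction htop h2
    refine hc.congr_of_eventuallyEq ?_
    have hself := h3.implicitFunction_apply_self htop h2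
    have ht : Tendsto (fun x => (x, h3.implicitFunction htop h2 x)) (𝓝 v.1) (𝓝 v) := by
      have := (continuousAt_id (x := v.1)).prodMk hc.continuousAt
      rw [ContinuousAt, id, hself] at this
      exact this
    filter_upwards [ht.eventually h1, h3.eventually_apply_implicitFunction htop h2] with x hx1 hx2
    exact hx1.1 (hx2.trans hv)
  obtain ⟨A, hA, V, hV, hAV⟩ := eventually_prod_iff.1 (nhds_prod_eq (x := x₀) (y := y₀) ▸ e1.and e3)
  obtain ⟨A', hA', hAo, hxA⟩ := eventually_nhds_iff.1 hA
  obtain ⟨V', hV', hVo, hyV⟩ := eventually_nhds_iff.1 hV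
  have hmem : A' ∩ ψ ⁻¹' V' ∈ 𝓝 x₀ :=
    inter_mem (hAo.mem_nhds hxA) (hψd.continuousAt (hVo.mem_nhds (by rw [hψ0]; exact hyV)))
  refine ⟨ψ, ⟨hψ0, interior (A' ∩ ψ ⁻¹' V'), V', isOpen_interior, mem_interior_iff_mem_nhds.2 hmem,
    hVo, hyV, ?_, fun x hx => (interior_subset hx).2, ?_⟩, hψd⟩
  · intro x hx
    obtain ⟨hx1, hx2⟩ := interior_subset hx
    have := hAV (hA' x hx1) (hV' _ hx2)
    exact (this.2 (this.1.2 rfl)).contDiffWithinAt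
  · intro x hx y hy
    rw [eq_comm (a := y)]
    exact (hAV (hA' x (interior_subset hx).1) (hV' _ hy)).1

end ImplicitFunction

/-! ### Smoothness of composition operators on bounded continuous functions -/

section Composition

open BoundedContinuousFunction

variable {α : Type*} [TopologicalSpace α]

/-- The composition operator `w ↦ f ∘ w` of a continuous function with compact support. -/
noncomputable def compOp {E F : Type*} [NormedAddCommGroup E] [NormedAddCommGroup F]
    (f : E → F) (hf : Continuous f) (hc : HasCompactSupport f) (w : α →ᵇ E) : α →ᵇ F :=
  ofNormedAddCommGroup (f ∘ w) (hf.comp w.continuous)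
    (hc.exists_bound_of_continuous hf).choose
    fun x => (hc.exists_bound_of_continuous hf).choose_spec (w x)

@[simp] theorem compOp_apply {E F : Type*} [NormedAddCommGroup E] [NormedAddCommGroup F]
    (f : E → F) (hf : Continuous f) (hc : HasCompactSupport f) (w : α →ᵇ E) (t : α) :
    compOp f hf hc w t = f (w t) := rfl

/-- The pointwise application of bounded operator-valued functions. -/
noncomputable def bcfApply (E F : Type*)
    [NormedAddCommGroup E] [NormedSpace ℝ E]
    [NormedAddCommGroup F] [NormedSpace ℝ F] :
    (α →ᵇ (E →L[ℝ] F)) →L[ℝ] (α →ᵇ E) →L[ℝ] (α →ᵇ F) :=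
  LinearMap.mkContinuous₂
    (LinearMap.mk₂ ℝ
      (fun (A : α →ᵇ (E →L[ℝ] F)) (w : α →ᵇ E) => ofNormedAddCommGroup (fun t => A t (w t))
        (A.continuous.clm_apply w.continuous) (‖A‖ * ‖w‖) fun t =>
          (A t).le_of_opNorm_le_of_le (A.norm_coe_le_norm t) (w.norm_coe_le_norm t))
      (fun _ _ _ => by ext; simp) (fun _ _ _ => by ext; simp)
      (fun _ _ _ => by ext; simp) (fun _ _ _ => by ext; simp)) 1
    (fun (A : α →ᵇ (E →L[ℝ] F)) (w : α →ᵇ E) => by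
      rw [one_mul]
      exact (norm_le (by positivity)).2 fun t =>
        (A t).le_of_opNorm_le_of_le (A.norm_coe_le_norm t) (w.norm_coe_le_norm t))

@[simp] theorem bcfApply_apply {E F : Type*} [NormedAddCommGroup E] [NormedSpace ℝ E]
    [NormedAddCommGroup F] [NormedSpace ℝ F] (A : α →ᵇ (E →L[ℝ] F)) (w : α →ᵇ E) (t : α) :
    bcfApply (α := α) E F A w t = A t (w t) := rfl

/-- The mean value inequality on the ball of radius `‖h‖` about `x`, where the derivative varies by
at most `C ‖h‖`. The constant does not depend on `x`, which makes the remainder uniform over a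
function space. -/
theorem norm_taylor_le {E F : Type*} [NormedAddCommGroup E] [NormedSpace ℝ E]
    [NormedAddCommGroup F] [NormedSpace ℝ F] {f : E → F} (hf : ContDiff ℝ ∞ f)
    {C : NNReal} (hC : LipschitzWith C (fderiv ℝ f)) (x h : E) :
    ‖f (x + h) - f x - fderiv ℝ f x h‖ ≤ C * ‖h‖ * ‖h‖ := by
  have := (convex_closedBall x ‖h‖).norm_image_sub_le_of_norm_fderiv_le' (𝕜 := ℝ) (f := f)
    (φ := fderiv ℝ f x) (C := C * ‖h‖) (x := x) (y := x + h)
    (fun y _ => (hf.differentiable (by simp)) y)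
    (fun y hy => by
      have h1 := hC.dist_le_mul y x
      rw [dist_eq_norm] at h1
      exact h1.trans (by gcongr; exact Metric.mem_closedBall.1 hy))
    (by simp) (by simp)
  simpa using this

/-- Compact support makes the derivative of `f` globally Lipschitz, so the quadratic Taylor
remainder is uniform and the pointwise derivative is a derivative for the supremum norm. -/
theorem hasFDerivAt_compOp {E F : Type*} [NormedAddCommGroup E] [NormedSpace ℝ E]
    [NormedAddCommGroup F] [NormedSpace ℝ F] {f : E → F} (hf : ContDiff ℝ ∞ f)
    (hc : HasCompactSupport f) (w : α →ᵇ E) :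
    HasFDerivAt (compOp (α := α) f hf.continuous hc)
      (bcfApply (α := α) E F (compOp (fderiv ℝ f) (hf.continuous_fderiv (by simp)) (hc.fderiv ℝ) w)) w := by
  obtain ⟨C, hC⟩ := (hf.fderiv_right (m := ∞) (by simp)).lipschitzWith_of_hasCompactSupport
    (hc.fderiv ℝ) (by simp)
  rw [hasFDerivAt_iff_isLittleO_nhds_zero]
  refine Asymptotics.IsBigO.trans_isLittleO (g := fun h : α →ᵇ E => ‖h‖ * ‖h‖) ?_ ?_
  · refine Asymptotics.IsBigO.of_bound C (Eventually.of_forall fun h => ?_)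
    rw [Real.norm_of_nonneg (by positivity), ← mul_assoc]
    refine (norm_le (by positivity)).2 fun t => ?_
    refine (norm_taylor_le hf hC (w t) (h t)).trans ?_
    have := h.norm_coe_le_norm t
    gcongr
  · have h1 : (fun h : α →ᵇ E => ‖h‖) =o[𝓝 0] (fun _ => (1 : ℝ)) := by
      rw [Asymptotics.isLittleO_one_iff]
      simpa using (continuous_norm (E := α →ᵇ E)).tendsto 0
    have := h1.mul_isBigO (Asymptotics.isBigO_refl (fun h : α →ᵇ E => ‖h‖) (𝓝 0))
    simp only [one_mul] at this
    exact this.of_norm_right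

/-- The derivative of a composition operator is again one, for `fderiv ℝ f`, followed by a
continuous linear map. Induction on the order therefore runs over all target spaces at once. -/
theorem contDiff_compOp {E F : Type} [NormedAddCommGroup E] [NormedSpace ℝ E]
    [NormedAddCommGroup F] [NormedSpace ℝ F] {f : E → F} (hf : ContDiff ℝ ∞ f)
    (hc : HasCompactSupport f) : ContDiff ℝ ∞ (compOp (α := α) f hf.continuous hc) := by
  rw [contDiff_infty]
  intro n
  induction n generalizing F with
  | zero =>
    refine contDiff_zero.2 (continuous_iff_continuousAt.2 fun w => ?_)
    exact (hasFDerivAt_compOp hf hc w).continuousAt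
  | succ n ih =>
    push_cast
    refine contDiff_succ_iff_hasFDerivAt.2 ⟨_, ?_, hasFDerivAt_compOp hf hc⟩
    exact (bcfApply (α := α) E F).contDiff.comp (ih (hf.fderiv_right (by simp)) (hc.fderiv ℝ))

end Composition

/-! ### Scalar variation of constants on the half-line -/

section Duhamel

open MeasureTheory intervalIntegral

/-- A particular solution of `y' = d y + f`: the one with `y 0 = 0` if `d ≤ 0`, and the bounded one
if `0 < d`. -/
noncomputable def duhamel (d : ℝ) (f : ℝ → ℝ) (ξ : ℝ) : ℝ :=
  Real.exp (d * ξ) * ((∫ s in (0 : ℝ)..ξ, Real.exp (-d * s) * f s) -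
    if 0 < d then ∫ s in Ioi (0 : ℝ), Real.exp (-d * s) * f s else 0)

variable {d : ℝ} {f g : ℝ → ℝ} {C : ℝ}

theorem integrableOn_exp_mul_of_bounded (hd : 0 < d) (hf : Continuous f) (hC : ∀ s, |f s| ≤ C)
    (a : ℝ) : IntegrableOn (fun s => Real.exp (-d * s) * f s) (Ioi a) := by
  refine (integrableOn_exp_mul_Ioi (neg_lt_zero.2 hd) a).mul_bdd (c := C)
    hf.aestronglyMeasurable (Eventually.of_forall fun s => ?_)
  simpa using hC s

theorem hasDerivAt_duhamel (d : ℝ) (hf : Continuous f) (ξ : ℝ) :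
    HasDerivAt (duhamel d f) (d * duhamel d f ξ + f ξ) ξ := by
  have hc : Continuous fun s => Real.exp (-d * s) * f s := by fun_prop
  have h1 : HasDerivAt (fun ξ => ∫ s in (0 : ℝ)..ξ, Real.exp (-d * s) * f s)
      (Real.exp (-d * ξ) * f ξ) ξ := hc.integral_hasStrictDerivAt 0 ξ |>.hasDerivAt
  have h2 : HasDerivAt (fun ξ => Real.exp (d * ξ)) (Real.exp (d * ξ) * d) ξ := by
    simpa using ((hasDerivAt_id ξ).const_mul d).exp
  have h3 := h2.mul (h1.sub_const (if 0 < d then ∫ s in Ioi (0 : ℝ), Real.exp (-d * s) * f s else 0))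
  refine h3.congr_deriv ?_
  have : Real.exp (d * ξ) * Real.exp (-d * ξ) = 1 := by rw [← Real.exp_add]; simp
  simp only [duhamel]
  linear_combination f ξ * this

theorem duhamel_of_neg_zero (hd : d < 0) (f : ℝ → ℝ) : duhamel d f 0 = 0 := by
  simp [duhamel, hd.not_gt]

/-- The two integrals of the definition combine into a tail integral, the form in which boundedness
is visible. -/
theorem duhamel_of_pos (hd : 0 < d) (hf : Continuous f) (hC : ∀ s, |f s| ≤ C) (ξ : ℝ) :
    duhamel d f ξ = -(Real.exp (d * ξ) * ∫ s in Ioi ξ, Real.exp (-d * s) * f s) := by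
  have := integral_interval_add_Ioi (integrableOn_exp_mul_of_bounded hd hf hC 0)
    (integrableOn_exp_mul_of_bounded hd hf hC ξ)
  rw [duhamel, if_pos hd, ← this]
  ring

theorem abs_duhamel_le_of_pos (hd : 0 < d) (hf : Continuous f) (hC : ∀ s, |f s| ≤ C) (ξ : ℝ) :
    |duhamel d f ξ| ≤ C / d := by
  rw [duhamel_of_pos hd hf hC, abs_neg, abs_mul, abs_of_pos (Real.exp_pos _)]
  have h1 : ‖∫ s in Ioi ξ, Real.exp (-d * s) * f s‖ ≤ ∫ s in Ioi ξ, Real.exp (-d * s) * C := by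
    refine norm_integral_le_of_norm_le ((integrableOn_exp_mul_Ioi (neg_lt_zero.2 hd) ξ).mul_const C)
      (Eventually.of_forall fun s => ?_)
    rw [norm_mul, Real.norm_of_nonneg (Real.exp_pos _).le]
    exact mul_le_mul_of_nonneg_left (hC s) (Real.exp_pos _).le
  rw [MeasureTheory.integral_mul_const, integral_exp_mul_Ioi (neg_lt_zero.2 hd)] at h1
  calc Real.exp (d * ξ) * |∫ s in Ioi ξ, Real.exp (-d * s) * f s|
      ≤ Real.exp (d * ξ) * (-Real.exp (-d * ξ) / -d * C) := by gcongr; exact h1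
    _ = (Real.exp (d * ξ) * Real.exp (-d * ξ)) * C / d := by rw [neg_div_neg_eq]; ring
    _ = C / d := by rw [← Real.exp_add]; simp

/-- The factor `1 - exp (d ξ)` is kept because, together with the weight `exp (d ξ)` of the initial
value, it forms a convex combination. This later gives bounds with constant one, and decay. -/
theorem abs_duhamel_le_of_neg (hd : d < 0) (hC : ∀ s, |f s| ≤ C) {ξ : ℝ}
    (hξ : 0 ≤ ξ) : |duhamel d f ξ| ≤ (1 - Real.exp (d * ξ)) * (C / -d) := by
  rw [duhamel, if_neg hd.not_gt, sub_zero, abs_mul, abs_of_pos (Real.exp_pos _)]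
  have h1 : ‖∫ s in (0 : ℝ)..ξ, Real.exp (-d * s) * f s‖ ≤
      ∫ s in (0 : ℝ)..ξ, Real.exp (-d * s) * C := by
    refine norm_integral_le_of_norm_le hξ (Eventually.of_forall fun s _ => ?_)
      (Continuous.intervalIntegrable (by fun_prop) _ _)
    rw [norm_mul, Real.norm_of_nonneg (Real.exp_pos _).le]
    exact mul_le_mul_of_nonneg_left (hC s) (Real.exp_pos _).le
  have h2 : ∫ s in (0 : ℝ)..ξ, Real.exp (-d * s) = (Real.exp (-d * ξ) - 1) / -d := by
    rw [integral_comp_mul_left (fun x => Real.exp x) (neg_ne_zero.2 hd.ne), integral_exp]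
    simp [div_eq_inv_mul]
  rw [intervalIntegral.integral_mul_const, h2] at h1
  calc Real.exp (d * ξ) * |∫ s in (0 : ℝ)..ξ, Real.exp (-d * s) * f s|
      ≤ Real.exp (d * ξ) * ((Real.exp (-d * ξ) - 1) / -d * C) := by gcongr; exact h1
    _ = (Real.exp (d * ξ) * Real.exp (-d * ξ) - Real.exp (d * ξ)) * (C / -d) := by ring
    _ = _ := by rw [← Real.exp_add]; simp

theorem abs_duhamel_le (hd : d ≠ 0) (hf : Continuous f) (hC : ∀ s, |f s| ≤ C) {ξ : ℝ}
    (hξ : 0 ≤ ξ) : |duhamel d f ξ| ≤ C / |d| := by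
  have hC0 : 0 ≤ C := (abs_nonneg _).trans (hC 0)
  rcases hd.lt_or_gt with h | h
  · rw [abs_of_neg h]
    refine (abs_duhamel_le_of_neg h hC hξ).trans ?_
    refine mul_le_of_le_one_left (div_nonneg hC0 (neg_pos.2 h).le) ?_
    linarith [Real.exp_pos (d * ξ)]
  · rw [abs_of_pos h]
    exact abs_duhamel_le_of_pos h hf hC ξ

theorem duhamel_add {C' : ℝ} (hf : Continuous f) (hC : ∀ s, |f s| ≤ C) (hg : Continuous g)
    (hC' : ∀ s, |g s| ≤ C') (ξ : ℝ) :
    duhamel d (fun s => f s + g s) ξ = duhamel d f ξ + duhamel d g ξ := by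
  simp only [duhamel, mul_add]
  rw [integral_add (Continuous.intervalIntegrable (by fun_prop) _ _)
    (Continuous.intervalIntegrable (by fun_prop) _ _)]
  split_ifs with h
  · rw [MeasureTheory.integral_add (integrableOn_exp_mul_of_bounded h hf hC 0)
      (integrableOn_exp_mul_of_bounded h hg hC' 0)]
    ring
  · ring

theorem duhamel_const_mul (c : ℝ) (ξ : ℝ) :
    duhamel d (fun s => c * f s) ξ = c * duhamel d f ξ := by
  have h : ∀ s, Real.exp (-d * s) * (c * f s) = c * (Real.exp (-d * s) * f s) := fun s => by ring
  simp only [duhamel, h]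
  rw [intervalIntegral.integral_const_mul, MeasureTheory.integral_const_mul]
  split_ifs <;> ring

/-- A solution of `y' = d y + f` on the half-line differs from `duhamel d f` by an exponential. -/
theorem sub_duhamel_eq {y : ℝ → ℝ} (hf : Continuous f)
    (hy : ∀ ξ, 0 ≤ ξ → HasDerivWithinAt y (d * y ξ + f ξ) (Ici 0) ξ) {ξ : ℝ} (hξ : 0 ≤ ξ) :
    y ξ - duhamel d f ξ = Real.exp (d * ξ) * (y 0 - duhamel d f 0) := by
  -- The integrating factor turns the difference of two solutions into a function with zero
  -- derivative.
  set z : ℝ → ℝ := fun ξ => Real.exp (-d * ξ) * (y ξ - duhamel d f ξ) with hz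
  have hd : ∀ s, 0 ≤ s → HasDerivWithinAt z 0 (Ici 0) s := by
    intro s hs
    have h2 : HasDerivAt (fun ξ => Real.exp (-d * ξ)) (Real.exp (-d * s) * (-d)) s := by
      simpa using ((hasDerivAt_id s).const_mul (-d)).exp
    have h3 := h2.hasDerivWithinAt.mul
      ((hy s hs).sub (hasDerivAt_duhamel d hf s).hasDerivWithinAt)
    refine h3.congr_deriv ?_
    simp only [Pi.sub_apply]
    ring
  have hconst : z ξ = z 0 := by
    refine constant_of_has_deriv_right_zero (a := 0) (b := ξ)
      (fun s hs => ((hd s hs.1).continuousWithinAt).mono Icc_subset_Ici_self)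
      (fun s hs => (hd s hs.1).mono (Ici_subset_Ici.2 hs.1)) ξ ⟨hξ, le_rfl⟩
  have he : Real.exp (d * ξ) * Real.exp (-d * ξ) = 1 := by rw [← Real.exp_add]; simp
  simp only [hz, mul_zero, Real.exp_zero, one_mul] at hconst
  rw [← hconst, ← mul_assoc, he, one_mul]

theorem eq_duhamel_of_neg {y : ℝ → ℝ} (hd : d < 0) (hf : Continuous f)
    (hy : ∀ ξ, 0 ≤ ξ → HasDerivWithinAt y (d * y ξ + f ξ) (Ici 0) ξ) {ξ : ℝ} (hξ : 0 ≤ ξ) :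
    y ξ = Real.exp (d * ξ) * y 0 + duhamel d f ξ := by
  have := sub_duhamel_eq hf hy hξ
  rw [duhamel_of_neg_zero hd] at this
  linarith

/-- A nonzero initial difference would grow like `exp (d ξ)`, although both functions are bounded. A
growing mode thus leaves no free initial value. -/
theorem eq_duhamel_of_pos {y : ℝ → ℝ} {B : ℝ} (hd : 0 < d) (hf : Continuous f)
    (hC : ∀ s, |f s| ≤ C) (hy : ∀ ξ, 0 ≤ ξ → HasDerivWithinAt y (d * y ξ + f ξ) (Ici 0) ξ)
    (hB : ∀ ξ, 0 ≤ ξ → |y ξ| ≤ B) {ξ : ℝ} (hξ : 0 ≤ ξ) : y ξ = duhamel d f ξ := by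
  have key : y 0 - duhamel d f 0 = 0 := by
    by_contra hne
    have hpos : 0 < |y 0 - duhamel d f 0| := abs_pos.2 hne
    have ht : Tendsto (fun s => Real.exp (d * s) * |y 0 - duhamel d f 0|) atTop atTop :=
      (Real.tendsto_exp_atTop.comp (tendsto_id.const_mul_atTop hd)).atTop_mul_const hpos
    obtain ⟨s, hs, hs0⟩ := ((ht.eventually_gt_atTop (B + C / d)).and (eventually_ge_atTop 0)).exists
    have h1 := sub_duhamel_eq hf hy hs0
    have h2 : |y s - duhamel d f s| ≤ B + C / d :=
      (abs_sub _ _).trans (add_le_add (hB s hs0) (abs_duhamel_le_of_pos hd hf hC s))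
    rw [h1, abs_mul, abs_of_pos (Real.exp_pos _)] at h2
    linarith
  have := sub_duhamel_eq hf hy hξ
  rw [key, mul_zero] at this
  linarith

end Duhamel

/-! ### The Lyapunov–Perron operator -/

section LyapunovPerron

open BoundedContinuousFunction

variable {k m : ℕ}

theorem abs_apply_le_norm (w : ℝ →ᵇ (Fin k → ℝ)) (i : Fin k) (s : ℝ) : |w s i| ≤ ‖w‖ :=
  (norm_le_pi_norm (w s) i).trans (w.norm_coe_le_norm s)

theorem continuous_apply_apply (w : ℝ →ᵇ (Fin k → ℝ)) (i : Fin k) : Continuous fun s => w s i :=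
  (continuous_apply i).comp w.continuous

/-- Evaluation at `max ξ 0` extends functions on the half-line by a constant, so that all operators
act on bounded functions on `ℝ`. -/
theorem norm_duhamel_pi_le {d : Fin k → ℝ} {lam : ℝ} (hlam : 0 < lam) (hd : ∀ i, lam ≤ |d i|)
    (w : ℝ →ᵇ (Fin k → ℝ)) (ξ : ℝ) :
    ‖(fun i => duhamel (d i) (fun s => w s i) (max ξ 0) : Fin k → ℝ)‖ ≤ lam⁻¹ * ‖w‖ :=
  (pi_norm_le_iff_of_nonneg (by positivity)).2 fun i => by
    have hi : 0 < |d i| := hlam.trans_le (hd i)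
    refine (abs_duhamel_le (abs_pos.1 hi) (continuous_apply_apply w i) (abs_apply_le_norm w i)
      (le_max_right _ _)).trans ?_
    rw [div_eq_inv_mul]
    have := hd i
    gcongr

/-- Componentwise bounded solution operator of `w' = diag(d) w + f`, where `lam ≤ |d i|`. -/
noncomputable def duhamelOp (d : Fin k → ℝ) {lam : ℝ} (hlam : 0 < lam) (hd : ∀ i, lam ≤ |d i|) :
    (ℝ →ᵇ (Fin k → ℝ)) →L[ℝ] (ℝ →ᵇ (Fin k → ℝ)) :=
  LinearMap.mkContinuous
    { toFun := fun w => ofNormedAddCommGroup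
        (fun ξ i => duhamel (d i) (fun s => w s i) (max ξ 0))
        (continuous_pi fun i => by
          have h1 : Continuous (duhamel (d i) (fun s => w s i)) :=
            continuous_iff_continuousAt.2 fun ξ =>
              (hasDerivAt_duhamel (d i) (continuous_apply_apply w i) ξ).continuousAt
          exact h1.comp (continuous_id.max continuous_const))
        (lam⁻¹ * ‖w‖) (norm_duhamel_pi_le hlam hd w)
      map_add' := fun w w' => by
        ext ξ i
        exact duhamel_add (continuous_apply_apply w i) (abs_apply_le_norm w i)
          (continuous_apply_apply w' i) (abs_apply_le_norm w' i) _
      map_smul' := fun c w => by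
        ext ξ i
        exact duhamel_const_mul c _ }
    lam⁻¹ (fun w => (norm_le (by positivity)).2 (norm_duhamel_pi_le hlam hd w))

variable {d : Fin k → ℝ} {lam : ℝ} {hlam : 0 < lam} {hd : ∀ i, lam ≤ |d i|}

theorem duhamelOp_apply (w : ℝ →ᵇ (Fin k → ℝ)) (ξ : ℝ) (i : Fin k) :
    duhamelOp d hlam hd w ξ i = duhamel (d i) (fun s => w s i) (max ξ 0) := rfl

theorem norm_duhamelOp_le (w : ℝ →ᵇ (Fin k → ℝ)) : ‖duhamelOp d hlam hd w‖ ≤ lam⁻¹ * ‖w‖ :=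
  (norm_le (by positivity)).2 (norm_duhamel_pi_le hlam hd w)

/-- The decaying solutions of `w' = diag(d) w`. -/
noncomputable def expOp (d : Fin k → ℝ) : (Fin k → ℝ) →L[ℝ] (ℝ →ᵇ (Fin k → ℝ)) :=
  have hbd : ∀ (a : Fin k → ℝ) (ξ : ℝ),
      ‖(fun i => if d i < 0 then Real.exp (d i * max ξ 0) * a i else 0 : Fin k → ℝ)‖ ≤ 1 * ‖a‖ :=
    fun a ξ => (pi_norm_le_iff_of_nonneg (by positivity)).2 fun i => by
      split_ifs with h
      · rw [norm_mul, Real.norm_of_nonneg (Real.exp_pos _).le]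
        refine mul_le_mul ?_ (norm_le_pi_norm a i) (norm_nonneg _) zero_le_one
        exact Real.exp_le_one_iff.2 (mul_nonpos_of_nonpos_of_nonneg h.le (le_max_right _ _))
      · simp
  LinearMap.mkContinuous
    { toFun := fun a => ofNormedAddCommGroup
        (fun ξ i => if d i < 0 then Real.exp (d i * max ξ 0) * a i else 0)
        (continuous_pi fun i => by split_ifs <;> fun_prop)
        (1 * ‖a‖) (hbd a)
      map_add' := fun a a' => by
        ext ξ i
        simp only [coe_ofNormedAddCommGroup, Pi.add_apply, BoundedContinuousFunction.coe_add]
        split_ifs <;> ring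
      map_smul' := fun c a => by
        ext ξ i
        simp only [coe_ofNormedAddCommGroup, Pi.smul_apply, BoundedContinuousFunction.coe_smul,
          smul_eq_mul, RingHom.id_apply]
        split_ifs <;> ring }
    1 (fun a => (norm_le (by positivity)).2 (hbd a))

theorem expOp_apply (d : Fin k → ℝ) (a : Fin k → ℝ) (ξ : ℝ) (i : Fin k) :
    expOp d a ξ i = if d i < 0 then Real.exp (d i * max ξ 0) * a i else 0 := rfl

/-- Pairing of a bounded function with a constant parameter. -/
noncomputable def pairConst (E P : Type*) [NormedAddCommGroup E] [NormedSpace ℝ E]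
    [NormedAddCommGroup P] [NormedSpace ℝ P] :
    (ℝ →ᵇ E) × P →L[ℝ] (ℝ →ᵇ (E × P)) :=
  LinearMap.mkContinuous
    { toFun := fun x => ofNormedAddCommGroup (fun ξ => (x.1 ξ, x.2))
        (x.1.continuous.prodMk continuous_const) (1 * ‖x‖) (fun ξ => by
          rw [one_mul]
          exact max_le_max (x.1.norm_coe_le_norm ξ) le_rfl)
      map_add' := fun x y => by ext ξ <;> rfl
      map_smul' := fun c x => by ext ξ <;> rfl }
    1 (fun x => (norm_le (by positivity)).2 fun ξ => by
          rw [one_mul]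
          exact max_le_max (x.1.norm_coe_le_norm ξ) le_rfl)

@[simp] theorem pairConst_apply {E P : Type*} [NormedAddCommGroup E] [NormedSpace ℝ E]
    [NormedAddCommGroup P] [NormedSpace ℝ P] (x : (ℝ →ᵇ E) × P) (ξ : ℝ) :
    pairConst E P x ξ = (x.1 ξ, x.2) := rfl

variable {R : (Fin k → ℝ) × (Fin m → ℝ) → (Fin k → ℝ)}

/-- The parameters `(a, u)` of the Lyapunov–Perron equation. -/
abbrev LPParam (k m : ℕ) : Type := (Fin k → ℝ) × (Fin m → ℝ)

/-- The unknowns of the Lyapunov–Perron equation. -/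
abbrev LPState (k : ℕ) : Type := ℝ →ᵇ (Fin k → ℝ)

/-- The equation `lpEq w (a, u) = 0` characterizes the bounded solutions of
`w' = diag(d) w + R(w, u)` whose stable components start at those of `a`. -/
noncomputable def lpEq (d : Fin k → ℝ) {lam : ℝ} (hlam : 0 < lam) (hd : ∀ i, lam ≤ |d i|)
    (R : (Fin k → ℝ) × (Fin m → ℝ) → (Fin k → ℝ)) (hR : ContDiff ℝ ∞ R) (hc : HasCompactSupport R)
    (w : ℝ →ᵇ (Fin k → ℝ)) (x : (Fin k → ℝ) × (Fin m → ℝ)) : ℝ →ᵇ (Fin k → ℝ) :=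
  w - expOp d x.1 - duhamelOp d hlam hd (compOp R hR.continuous hc (pairConst _ _ (w, x.2)))

variable {hR : ContDiff ℝ ∞ R} {hc : HasCompactSupport R}

theorem lpEq_eq_zero_iff {w : ℝ →ᵇ (Fin k → ℝ)} {x : (Fin k → ℝ) × (Fin m → ℝ)} :
    lpEq d hlam hd R hR hc w x = 0 ↔ ∀ ξ i, w ξ i =
      (if d i < 0 then Real.exp (d i * max ξ 0) * x.1 i else 0) +
        duhamel (d i) (fun s => R (w s, x.2) i) (max ξ 0) := by
  rw [lpEq, sub_sub, sub_eq_zero]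
  constructor
  · intro h ξ i
    exact congrArg (fun v : ℝ →ᵇ (Fin k → ℝ) => v ξ i) h
  · intro h
    ext ξ i
    exact h ξ i

theorem contDiff_lpEq : ContDiff ℝ ∞ (fun p : ((Fin k → ℝ) × (Fin m → ℝ)) × (ℝ →ᵇ (Fin k → ℝ)) =>
    lpEq d hlam hd R hR hc p.2 p.1) := by
  unfold lpEq
  refine (contDiff_snd.sub ((expOp d).contDiff.comp (contDiff_fst.comp contDiff_fst))).sub ?_
  refine (duhamelOp d hlam hd).contDiff.comp ((contDiff_compOp hR hc).comp ?_)
  exact (pairConst (Fin k → ℝ) (Fin m → ℝ)).contDiff.comp (contDiff_snd.prodMk (contDiff_snd.comp contDiff_fst))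

/-- The nonlinear term has zero derivative at `(0, u₀)`, so the derivative in the unknown function
is the identity and the implicit function theorem applies. -/
theorem hasFDerivAt_lpEq {u₀ : Fin m → ℝ} (h0 : fderiv ℝ R (0, u₀) = 0) :
    HasFDerivAt (fun p : LPParam k m × LPState k =>
      lpEq d hlam hd R hR hc p.2 p.1)
      ((-(expOp d ∘L ContinuousLinearMap.fst ℝ (Fin k → ℝ) (Fin m → ℝ))).coprod
        (ContinuousLinearMap.id ℝ (ℝ →ᵇ (Fin k → ℝ)))) ((0, u₀), 0) := by
  have e1 : HasFDerivAt (fun p : LPParam k m × LPState k => (p.2, p.1.2))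
      ((ContinuousLinearMap.snd ℝ (LPParam k m) (LPState k)).prod
        (ContinuousLinearMap.snd ℝ (Fin k → ℝ) (Fin m → ℝ) ∘L ContinuousLinearMap.fst ℝ (LPParam k m) (LPState k)))
      ((0, u₀), 0) :=
    ((ContinuousLinearMap.snd ℝ (LPParam k m) (LPState k)).prod (ContinuousLinearMap.snd ℝ (Fin k → ℝ) (Fin m → ℝ) ∘L
      ContinuousLinearMap.fst ℝ (LPParam k m) (LPState k))).hasFDerivAt
  have e2 : HasFDerivAt (fun p : LPParam k m × LPState k => expOp d p.1.1)
      (expOp d ∘L ContinuousLinearMap.fst ℝ (Fin k → ℝ) (Fin m → ℝ) ∘L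
        ContinuousLinearMap.fst ℝ (LPParam k m) (LPState k)) ((0, u₀), 0) :=
    (expOp d ∘L ContinuousLinearMap.fst ℝ (Fin k → ℝ) (Fin m → ℝ) ∘L
        ContinuousLinearMap.fst ℝ (LPParam k m) (LPState k)).hasFDerivAt
  have h1 : HasFDerivAt (fun p : LPParam k m × LPState k =>
      compOp R hR.continuous hc (pairConst _ _ (p.2, p.1.2))) (0 : LPParam k m × LPState k →L[ℝ] (ℝ →ᵇ (Fin k → ℝ)))
      ((0, u₀), 0) := by
    have h2 := (hasFDerivAt_compOp (α := ℝ) hR hc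
      (pairConst (Fin k → ℝ) (Fin m → ℝ) (0, u₀))).comp (((0, u₀), 0) : LPParam k m × LPState k)
      (((pairConst (Fin k → ℝ) (Fin m → ℝ)).hasFDerivAt).comp (((0, u₀), 0) : LPParam k m × LPState k) e1)
    refine h2.congr_fderiv ?_
    -- Along the constant pair `(0, u₀)` the multiplier is the constant `fderiv ℝ R (0, u₀)`.
    have h3 : compOp (fderiv ℝ R) (hR.continuous_fderiv (by simp)) (hc.fderiv ℝ)
        (pairConst (Fin k → ℝ) (Fin m → ℝ) ((0 : (ℝ →ᵇ (Fin k → ℝ))), u₀)) = 0 := by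
      ext1 ξ
      exact h0
    rw [h3, map_zero, ContinuousLinearMap.zero_comp]
  have h4 := ((ContinuousLinearMap.snd ℝ (LPParam k m) (LPState k)).hasFDerivAt.sub e2).sub
      ((duhamelOp d hlam hd).hasFDerivAt.comp (((0, u₀), 0) : LPParam k m × LPState k) h1)
  refine h4.congr_fderiv ?_
  refine ContinuousLinearMap.ext fun x => ?_
  simp [sub_eq_neg_add]

end LyapunovPerron

/-! ### The local stable manifold in diagonal coordinates -/

section StableManifold

open BoundedContinuousFunction

variable {k m : ℕ} {d : Fin k → ℝ} {lam ρ : ℝ} {hlam : 0 < lam} {hd : ∀ i, lam ≤ |d i|}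
  {R : (Fin k → ℝ) × (Fin m → ℝ) → (Fin k → ℝ)} {hR : ContDiff ℝ ∞ R} {hc : HasCompactSupport R}
  {w w' : ℝ →ᵇ (Fin k → ℝ)} {a a' : Fin k → ℝ} {u : Fin m → ℝ}

theorem continuous_comp_pair (hR : ContDiff ℝ ∞ R) (w : ℝ →ᵇ (Fin k → ℝ)) (u : Fin m → ℝ)
    (i : Fin k) : Continuous fun s => R (w s, u) i :=
  (continuous_apply i).comp (hR.continuous.comp (w.continuous.prodMk continuous_const))

theorem lpEq_apply_max (h : lpEq d hlam hd R hR hc w (a, u) = 0) (ξ : ℝ) : w (max ξ 0) = w ξ := by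
  rw [lpEq_eq_zero_iff] at h
  ext i
  rw [h, h, max_eq_left (le_max_right ξ 0)]

/-- Since `lam ≤ |d i|`, a forcing of size `lam / 2 * ‖w‖` contributes at most `‖w‖ / 2`. Initial
value and forcing enter with weights adding up to one. -/
theorem lpEq_stable_bound (h : lpEq d hlam hd R hR hc w (a, u) = 0)
    (hw : ∀ s, ‖R (w s, u)‖ ≤ lam / 2 * ‖w‖) {i : Fin k} (hi : d i < 0) {ξ : ℝ} (hξ : 0 ≤ ξ) :
    |w ξ i| ≤ Real.exp (d i * ξ) * |a i| + (1 - Real.exp (d i * ξ)) * (‖w‖ / 2) := by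
  have hC : ∀ s, |R (w s, u) i| ≤ lam / 2 * ‖w‖ := fun s => (norm_le_pi_norm _ i).trans (hw s)
  rw [lpEq_eq_zero_iff.1 h ξ i, if_pos hi, max_eq_left hξ]
  refine (abs_add_le _ _).trans (add_le_add ?_ ((abs_duhamel_le_of_neg hi hC hξ).trans ?_))
  · rw [abs_mul, abs_of_pos (Real.exp_pos _)]
  · refine mul_le_mul_of_nonneg_left ?_ ?_
    · have h1 := hd i
      rw [abs_of_neg hi] at h1
      rw [div_le_iff₀ (by linarith)]
      nlinarith [norm_nonneg w]
    · have := Real.exp_le_one_iff.2 (mul_nonpos_of_nonpos_of_nonneg hi.le hξ)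
      linarith

theorem lpEq_unstable_bound (h : lpEq d hlam hd R hR hc w (a, u) = 0)
    (hw : ∀ s, ‖R (w s, u)‖ ≤ lam / 2 * ‖w‖) {i : Fin k} (hi : 0 < d i) (ξ : ℝ) :
    |w ξ i| ≤ ‖w‖ / 2 := by
  have hC : ∀ s, |R (w s, u) i| ≤ lam / 2 * ‖w‖ := fun s => (norm_le_pi_norm _ i).trans (hw s)
  rw [lpEq_eq_zero_iff.1 h ξ i, if_neg hi.not_gt, zero_add]
  refine (abs_duhamel_le_of_pos hi (continuous_comp_pair hR w u i) hC _).trans ?_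
  have h1 := hd i
  rw [abs_of_pos hi] at h1
  rw [div_le_iff₀ hi]
  nlinarith [norm_nonneg w]

theorem ne_zero_of_le_abs (hlam : 0 < lam) (hd : ∀ i, lam ≤ |d i|) (i : Fin k) : d i ≠ 0 :=
  abs_pos.1 (hlam.trans_le (hd i))

/-- Componentwise, `‖w‖` is at most the maximum of `‖a‖` and `‖w‖ / 2`, and the second alternative
forces `w = 0`. The constant one keeps orbits in the ball from which their data are taken. -/
theorem lpEq_norm_le (h : lpEq d hlam hd R hR hc w (a, u) = 0)
    (hw : ∀ s, ‖R (w s, u)‖ ≤ lam / 2 * ‖w‖) : ‖w‖ ≤ ‖a‖ := by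
  have key : ‖w‖ ≤ max ‖a‖ (‖w‖ / 2) := by
    refine (norm_le (le_max_of_le_left (norm_nonneg _))).2 fun ξ => ?_
    refine (pi_norm_le_iff_of_nonneg (le_max_of_le_left (norm_nonneg _))).2 fun i => ?_
    rcases (ne_zero_of_le_abs hlam hd i).lt_or_gt with hi | hi
    · rw [← lpEq_apply_max h]
      refine (lpEq_stable_bound h hw hi (le_max_right ξ 0)).trans ?_
      set e := Real.exp (d i * max ξ 0)
      have he0 : 0 ≤ e := (Real.exp_pos _).le
      have he1 : e ≤ 1 :=
        Real.exp_le_one_iff.2 (mul_nonpos_of_nonpos_of_nonneg hi.le (le_max_right _ _))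
      have ha : |a i| ≤ max ‖a‖ (‖w‖ / 2) := (norm_le_pi_norm a i).trans (le_max_left _ _)
      have hb : ‖w‖ / 2 ≤ max ‖a‖ (‖w‖ / 2) := le_max_right _ _
      nlinarith [mul_le_mul_of_nonneg_left ha he0,
        mul_le_mul_of_nonneg_left hb (sub_nonneg.2 he1)]
    · exact (lpEq_unstable_bound h hw hi ξ).trans (le_max_right _ _)
  rcases le_max_iff.1 key with h1 | h1
  · exact h1
  · linarith [norm_nonneg w, norm_nonneg a]

theorem norm_comp_le (hR0 : R (0, u) = 0)
    (hL : ∀ z ∈ Metric.ball (0 : Fin k → ℝ) ρ, ∀ z' ∈ Metric.ball (0 : Fin k → ℝ) ρ,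
      ‖R (z, u) - R (z', u)‖ ≤ lam / 2 * ‖z - z'‖) (hlam : 0 < lam) (hw : ‖w‖ < ρ) (s : ℝ) :
    ‖R (w s, u)‖ ≤ lam / 2 * ‖w‖ := by
  have h1 := hL (w s) (mem_ball_zero_iff.2 ((w.norm_coe_le_norm s).trans_lt hw)) 0
    (Metric.mem_ball_self ((norm_nonneg w).trans_lt hw))
  rw [hR0, sub_zero, sub_zero] at h1
  refine h1.trans ?_
  have := w.norm_coe_le_norm s
  gcongr

/-- The Lipschitz constant `lam / 2` against the bound `lam⁻¹` of `duhamelOp` gives the contraction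
factor `1 / 2`. Unstable components of the data do not enter the equation, so they need not agree.
-/
theorem lpEq_unique (hL : ∀ z ∈ Metric.ball (0 : Fin k → ℝ) ρ,
      ∀ z' ∈ Metric.ball (0 : Fin k → ℝ) ρ, ‖R (z, u) - R (z', u)‖ ≤ lam / 2 * ‖z - z'‖)
    (h : lpEq d hlam hd R hR hc w (a, u) = 0) (h' : lpEq d hlam hd R hR hc w' (a', u) = 0)
    (ha : ∀ i, d i < 0 → a i = a' i) (hw : ‖w‖ < ρ) (hw' : ‖w'‖ < ρ) : w = w' := by
  have he : expOp d a = expOp d a' := by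
    ext ξ i
    rw [expOp_apply, expOp_apply]
    split_ifs with hi
    · rw [ha i hi]
    · rfl
  have h1 : w - w' = duhamelOp d hlam hd
      (compOp R hR.continuous hc (pairConst _ _ (w, u)) -
        compOp R hR.continuous hc (pairConst _ _ (w', u))) := by
    rw [lpEq, sub_sub, sub_eq_zero] at h h'
    rw [map_sub]
    conv_lhs => rw [h, h']
    simp only [he, add_sub_add_left_eq_sub]
  have h2 : ‖compOp R hR.continuous hc (pairConst _ _ (w, u)) -
        compOp R hR.continuous hc (pairConst _ _ (w', u))‖ ≤ lam / 2 * ‖w - w'‖ := by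
    refine (norm_le (by positivity)).2 fun s => ?_
    refine (hL (w s) (mem_ball_zero_iff.2 ((w.norm_coe_le_norm s).trans_lt hw)) (w' s)
      (mem_ball_zero_iff.2 ((w'.norm_coe_le_norm s).trans_lt hw'))).trans ?_
    have := (w - w').norm_coe_le_norm s
    rw [BoundedContinuousFunction.sub_apply] at this
    gcongr
  have h3 : ‖w - w'‖ ≤ lam⁻¹ * (lam / 2 * ‖w - w'‖) := by
    conv_lhs => rw [h1]
    refine (norm_duhamelOp_le _).trans ?_
    gcongr
  have h4 : lam⁻¹ * (lam / 2 * ‖w - w'‖) = ‖w - w'‖ / 2 := by field_simp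
  rw [h4] at h3
  have h5 : ‖w - w'‖ = 0 := by linarith [norm_nonneg (w - w')]
  exact sub_eq_zero.1 (norm_eq_zero.1 h5)

theorem lpEq_zero_apply (h : lpEq d hlam hd R hR hc w (a, u) = 0) {i : Fin k} (hi : d i < 0) :
    w 0 i = a i := by
  rw [lpEq_eq_zero_iff.1 h 0 i, if_pos hi, max_self, duhamel_of_neg_zero hi]
  simp

theorem lpEq_hasDerivWithinAt (h : lpEq d hlam hd R hR hc w (a, u) = 0) {ξ : ℝ} (hξ : 0 ≤ ξ) :
    HasDerivWithinAt w (fun i => d i * w ξ i + R (w ξ, u) i) (Ici 0) ξ := by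
  refine hasDerivWithinAt_pi.2 fun i => ?_
  rw [lpEq_eq_zero_iff] at h
  have h1 : HasDerivAt (fun ξ => (if d i < 0 then Real.exp (d i * ξ) * a i else 0) +
      duhamel (d i) (fun s => R (w s, u) i) ξ)
      ((if d i < 0 then Real.exp (d i * ξ) * d i * a i else 0) +
        (d i * duhamel (d i) (fun s => R (w s, u) i) ξ + R (w ξ, u) i)) ξ := by
    refine HasDerivAt.add ?_ (hasDerivAt_duhamel (d i) (continuous_comp_pair hR w u i) ξ)
    split_ifs with hi
    · have h2 : HasDerivAt (fun ξ => Real.exp (d i * ξ)) (Real.exp (d i * ξ) * d i) ξ := by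
        simpa using ((hasDerivAt_id ξ).const_mul (d i)).exp
      exact h2.mul_const _
    · exact hasDerivAt_const _ _
  have h2 : ∀ s ∈ Ici (0 : ℝ), w s i = (if d i < 0 then Real.exp (d i * s) * a i else 0) +
      duhamel (d i) (fun s => R (w s, u) i) s := fun s hs => by
    rw [h s i, max_eq_left hs]
  refine (h1.hasDerivWithinAt.congr h2 (h2 ξ hξ)).congr_deriv ?_
  rw [h2 ξ hξ]
  split_ifs <;> ring

/-- A bounded solution on the half-line, extended by a constant, as a bounded function. -/
theorem exists_lpEq_of_hasDerivWithinAt {W : ℝ → (Fin k → ℝ)} {r : ℝ}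
    (hr : ∀ ξ, 0 ≤ ξ → ‖W ξ‖ ≤ r)
    (hW : ∀ ξ, 0 ≤ ξ → HasDerivWithinAt W (fun i => d i * W ξ i + R (W ξ, u) i) (Ici 0) ξ) :
    ∃ w : ℝ →ᵇ (Fin k → ℝ), (∀ ξ, w ξ = W (max ξ 0)) ∧ ‖w‖ ≤ r ∧
      lpEq d hlam hd R hR hc w (W 0, u) = 0 := by
  have hcont : Continuous fun ξ => W (max ξ 0) := by
    have h1 : ContinuousOn W (Ici 0) := fun ξ hξ => (hW ξ hξ).continuousWithinAt
    exact h1.comp_continuous (continuous_id.max continuous_const) fun ξ =>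
      mem_Ici.2 (le_max_right _ _)
  have hr0 : 0 ≤ r := (norm_nonneg _).trans (hr 0 le_rfl)
  let w : ℝ →ᵇ (Fin k → ℝ) :=
    ofNormedAddCommGroup (fun ξ => W (max ξ 0)) hcont r fun ξ => hr _ (le_max_right _ _)
  have hw : ∀ ξ, w ξ = W (max ξ 0) := fun ξ => rfl
  refine ⟨w, hw, (norm_le hr0).2 fun ξ => hr _ (le_max_right _ _), ?_⟩
  rw [lpEq_eq_zero_iff]
  intro ξ i
  have hξ : 0 ≤ max ξ 0 := le_max_right _ _
  obtain ⟨C, hC⟩ := hc.exists_bound_of_continuous hR.continuous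
  have hC' : ∀ s, |R (w s, u) i| ≤ C := fun s => (norm_le_pi_norm _ i).trans (hC _)
  have hy : ∀ s, 0 ≤ s → HasDerivWithinAt (fun s => W s i) (d i * W s i + R (w s, u) i)
      (Ici 0) s := fun s hs => by
    rw [hw, max_eq_left hs]
    exact hasDerivWithinAt_pi.1 (hW s hs) i
  rw [hw]
  -- Decaying modes are determined by their initial value, growing modes by boundedness.
  rcases (ne_zero_of_le_abs hlam hd i).lt_or_gt with hi | hi
  · rw [if_pos hi]
    exact eq_duhamel_of_neg hi (continuous_comp_pair hR w u i) hy hξ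
  · rw [if_neg hi.not_gt, zero_add]
    exact eq_duhamel_of_pos hi (continuous_comp_pair hR w u i) hC' hy
      (fun s hs => (norm_le_pi_norm _ i).trans (hr s hs)) hξ

/-- The equation is autonomous, so estimates in terms of the value at time zero can be restarted at
any time `σ`. -/
theorem lpEq_shift (h : lpEq d hlam hd R hR hc w (a, u) = 0) {σ : ℝ} (hσ : 0 ≤ σ) :
    ∃ v : ℝ →ᵇ (Fin k → ℝ), (∀ ξ, v ξ = w (max ξ 0 + σ)) ∧ ‖v‖ ≤ ‖w‖ ∧
      lpEq d hlam hd R hR hc v (w σ, u) = 0 := by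
  have := exists_lpEq_of_hasDerivWithinAt (d := d) (hlam := hlam) (hd := hd) (hR := hR) (hc := hc)
    (u := u) (W := fun ξ => w (ξ + σ)) (r := ‖w‖) (fun ξ _ => w.norm_coe_le_norm _) (fun ξ hξ => by
      have h1 := lpEq_hasDerivWithinAt h (add_nonneg hξ hσ)
      refine h1.scomp_of_eq (h := fun ξ => ξ + σ) (h' := 1) ξ ?_ ?_ rfl |>.congr_deriv (by simp)
      · exact ((hasDerivAt_id ξ).add_const σ).hasDerivWithinAt
      · exact fun s hs => add_nonneg hs hσ)
  simpa using this

/-- Restarting at `σ` bounds the later orbit by `‖w σ‖`, and after one unit of time every component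
is at most the fraction `θ` of it. Iteration gives geometric decay at integer times, and the first
bound covers the times in between. -/
theorem lpEq_tendsto (hR0 : R (0, u) = 0)
    (hL : ∀ z ∈ Metric.ball (0 : Fin k → ℝ) ρ, ∀ z' ∈ Metric.ball (0 : Fin k → ℝ) ρ,
      ‖R (z, u) - R (z', u)‖ ≤ lam / 2 * ‖z - z'‖)
    (h : lpEq d hlam hd R hR hc w (a, u) = 0) (hw : ‖w‖ < ρ) : Tendsto w atTop (𝓝 0) := by
  -- This is `e + (1 - e) / 2` at `e = exp (-lam)`, the largest weight the initial value can have
  -- after unit time.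
  set θ := (1 + Real.exp (-lam)) / 2 with hθ
  have hθ1 : θ < 1 := by
    have : Real.exp (-lam) < 1 := by
      rw [← Real.exp_zero]
      exact Real.exp_lt_exp.2 (neg_lt_zero.2 hlam)
    linarith
  have hθ0 : 0 < θ := by positivity
  have hθ2 : 1 / 2 ≤ θ := by linarith [Real.exp_pos (-lam)]
  have step : ∀ σ, 0 ≤ σ → (∀ ξ, 0 ≤ ξ → ‖w (ξ + σ)‖ ≤ ‖w σ‖) ∧ ‖w (1 + σ)‖ ≤ θ * ‖w σ‖ := by
    intro σ hσ
    obtain ⟨v, hv, hvn, hv0⟩ := lpEq_shift h hσ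
    have hvb := norm_comp_le hR0 hL hlam (hvn.trans_lt hw)
    have hva := lpEq_norm_le hv0 hvb
    refine ⟨fun ξ hξ => ?_, ?_⟩
    · have := v.norm_coe_le_norm ξ
      rw [hv, max_eq_left hξ] at this
      exact this.trans hva
    · have hv1 : v 1 = w (1 + σ) := by rw [hv, max_eq_left zero_le_one]
      rw [← hv1]
      refine (pi_norm_le_iff_of_nonneg (by positivity)).2 fun i => ?_
      rcases (ne_zero_of_le_abs hlam hd i).lt_or_gt with hi | hi
      · refine (lpEq_stable_bound hv0 hvb hi zero_le_one).trans ?_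
        rw [mul_one]
        have h1 := hd i
        rw [abs_of_neg hi] at h1
        have h2 : Real.exp (d i) ≤ Real.exp (-lam) := Real.exp_le_exp.2 (by linarith)
        have h3 : Real.exp (d i) ≤ 1 := Real.exp_le_one_iff.2 hi.le
        have h4 : |w σ i| ≤ ‖w σ‖ := norm_le_pi_norm (w σ) i
        have h5 := mul_le_mul_of_nonneg_left h4 (Real.exp_pos (d i)).le
        have h6 := mul_le_mul_of_nonneg_left hva (sub_nonneg.2 h3)
        have h7 := mul_le_mul_of_nonneg_right h2 (norm_nonneg (w σ))
        rw [hθ]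
        linarith
      · refine (lpEq_unstable_bound hv0 hvb hi 1).trans ?_
        nlinarith [norm_nonneg (w σ)]
  have pow : ∀ n : ℕ, ‖w n‖ ≤ θ ^ n * ‖w 0‖ := by
    intro n
    induction n with
    | zero => simp
    | succ n ih =>
      rw [Nat.cast_succ, add_comm, pow_succ', mul_assoc]
      exact (step n n.cast_nonneg).2.trans (mul_le_mul_of_nonneg_left ih hθ0.le)
  have hfl : ∀ ξ, 0 ≤ ξ → ‖w ξ‖ ≤ θ ^ ⌊ξ⌋₊ * ‖w 0‖ := by
    intro ξ hξ
    have := (step ⌊ξ⌋₊ (Nat.cast_nonneg _)).1 (ξ - ⌊ξ⌋₊) (sub_nonneg.2 (Nat.floor_le hξ))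
    rw [sub_add_cancel] at this
    exact this.trans (pow _)
  refine squeeze_zero_norm' (eventually_atTop.2 ⟨0, hfl⟩) ?_
  have := ((tendsto_pow_atTop_nhds_zero_of_lt_one hθ0.le hθ1).comp
    (tendsto_nat_floor_atTop (α := ℝ))).mul_const ‖w 0‖
  simpa using this

end StableManifold

/-! ### The stable manifold as a graph over the stable coordinates. -/

section StableGraph

open BoundedContinuousFunction

/-- The projection onto the components with `d i < 0`. -/
noncomputable def stableMask {k : ℕ} (d : Fin k → ℝ) : (Fin k → ℝ) →L[ℝ] (Fin k → ℝ) :=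
  ContinuousLinearMap.pi fun i =>
    if d i < 0 then ContinuousLinearMap.proj (R := ℝ) (φ := fun _ : Fin k => ℝ) i else 0

theorem stableMask_apply {k : ℕ} (d : Fin k → ℝ) (z : Fin k → ℝ) (i : Fin k) :
    stableMask d z i = if d i < 0 then z i else 0 := by
  simp only [stableMask, ContinuousLinearMap.pi_apply]
  split_ifs <;> rfl

/-- A function which is smooth near a point agrees near this point with a smooth function with
compact support. -/
theorem exists_smooth_compactSupport_eventuallyEq {E F : Type*} [NormedAddCommGroup E]
    [NormedSpace ℝ E] [FiniteDimensional ℝ E] [NormedAddCommGroup F] [NormedSpace ℝ F]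
    {f : E → F} {x₀ : E} (hf : ∀ᶠ x in 𝓝 x₀, ContDiffAt ℝ ∞ f x) :
    ∃ g : E → F, ContDiff ℝ ∞ g ∧ HasCompactSupport g ∧ g =ᶠ[𝓝 x₀] f := by
  obtain ⟨r, hr, hball⟩ := Metric.eventually_nhds_iff_ball.1 hf
  let χ : ContDiffBump x₀ := ⟨r / 4, r / 2, by positivity, by linarith⟩
  refine ⟨fun x => χ x • f x, contDiff_iff_contDiffAt.2 fun x => ?_, χ.hasCompactSupport.smul_right,
    ?_⟩
  · by_cases hx : x ∈ Metric.ball x₀ r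
    · exact χ.contDiffAt.smul (hball x hx)
    · have h1 : x ∉ tsupport χ := by
        rw [χ.tsupport_eq]
        intro h
        rw [Metric.mem_closedBall] at h
        rw [Metric.mem_ball] at hx
        have : χ.rOut = r / 2 := rfl
        linarith
      have h2 : (fun x => χ x • f x) =ᶠ[𝓝 x] fun _ => 0 := by
        filter_upwards [notMem_tsupport_iff_eventuallyEq.1 h1] with y hy
        rw [hy]
        simp
      exact contDiffAt_const.congr_of_eventuallyEq h2
  · filter_upwards [χ.eventuallyEq_one] with x hx
    rw [hx]
    simp

/-- `G (z, u)` is the initial value of the Lyapunov–Perron solution with the stable data of `z`. The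
stable manifold is the fixed point set of `z ↦ G (z, u)`: values of `G` start decaying orbits, and
by uniqueness a decaying orbit from `z` is the solution built from `z`. A single ball serves for all
statements because the solution is bounded by `‖z‖`. -/
theorem exists_stable_graph {k m : ℕ} {d : Fin k → ℝ} (hd0 : ∀ i, d i ≠ 0)
    {R : (Fin k → ℝ) × (Fin m → ℝ) → (Fin k → ℝ)} {u₀ : Fin m → ℝ}
    (hR : ∀ᶠ x in 𝓝 ((0 : Fin k → ℝ), u₀), ContDiffAt ℝ ∞ R x)
    (hR0 : ∀ᶠ u in 𝓝 u₀, R (0, u) = 0) (hR1 : fderiv ℝ R (0, u₀) = 0)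
    {𝒰 : Set ((Fin k → ℝ) × (Fin m → ℝ))} (h𝒰 : 𝒰 ∈ 𝓝 ((0 : Fin k → ℝ), u₀)) :
    ∃ (δ : ℝ) (N : Set (Fin m → ℝ)) (G : (Fin k → ℝ) × (Fin m → ℝ) → (Fin k → ℝ)),
      0 < δ ∧ IsOpen N ∧ u₀ ∈ N ∧ Metric.ball 0 δ ×ˢ N ⊆ 𝒰 ∧
      ContDiffOn ℝ ∞ G (Metric.ball 0 δ ×ˢ N) ∧
      HasFDerivAt G (stableMask d ∘L ContinuousLinearMap.fst ℝ _ _) (0, u₀) ∧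
      ∀ u ∈ N, G (0, u) = 0 ∧ ∀ z ∈ Metric.ball (0 : Fin k → ℝ) δ,
        (∀ i, d i < 0 → G (z, u) i = z i) ∧
        (∀ z' ∈ Metric.ball (0 : Fin k → ℝ) δ, (∀ i, d i < 0 → z i = z' i) →
          G (z, u) = G (z', u)) ∧
        (∃ W, W 0 = G (z, u) ∧
          IsDecayingOrbit (fun z i => d i * z i + R (z, u) i) (Metric.ball 0 δ) W ∧
          ∀ ξ, 0 ≤ ξ → ‖W ξ‖ ≤ ‖z‖) ∧
        ∀ W, W 0 = z → IsDecayingOrbit (fun z i => d i * z i + R (z, u) i) (Metric.ball 0 δ) W →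
          G (z, u) = z := by
  -- The spectral gap; its value is arbitrary when `k = 0`.
  obtain ⟨lam, hlam, hd⟩ : ∃ lam : ℝ, 0 < lam ∧ ∀ i, lam ≤ |d i| := by
    rcases isEmpty_or_nonempty (Fin k) with h | h
    · exact ⟨1, one_pos, fun i => h.elim i⟩
    · obtain ⟨i, hi⟩ := Finite.exists_min fun i => |d i|
      exact ⟨|d i|, abs_pos.2 (hd0 i), hi⟩
  -- The cut-off changes nothing near `(0, u₀)` and makes the composition operator smooth on all
  -- bounded functions.
  obtain ⟨Rc, hRs, hRc, hRe⟩ := exists_smooth_compactSupport_eventuallyEq hR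
  have hRc1 : fderiv ℝ Rc (0, u₀) = 0 := by rw [hRe.fderiv_eq, hR1]
  -- the Lyapunov–Perron equation and its solution
  obtain ⟨ψ, ⟨hψ0, O, Vb, hO, hxO, -, -, hψs, hψV, hψe⟩, hψd⟩ :=
    exists_isImplicitSolution (Φ := lpEq d hlam hd Rc hRs hRc) (y₀ := 0) (x₀ := (0, u₀))
      (Dy := ContinuousLinearEquiv.refl ℝ (LPState k))
      (Dx := -(expOp d ∘L ContinuousLinearMap.fst ℝ (Fin k → ℝ) (Fin m → ℝ)))
      (Eventually.of_forall fun p => contDiff_lpEq.contDiffAt)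
      (by
        have h0 : Rc (0, u₀) = 0 := by rw [hRe.self_of_nhds]; exact hR0.self_of_nhds
        rw [lpEq_eq_zero_iff]
        intro ξ i
        simp [h0, duhamel])
      (hasFDerivAt_lpEq hRc1)
  have hsol : ∀ x ∈ O, lpEq d hlam hd Rc hRs hRc (ψ x) x = 0 := fun x hx =>
    (hψe x hx _ (hψV hx)).2 rfl
  -- a small neighbourhood
  obtain ⟨s, hs, hsL⟩ := (hRs.contDiffAt (x := (0, u₀))).hasStrictFDerivAt (by simp)
    |>.exists_lipschitzOnWith_of_nnnorm_lt (K := ⟨lam / 2, by positivity⟩) (by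
      rw [hRc1, nnnorm_zero]
      exact NNReal.coe_pos.1 (half_pos hlam))
  have hψc : ContinuousAt ψ (0, u₀) := hψd.continuousAt
  obtain ⟨ρ, hρ, N₁, hN₁, hN₁o, hsub⟩ : ∃ ρ > 0, ∃ N₁ ∈ 𝓝 u₀, IsOpen N₁ ∧
      ∀ z ∈ Metric.ball (0 : Fin k → ℝ) ρ, ∀ u ∈ N₁,
      (z, u) ∈ s ∧ (z, u) ∈ O ∧ (z, u) ∈ 𝒰 ∧ Rc (z, u) = R (z, u) ∧ R (0, u) = 0 := by
    have hev : ∀ᶠ x in 𝓝 ((0 : Fin k → ℝ), u₀), x ∈ s ∧ x ∈ O ∧ x ∈ 𝒰 ∧ Rc x = R x ∧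
        R (0, x.2) = 0 := by
      filter_upwards [hs, hO.mem_nhds hxO, h𝒰, hRe,
        (continuous_snd.tendsto ((0 : Fin k → ℝ), u₀)).eventually hR0] with x h1 h2 h3 h4 h5
      exact ⟨h1, h2, h3, h4, h5⟩
    rw [nhds_prod_eq] at hev
    obtain ⟨A, hA, B, hB, hAB⟩ := eventually_prod_iff.1 hev
    obtain ⟨ρ, hρ, hρA⟩ := Metric.eventually_nhds_iff_ball.1 hA
    obtain ⟨N₁, hN₁, hN₁o, hu⟩ := eventually_nhds_iff.1 hB
    exact ⟨ρ, hρ, N₁, hN₁o.mem_nhds hu, hN₁o, fun z hz u hu => hAB (hρA z hz) (hN₁ u hu)⟩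
  -- Continuity of `ψ` keeps the whole solution in the ball of radius `ρ`, where the Lipschitz bound
  -- and `Rc = R` hold.
  obtain ⟨δ, hδ, N₂, hN₂, hN₂o, hsub₂⟩ : ∃ δ > 0, ∃ N₂ ∈ 𝓝 u₀, IsOpen N₂ ∧
      ∀ z ∈ Metric.ball (0 : Fin k → ℝ) δ, ∀ u ∈ N₂,
      ‖ψ (z, u)‖ < ρ := by
    have hev : ∀ᶠ x in 𝓝 ((0 : Fin k → ℝ), u₀), ‖ψ x‖ < ρ := by
      have := hψc.norm
      rw [ContinuousAt, hψ0, norm_zero] at this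
      exact this.eventually_lt_const hρ
    rw [nhds_prod_eq] at hev
    obtain ⟨A, hA, B, hB, hAB⟩ := eventually_prod_iff.1 hev
    obtain ⟨δ, hδ, hδA⟩ := Metric.eventually_nhds_iff_ball.1 hA
    obtain ⟨N₁, hN₁, hN₁o, hu⟩ := eventually_nhds_iff.1 hB
    exact ⟨δ, hδ, N₁, hN₁o.mem_nhds hu, hN₁o, fun z hz u hu => hAB (hδA z hz) (hN₁ u hu)⟩
  set δ' := min δ ρ with hδ'
  have hbδ : Metric.ball (0 : Fin k → ℝ) δ' ⊆ Metric.ball 0 δ :=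
    Metric.ball_subset_ball (min_le_left _ _)
  have hbρ : Metric.ball (0 : Fin k → ℝ) δ' ⊆ Metric.ball 0 ρ :=
    Metric.ball_subset_ball (min_le_right _ _)
  have hL : ∀ u ∈ N₁, ∀ z ∈ Metric.ball (0 : Fin k → ℝ) ρ,
      ∀ z' ∈ Metric.ball (0 : Fin k → ℝ) ρ, ‖Rc (z, u) - Rc (z', u)‖ ≤ lam / 2 * ‖z - z'‖ := by
    intro u hu z hz z' hz'
    have : ‖Rc (z, u) - Rc (z', u)‖ ≤ lam / 2 * ‖(z, u) - (z', u)‖ :=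
      hsL.norm_sub_le (hsub z hz u hu).1 (hsub z' hz' u hu).1
    simpa [Prod.norm_def] using this
  have hRc0 : ∀ u ∈ N₁, Rc (0, u) = 0 := fun u hu => by
    obtain ⟨-, -, -, h4, h5⟩ := hsub 0 (Metric.mem_ball_self hρ) u hu
    rw [h4, h5]
  refine ⟨δ', N₁ ∩ N₂, fun x => ψ x 0, lt_min hδ hρ, hN₁o.inter hN₂o,
    ⟨mem_of_mem_nhds hN₁, mem_of_mem_nhds hN₂⟩, ?_, ?_, ?_, ?_⟩
  · rintro ⟨z, u⟩ ⟨hz, hu⟩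
    exact (hsub z (hbρ hz) u hu.1).2.2.1
  · have h1 : ContDiffOn ℝ ∞ ψ (Metric.ball 0 δ' ×ˢ (N₁ ∩ N₂)) := hψs.mono (by
      rintro ⟨z, u⟩ ⟨hz, hu⟩
      exact (hsub z (hbρ hz) u hu.1).2.1)
    exact (evalCLM ℝ (0 : ℝ)).contDiff.comp_contDiffOn h1
  · have h1 := (evalCLM ℝ (0 : ℝ) (β := Fin k → ℝ)).hasFDerivAt.comp ((0 : Fin k → ℝ), u₀) hψd
    refine h1.congr_fderiv ?_
    refine ContinuousLinearMap.ext fun x => ?_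
    ext i
    simp [stableMask_apply, expOp_apply]
  · rintro u ⟨hu₁, hu₂⟩
    have hψz : ∀ z ∈ Metric.ball (0 : Fin k → ℝ) δ', lpEq d hlam hd Rc hRs hRc (ψ (z, u)) (z, u) = 0
        ∧ ‖ψ (z, u)‖ < ρ ∧ ‖ψ (z, u)‖ ≤ ‖z‖ := by
      intro z hz
      have h1 := hsol _ (hsub z (hbρ hz) u hu₁).2.1
      have h2 := hsub₂ z (hbδ hz) u hu₂
      exact ⟨h1, h2, lpEq_norm_le h1 (norm_comp_le (hRc0 u hu₁) (hL u hu₁) hlam h2)⟩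
    refine ⟨?_, fun z hz => ?_⟩
    · have h1 := (hψz 0 (Metric.mem_ball_self (lt_min hδ hρ))).2.2
      rw [norm_zero] at h1
      have h2 : ψ (0, u) = 0 := norm_le_zero_iff.1 h1
      simp [h2]
    · obtain ⟨h1, h2, h3⟩ := hψz z hz
      have hin : ∀ ξ, ψ (z, u) ξ ∈ Metric.ball (0 : Fin k → ℝ) δ' := fun ξ =>
        mem_ball_zero_iff.2 ((((ψ (z, u)).norm_coe_le_norm ξ).trans h3).trans_lt
          (mem_ball_zero_iff.1 hz))
      refine ⟨fun i hi => lpEq_zero_apply h1 hi, fun z' hz' hzz' => ?_, ⟨ψ (z, u), rfl, ⟨fun ξ hξ => ⟨hin ξ, ?_⟩,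
        lpEq_tendsto (hRc0 u hu₁) (hL u hu₁) h1 h2⟩,
        fun ξ _ => ((ψ (z, u)).norm_coe_le_norm ξ).trans h3⟩, ?_⟩
      · obtain ⟨h1', h2', -⟩ := hψz z' hz'
        show ψ (z, u) 0 = ψ (z', u) 0
        rw [lpEq_unique (hL u hu₁) h1 h1' hzz' h2 h2']
      · have := lpEq_hasDerivWithinAt h1 hξ
        rwa [(hsub _ (hbρ (hin ξ)) u hu₁).2.2.2.1] at this
      · rintro W hW0 ⟨hW, hWt⟩
        -- A decaying orbit in the open ball has a bound strictly below `δ'`: a tail is below `δ' /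
        -- 2`, and the remaining time interval is compact. Uniqueness requires the strict
        -- inequality.
        obtain ⟨r, hr, hWr⟩ : ∃ r < δ', ∀ ξ, 0 ≤ ξ → ‖W ξ‖ ≤ r := by
          obtain ⟨T, hT⟩ := eventually_atTop.1
            ((tendsto_zero_iff_norm_tendsto_zero.1 hWt).eventually_lt_const
              (half_pos (lt_min hδ hρ)))
          have hcont : ContinuousOn (fun ξ => ‖W ξ‖) (Icc 0 (max T 0)) := fun ξ hξ =>
            ((hW ξ hξ.1).2.continuousWithinAt.mono Icc_subset_Ici_self).norm
          obtain ⟨ξ₀, hξ₀, hmax⟩ := isCompact_Icc.exists_isMaxOn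
            ⟨0, left_mem_Icc.2 (le_max_right T 0)⟩ hcont
          refine ⟨max ‖W ξ₀‖ (δ' / 2), max_lt (mem_ball_zero_iff.1 (hW ξ₀ hξ₀.1).1)
            (half_lt_self (lt_min hδ hρ)), fun ξ hξ => ?_⟩
          rcases le_total ξ (max T 0) with h | h
          · exact le_max_of_le_left (hmax ⟨hξ, h⟩)
          · exact le_max_of_le_right (hT ξ ((le_max_left _ _).trans h)).le
        obtain ⟨v, hv, hvn, hv0⟩ := exists_lpEq_of_hasDerivWithinAt (d := d) (hlam := hlam)
          (hd := hd) (hR := hRs) (hc := hRc) (u := u) hWr (fun ξ hξ => by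
            rw [(hsub _ (hbρ (hW ξ hξ).1) u hu₁).2.2.2.1]
            exact (hW ξ hξ).2)
        have hvψ : v = ψ (z, u) := lpEq_unique (hL u hu₁) hv0 h1 (fun i _ => by rw [hW0])
          (hvn.trans_lt (hr.trans_le (min_le_right _ _))) h2
        show ψ (z, u) 0 = z
        rw [← hvψ, hv, max_self, hW0]

end StableGraph


/-! ### Matrices as linear maps, Jacobians, complexification -/

section Jacobians

variable {ι κ μ : Type*} [Fintype ι] [Fintype κ] [Fintype μ]

/-- Multiplication by a matrix as a continuous linear map. -/
noncomputable def mvL (A : Matrix ι κ ℝ) : (κ → ℝ) →L[ℝ] (ι → ℝ) :=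
  LinearMap.toContinuousLinearMap A.mulVecLin

@[simp] theorem mvL_apply (A : Matrix ι κ ℝ) (v : κ → ℝ) : mvL A v = A *ᵥ v := rfl

variable {a b c : ℕ}

@[simp] theorem jac_mulVec (F : (Fin a → ℝ) → (Fin c → ℝ)) (x v : Fin a → ℝ) :
    jac F x *ᵥ v = fderiv ℝ F x v := by
  rw [jac, ← Matrix.toLin'_apply, Matrix.toLin'_toMatrix']; rfl

@[simp] theorem jac₁_mulVec (F : (Fin a → ℝ) × (Fin b → ℝ) → (Fin c → ℝ))
    (x : (Fin a → ℝ) × (Fin b → ℝ)) (v : Fin a → ℝ) : jac₁ F x *ᵥ v = fderiv ℝ F x (v, 0) := by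
  rw [jac₁, ← Matrix.toLin'_apply, Matrix.toLin'_toMatrix']; rfl

@[simp] theorem jac₂_mulVec (F : (Fin a → ℝ) × (Fin b → ℝ) → (Fin c → ℝ))
    (x : (Fin a → ℝ) × (Fin b → ℝ)) (v : Fin b → ℝ) : jac₂ F x *ᵥ v = fderiv ℝ F x (0, v) := by
  rw [jac₂, ← Matrix.toLin'_apply, Matrix.toLin'_toMatrix']; rfl

theorem fderiv_eq_jac (F : (Fin a → ℝ) × (Fin b → ℝ) → (Fin c → ℝ))
    (x y : (Fin a → ℝ) × (Fin b → ℝ)) :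
    fderiv ℝ F x y = jac₁ F x *ᵥ y.1 + jac₂ F x *ᵥ y.2 := by
  rw [jac₁_mulVec, jac₂_mulVec, ← map_add]; simp

theorem jac₁_apply (F : (Fin a → ℝ) × (Fin b → ℝ) → (Fin c → ℝ))
    (x : (Fin a → ℝ) × (Fin b → ℝ)) (i : Fin c) (j : Fin a) :
    jac₁ F x i j = fderiv ℝ F x (Pi.single j 1, 0) i := by
  rw [← jac₁_mulVec, Matrix.mulVec_single_one]; rfl

theorem jac₂_apply (F : (Fin a → ℝ) × (Fin b → ℝ) → (Fin c → ℝ))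
    (x : (Fin a → ℝ) × (Fin b → ℝ)) (i : Fin c) (j : Fin b) :
    jac₂ F x i j = fderiv ℝ F x (0, Pi.single j 1) i := by
  rw [← jac₂_mulVec, Matrix.mulVec_single_one]; rfl

theorem jac_apply (F : (Fin a → ℝ) → (Fin c → ℝ)) (x : Fin a → ℝ) (i : Fin c) (j : Fin a) :
    jac F x i j = fderiv ℝ F x (Pi.single j 1) i := by
  rw [← jac_mulVec, Matrix.mulVec_single_one]; rfl

theorem matrix_eq_of_mulVec {ι κ : Type*} [Fintype κ] [DecidableEq κ] {A B : Matrix ι κ ℝ}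
    (h : ∀ v, A *ᵥ v = B *ᵥ v) : A = B :=
  Matrix.ext_of_mulVec_single fun _ => h _

theorem HasFDerivAt.jac₁_eq {F : (Fin a → ℝ) × (Fin b → ℝ) → (Fin c → ℝ)}
    {x : (Fin a → ℝ) × (Fin b → ℝ)} {D : (Fin a → ℝ) × (Fin b → ℝ) →L[ℝ] (Fin c → ℝ)}
    (h : HasFDerivAt F D x) {A : Matrix (Fin c) (Fin a) ℝ} (hA : ∀ v, D (v, 0) = A *ᵥ v) :
    jac₁ F x = A :=
  matrix_eq_of_mulVec fun v => by rw [jac₁_mulVec, h.fderiv, hA]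

theorem HasFDerivAt.jac₂_eq {F : (Fin a → ℝ) × (Fin b → ℝ) → (Fin c → ℝ)}
    {x : (Fin a → ℝ) × (Fin b → ℝ)} {D : (Fin a → ℝ) × (Fin b → ℝ) →L[ℝ] (Fin c → ℝ)}
    (h : HasFDerivAt F D x) {A : Matrix (Fin c) (Fin b) ℝ} (hA : ∀ v, D (0, v) = A *ᵥ v) :
    jac₂ F x = A :=
  matrix_eq_of_mulVec fun v => by rw [jac₂_mulVec, h.fderiv, hA]

/-- The partial Jacobian in the second variable of a function which is constant in it. -/
theorem jac₂_eq_zero_of_eventually {F : (Fin a → ℝ) × (Fin b → ℝ) → (Fin c → ℝ)}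
    {x : Fin a → ℝ} {y : Fin b → ℝ} {p : Fin c → ℝ} (hF : DifferentiableAt ℝ F (x, y))
    (h : ∀ᶠ v in 𝓝 y, F (x, v) = p) : jac₂ F (x, y) = 0 := by
  refine matrix_eq_of_mulVec fun v => ?_
  have h1 : HasFDerivAt (fun v => F (x, v)) (fderiv ℝ F (x, y) ∘L
      ContinuousLinearMap.inr ℝ (Fin a → ℝ) (Fin b → ℝ)) y :=
    hF.hasFDerivAt.comp y (hasFDerivAt_prodMk_right x y)
  have h2 : HasFDerivAt (fun v => F (x, v)) (0 : (Fin b → ℝ) →L[ℝ] (Fin c → ℝ)) y :=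
    (hasFDerivAt_const p y).congr_of_eventuallyEq h
  have h3 := congrArg (fun D : (Fin b → ℝ) →L[ℝ] (Fin c → ℝ) => D v) (h1.unique h2)
  simpa using h3

end Jacobians

/-! ### Complexification of real matrices. -/

section Complexification

variable {ι κ μ : Type*}

@[simp] theorem toC_mul [Fintype κ] (A : Matrix ι κ ℝ) (B : Matrix κ μ ℝ) :
    toC (A * B) = toC A * toC B :=
  Matrix.map_mul (f := Complex.ofRealHom)

@[simp] theorem toC_one [DecidableEq ι] : toC (1 : Matrix ι ι ℝ) = 1 := by
  simp [toC]

@[simp] theorem toC_zero : toC (0 : Matrix ι κ ℝ) = 0 := by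
  ext i j; simp [toC]

@[simp] theorem toC_add (A B : Matrix ι κ ℝ) : toC (A + B) = toC A + toC B := by
  ext i j; simp [toC]

@[simp] theorem toC_sub (A B : Matrix ι κ ℝ) : toC (A - B) = toC A - toC B := by
  ext i j; simp [toC]

@[simp] theorem toC_neg (A : Matrix ι κ ℝ) : toC (-A) = -toC A := by
  ext i j; simp [toC]

@[simp] theorem toC_smul (c : ℝ) (A : Matrix ι κ ℝ) : toC (c • A) = (c : ℂ) • toC A := by
  ext i j; simp [toC]

@[simp] theorem toC_apply (A : Matrix ι κ ℝ) (i : ι) (j : κ) : toC A i j = (A i j : ℂ) := rfl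

theorem toC_det [Fintype ι] [DecidableEq ι] (A : Matrix ι ι ℝ) : (toC A).det = (A.det : ℂ) :=
  (RingHom.map_det Complex.ofRealHom A).symm

theorem isUnit_toC [Fintype ι] [DecidableEq ι] {A : Matrix ι ι ℝ} (h : IsUnit A) :
    IsUnit (toC A) := by
  rw [Matrix.isUnit_iff_isUnit_det] at h ⊢
  rw [toC_det]
  exact h.map Complex.ofRealHom

/-- Singular matrices are covered: both inverses then have the default value zero. -/
theorem toC_inv [Fintype ι] [DecidableEq ι] (A : Matrix ι ι ℝ) : toC A⁻¹ = (toC A)⁻¹ := by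
  by_cases h : IsUnit A
  · refine (Matrix.inv_eq_right_inv ?_).symm
    rw [← toC_mul, Matrix.mul_nonsing_inv _ ((Matrix.isUnit_iff_isUnit_det _).1 h), toC_one]
  · rw [Matrix.nonsing_inv_apply_not_isUnit _ (by rwa [← Matrix.isUnit_iff_isUnit_det]), toC_zero,
      Matrix.nonsing_inv_apply_not_isUnit]
    rw [toC_det, isUnit_iff_ne_zero, Complex.ofReal_ne_zero, ← isUnit_iff_ne_zero,
      ← Matrix.isUnit_iff_isUnit_det]
    exact h

end Complexification

/-! ### Stable and unstable matrices -/

section Splitting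

variable {ι κ : Type*} [Fintype ι] [DecidableEq ι] [Fintype κ] [DecidableEq κ]

/-- A map intertwining `f` and `g` also intertwines the powers of `f - z` and `g - z`. -/
theorem map_maxGenEigenspace_le {K V W : Type*} [Field K] [AddCommGroup V] [Module K V]
    [AddCommGroup W] [Module K W] {f : Module.End K V} {g : Module.End K W} {T : V →ₗ[K] W}
    (h : g ∘ₗ T = T ∘ₗ f) (z : K) :
    (f.maxGenEigenspace z).map T ≤ g.maxGenEigenspace z := by
  rintro _ ⟨x, hx, rfl⟩
  rw [SetLike.mem_coe, Module.End.mem_maxGenEigenspace] at hx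
  obtain ⟨n, hn⟩ := hx
  rw [Module.End.mem_maxGenEigenspace]
  have h1 : (g - z • 1) ∘ₗ T = T ∘ₗ (f - z • 1) := by
    rw [LinearMap.sub_comp, LinearMap.comp_sub, h]
    ext v
    simp
  have h2 := Module.End.commute_pow_left_of_commute h1 n
  refine ⟨n, ?_⟩
  have h3 := congrArg (fun F : V →ₗ[K] W => F x) h2
  simpa [hn] using h3

theorem maxGenEigenspace_eq_bot {A : Matrix ι ι ℂ} {z : ℂ} (h : IsUnit (A - z • 1)) :
    Module.End.maxGenEigenspace (Matrix.toLin' A) z = ⊥ := by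
  rw [Submodule.eq_bot_iff]
  intro x hx
  rw [Module.End.mem_maxGenEigenspace] at hx
  obtain ⟨n, hn⟩ := hx
  have h1 : Matrix.toLin' A - z • 1 = Matrix.toLin' (A - z • 1) := by
    rw [map_sub, map_smul, Matrix.toLin'_one]; rfl
  rw [h1, ← Matrix.toLin'_pow, Matrix.toLin'_apply] at hn
  exact Matrix.mulVec_injective_of_isUnit (h.pow n) (by rw [hn, Matrix.mulVec_zero])

theorem isUnit_transpose_sub {M : Matrix ι ι ℂ} {z : ℂ} (h : IsUnit (M - z • 1)) :
    IsUnit (Mᵀ - z • 1) := by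
  have := (Matrix.isUnit_transpose _).2 h
  simpa using this

theorem linearIndependent_columns {R : Matrix ι κ ℂ} {Y : Matrix κ ι ℂ} (h : Y * R = 1) :
    LinearIndependent ℂ (fun j : κ => fun i : ι => R i j) := by
  refine Matrix.mulVec_injective_iff.1 (Function.LeftInverse.injective (g := Y.mulVec) fun v => ?_)
  rw [Matrix.mulVec_mulVec, h, Matrix.one_mulVec]

theorem span_columns (R : Matrix ι κ ℂ) :
    Submodule.span ℂ (range (fun j : κ => fun i : ι => R i j)) = LinearMap.range R.mulVecLin :=
  (Matrix.range_mulVecLin R).symm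

/-- A left-unstable matrix from an invariant splitting: `N` is a projection onto an invariant
subspace whose annihilator has the rows of `L` as a basis. -/
theorem isLeftUnstable_of_splitting {A : Matrix ι ι ℝ} {L : Matrix κ ι ℝ} {Y : Matrix ι κ ℝ}
    {N D : Matrix ι ι ℝ} {E : Matrix κ κ ℝ} (hLY : L * Y = 1) (hYL : Y * L = 1 - N)
    (hLA : L * A = E * L) (hAN : A * N = N * D)
    (hE : ∀ z : ℂ, z.re ≤ 0 → IsUnit (toC E - z • 1))
    (hD : ∀ z : ℂ, 0 < z.re → IsUnit (toC D - z • 1)) : IsLeftUnstable (toC A) (toC L) := by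
  refine ⟨linearIndependent_columns (Y := (toC Y)ᵀ) ?_, ?_⟩
  · rw [← Matrix.transpose_mul, ← toC_mul, hLY, toC_one, Matrix.transpose_one]
  rw [span_columns]
  -- `Lᵀ` intertwines `Eᵀ` with `Aᵀ`, and `Nᵀ` intertwines `Aᵀ` with `Dᵀ`.
  have hT1 : Matrix.toLin' (toC A)ᵀ ∘ₗ (toC L)ᵀ.mulVecLin =
      (toC L)ᵀ.mulVecLin ∘ₗ Matrix.toLin' (toC E)ᵀ := by
    rw [Matrix.toLin'_apply', Matrix.toLin'_apply', ← Matrix.mulVecLin_mul, ← Matrix.mulVecLin_mul,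
      ← Matrix.transpose_mul, ← Matrix.transpose_mul, ← toC_mul, ← toC_mul, hLA]
  have hT2 : Matrix.toLin' (toC D)ᵀ ∘ₗ (toC N)ᵀ.mulVecLin =
      (toC N)ᵀ.mulVecLin ∘ₗ Matrix.toLin' (toC A)ᵀ := by
    rw [Matrix.toLin'_apply', Matrix.toLin'_apply', ← Matrix.mulVecLin_mul, ← Matrix.mulVecLin_mul,
      ← Matrix.transpose_mul, ← Matrix.transpose_mul, ← toC_mul, ← toC_mul, hAN]
  apply le_antisymm
  -- Every vector is a sum of generalized eigenvectors of `Eᵀ`, and these exist only for eigenvalues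
  -- in the right half-plane.
  · rw [LinearMap.range_eq_map, ← Module.End.iSup_maxGenEigenspace_eq_top (Matrix.toLin' (toC E)ᵀ),
      Submodule.map_iSup]
    refine iSup_le fun z => ?_
    by_cases hz : 0 < z.re
    · exact (map_maxGenEigenspace_le hT1 z).trans (le_iSup₂_of_le z hz le_rfl)
    · rw [maxGenEigenspace_eq_bot (isUnit_transpose_sub (hE z (not_lt.1 hz))), Submodule.map_bot]
      exact bot_le
  -- An unstable generalized eigenvector of `Aᵀ` is sent by `Nᵀ` to one of `Dᵀ`, hence to zero. The
  -- identity `Y L = 1 - N` then puts it in the range of `Lᵀ`.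
  · refine iSup₂_le fun z hz x hx => ?_
    have h1 := map_maxGenEigenspace_le hT2 z (Submodule.mem_map_of_mem hx)
    rw [maxGenEigenspace_eq_bot (isUnit_transpose_sub (hD z hz)), Submodule.mem_bot, Matrix.mulVecLin_apply] at h1
    refine ⟨(toC Y)ᵀ *ᵥ x, ?_⟩
    rw [Matrix.mulVecLin_apply, Matrix.mulVec_mulVec, ← Matrix.transpose_mul, ← toC_mul, hYL,
      toC_sub, Matrix.transpose_sub, Matrix.sub_mulVec, h1, toC_one, Matrix.transpose_one,
      Matrix.one_mulVec, sub_zero]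

/-- Gershgorin: a diagonally dominant matrix with positive diagonal has its eigenvalues in the
right half-plane. -/
theorem isUnit_sub_of_diag_dominant {M : Matrix ι ι ℝ}
    (h : ∀ i, ∑ j ∈ Finset.univ.erase i, |M i j| < M i i) {z : ℂ} (hz : z.re ≤ 0) :
    IsUnit (toC M - z • 1) := by
  rw [Matrix.isUnit_iff_isUnit_det, isUnit_iff_ne_zero]
  refine det_ne_zero_of_sum_row_lt_diag fun i => ?_
  have h1 : ∑ j ∈ Finset.univ.erase i, ‖(toC M - z • 1) i j‖ =
      ∑ j ∈ Finset.univ.erase i, |M i j| := by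
    refine Finset.sum_congr rfl fun j hj => ?_
    have : i ≠ j := (Finset.ne_of_mem_erase hj).symm
    simp [this]
  rw [h1]
  refine (h i).trans_le ?_
  have h2 : M i i ≤ ((toC M - z • 1) i i).re := by simp; exact hz
  exact h2.trans (Complex.re_le_norm _)

theorem isUnit_sub_of_neg_diag_dominant {M : Matrix ι ι ℝ}
    (h : ∀ i, ∑ j ∈ Finset.univ.erase i, |M i j| < -M i i) {z : ℂ} (hz : 0 ≤ z.re) :
    IsUnit (toC M - z • 1) := by
  have h1 := isUnit_sub_of_diag_dominant (M := -M) (z := -z) (fun i => by simpa using h i)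
    (by simpa using hz)
  have h2 := h1.neg
  simpa [sub_eq_add_neg, add_comm] using h2

theorem isUnit_sub_conj {X M : Matrix ι ι ℝ} (hX : IsUnit X) {z : ℂ} (h : IsUnit (toC M - z • 1)) :
    IsUnit (toC (X * M * X⁻¹) - z • 1) := by
  have h1 : toC X * toC X⁻¹ = 1 := by
    rw [← toC_mul, Matrix.mul_nonsing_inv _ ((Matrix.isUnit_iff_isUnit_det _).1 hX), toC_one]
  have h2 : toC (X * M * X⁻¹) - z • 1 = toC X * (toC M - z • 1) * toC X⁻¹ := by
    rw [Matrix.mul_sub, Matrix.sub_mul, Matrix.mul_smul, Matrix.smul_mul, mul_one, h1, toC_mul,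
      toC_mul]
  rw [h2]
  refine ((isUnit_toC hX).mul h).mul ?_
  exact isUnit_toC ((Matrix.isUnit_nonsing_inv_iff).2 hX)

end Splitting

/-! ### Invariance of the stable graph under the flow. -/

section LocalStableManifold

variable {k m nu : ℕ}

theorem IsDecayingOrbit.shift {X : (Fin k → ℝ) → (Fin k → ℝ)} {V : Set (Fin k → ℝ)}
    {W : ℝ → (Fin k → ℝ)} (h : IsDecayingOrbit X V W) {σ : ℝ} (hσ : 0 ≤ σ) :
    IsDecayingOrbit X V (fun ξ => W (ξ + σ)) := by
  refine ⟨fun ξ hξ => ⟨(h.1 _ (add_nonneg hξ hσ)).1, ?_⟩,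
    h.2.comp (tendsto_atTop_add_const_right _ σ tendsto_id)⟩
  have h1 := (h.1 _ (add_nonneg hξ hσ)).2
  refine (h1.scomp_of_eq (h := fun ξ => ξ + σ) (h' := 1) ξ
    ((hasDerivAt_id ξ).add_const σ).hasDerivWithinAt
    (fun s hs => add_nonneg hs hσ) rfl).congr_deriv (by simp)

/-- A linear change of coordinates maps decaying orbits to decaying orbits. -/
theorem IsDecayingOrbit.map {X X' : (Fin k → ℝ) → (Fin k → ℝ)} {V V' : Set (Fin k → ℝ)}
    {W : ℝ → (Fin k → ℝ)} (h : IsDecayingOrbit X V W) (T : (Fin k → ℝ) →L[ℝ] (Fin k → ℝ))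
    (hV : MapsTo T V V') (hX : ∀ w, T (X w) = X' (T w)) :
    IsDecayingOrbit X' V' (fun ξ => T (W ξ)) := by
  refine ⟨fun ξ hξ => ⟨hV (h.1 ξ hξ).1, ?_⟩, ?_⟩
  · rw [← hX]
    exact T.hasFDerivAt.comp_hasDerivWithinAt ξ (h.1 ξ hξ).2
  · have := (T.continuous.tendsto 0).comp h.2
    rwa [map_zero] at this

/-- The linearization of a graph map of a stable manifold is a projection onto an invariant
subspace. -/
theorem stable_graph_linearization {F G : (Fin k → ℝ) → (Fin k → ℝ)} {δ : ℝ} (hδ : 0 < δ)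
    (hG : ContDiffOn ℝ ∞ G (Metric.ball 0 δ)) (hF : DifferentiableAt ℝ F 0)
    (hG0 : G 0 = 0) (hF0 : F 0 = 0)
    (horb : ∀ z ∈ Metric.ball (0 : Fin k → ℝ) δ, ∃ W, W 0 = G z ∧
      IsDecayingOrbit F (Metric.ball 0 δ) W)
    (hfix : ∀ z ∈ Metric.ball (0 : Fin k → ℝ) δ, ∀ W, W 0 = z →
      IsDecayingOrbit F (Metric.ball 0 δ) W → G z = z) (v : Fin k → ℝ) :
    fderiv ℝ G 0 (fderiv ℝ G 0 v) = fderiv ℝ G 0 v ∧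
    fderiv ℝ G 0 (fderiv ℝ F 0 (fderiv ℝ G 0 v)) = fderiv ℝ F 0 (fderiv ℝ G 0 v) := by
  have hball : Metric.ball (0 : Fin k → ℝ) δ ∈ 𝓝 0 := Metric.ball_mem_nhds 0 hδ
  have hGc : ContDiffAt ℝ ∞ G 0 := hG.contDiffAt hball
  have hGd : HasFDerivAt G (fderiv ℝ G 0) 0 := (hGc.differentiableAt (by simp)).hasFDerivAt
  have hGmem : ∀ z ∈ Metric.ball (0 : Fin k → ℝ) δ, G z ∈ Metric.ball (0 : Fin k → ℝ) δ := by
    intro z hz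
    obtain ⟨W, hW0, hW⟩ := horb z hz
    rw [← hW0]
    exact (hW.1 0 le_rfl).1
  constructor
  -- `G z` starts a decaying orbit, so it is fixed by `G`; the identity `G ∘ G = G` is
  -- differentiated.
  · have h1 : HasFDerivAt (fun z => G (G z)) (fderiv ℝ G 0 ∘L fderiv ℝ G 0) 0 := by
      refine HasFDerivAt.comp (g := G) 0 ?_ hGd
      rwa [hG0]
    have h2 : (fun z => G (G z)) =ᶠ[𝓝 0] G := by
      filter_upwards [hball] with z hz
      obtain ⟨W, hW0, hW⟩ := horb z hz
      exact hfix _ (hGmem z hz) W hW0 hW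
    have h3 := (h1.congr_of_eventuallyEq h2.symm).unique hGd
    exact congrArg (fun D : (Fin k → ℝ) →L[ℝ] (Fin k → ℝ) => D v) h3
  -- The orbit from `G z` consists of fixed points of `G`. Differentiating `G (W ξ) = W ξ` in `ξ`
  -- gives this identity; differentiating it in `z` at `0`, where `F` vanishes, gives invariance of
  -- the tangent space.
  · have hinv : ∀ z ∈ Metric.ball (0 : Fin k → ℝ) δ,
        fderiv ℝ G (G z) (F (G z)) = F (G z) := by
      intro z hz
      obtain ⟨W, hW0, hW⟩ := horb z hz
      have h1 : HasDerivWithinAt W (F (G z)) (Ici 0) 0 := by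
        rw [← hW0]; exact (hW.1 0 le_rfl).2
      have h2 : HasFDerivAt G (fderiv ℝ G (G z)) (W 0) := by
        rw [hW0]
        exact ((hG.contDiffAt (Metric.isOpen_ball.mem_nhds (hGmem z hz))).differentiableAt
          (by simp)).hasFDerivAt
      have h3 : HasDerivWithinAt (fun ξ => G (W ξ)) (fderiv ℝ G (G z) (F (G z))) (Ici 0) 0 :=
        h2.comp_hasDerivWithinAt 0 h1
      have h4 : ∀ ξ ∈ Ici (0 : ℝ), G (W ξ) = W ξ := fun ξ hξ =>
        hfix (W ξ) (hW.1 ξ hξ).1 (fun s => W (s + ξ)) (by simp) (hW.shift hξ)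
      have h5 := h3.congr (fun ξ hξ => (h4 ξ hξ).symm) (h4 0 self_mem_Ici).symm
      have h6 := (uniqueDiffWithinAt_Ici (0 : ℝ)).eq_deriv (Ici (0 : ℝ)) h5 h1
      exact h6
    have hF' : HasFDerivAt F (fderiv ℝ F 0) (G 0) := by
      rw [hG0]; exact hF.hasFDerivAt
    have hFG : HasFDerivAt (fun z => F (G z)) (fderiv ℝ F 0 ∘L fderiv ℝ G 0) 0 :=
      HasFDerivAt.comp (g := F) 0 hF' hGd
    have hdG : DifferentiableAt ℝ (fun z => fderiv ℝ G (G z)) 0 := by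
      have h1 : DifferentiableAt ℝ (fderiv ℝ G) (G 0) := by
        rw [hG0]
        exact (hGc.fderiv_right (m := 1) (by decide)).differentiableAt (by simp)
      exact h1.comp 0 hGd.differentiableAt
    have h1 := hdG.hasFDerivAt.clm_apply hFG
    have h2 : (fun z => fderiv ℝ G (G z) (F (G z))) =ᶠ[𝓝 0] fun z => F (G z) := by
      filter_upwards [hball] with z hz
      exact hinv z hz
    have h3 := (h1.congr_of_eventuallyEq h2.symm).unique hFG
    have h4 := congrArg (fun D : (Fin k → ℝ) →L[ℝ] (Fin k → ℝ) => D v) h3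
    simpa [hG0, hF0] using h4

end LocalStableManifold

/-! ### The local stable manifold of a vector field depending on a parameter. -/

section LocalStableManifold

variable {k m nu : ℕ}

theorem continuousAt_jac₁_apply {a b c : ℕ} {F : (Fin a → ℝ) × (Fin b → ℝ) → (Fin c → ℝ)}
    {x : (Fin a → ℝ) × (Fin b → ℝ)} (hF : ContDiffAt ℝ ∞ F x) (i : Fin c) (j : Fin a) :
    ContinuousAt (fun y => jac₁ F y i j) x := by
  simp only [jac₁_apply]
  have h1 : ContinuousAt (fderiv ℝ F) x := hF.continuousAt_fderiv (by simp)
  exact (continuous_apply i).continuousAt.comp (h1.clm_apply continuousAt_const)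

theorem fderiv_comp_prodMk {a b c : ℕ} {F : (Fin a → ℝ) × (Fin b → ℝ) → (Fin c → ℝ)}
    {x : Fin a → ℝ} {y : Fin b → ℝ} (hF : DifferentiableAt ℝ F (x, y)) (v : Fin a → ℝ) :
    fderiv ℝ (fun z => F (z, y)) x v = jac₁ F (x, y) *ᵥ v := by
  have h : HasFDerivAt (fun z => F (z, y)) (fderiv ℝ F (x, y) ∘L
      ContinuousLinearMap.inl ℝ (Fin a → ℝ) (Fin b → ℝ)) x :=
    hF.hasFDerivAt.comp x (hasFDerivAt_prodMk_left x y)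
  rw [h.fderiv, jac₁_mulVec]
  rfl

/-- Strict diagonal dominance is an open condition, valid at `u₀` where the matrix is diagonal. With
Gershgorin's theorem it locates the spectrum in a half-plane without following individual
eigenvalues. -/
theorem eventually_diag_dominant {ι : Type*} [Fintype ι] [DecidableEq ι] {E : Type*}
    [TopologicalSpace E] {M : E → Matrix ι ι ℝ} {u₀ : E} (hM : ContinuousAt M u₀)
    (h0 : ∀ i j, i ≠ j → M u₀ i j = 0) (hp : ∀ i, 0 < M u₀ i i) :
    ∀ᶠ u in 𝓝 u₀, ∀ i, ∑ j ∈ Finset.univ.erase i, |M u i j| < M u i i := by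
  have hc : ∀ i j, ContinuousAt (fun u => M u i j) u₀ := fun i j =>
    (_root_.continuous_apply_apply i j).continuousAt.comp hM
  refine eventually_all.2 fun i => ?_
  have h1 : ContinuousAt (fun u => ∑ j ∈ Finset.univ.erase i, |M u i j|) u₀ :=
    tendsto_finsetSum _ fun j _ => (hc i j).abs
  refine h1.eventually_lt (hc i i) ?_
  rw [Finset.sum_eq_zero fun j hj => by rw [h0 i j (Finset.ne_of_mem_erase hj).symm, abs_zero]]
  exact hp i

/-- In the coordinates given by `X` the manifold is the fixed point set of the graph map. As `G`
keeps stable components, only the unstable components of `z - G (z, u)` impose conditions, and these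
form `St`. Away from `u₀` the linearization need not be diagonal, and its spectrum on the invariant
splitting is controlled by perturbation. The clause on `X⁻¹ *ᵥ y` places the kernel of the
linearized `St` in the stable eigenspace. The constant `C` bounds orbits by their initial values,
which later keeps layers inside a prescribed neighbourhood. -/
theorem exists_local_stable_manifold {H : (Fin k → ℝ) × (Fin m → ℝ) → (Fin k → ℝ)}
    {u₀ : Fin m → ℝ} (hH : ∀ᶠ x in 𝓝 ((0 : Fin k → ℝ), u₀), ContDiffAt ℝ ∞ H x)
    (hH0 : ∀ᶠ u in 𝓝 u₀, H (0, u) = 0) {X : Matrix (Fin k) (Fin k) ℝ} (hX : IsUnit X)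
    {d : Fin k → ℝ} (hd : ∀ i, d i ≠ 0) (hJ : jac₁ H (0, u₀) * X = X * Matrix.diagonal d)
    (e : Fin nu ≃ {i // 0 < d i}) {𝒰 : Set ((Fin k → ℝ) × (Fin m → ℝ))}
    (h𝒰 : 𝒰 ∈ 𝓝 ((0 : Fin k → ℝ), u₀)) :
    ∃ (V : Set (Fin k → ℝ)) (N : Set (Fin m → ℝ)) (St : (Fin k → ℝ) × (Fin m → ℝ) → (Fin nu → ℝ))
      (C : ℝ), IsOpen V ∧ 0 ∈ V ∧ IsOpen N ∧ u₀ ∈ N ∧ V ×ˢ N ⊆ 𝒰 ∧ ContDiffOn ℝ ∞ St (V ×ˢ N) ∧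
      (∀ y, jac₁ St (0, u₀) *ᵥ y = 0 → ∀ i, 0 < d i → (X⁻¹ *ᵥ y) i = 0) ∧
      ∀ u ∈ N, St (0, u) = 0 ∧
        IsLeftUnstable (toC (jac₁ H (0, u))) (toC (jac₁ St (0, u))) ∧
        ∀ w ∈ V, (St (w, u) = 0 ↔ w ∈ localStableSet (fun w' => H (w', u)) V) ∧
          (St (w, u) = 0 → ∃ W, W 0 = w ∧ IsDecayingOrbit (fun w' => H (w', u)) V W ∧
            ∀ ξ, 0 ≤ ξ → ‖W ξ‖ ≤ C * ‖w‖) := by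
  have hXdet := (Matrix.isUnit_iff_isUnit_det _).1 hX
  have hXX : X * X⁻¹ = 1 := Matrix.mul_nonsing_inv _ hXdet
  have hXX' : X⁻¹ * X = 1 := Matrix.nonsing_inv_mul _ hXdet
  have hXv : ∀ v, X *ᵥ (X⁻¹ *ᵥ v) = v := fun v => by rw [Matrix.mulVec_mulVec, hXX, Matrix.one_mulVec]
  have hXv' : ∀ v, X⁻¹ *ᵥ (X *ᵥ v) = v := fun v => by rw [Matrix.mulVec_mulVec, hXX', Matrix.one_mulVec]
  have hHd : DifferentiableAt ℝ H (0, u₀) := hH.self_of_nhds.differentiableAt (by simp)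
  -- the nonlinear part in diagonal coordinates
  set T : (Fin k → ℝ) × (Fin m → ℝ) →L[ℝ] (Fin k → ℝ) × (Fin m → ℝ) :=
    (mvL X).prodMap (ContinuousLinearMap.id ℝ (Fin m → ℝ)) with hT
  have hTap : ∀ z u, T (z, u) = (X *ᵥ z, u) := fun z u => rfl
  set R : (Fin k → ℝ) × (Fin m → ℝ) → (Fin k → ℝ) :=
    fun x => mvL X⁻¹ (H (T x)) - mvL (Matrix.diagonal d) x.1 with hRdef
  have hF : ∀ z u, (fun i => d i * z i + R (z, u) i) = X⁻¹ *ᵥ H (X *ᵥ z, u) := by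
    intro z u
    ext i
    simp [hRdef, hTap, Matrix.mulVec_diagonal]
  have hF' : ∀ u, (fun z i => d i * z i + R (z, u) i) = fun z => X⁻¹ *ᵥ H (X *ᵥ z, u) :=
    fun u => funext fun z => hF z u
  have hT0 : T (0, u₀) = (0, u₀) := by rw [hTap, Matrix.mulVec_zero]
  have hRs : ∀ x, ContDiffAt ℝ ∞ H (T x) → ContDiffAt ℝ ∞ R x := fun x hx =>
    ((mvL X⁻¹).contDiff.contDiffAt.comp x (hx.comp x T.contDiff.contDiffAt)).sub
      ((mvL (Matrix.diagonal d)).contDiff.contDiffAt.comp x contDiffAt_fst)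
  have hT_tendsto : Tendsto T (𝓝 (0, u₀)) (𝓝 (0, u₀)) := by
    have := T.continuous.tendsto (0, u₀)
    rwa [hT0] at this
  have hR : ∀ᶠ x in 𝓝 ((0 : Fin k → ℝ), u₀), ContDiffAt ℝ ∞ R x :=
    (hT_tendsto.eventually hH).mono hRs
  have hR0 : ∀ᶠ u in 𝓝 u₀, R (0, u) = 0 := by
    filter_upwards [hH0] with u hu
    simp [hRdef, hTap, hu]
  have hR1 : fderiv ℝ R (0, u₀) = 0 := by
    have h1 : HasFDerivAt R (mvL X⁻¹ ∘L (fderiv ℝ H (0, u₀) ∘L T) -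
        mvL (Matrix.diagonal d) ∘L ContinuousLinearMap.fst ℝ _ _) (0, u₀) := by
      refine HasFDerivAt.sub ?_ ((mvL (Matrix.diagonal d)).hasFDerivAt.comp _ hasFDerivAt_fst)
      refine (mvL X⁻¹).hasFDerivAt.comp _ (HasFDerivAt.comp _ ?_ T.hasFDerivAt)
      rw [hT0]
      exact hHd.hasFDerivAt
    rw [h1.fderiv]
    refine ContinuousLinearMap.ext fun x => ?_
    have h2 : fderiv ℝ H (0, u₀) (T x) = jac₁ H (0, u₀) *ᵥ (X *ᵥ x.1) := by
      rw [fderiv_eq_jac, jac₂_eq_zero_of_eventually hHd hH0]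
      simp [hT]
    simp only [sub_apply, ContinuousLinearMap.comp_apply, h2, mvL_apply,
      ContinuousLinearMap.coe_fst', zero_apply]
    rw [Matrix.mulVec_mulVec (M := jac₁ H (0, u₀)), hJ, ← Matrix.mulVec_mulVec, hXv', sub_self]
  obtain ⟨δ, N, G, hδ, hNo, hu₀, hsub, hGs, hGd, hG⟩ :=
    exists_stable_graph hd hR hR0 hR1
      (𝒰 := T ⁻¹' (𝒰 ∩ {x | ContDiffAt ℝ ∞ H x ∧ H (0, x.2) = 0})) (by
        refine hT_tendsto ?_
        filter_upwards [h𝒰, hH, (continuous_snd.tendsto ((0 : Fin k → ℝ), u₀)).eventually hH0]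
          with x h1 h2 h3
        exact ⟨h1, h2, h3⟩)
  have h0δ : (0 : Fin k → ℝ) ∈ Metric.ball 0 δ := Metric.mem_ball_self hδ
  -- matrices of the linearization
  set Nm : (Fin m → ℝ) → Matrix (Fin k) (Fin k) ℝ := fun u => jac₁ G (0, u) with hNm
  set Am : (Fin m → ℝ) → Matrix (Fin k) (Fin k) ℝ := fun u => X⁻¹ * jac₁ H (0, u) * X with hAm
  set U : Matrix (Fin nu) (Fin k) ℝ := Matrix.of fun j i => if i = e j then 1 else 0 with hU
  have hUmul : ∀ (M : Matrix (Fin k) (Fin k) ℝ) j i, (U * M) j i = M (e j) i := by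
    intro M j i
    simp [hU, Matrix.mul_apply]
  have hmulU : ∀ {α : Type} (M : Matrix α (Fin k) ℝ) j i, (M * Uᵀ) i j = M i (e j) := by
    intro α M j i
    simp [hU, Matrix.mul_apply]
  have hUv : ∀ (v : Fin k → ℝ) j, (U *ᵥ v) j = v (e j) := by
    intro v j
    simp [hU, Matrix.mulVec, dotProduct]
  have hGdiff : ∀ z ∈ Metric.ball (0 : Fin k → ℝ) δ, ∀ u ∈ N, ContDiffAt ℝ ∞ G (z, u) :=
    fun z hz u hu => hGs.contDiffAt ((Metric.isOpen_ball.prod hNo).mem_nhds ⟨hz, hu⟩)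
  have hHu : ∀ u ∈ N, ContDiffAt ℝ ∞ H (0, u) ∧ H (0, u) = 0 := by
    intro u hu
    have h1 := (hsub (mk_mem_prod h0δ hu)).2
    simpa [hTap] using h1
  have hlin : ∀ u ∈ N, Nm u * Nm u = Nm u ∧ Nm u * (Am u * Nm u) = Am u * Nm u := by
    intro u hu
    have hFd : HasFDerivAt (fun z => X⁻¹ *ᵥ H (X *ᵥ z, u)) (mvL (Am u)) 0 := by
      have h2 : HasFDerivAt (fun z : Fin k → ℝ => H (z, u)) (mvL (jac₁ H (0, u))) (X *ᵥ 0) := by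
        rw [Matrix.mulVec_zero]
        refine ((hHu u hu).1.differentiableAt (by simp)).hasFDerivAt.comp (0 : Fin k → ℝ)
          (hasFDerivAt_prodMk_left 0 u) |>.congr_fderiv ?_
        refine ContinuousLinearMap.ext fun v => ?_
        simp
      have h3 := (mvL X⁻¹).hasFDerivAt.comp 0 (h2.comp (0 : Fin k → ℝ) (mvL X).hasFDerivAt)
      refine h3.congr_fderiv ?_
      refine ContinuousLinearMap.ext fun v => ?_
      simp [hAm, Matrix.mulVec_mulVec, Matrix.mul_assoc]
    have hGu : ContDiffOn ℝ ∞ (fun z => G (z, u)) (Metric.ball 0 δ) :=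
      hGs.comp (contDiff_id.prodMk contDiff_const).contDiffOn fun z hz => ⟨hz, hu⟩
    have key := stable_graph_linearization (F := fun z => X⁻¹ *ᵥ H (X *ᵥ z, u))
      (G := fun z => G (z, u)) hδ hGu hFd.differentiableAt (hG u hu).1
      (by rw [Matrix.mulVec_zero, (hHu u hu).2, Matrix.mulVec_zero])
      (fun z hz => by
        obtain ⟨-, -, ⟨W, hW0, hW, -⟩, -⟩ := (hG u hu).2 z hz
        rw [hF'] at hW
        exact ⟨W, hW0, hW⟩)
      (fun z hz W hW0 hW => by
        refine ((hG u hu).2 z hz).2.2.2 W hW0 ?_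
        rw [hF']
        exact hW)
    have hGv : ∀ v, fderiv ℝ (fun z => G (z, u)) 0 v = Nm u *ᵥ v :=
      fderiv_comp_prodMk ((hGdiff 0 h0δ u hu).differentiableAt (by simp))
    simp only [hGv, hFd.fderiv, mvL_apply] at key
    constructor
    · refine matrix_eq_of_mulVec fun v => ?_
      rw [← Matrix.mulVec_mulVec]
      exact (key v).1
    · refine matrix_eq_of_mulVec fun v => ?_
      rw [← Matrix.mulVec_mulVec, ← Matrix.mulVec_mulVec]
      exact (key v).2
  -- `G` preserves stable components, so the stable rows of its linearization are those of the
  -- identity.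
  have hrow : ∀ u ∈ N, ∀ i, d i < 0 → ∀ j, Nm u i j = (1 : Matrix (Fin k) (Fin k) ℝ) i j := by
    intro u hu i hi j
    have hGv : ∀ v, fderiv ℝ (fun z => G (z, u)) 0 v = Nm u *ᵥ v :=
      fderiv_comp_prodMk ((hGdiff 0 h0δ u hu).differentiableAt (by simp))
    have h1 : HasFDerivAt (fun z => G (z, u)) (fderiv ℝ (fun z => G (z, u)) 0) 0 :=
      (((hGdiff 0 h0δ u hu).differentiableAt (by simp)).comp (0 : Fin k → ℝ)
        (hasFDerivAt_prodMk_left (𝕜 := ℝ) 0 u).differentiableAt).hasFDerivAt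
    have h2 := (hasFDerivAt_pi'.1 h1) i
    have h3 : HasFDerivAt (fun z : Fin k → ℝ => G (z, u) i)
        (ContinuousLinearMap.proj (R := ℝ) (φ := fun _ : Fin k => ℝ) i) 0 := by
      refine (ContinuousLinearMap.proj (R := ℝ) (φ := fun _ : Fin k => ℝ) i).hasFDerivAt
        |>.congr_of_eventuallyEq ?_
      filter_upwards [Metric.ball_mem_nhds (0 : Fin k → ℝ) hδ] with z hz
      exact ((hG u hu).2 z hz).1 i hi
    have h4 := congrArg (fun D : (Fin k → ℝ) →L[ℝ] ℝ => D (Pi.single j 1)) (h2.unique h3)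
    simp only [ContinuousLinearMap.comp_apply, ContinuousLinearMap.proj_apply, hGv,
      Matrix.mulVec_single_one] at h4
    rw [Matrix.one_apply, ← Pi.single_apply, Pi.single_comm] at *
    simpa [Matrix.col_apply, Matrix.one_apply, Pi.single_apply, eq_comm] using h4
  have hN0 : Nm u₀ = Matrix.diagonal fun i => if d i < 0 then 1 else 0 := by
    refine HasFDerivAt.jac₁_eq hGd fun v => ?_
    ext i
    simp [stableMask_apply, Matrix.mulVec_diagonal]
  have hA0 : Am u₀ = Matrix.diagonal d := by
    rw [hAm]
    simp only
    rw [Matrix.mul_assoc, hJ, ← Matrix.mul_assoc, hXX', Matrix.one_mul]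
  -- `G` depends on the stable components only, so the unstable columns vanish.
  have hcol : ∀ u ∈ N, ∀ i j, Nm u i (e j) = 0 := by
    intro u hu i j
    have hGd' : HasFDerivAt (fun z => G (z, u)) (mvL (Nm u)) 0 := by
      refine ((hGdiff 0 h0δ u hu).differentiableAt (by simp)).hasFDerivAt.comp (0 : Fin k → ℝ)
        (hasFDerivAt_prodMk_left 0 u) |>.congr_fderiv ?_
      refine ContinuousLinearMap.ext fun v => ?_
      simp [hNm]
    have h1 : HasFDerivAt (fun z => G (stableMask d z, u)) (mvL (Nm u) ∘L stableMask d) 0 := by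
      refine HasFDerivAt.comp (g := fun z => G (z, u)) 0 ?_ (stableMask d).hasFDerivAt
      rwa [map_zero]
    have h2 : (fun z => G (stableMask d z, u)) =ᶠ[𝓝 0] fun z => G (z, u) := by
      have h3 : Tendsto (stableMask d) (𝓝 0) (𝓝 0) := by
        simpa using (stableMask d).continuous.tendsto 0
      filter_upwards [Metric.ball_mem_nhds (0 : Fin k → ℝ) hδ,
        h3 (Metric.ball_mem_nhds (0 : Fin k → ℝ) hδ)] with z hz hz'
      refine (((hG u hu).2 z hz).2.1 _ hz' fun i hi => ?_).symm
      rw [stableMask_apply, if_pos hi]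
    have h3 := congrArg (fun D : (Fin k → ℝ) →L[ℝ] (Fin k → ℝ) => D (Pi.single (e j : Fin k) 1) i)
      ((h1.congr_of_eventuallyEq h2.symm).unique hGd')
    have h4 : stableMask d (Pi.single (e j : Fin k) 1) = 0 := by
      ext i'
      rw [stableMask_apply]
      split_ifs with hi'
      · have : i' ≠ e j := fun h => by rw [h] at hi'; exact hi'.not_gt (e j).2
        simp [this]
      · rfl
    simp only [ContinuousLinearMap.comp_apply, h4, map_zero, mvL_apply,
      Matrix.mulVec_single_one] at h3
    exact h3.symm
  -- The stable rows of `1 - Nm u` are zero, so restriction to the unstable rows followed by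
  -- extension by zero loses nothing.
  have hUU : ∀ u ∈ N, Uᵀ * (U * (1 - Nm u)) = 1 - Nm u := by
    intro u hu
    ext i j
    by_cases hi : 0 < d i
    · have h1 : ∀ j', Uᵀ i j' = if j' = e.symm ⟨i, hi⟩ then 1 else 0 := by
        intro j'
        simp only [hU, Matrix.transpose_apply, Matrix.of_apply]
        refine if_congr ?_ rfl rfl
        rw [Equiv.eq_symm_apply, Subtype.ext_iff]
        exact eq_comm
      rw [Matrix.mul_apply]
      simp only [h1, hUmul, ite_mul, one_mul, zero_mul, Finset.sum_ite_eq', Finset.sum_ite_eq,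
        Finset.mem_univ, if_true, Equiv.apply_symm_apply]
    · have h1 : ∀ j', Uᵀ i j' = 0 := by
        intro j'
        simp only [hU, Matrix.transpose_apply, Matrix.of_apply]
        exact if_neg fun h : i = (e j' : Fin k) => hi (by rw [h]; exact (e j').2)
      rw [Matrix.mul_apply]
      simp only [h1, zero_mul, Finset.sum_const_zero, Matrix.sub_apply]
      rw [hrow u hu i (lt_of_le_of_ne (not_lt.1 hi) (hd i)), sub_self]
  have hUNU : ∀ u ∈ N, U * (1 - Nm u) * Uᵀ = 1 := by
    intro u hu
    ext j j'
    rw [hmulU, hUmul, Matrix.sub_apply, hcol u hu, sub_zero, Matrix.one_apply, Matrix.one_apply]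
    congr 1
    rw [← Subtype.ext_iff, e.injective.eq_iff]
  have hNc : ContinuousAt Nm u₀ := continuousAt_pi.2 fun i => continuousAt_pi.2 fun j =>
    (continuousAt_jac₁_apply (hGdiff 0 h0δ u₀ hu₀) i j).comp (f := fun u => ((0 : Fin k → ℝ), u))
      (by fun_prop)
  have hAc : ContinuousAt Am u₀ := by
    have h1 : ContinuousAt (fun u => jac₁ H (0, u)) u₀ :=
      continuousAt_pi.2 fun i => continuousAt_pi.2 fun j =>
        (continuousAt_jac₁_apply hH.self_of_nhds i j).comp (f := fun u => ((0 : Fin k → ℝ), u))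
          (by fun_prop)
    exact (continuousAt_const.mul h1).mul continuousAt_const
  -- `Am * Nm - (1 - Nm)` acts as the linearization on the range of the projection `Nm` and as `-1`
  -- on its kernel. At `u₀` it is diagonal with entries `d i < 0` or `-1`.
  have hev1 := eventually_diag_dominant (M := fun u => -(Am u * Nm u - (1 - Nm u)))
    ((hAc.mul hNc).sub (continuousAt_const.sub hNc)).neg
    (fun i j hij => by simp [hA0, hN0, hij, Matrix.one_apply])
    (fun i => by
      rcases (hd i).lt_or_gt with h | h
      · simp [hA0, hN0, h]
      · simp [hA0, hN0, h.not_gt])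
  -- This is the action induced on the unstable quotient; at `u₀` it is the diagonal matrix of the
  -- positive `d i`.
  have hev2 := eventually_diag_dominant (M := fun u => U * ((1 - Nm u) * Am u) * Uᵀ) (u₀ := u₀)
    (by
      refine continuousAt_pi.2 fun i => continuousAt_pi.2 fun j => ?_
      simp only [hmulU, hUmul]
      exact (_root_.continuous_apply_apply _ _).continuousAt.comp
        ((continuousAt_const.sub hNc).mul hAc))
    (fun i j hij => by
      have h1 : (e i : Fin k) ≠ e j := fun h => hij (e.injective (Subtype.ext h))
      simp [hmulU, hUmul, hA0, hN0, h1, Matrix.one_apply])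
    (fun i => by
      have h1 := (e i).2
      simp [hmulU, hUmul, hA0, hN0, h1.not_gt, h1])
  obtain ⟨N', hN', hN'o, hu₀'⟩ := eventually_nhds_iff.1 (hev1.and hev2)
  set St : (Fin k → ℝ) × (Fin m → ℝ) → (Fin nu → ℝ) :=
    fun x => mvL U (mvL X⁻¹ x.1 - G (mvL X⁻¹ x.1, x.2)) with hSt
  have hStd : ∀ u ∈ N, jac₁ St (0, u) = U * (1 - Nm u) * X⁻¹ := by
    intro u hu
    have h0 : HasFDerivAt (fun x : (Fin k → ℝ) × (Fin m → ℝ) => mvL X⁻¹ x.1)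
        (mvL X⁻¹ ∘L ContinuousLinearMap.fst ℝ (Fin k → ℝ) (Fin m → ℝ)) (0, u) :=
      (mvL X⁻¹).hasFDerivAt.comp _ hasFDerivAt_fst
    have h1 : HasFDerivAt G (fderiv ℝ G (0, u)) (mvL X⁻¹ (0 : Fin k → ℝ), u) := by
      rw [map_zero]
      exact ((hGdiff 0 h0δ u hu).differentiableAt (by simp)).hasFDerivAt
    have h2 : HasFDerivAt (fun x : (Fin k → ℝ) × (Fin m → ℝ) => G (mvL X⁻¹ x.1, x.2))
        _ (0, u) := HasFDerivAt.comp (g := G) ((0 : Fin k → ℝ), u) h1 (h0.prodMk hasFDerivAt_snd)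
    have h3 : HasFDerivAt St _ (0, u) :=
      (mvL U).hasFDerivAt.comp ((0 : Fin k → ℝ), u) (h0.sub h2)
    refine HasFDerivAt.jac₁_eq h3 fun v => ?_
    have h4 : fderiv ℝ G (0, u) (X⁻¹ *ᵥ v, 0) = Nm u *ᵥ (X⁻¹ *ᵥ v) := by rw [hNm, jac₁_mulVec]
    simp [h4, Matrix.mulVec_sub, Matrix.mul_sub, Matrix.sub_mul, Matrix.sub_mulVec,
      Matrix.mul_assoc]
  have hSt0 : ∀ u ∈ N, ∀ w, mvL X⁻¹ w ∈ Metric.ball (0 : Fin k → ℝ) δ →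
      (St (w, u) = 0 ↔ G (X⁻¹ *ᵥ w, u) = X⁻¹ *ᵥ w) := by
    intro u hu w hw
    constructor
    · intro h
      ext i
      rcases (hd i).lt_or_gt with hi | hi
      · exact ((hG u hu).2 _ hw).1 i hi
      · have h1 := congrFun h (e.symm ⟨i, hi⟩)
        simp only [hSt, mvL_apply, hUv, Equiv.apply_symm_apply, Pi.sub_apply, Pi.zero_apply] at h1
        linarith
    · intro h
      simp only [hSt, mvL_apply, h, sub_self, Matrix.mulVec_zero]
  -- `V` is a ball in the diagonal coordinates; passing to them and back costs the factor `‖X‖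
  -- ‖X⁻¹‖` in the orbit bound.
  refine ⟨mvL X⁻¹ ⁻¹' Metric.ball 0 δ, N ∩ N', St, ‖mvL X‖ * ‖mvL X⁻¹‖,
    Metric.isOpen_ball.preimage (mvL X⁻¹).continuous, by simpa using hδ, hNo.inter hN'o,
    ⟨hu₀, hu₀'⟩, ?_, ?_, ?_, ?_⟩
  · rintro ⟨w, u⟩ ⟨hw, hu⟩
    have h1 := (hsub (mk_mem_prod hw hu.1)).1
    rwa [hTap, mvL_apply, hXv] at h1
  · refine (mvL U).contDiff.comp_contDiffOn (ContDiffOn.sub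
      ((mvL X⁻¹).contDiff.comp contDiff_fst).contDiffOn ?_)
    refine hGs.comp (((mvL X⁻¹).contDiff.comp contDiff_fst).prodMk contDiff_snd).contDiffOn ?_
    rintro ⟨w, u⟩ ⟨hw, hu⟩
    exact ⟨hw, hu.1⟩
  · intro y hy i hi
    rw [hStd u₀ hu₀, ← Matrix.mulVec_mulVec, ← Matrix.mulVec_mulVec] at hy
    have h1 := congrFun hy (e.symm ⟨i, hi⟩)
    rw [hUv, Equiv.apply_symm_apply, Matrix.sub_mulVec, Matrix.one_mulVec, hN0] at h1
    rw [Pi.sub_apply, Matrix.mulVec_diagonal, if_neg hi.not_gt, zero_mul, sub_zero] at h1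
    exact h1
  · rintro u ⟨hu, hu'⟩
    refine ⟨(hSt0 u hu 0 (by simpa using hδ)).2 (by rw [Matrix.mulVec_zero, (hG u hu).1]), ?_,
      fun w hw => ?_⟩
    · rw [hStd u hu]
      obtain ⟨hN2, hNAN⟩ := hlin u hu
      obtain ⟨hg1, hg2⟩ := hN' u hu'
      have hAw : jac₁ H (0, u) = X * Am u * X⁻¹ := by
        simp only [hAm, Matrix.mul_assoc, hXX, Matrix.mul_one]
        rw [← Matrix.mul_assoc, hXX, Matrix.one_mul]
      refine isLeftUnstable_of_splitting (Y := X * Uᵀ) (N := X * Nm u * X⁻¹)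
        (D := X * (Am u * Nm u - (1 - Nm u)) * X⁻¹) (E := U * ((1 - Nm u) * Am u) * Uᵀ)
        ?_ ?_ ?_ ?_ (fun z hz => isUnit_sub_of_diag_dominant hg2 hz)
        (fun z hz => isUnit_sub_conj hX (isUnit_sub_of_neg_diag_dominant (fun i => ?_) hz.le))
      · rw [Matrix.mul_assoc, ← Matrix.mul_assoc X⁻¹, hXX', Matrix.one_mul, hUNU u hu]
      · rw [← Matrix.mul_assoc, Matrix.mul_assoc X, hUU u hu, Matrix.mul_sub, Matrix.sub_mul,
          Matrix.mul_one, hXX]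
      · have h1 : (1 - Nm u) * Am u * Nm u = 0 := by
          rw [Matrix.mul_assoc, Matrix.sub_mul, Matrix.one_mul, hNAN, sub_self]
        have h2 : (1 - Nm u) * Am u = (1 - Nm u) * Am u * (1 - Nm u) := by
          rw [Matrix.mul_sub, h1, Matrix.mul_one, sub_zero]
        calc U * (1 - Nm u) * X⁻¹ * jac₁ H (0, u)
            = U * ((1 - Nm u) * Am u) * X⁻¹ := by
              rw [hAw]
              simp only [Matrix.mul_assoc]
              rw [← Matrix.mul_assoc X⁻¹ X, hXX', Matrix.one_mul]
          _ = U * ((1 - Nm u) * Am u * (Uᵀ * (U * (1 - Nm u)))) * X⁻¹ := by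
              rw [hUU u hu, ← h2]
          _ = _ := by simp only [Matrix.mul_assoc]
      · have h1 : Nm u * (Am u * Nm u - (1 - Nm u)) = Am u * Nm u := by
          rw [Matrix.mul_sub, hNAN, Matrix.mul_sub, hN2, Matrix.mul_one, sub_self, sub_zero]
        calc jac₁ H (0, u) * (X * Nm u * X⁻¹) = X * (Am u * Nm u) * X⁻¹ := by
              rw [hAw]
              simp only [Matrix.mul_assoc]
              rw [← Matrix.mul_assoc X⁻¹ X, hXX', Matrix.one_mul]
          _ = X * (Nm u * (Am u * Nm u - (1 - Nm u))) * X⁻¹ := by rw [h1]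
          _ = _ := by
              simp only [Matrix.mul_assoc]
              rw [← Matrix.mul_assoc X⁻¹ X, hXX', Matrix.one_mul]
      · have h1 := hg1 i
        simp only [Matrix.neg_apply, abs_neg] at h1
        exact h1
    · have hfix : ∀ z ∈ Metric.ball (0 : Fin k → ℝ) δ, ∀ W, W 0 = z →
          IsDecayingOrbit (fun z => X⁻¹ *ᵥ H (X *ᵥ z, u)) (Metric.ball 0 δ) W → G (z, u) = z := by
        intro z hz W hW0 hW
        refine ((hG u hu).2 z hz).2.2.2 W hW0 ?_
        rw [hF']
        exact hW
      have horb : St (w, u) = 0 → ∃ W, W 0 = w ∧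
          IsDecayingOrbit (fun w' => H (w', u)) (mvL X⁻¹ ⁻¹' Metric.ball 0 δ) W ∧
            ∀ ξ, 0 ≤ ξ → ‖W ξ‖ ≤ ‖mvL X‖ * ‖mvL X⁻¹‖ * ‖w‖ := by
        intro h
        have hGz := (hSt0 u hu w hw).1 h
        obtain ⟨-, -, ⟨W, hW0, hW, hWn⟩, -⟩ := (hG u hu).2 _ hw
        rw [hF'] at hW
        refine ⟨fun ξ => mvL X (W ξ), ?_, hW.map (mvL X) ?_ ?_, fun ξ hξ => ?_⟩
        · show mvL X (W 0) = w
          rw [hW0, mvL_apply, mvL_apply, hGz, hXv]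
        · intro z hz
          rw [mem_preimage, mvL_apply, mvL_apply, hXv']
          exact hz
        · intro z
          rw [mvL_apply, hXv, mvL_apply]
        · rw [mul_assoc]
          refine ((mvL X).le_opNorm _).trans (mul_le_mul_of_nonneg_left ?_ (norm_nonneg _))
          exact (hWn ξ hξ).trans ((mvL X⁻¹).le_opNorm w)
      refine ⟨⟨fun h => ?_, ?_⟩, horb⟩
      · obtain ⟨W, hW0, hW, -⟩ := horb h
        exact ⟨W, hW0, hW⟩
      · rintro ⟨W, hW0, hW⟩
        rw [hSt0 u hu w hw]
        refine hfix _ hw (fun ξ => mvL X⁻¹ (W ξ)) (by show mvL X⁻¹ (W 0) = _; rw [hW0, mvL_apply])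
          (hW.map (mvL X⁻¹) (fun z hz => hz) fun z => ?_)
        rw [mvL_apply, mvL_apply, hXv]

end LocalStableManifold


/-! ### Diagonalization and inertia of real symmetric matrices -/

section Inertia

variable {ι κ : Type*} [Fintype ι] [DecidableEq ι] [Fintype κ] [DecidableEq κ]

theorem exists_orthogonal_diagonalization {A : Matrix ι ι ℝ} (hA : Aᵀ = A) :
    ∃ (V : Matrix ι ι ℝ) (d : ι → ℝ), Vᵀ * V = 1 ∧ V * Vᵀ = 1 ∧ Vᵀ * A * V = Matrix.diagonal d := by
  have hA' : A.IsHermitian := by rwa [Matrix.IsHermitian, Matrix.conjTranspose_eq_transpose_of_trivial]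
  refine ⟨hA'.eigenvectorUnitary, hA'.eigenvalues, ?_, ?_, ?_⟩
  · have := Unitary.coe_star_mul_self hA'.eigenvectorUnitary
    rwa [Matrix.star_eq_conjTranspose, Matrix.conjTranspose_eq_transpose_of_trivial] at this
  · have := Unitary.coe_mul_star_self hA'.eigenvectorUnitary
    rwa [Unitary.coe_star, Matrix.star_eq_conjTranspose,
      Matrix.conjTranspose_eq_transpose_of_trivial] at this
  · have := hA'.conjStarAlgAut_star_eigenvectorUnitary
    rw [Unitary.conjStarAlgAut_star_apply, Matrix.star_eq_conjTranspose,
      Matrix.conjTranspose_eq_transpose_of_trivial] at this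
    exact this

theorem PosDef.pos {Q : Matrix ι ι ℝ} (hQ : Q.PosDef) {x : ι → ℝ} (hx : x ≠ 0) :
    0 < x ⬝ᵥ (Q *ᵥ x) := by
  simpa using hQ.dotProduct_mulVec_pos hx

theorem PosDef.symm {Q : Matrix ι ι ℝ} (hQ : Q.PosDef) : Qᵀ = Q := by
  have := hQ.isHermitian
  rwa [Matrix.IsHermitian, Matrix.conjTranspose_eq_transpose_of_trivial] at this

theorem PosDef.of_pos {Q : Matrix ι ι ℝ} (hQ : Qᵀ = Q) (h : ∀ x, x ≠ 0 → 0 < x ⬝ᵥ (Q *ᵥ x)) :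
    Q.PosDef := by
  refine Matrix.PosDef.of_dotProduct_mulVec_pos ?_ fun x hx => by simpa using h x hx
  rwa [Matrix.IsHermitian, Matrix.conjTranspose_eq_transpose_of_trivial]

theorem dotProduct_congr (Q : Matrix ι ι ℝ) (X : Matrix ι κ ℝ) (x y : κ → ℝ) :
    x ⬝ᵥ ((Xᵀ * Q * X) *ᵥ y) = (X *ᵥ x) ⬝ᵥ (Q *ᵥ (X *ᵥ y)) := by
  rw [← Matrix.mulVec_mulVec, ← Matrix.mulVec_mulVec, Matrix.dotProduct_mulVec,
    Matrix.vecMul_transpose]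

theorem PosDef.congr {Q : Matrix ι ι ℝ} (hQ : Q.PosDef) {X : Matrix ι κ ℝ}
    (hX : ∀ x, X *ᵥ x = 0 → x = 0) : (Xᵀ * Q * X).PosDef := by
  refine PosDef.of_pos ?_ fun x hx => ?_
  · simp only [Matrix.transpose_mul, Matrix.transpose_transpose, PosDef.symm hQ, Matrix.mul_assoc]
  · rw [dotProduct_congr]
    exact PosDef.pos hQ fun h => hx (hX x h)

theorem isUnit_of_mulVec_eq_zero {K : Type*} [Field K] {A : Matrix ι ι K}
    (h : ∀ x, A *ᵥ x = 0 → x = 0) : IsUnit A := by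
  rw [← Matrix.mulVec_injective_iff_isUnit]
  intro x y hxy
  refine sub_eq_zero.1 (h _ ?_)
  rw [Matrix.mulVec_sub, sub_eq_zero]
  exact hxy

theorem eq_zero_of_isUnit_mulVec {K : Type*} [Field K] {A : Matrix ι ι K} (hA : IsUnit A)
    {x : ι → K} (h : A *ᵥ x = 0) : x = 0 :=
  Matrix.mulVec_injective_iff_isUnit.2 hA (by rw [h, Matrix.mulVec_zero])

/-- Simultaneous diagonalization of a symmetric and a positive definite matrix. -/
theorem exists_simultaneous_diagonalization {A Q : Matrix ι ι ℝ} (hA : Aᵀ = A) (hQ : Q.PosDef) :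
    ∃ (X : Matrix ι ι ℝ) (d : ι → ℝ), IsUnit X ∧ Xᵀ * Q * X = 1 ∧ Xᵀ * A * X = Matrix.diagonal d := by
  obtain ⟨U, l, hU, hU', hUQ⟩ := exists_orthogonal_diagonalization (PosDef.symm hQ)
  have hl : ∀ i, 0 < l i := by
    intro i
    have h1 : U *ᵥ Pi.single i 1 ≠ 0 := fun h => by
      have h2 := congrArg (fun v => (Uᵀ *ᵥ v) i) h
      simp only [Matrix.mulVec_mulVec, hU] at h2
      simp at h2
    have h2 := PosDef.pos hQ h1
    rw [← dotProduct_congr, hUQ] at h2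
    simpa using h2
  -- Scaling the eigenvectors of `Q` turns `Q` into the identity; a further orthogonal change
  -- diagonalizes the transformed `A` without disturbing this.
  set Y := U * Matrix.diagonal fun i => (Real.sqrt (l i))⁻¹ with hY
  have hYQ : Yᵀ * Q * Y = 1 := by
    have h1 : Yᵀ * Q * Y = Matrix.diagonal (fun i => (Real.sqrt (l i))⁻¹) * (Uᵀ * Q * U) *
        Matrix.diagonal fun i => (Real.sqrt (l i))⁻¹ := by
      simp only [hY, Matrix.transpose_mul, Matrix.diagonal_transpose, Matrix.mul_assoc]
    rw [h1, hUQ, Matrix.diagonal_mul_diagonal, Matrix.diagonal_mul_diagonal, ← Matrix.diagonal_one]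
    congr 1
    ext i
    have h2 := Real.sqrt_ne_zero'.2 (hl i)
    field_simp
    exact (Real.sq_sqrt (hl i).le).symm
  obtain ⟨V, d, hV, hV', hVA⟩ := exists_orthogonal_diagonalization (A := Yᵀ * A * Y) (by
    simp only [Matrix.transpose_mul, Matrix.transpose_transpose, hA, Matrix.mul_assoc])
  have h3 : (Y * V)ᵀ * Q * (Y * V) = 1 := by
    have : (Y * V)ᵀ * Q * (Y * V) = Vᵀ * (Yᵀ * Q * Y) * V := by
      simp only [Matrix.transpose_mul, Matrix.mul_assoc]
    rw [this, hYQ, Matrix.mul_one, hV]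
  refine ⟨Y * V, d, ?_, h3, ?_⟩
  · exact (Matrix.isUnit_iff_isUnit_det _).2 (Matrix.isUnit_det_of_left_inverse h3)
  · rw [← hVA]
    simp only [Matrix.transpose_mul, Matrix.mul_assoc]

theorem roots_charpoly_of_diag {M X : Matrix ι ι ℝ} {e : ι → ℝ} (hX : IsUnit X)
    (h : M * X = X * Matrix.diagonal e) : M.charpoly.roots = Finset.univ.val.map e := by
  have hX' := (Matrix.isUnit_iff_isUnit_det _).1 hX
  have h1 : M = X * Matrix.diagonal e * X⁻¹ := by
    rw [← h, Matrix.mul_nonsing_inv_cancel_right _ _ hX']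
  rw [h1, Matrix.charpoly_mul_comm, ← Matrix.mul_assoc, Matrix.nonsing_inv_mul _ hX',
    Matrix.one_mul, Matrix.charpoly_diagonal, Polynomial.roots_prod]
  · simp
  · simp [Finset.prod_ne_zero_iff, Polynomial.X_sub_C_ne_zero]

theorem card_filter_map (e : ι → ℝ) (P : ℝ → Prop) [DecidablePred P] :
    ((Finset.univ.val.map e).filter P).card = Fintype.card {i // P (e i)} := by
  rw [Multiset.filter_map, Multiset.card_map, Fintype.card_subtype]
  rfl

theorem numPosEig_of_diag {M X : Matrix ι ι ℝ} {e : ι → ℝ} (hX : IsUnit X)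
    (h : M * X = X * Matrix.diagonal e) : numPosEig M = Fintype.card {i // 0 < e i} := by
  rw [numPosEig, roots_charpoly_of_diag hX h]
  exact card_filter_map e (fun x => 0 < x)

theorem numNegEig_of_diag {M X : Matrix ι ι ℝ} {e : ι → ℝ} (hX : IsUnit X)
    (h : M * X = X * Matrix.diagonal e) : numNegEig M = Fintype.card {i // e i < 0} := by
  rw [numNegEig, roots_charpoly_of_diag hX h]
  exact card_filter_map e (fun x => x < 0)

theorem numZeroEig_of_diag {M X : Matrix ι ι ℝ} {e : ι → ℝ} (hX : IsUnit X)
    (h : M * X = X * Matrix.diagonal e) : numZeroEig M = Fintype.card {i // e i = 0} := by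
  rw [numZeroEig, ← Polynomial.count_roots, roots_charpoly_of_diag hX h, Multiset.count,
    Multiset.countP_eq_card_filter]
  exact (congrArg _ (Multiset.filter_congr fun _ _ => eq_comm)).trans (card_filter_map e (fun x => x = 0))

/-- The congruence is an equivalence of the two diagonal quadratic forms, and the positive index of
inertia is invariant under equivalence. -/
theorem card_pos_of_congr {d : ι → ℝ} {d' : κ → ℝ} {Z : Matrix ι κ ℝ} {Z' : Matrix κ ι ℝ}
    (h : Z' * Z = 1) (h' : Z * Z' = 1) (hZ : Zᵀ * Matrix.diagonal d * Z = Matrix.diagonal d') :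
    Fintype.card {i // 0 < d i} = Fintype.card {i // 0 < d' i} := by
  have h1 : QuadraticMap.Equivalent (QuadraticMap.weightedSumSquares ℝ d')
      (QuadraticMap.weightedSumSquares ℝ d) := by
    refine ⟨⟨LinearEquiv.ofLinear Z.mulVecLin Z'.mulVecLin ?_ ?_, fun v => ?_⟩⟩
    · rw [← Matrix.mulVecLin_mul, h', Matrix.mulVecLin_one]
    · rw [← Matrix.mulVecLin_mul, h, Matrix.mulVecLin_one]
    · have h2 := dotProduct_congr (Matrix.diagonal d) Z v v
      rw [hZ] at h2
      simp only [QuadraticMap.weightedSumSquares_apply, smul_eq_mul]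
      simp only [dotProduct, Matrix.mulVec_diagonal] at h2
      calc _ = ∑ i, (Z *ᵥ v) i * (d i * (Z *ᵥ v) i) :=
            Finset.sum_congr rfl fun i _ => by
              change d i * ((Z *ᵥ v) i * (Z *ᵥ v) i) = _
              ring
        _ = _ := by
            rw [← h2]
            exact Finset.sum_congr rfl fun i _ => by ring
  have h2 := QuadraticMap.Equivalent.sigPos_eq h1
  rw [QuadraticForm.sigPos_weightedSumSquares, QuadraticForm.sigPos_weightedSumSquares,
    ← Nat.card_coe_set_eq, ← Nat.card_coe_set_eq, Nat.card_eq_fintype_card,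
    Nat.card_eq_fintype_card] at h2
  exact h2.symm

/-- Sylvester's law of inertia for the number of positive eigenvalues. -/
theorem numPosEig_of_congr {A : Matrix ι ι ℝ} (hA : Aᵀ = A) {X : Matrix ι κ ℝ} {Y : Matrix κ ι ℝ}
    (h : Y * X = 1) (h' : X * Y = 1) {d : κ → ℝ} (hX : Xᵀ * A * X = Matrix.diagonal d) :
    numPosEig A = Fintype.card {i // 0 < d i} := by
  obtain ⟨V, l, hV, hV', hVA⟩ := exists_orthogonal_diagonalization hA
  have h1 : A * V = V * Matrix.diagonal l := by
    rw [← hVA, ← Matrix.mul_assoc, ← Matrix.mul_assoc, hV', Matrix.one_mul]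
  rw [numPosEig_of_diag ((Matrix.isUnit_iff_isUnit_det _).2
    (Matrix.isUnit_det_of_left_inverse hV)) h1]
  refine card_pos_of_congr (Z := Vᵀ * X) (Z' := Y * V) ?_ ?_ ?_
  · rw [Matrix.mul_assoc, ← Matrix.mul_assoc V, hV', Matrix.one_mul, h]
  · rw [Matrix.mul_assoc, ← Matrix.mul_assoc X, h', Matrix.one_mul, hV]
  · rw [← hX, ← hVA]
    have : A = V * (Vᵀ * A * V) * Vᵀ := by
      simp only [Matrix.mul_assoc, hV', Matrix.mul_one]
      rw [← Matrix.mul_assoc, hV', Matrix.one_mul]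
    conv_rhs => rw [this]
    simp only [Matrix.transpose_mul, Matrix.transpose_transpose, Matrix.mul_assoc]

theorem numPosEig_congr {A : Matrix ι ι ℝ} {A' : Matrix κ κ ℝ} (hA : Aᵀ = A)
    {X : Matrix ι κ ℝ} {Y : Matrix κ ι ℝ}
    (h : Y * X = 1) (h' : X * Y = 1) (hX : Xᵀ * A * X = A') : numPosEig A = numPosEig A' := by
  have hA' : A'ᵀ = A' := by
    rw [← hX]
    simp only [Matrix.transpose_mul, Matrix.transpose_transpose, hA, Matrix.mul_assoc]
  obtain ⟨V, l, hV, hV', hVA⟩ := exists_orthogonal_diagonalization hA'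
  rw [numPosEig_of_congr hA' hV hV' hVA]
  refine numPosEig_of_congr hA (X := X * V) (Y := Vᵀ * Y) ?_ ?_ ?_
  · rw [Matrix.mul_assoc, ← Matrix.mul_assoc Y, h, Matrix.one_mul, hV]
  · rw [Matrix.mul_assoc, ← Matrix.mul_assoc V, hV', Matrix.one_mul, h']
  · rw [← hVA, ← hX]
    simp only [Matrix.transpose_mul, Matrix.mul_assoc]

theorem numPosEig_fromBlocks {A : Matrix ι ι ℝ} {D : Matrix κ κ ℝ} (hA : Aᵀ = A) (hD : Dᵀ = D) :
    numPosEig (Matrix.fromBlocks A 0 0 D) = numPosEig A + numPosEig D := by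
  obtain ⟨V, l, hV, hV', hVA⟩ := exists_orthogonal_diagonalization hA
  obtain ⟨V₂, l₂, hV₂, hV₂', hVA₂⟩ := exists_orthogonal_diagonalization hD
  rw [numPosEig_of_congr hA hV hV' hVA, numPosEig_of_congr hD hV₂ hV₂' hVA₂,
    numPosEig_of_congr (A := Matrix.fromBlocks A 0 0 D) (X := Matrix.fromBlocks V 0 0 V₂)
      (Y := Matrix.fromBlocks Vᵀ 0 0 V₂ᵀ) (d := Sum.elim l l₂), ← Fintype.card_sum]
  · exact Fintype.card_congr Equiv.subtypeSum
  · simp [Matrix.fromBlocks_transpose, hA, hD]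
  · simp [Matrix.fromBlocks_multiply, hV, hV₂]
  · simp [Matrix.fromBlocks_multiply, hV', hV₂']
  · simp [Matrix.fromBlocks_transpose, Matrix.fromBlocks_multiply, hVA, hVA₂]

end Inertia

/-! ### Stable and unstable subspaces of diagonalizable matrices -/

section Diagonalizable

variable {ι κ : Type*} [Fintype ι] [DecidableEq ι] [Fintype κ] [DecidableEq κ]

/-- The eigenvectors of a diagonalizable matrix belonging to a set of eigenvalues span the sum of
the corresponding generalized eigenspaces. -/
theorem mem_iSup_maxGenEigenspace {M X : Matrix ι ι ℝ} {e : ι → ℝ} (hX : IsUnit X)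
    (h : M * X = X * Matrix.diagonal e) (s : Set ℂ) (v : ι → ℂ) :
    v ∈ ⨆ z ∈ s, Module.End.maxGenEigenspace (Matrix.toLin' (toC M)) z ↔
      ∀ i, (e i : ℂ) ∉ s → (toC X⁻¹ *ᵥ v) i = 0 := by
  have hX' := (Matrix.isUnit_iff_isUnit_det _).1 hX
  have hXX : toC X * toC X⁻¹ = 1 := by rw [← toC_mul, Matrix.mul_nonsing_inv _ hX', toC_one]
  have hMX : toC M * toC X = toC X * Matrix.diagonal fun i => (e i : ℂ) := by
    rw [← toC_mul, h, toC_mul]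
    congr 1
    ext i j
    rcases eq_or_ne i j with rfl | hij
    · simp
    · simp [hij]
  constructor
  · intro hv i hi
    -- The `i`-th eigencoordinate vanishes on each generalized eigenspace with `z ∈ s`, because `e i
    -- ≠ z`.
    let L : (ι → ℂ) →ₗ[ℂ] ℂ := LinearMap.proj i ∘ₗ Matrix.toLin' (toC X⁻¹)
    suffices h1 : (⨆ z ∈ s, Module.End.maxGenEigenspace (Matrix.toLin' (toC M)) z) ≤ L.ker from
      h1 hv
    refine iSup₂_le fun z hz x hx => ?_
    have h2 : (Matrix.toLin' (Matrix.diagonal fun i => (e i : ℂ))) ∘ₗ Matrix.toLin' (toC X⁻¹) =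
        Matrix.toLin' (toC X⁻¹) ∘ₗ Matrix.toLin' (toC M) := by
      rw [← Matrix.toLin'_mul, ← Matrix.toLin'_mul]
      congr 1
      have h3 : toC X⁻¹ * toC X = 1 := by rw [← toC_mul, Matrix.nonsing_inv_mul _ hX', toC_one]
      calc _ = toC X⁻¹ * (toC X * Matrix.diagonal fun i => (e i : ℂ)) * toC X⁻¹ := by
            rw [← Matrix.mul_assoc, h3, Matrix.one_mul]
        _ = _ := by
            rw [← hMX]
            simp only [Matrix.mul_assoc, hXX, Matrix.mul_one]
    have h3 := map_maxGenEigenspace_le h2 z ⟨x, hx, rfl⟩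
    rw [Module.End.mem_maxGenEigenspace] at h3
    obtain ⟨n, hn⟩ := h3
    have h4 : ∀ (n : ℕ) (y : ι → ℂ),
        ((Matrix.toLin' (Matrix.diagonal fun i => (e i : ℂ)) - z • 1) ^ n) y =
          fun i => ((e i : ℂ) - z) ^ n * y i := by
      intro n
      induction n with
      | zero => intro y; simp
      | succ n ih =>
        intro y
        rw [pow_succ, Module.End.mul_apply, ih]
        ext i
        simp [Matrix.mulVec_diagonal, pow_succ]
        ring
    rw [h4] at hn
    have h5 := congrFun hn i
    simp only [Pi.zero_apply, mul_eq_zero, pow_eq_zero_iff', sub_eq_zero] at h5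
    rcases h5 with h5 | h5
    · exact absurd (h5.1 ▸ hz) hi
    · exact h5
  · intro hv
    have h1 : v = ∑ i, (toC X⁻¹ *ᵥ v) i • (toC X *ᵥ Pi.single i 1) := by
      conv_lhs => rw [← Matrix.one_mulVec v, ← hXX, ← Matrix.mulVec_mulVec]
      rw [Matrix.mulVec_eq_sum]
      refine Finset.sum_congr rfl fun i _ => ?_
      rw [Matrix.mulVec_single_one]
      ext j
      simp [mul_comm]
    rw [h1]
    refine Submodule.sum_mem _ fun i _ => ?_
    by_cases hi : (e i : ℂ) ∈ s
    · refine Submodule.smul_mem _ _ (Submodule.mem_iSup_of_mem (e i : ℂ)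
        (Submodule.mem_iSup_of_mem hi ?_))
      rw [Module.End.mem_maxGenEigenspace]
      refine ⟨1, ?_⟩
      have h2 : toC M *ᵥ toC X *ᵥ Pi.single i 1 = (e i : ℂ) • toC X *ᵥ Pi.single i 1 := by
        rw [Matrix.mulVec_mulVec, hMX, ← Matrix.mulVec_mulVec, ← Matrix.mulVec_smul]
        congr 1
        ext j
        rw [Matrix.mulVec_diagonal]
        by_cases hj : j = i
        · subst hj; simp
        · simp [hj]
      rw [pow_one, LinearMap.sub_apply, Matrix.toLin'_apply, h2]
      simp
    · rw [hv i hi, zero_smul]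
      exact Submodule.zero_mem _

theorem toC_mulVec_ofReal (A : Matrix ι κ ℝ) (v : κ → ℝ) :
    toC A *ᵥ (fun j => (v j : ℂ)) = fun i => ((A *ᵥ v) i : ℂ) := by
  ext i
  simp [Matrix.mulVec, dotProduct]

/-- A basis of the stable subspace of a diagonalizable matrix. -/
theorem isRightStable_of_diag {M X : Matrix ι ι ℝ} {e : ι → ℝ} (hX : IsUnit X)
    (h : M * X = X * Matrix.diagonal e) (σ : κ ≃ {i // e i < 0}) {Y : Matrix κ κ ℝ}
    (hY : IsUnit Y) :
    IsRightStable (toC M) (toC (X.submatrix id (fun j => (σ j : ι)) * Y)) := by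
  have hX' := (Matrix.isUnit_iff_isUnit_det _).1 hX
  have hY' := (Matrix.isUnit_iff_isUnit_det _).1 hY
  set R := X.submatrix id (fun j => (σ j : ι)) with hR
  have hXR : X⁻¹.submatrix (fun j => (σ j : ι)) id * R = 1 := by
    rw [hR, ← Matrix.submatrix_mul _ _ _ _ _ Function.bijective_id, Matrix.nonsing_inv_mul _ hX']
    ext i j
    simp [Matrix.one_apply, ← Subtype.ext_iff]
  refine ⟨linearIndependent_columns (Y := toC (Y⁻¹ * X⁻¹.submatrix (fun j => (σ j : ι)) id)) ?_, ?_⟩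
  · rw [← toC_mul, ← Matrix.mul_assoc, Matrix.mul_assoc Y⁻¹, hXR, Matrix.mul_one,
      Matrix.nonsing_inv_mul _ hY', toC_one]
  · rw [span_columns]
    ext v
    rw [mem_iSup_maxGenEigenspace hX h]
    simp only [mem_setOf_eq, Complex.ofReal_re, LinearMap.mem_range, Matrix.mulVecLin_apply]
    constructor
    · rintro ⟨w, rfl⟩ i hi
      have h1 : X⁻¹ * R = (1 : Matrix ι ι ℝ).submatrix id (fun j => (σ j : ι)) := by
        rw [← Matrix.nonsing_inv_mul _ hX']
        rfl
      rw [Matrix.mulVec_mulVec, ← toC_mul, ← Matrix.mul_assoc, h1, toC_mul, ← Matrix.mulVec_mulVec]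
      refine Finset.sum_eq_zero fun j _ => ?_
      have : i ≠ σ j := fun h => hi (by rw [h]; exact (σ j).2)
      simp [this]
    · intro hv
      refine ⟨toC (Y⁻¹ * X⁻¹.submatrix (fun j => (σ j : ι)) id) *ᵥ v, ?_⟩
      rw [Matrix.mulVec_mulVec, ← toC_mul, Matrix.mul_assoc, ← Matrix.mul_assoc Y,
        Matrix.mul_nonsing_inv _ hY', Matrix.one_mul]
      have hXX : toC X * toC X⁻¹ = 1 := by rw [← toC_mul, Matrix.mul_nonsing_inv _ hX', toC_one]
      conv_rhs => rw [← Matrix.one_mulVec v, ← hXX, ← Matrix.mulVec_mulVec]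
      rw [toC_mul, ← Matrix.mulVec_mulVec]
      ext i
      have h1 := σ.sum_comp fun j => toC X i j * (toC X⁻¹ *ᵥ v) j
      have h2 := Fintype.sum_subtype_add_sum_subtype (fun j => e j < 0)
        fun j => toC X i j * (toC X⁻¹ *ᵥ v) j
      rw [Finset.sum_eq_zero fun (j : {j // ¬ e j < 0}) _ => by rw [hv j j.2, mul_zero],
        add_zero] at h2
      exact h1.trans h2

end Diagonalizable


/-! ### Limits of stable subspaces -/

section StableLimits

variable {ι κ : Type*} [Fintype ι] [DecidableEq ι] [Fintype κ] [DecidableEq κ]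

/-- A real vector in the stable subspace of a real matrix. -/
def IsStableVec (M : Matrix ι ι ℝ) (v : ι → ℝ) : Prop :=
  (fun i => (v i : ℂ)) ∈
    ⨆ z ∈ {z : ℂ | z.re < 0}, Module.End.maxGenEigenspace (Matrix.toLin' (toC M)) z

theorem isStableVec_zero (M : Matrix ι ι ℝ) : IsStableVec M 0 := by
  have : (fun i => (((0 : ι → ℝ) i : ℝ) : ℂ)) = 0 := by ext i; simp
  rw [IsStableVec, this]
  exact Submodule.zero_mem _

theorem IsStableVec.add {M : Matrix ι ι ℝ} {v w : ι → ℝ} (hv : IsStableVec M v)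
    (hw : IsStableVec M w) : IsStableVec M (v + w) := by
  have : (fun i => (((v + w) i : ℝ) : ℂ)) = (fun i => (v i : ℂ)) + fun i => (w i : ℂ) := by
    ext i; simp
  rw [IsStableVec, this]
  exact Submodule.add_mem _ hv hw

theorem isStableVec_iff_of_diag {M X : Matrix ι ι ℝ} {e : ι → ℝ} (hX : IsUnit X)
    (h : M * X = X * Matrix.diagonal e) (v : ι → ℝ) :
    IsStableVec M v ↔ ∀ i, ¬ e i < 0 → (X⁻¹ *ᵥ v) i = 0 := by
  rw [IsStableVec, mem_iSup_maxGenEigenspace hX h]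
  simp [toC_mulVec_ofReal]

/-- `M` is minus the quotient of a positive definite and an invertible symmetric matrix. -/
structure IsSymmetrizedBy (M A Q : Matrix ι ι ℝ) : Prop where
  symm : Aᵀ = A
  isUnit : IsUnit A
  posDef : Q.PosDef
  mul_eq : A * M = -Q

/-- Reducing `Q` to the identity and `A` to `diag d` turns `A M = -Q` into `M X = X diag(-1/d)`.
Hence `M` has real spectrum, and its stable subspace has the dimension of the positive index of `A`.
-/
theorem IsSymmetrizedBy.exists_diag {M A Q : Matrix ι ι ℝ} (h : IsSymmetrizedBy M A Q) :
    ∃ (X : Matrix ι ι ℝ) (d : ι → ℝ), IsUnit X ∧ (∀ i, d i ≠ 0) ∧ Xᵀ * Q * X = 1 ∧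
      Xᵀ * A * X = Matrix.diagonal d ∧ M * X = X * Matrix.diagonal fun i => -(d i)⁻¹ := by
  obtain ⟨X, d, hX, hQ, hA⟩ := exists_simultaneous_diagonalization h.symm h.posDef
  have hX' := (Matrix.isUnit_iff_isUnit_det _).1 hX
  have hA' := (Matrix.isUnit_iff_isUnit_det _).1 h.isUnit
  have hd : ∀ i, d i ≠ 0 := by
    have h1 : IsUnit (Matrix.diagonal d) := by
      rw [← hA]
      exact (((Matrix.isUnit_transpose _).2 hX).mul h.isUnit).mul hX
    rw [Matrix.isUnit_iff_isUnit_det, Matrix.det_diagonal, isUnit_iff_ne_zero,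
      Finset.prod_ne_zero_iff] at h1
    exact fun i => h1 i (Finset.mem_univ _)
  refine ⟨X, d, hX, hd, hQ, hA, ?_⟩
  have h1 : IsUnit (Xᵀ * A) := ((Matrix.isUnit_transpose _).2 hX).mul h.isUnit
  refine h1.mul_left_cancel ?_
  calc Xᵀ * A * (M * X) = -(Xᵀ * Q * X) := by
        rw [← Matrix.mul_assoc, Matrix.mul_assoc Xᵀ, h.mul_eq, Matrix.mul_neg, Matrix.neg_mul]
    _ = Xᵀ * A * X * Matrix.diagonal fun i => -(d i)⁻¹ := by
        rw [hQ, hA, Matrix.diagonal_mul_diagonal, ← Matrix.diagonal_one, Matrix.diagonal_neg]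
        congr 1
        ext i
        simp [hd i]
    _ = _ := by rw [Matrix.mul_assoc]

/-- An approximate eigenvector for a negative number is close to the stable subspace. -/
theorem IsSymmetrizedBy.exists_isStableVec {M A Q : Matrix ι ι ℝ} (h : IsSymmetrizedBy M A Q)
    {z : ℝ} (hz : z < 0) (v : ι → ℝ) :
    ∃ v', IsStableVec M v' ∧ z ^ 2 * ((v - v') ⬝ᵥ (Q *ᵥ (v - v'))) ≤
      (M *ᵥ v - z • v) ⬝ᵥ (Q *ᵥ (M *ᵥ v - z • v)) := by
  obtain ⟨X, d, hX, hd, hQ, hA, hM⟩ := h.exists_diag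
  have hX' := (Matrix.isUnit_iff_isUnit_det _).1 hX
  have hXX := Matrix.mul_nonsing_inv _ hX'
  have hXX' := Matrix.nonsing_inv_mul _ hX'
  -- In these coordinates `Q` is the Euclidean form, so the estimate can be made component by
  -- component.
  have hnorm : ∀ y, (X *ᵥ y) ⬝ᵥ (Q *ᵥ (X *ᵥ y)) = ∑ i, y i ^ 2 := by
    intro y
    rw [← dotProduct_congr, hQ, Matrix.one_mulVec, dotProduct]
    exact Finset.sum_congr rfl fun i _ => (sq _).symm
  set y := X⁻¹ *ᵥ v with hy
  have hv : v = X *ᵥ y := by rw [hy, Matrix.mulVec_mulVec, hXX, Matrix.one_mulVec]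
  refine ⟨X *ᵥ fun i => if 0 < d i then y i else 0, ?_, ?_⟩
  · rw [isStableVec_iff_of_diag hX hM]
    intro i hi
    rw [Matrix.mulVec_mulVec, hXX', Matrix.one_mulVec, if_neg]
    simpa using hi
  · have h1 : M *ᵥ v - z • v = X *ᵥ fun i => (-(d i)⁻¹ - z) * y i := by
      rw [hv, Matrix.mulVec_mulVec, hM, ← Matrix.mulVec_mulVec, ← Matrix.mulVec_smul,
        ← Matrix.mulVec_sub]
      congr 1
      ext i
      simp only [Pi.sub_apply, Matrix.mulVec_diagonal, Pi.smul_apply, smul_eq_mul]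
      ring
    have h2 : v - X *ᵥ (fun i => if 0 < d i then y i else 0) =
        X *ᵥ fun i => if 0 < d i then 0 else y i := by
      conv_lhs => rw [hv]
      rw [← Matrix.mulVec_sub]
      congr 1
      ext i
      simp only [Pi.sub_apply]
      split_ifs <;> simp
    rw [h1, h2, hnorm, hnorm, Finset.mul_sum]
    refine Finset.sum_le_sum fun i _ => ?_
    split_ifs with hi
    · rw [zero_pow two_ne_zero, mul_zero]
      positivity
    -- Here the eigenvalue `-1/d` is positive and `z` is negative, so their distance is at least
    -- `|z|`.
    · have h3 : (d i)⁻¹ < 0 := inv_lt_zero.2 (lt_of_le_of_ne (not_lt.1 hi) (hd i))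
      rw [mul_pow]
      refine mul_le_mul_of_nonneg_right ?_ (sq_nonneg _)
      nlinarith

/-- An orthonormal basis of the stable subspace. -/
theorem IsSymmetrizedBy.exists_orthonormal {M A Q : Matrix ι ι ℝ} (h : IsSymmetrizedBy M A Q)
    {p : ℕ} (hp : numPosEig A = p) :
    ∃ R : Matrix ι (Fin p) ℝ, Rᵀ * R = 1 ∧ IsRightStable (toC M) (toC R) ∧
      ∀ v, IsStableVec M v → R *ᵥ (Rᵀ *ᵥ v) = v := by
  obtain ⟨X, d, hX, hd, hQ, hA, hM⟩ := h.exists_diag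
  have hX' := (Matrix.isUnit_iff_isUnit_det _).1 hX
  have hcard : Fintype.card (Fin p) = Fintype.card {i // -(d i)⁻¹ < 0} := by
    rw [Fintype.card_fin, ← hp, numPosEig_of_congr h.symm (Matrix.nonsing_inv_mul _ hX')
      (Matrix.mul_nonsing_inv _ hX') hA]
    exact Fintype.card_congr (Equiv.subtypeEquivRight fun i => by simp)
  let σ := Fintype.equivOfCardEq hcard
  set Z := X.submatrix id (fun j => (σ j : ι)) with hZ
  have hXZ : X⁻¹.submatrix (fun j => (σ j : ι)) id * Z = 1 := by
    rw [hZ, ← Matrix.submatrix_mul _ _ _ _ _ Function.bijective_id, Matrix.nonsing_inv_mul _ hX']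
    ext i j
    simp [Matrix.one_apply, ← Subtype.ext_iff]
  have hpos : (Zᵀ * (1 : Matrix ι ι ℝ) * Z).PosDef := by
    refine PosDef.congr Matrix.PosDef.one fun x hx => ?_
    rw [← Matrix.one_mulVec x, ← hXZ, ← Matrix.mulVec_mulVec, hx, Matrix.mulVec_zero]
  -- Diagonalizing the zero matrix together with the Gram matrix of the stable eigenvectors serves
  -- to orthonormalize them.
  obtain ⟨Y, -, hY, hYZ, -⟩ := exists_simultaneous_diagonalization (A := (0 : Matrix (Fin p) (Fin p) ℝ))
    Matrix.transpose_zero hpos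
  have horth : (Z * Y)ᵀ * (Z * Y) = 1 := by
    rw [← hYZ]
    simp only [Matrix.transpose_mul, Matrix.mul_one, Matrix.mul_assoc]
  have hst := isRightStable_of_diag hX hM σ hY
  refine ⟨Z * Y, horth, hst, fun v hv => ?_⟩
  rw [IsStableVec, ← hst.2, span_columns, LinearMap.mem_range] at hv
  obtain ⟨w, hw⟩ := hv
  have h1 : toC (Z * Y * (Z * Y)ᵀ) *ᵥ (fun i => (v i : ℂ)) = fun i => (v i : ℂ) := by
    rw [← hw, Matrix.mulVecLin_apply, Matrix.mulVec_mulVec, ← toC_mul, Matrix.mul_assoc, horth,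
      Matrix.mul_one]
  rw [toC_mulVec_ofReal] at h1
  rw [Matrix.mulVec_mulVec]
  ext i
  exact Complex.ofReal_injective (congrFun h1 i)

/-- Limits, as `ξ → 0+`, of vectors in the stable subspaces of `M ξ`. -/
def IsStableLimit (M : ℝ → Matrix ι ι ℝ) (v : ι → ℝ) : Prop :=
  ∃ w : ℝ → ι → ℝ, (∀ᶠ ξ in 𝓝[>] 0, IsStableVec (M ξ) (w ξ)) ∧ Tendsto w (𝓝[>] 0) (𝓝 v)

theorem isStableLimit_zero (M : ℝ → Matrix ι ι ℝ) : IsStableLimit M 0 :=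
  ⟨fun _ => 0, Eventually.of_forall fun ξ => isStableVec_zero (M ξ), tendsto_const_nhds⟩

theorem IsStableLimit.add {M : ℝ → Matrix ι ι ℝ} {v w : ι → ℝ} (hv : IsStableLimit M v)
    (hw : IsStableLimit M w) : IsStableLimit M (v + w) := by
  obtain ⟨v', h1, h2⟩ := hv
  obtain ⟨w', h3, h4⟩ := hw
  exact ⟨fun ξ => v' ξ + w' ξ, (h1.and h3).mono fun ξ h => h.1.add h.2, h2.add h4⟩

/-- Limits of sufficiently accurate approximate eigenvectors. -/
theorem isStableLimit_of_approx {M A Q : ℝ → Matrix ι ι ℝ} {c : ℝ} (hc : 0 < c)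
    (hM : ∀ᶠ ξ in 𝓝[>] 0, IsSymmetrizedBy (M ξ) (A ξ) (Q ξ) ∧
      ∀ x, c * ξ * (x ⬝ᵥ x) ≤ x ⬝ᵥ (Q ξ *ᵥ x))
    (hQ : ContinuousAt Q 0) {v s : ℝ → ι → ℝ} {z : ℝ → ℝ} (hv : ContinuousAt v 0)
    (hs : ContinuousAt s 0) (hz : ∀ᶠ ξ in 𝓝[>] 0, z ξ < 0)
    (hvs : ∀ᶠ ξ in 𝓝[>] 0, M ξ *ᵥ v ξ - z ξ • v ξ = (ξ * z ξ) • s ξ) : IsStableLimit M (v 0) := by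
  have hpos : ∀ᶠ ξ in 𝓝[>] (0 : ℝ), 0 < ξ := self_mem_nhdsWithin
  have h1 : ∀ ξ, ∃ v', (IsSymmetrizedBy (M ξ) (A ξ) (Q ξ) → z ξ < 0 → IsStableVec (M ξ) v' ∧
      z ξ ^ 2 * ((v ξ - v') ⬝ᵥ (Q ξ *ᵥ (v ξ - v'))) ≤
        (M ξ *ᵥ v ξ - z ξ • v ξ) ⬝ᵥ (Q ξ *ᵥ (M ξ *ᵥ v ξ - z ξ • v ξ))) := by
    intro ξ
    by_cases h : IsSymmetrizedBy (M ξ) (A ξ) (Q ξ) ∧ z ξ < 0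
    · obtain ⟨v', hv'⟩ := h.1.exists_isStableVec h.2 (v ξ)
      exact ⟨v', fun _ _ => hv'⟩
    · exact ⟨0, fun ha hb => absurd ⟨ha, hb⟩ h⟩
  choose w hw using h1
  refine ⟨w, ?_, ?_⟩
  · filter_upwards [hM, hz] with ξ h2 h3 using (hw ξ h2.1 h3).1
  have hcont : ContinuousAt (fun ξ => ξ * (s ξ ⬝ᵥ (Q ξ *ᵥ s ξ)) / c) 0 := by
    have h2 : ContinuousAt (fun ξ => s ξ ⬝ᵥ (Q ξ *ᵥ s ξ)) 0 := by
      have h3 : Continuous fun p : (ι → ℝ) × Matrix ι ι ℝ => p.1 ⬝ᵥ (p.2 *ᵥ p.1) := by fun_prop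
      exact h3.continuousAt.comp (hs.prodMk hQ)
    exact (continuousAt_id.mul h2).div_const c
  -- The form may degenerate like `c ξ`, while the residual is `ξ * z ξ` times a locally bounded
  -- vector. Dividing by `z ξ ^ 2 * c * ξ` leaves a bound of order `ξ` for the squared distance.
  have hlim : Tendsto (fun ξ => (v ξ - w ξ) ⬝ᵥ (v ξ - w ξ)) (𝓝[>] 0) (𝓝 0) := by
    have h2 := hcont.tendsto.mono_left (nhdsWithin_le_nhds (s := Ioi 0))
    rw [zero_mul, zero_div] at h2
    refine squeeze_zero' (Eventually.of_forall fun ξ => ?_) ?_ h2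
    · exact Finset.sum_nonneg fun i _ => mul_self_nonneg _
    · filter_upwards [hM, hz, hvs, hpos] with ξ h3 h4 h5 h6
      have h7 := (hw ξ h3.1 h4).2
      rw [h5, Matrix.mulVec_smul, smul_dotProduct, dotProduct_smul, smul_eq_mul, smul_eq_mul] at h7
      have h8 := h3.2 (v ξ - w ξ)
      have h9 : 0 < z ξ ^ 2 := by have := h4.ne; positivity
      rw [le_div_iff₀ hc]
      have h10 : z ξ ^ 2 * (ξ * (((v ξ - w ξ) ⬝ᵥ (v ξ - w ξ)) * c)) ≤
          z ξ ^ 2 * (ξ * (ξ * (s ξ ⬝ᵥ (Q ξ *ᵥ s ξ)))) := by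
        refine le_trans ?_ (h7.trans (le_of_eq (by ring)))
        refine mul_le_mul_of_nonneg_left (le_trans (le_of_eq (by ring)) h8) h9.le
      exact le_of_mul_le_mul_left (le_of_mul_le_mul_left h10 h9) h6
  have h2 : Tendsto (fun ξ => v ξ - w ξ) (𝓝[>] 0) (𝓝 0) := by
    rw [tendsto_pi_nhds]
    intro i
    rw [Pi.zero_apply, tendsto_zero_iff_abs_tendsto_zero]
    have h3 := hlim.sqrt
    rw [Real.sqrt_zero] at h3
    refine squeeze_zero (fun _ => abs_nonneg _) (fun ξ => ?_) h3
    refine Real.abs_le_sqrt ?_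
    rw [sq]
    exact Finset.single_le_sum (f := fun i => (v ξ - w ξ) i * (v ξ - w ξ) i)
      (fun i _ => mul_self_nonneg _) (Finset.mem_univ i)
  have h3 := (hv.tendsto.mono_left (nhdsWithin_le_nhds (s := Ioi 0))).sub h2
  simpa using h3

/-- A uniform lower bound for the determinants on the stable subspaces makes the limiting boundary
operator injective on limits of stable vectors. -/
theorem IsStableLimit.eq_zero {p : ℕ} {M A Q : ℝ → Matrix ι ι ℝ} {t : ℝ → Matrix (Fin p) ι ℝ}
    {c : ℝ} (hc : 0 < c)
    (hM : ∀ᶠ ξ in 𝓝[>] 0, IsSymmetrizedBy (M ξ) (A ξ) (Q ξ) ∧ numPosEig (A ξ) = p)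
    (ht : ContinuousAt t 0)
    (hdet : ∀ᶠ ξ in 𝓝[>] 0, ∀ R : Matrix ι (Fin p) ℝ, Rᵀ * R = 1 →
      IsRightStable (toC (M ξ)) (toC R) → c ≤ |(t ξ * R).det|)
    {v : ι → ℝ} (hv : IsStableLimit M v) (h0 : t 0 *ᵥ v = 0) : v = 0 := by
  obtain ⟨w, hw, hwv⟩ := hv
  have h1 : ∀ᶠ ξ in 𝓝[>] 0, ∃ R : Matrix ι (Fin p) ℝ, Rᵀ * R = 1 ∧ R *ᵥ (Rᵀ *ᵥ w ξ) = w ξ ∧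
      c ≤ |(t ξ * R).det| := by
    filter_upwards [hM, hw, hdet] with ξ h2 h3 h4
    obtain ⟨R, hR, hst, hRv⟩ := h2.1.exists_orthonormal h2.2
    exact ⟨R, hR, hRv _ h3, h4 R hR hst⟩
  -- Orthonormal bases lie in a compact set, so along a sequence they converge to some `S`. Then `v`
  -- is in the range of `S`, and the determinant bound makes `t 0` injective there.
  obtain ⟨x, hx⟩ := exists_seq_tendsto (𝓝[>] (0 : ℝ))
  have h2 : ∀ᶠ n in atTop, ∃ R : Matrix ι (Fin p) ℝ, Rᵀ * R = 1 ∧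
      R *ᵥ (Rᵀ *ᵥ w (x n)) = w (x n) ∧ c ≤ |(t (x n) * R).det| := hx.eventually h1
  obtain ⟨n₀, hn₀⟩ := eventually_atTop.1 h2
  choose R hR hRw hRd using fun n => hn₀ (n + n₀) (Nat.le_add_left _ _)
  have hx' : Tendsto (fun n => x (n + n₀)) atTop (𝓝[>] 0) := (tendsto_add_atTop_iff_nat n₀).2 hx
  have hK : IsCompact (Set.pi univ fun _ : ι => Set.pi univ fun _ : Fin p => Icc (-1 : ℝ) 1) :=
    isCompact_univ_pi fun _ => isCompact_univ_pi fun _ => isCompact_Icc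
  have hmem : ∀ n, (R n : ι → Fin p → ℝ) ∈
      (Set.pi univ fun _ : ι => Set.pi univ fun _ : Fin p => Icc (-1 : ℝ) 1) := by
    intro n i _ j _
    rw [mem_Icc, ← abs_le]
    have h3 := congrFun (congrFun (hR n) j) j
    rw [Matrix.mul_apply, Matrix.one_apply_eq] at h3
    have h4 : R n i j * R n i j ≤ ∑ i, (R n)ᵀ j i * R n i j :=
      Finset.single_le_sum (f := fun i => R n i j * R n i j)
        (fun i _ => mul_self_nonneg _) (Finset.mem_univ i)
    rw [h3] at h4
    exact abs_le_one_iff_mul_self_le_one.2 h4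
  obtain ⟨S', -, φ, hφ, hS⟩ := hK.tendsto_subseq hmem
  let S : Matrix ι (Fin p) ℝ := S'
  have hS' : Tendsto (fun n => R (φ n)) atTop (𝓝 S) := hS
  have hxφ : Tendsto (fun n => x (φ n + n₀)) atTop (𝓝[>] 0) := hx'.comp hφ.tendsto_atTop
  have hxφ' : Tendsto (fun n => x (φ n + n₀)) atTop (𝓝 0) := hxφ.mono_right nhdsWithin_le_nhds
  have hwS : Tendsto (fun n => w (x (φ n + n₀))) atTop (𝓝 v) := hwv.comp hxφ
  have h5 : S *ᵥ (Sᵀ *ᵥ v) = v := by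
    have h6 : Continuous fun q : Matrix ι (Fin p) ℝ × (ι → ℝ) => q.1 *ᵥ (q.1ᵀ *ᵥ q.2) := by
      fun_prop
    have h7 := (h6.tendsto (S, v)).comp (hS'.prodMk_nhds hwS)
    refine tendsto_nhds_unique h7 (hwS.congr fun n => ?_)
    exact (hRw (φ n)).symm
  have h6 : c ≤ |(t 0 * S).det| := by
    have h7 : Continuous fun q : Matrix (Fin p) ι ℝ × Matrix ι (Fin p) ℝ => |(q.1 * q.2).det| :=
      (Continuous.matrix_det (by fun_prop)).abs
    have h8 := (h7.tendsto (t 0, S)).comp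
      ((ht.tendsto.comp hxφ').prodMk_nhds hS')
    exact ge_of_tendsto h8 (Eventually.of_forall fun n => hRd (φ n))
  have h7 : IsUnit (t 0 * S) := by
    rw [Matrix.isUnit_iff_isUnit_det, isUnit_iff_ne_zero]
    exact abs_pos.1 (hc.trans_le h6)
  have h8 : Sᵀ *ᵥ v = 0 := by
    refine eq_zero_of_isUnit_mulVec h7 ?_
    rw [← Matrix.mulVec_mulVec, h5, h0]
  rw [← h5, h8, Matrix.mulVec_zero]

end StableLimits


/-! ### Linearity of stable limits, coercivity of definite forms, and eigenvector expansions. -/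

section

variable {ι κ : Type*} [Fintype ι] [DecidableEq ι] [Fintype κ] [DecidableEq κ]

theorem IsStableVec.smul {M : Matrix ι ι ℝ} {v : ι → ℝ} (hv : IsStableVec M v) (c : ℝ) :
    IsStableVec M (c • v) := by
  have : (fun i => (((c • v) i : ℝ) : ℂ)) = (c : ℂ) • fun i => (v i : ℂ) := by
    ext i; simp
  rw [IsStableVec, this]
  exact Submodule.smul_mem _ _ hv

theorem IsStableLimit.smul {M : ℝ → Matrix ι ι ℝ} {v : ι → ℝ} (hv : IsStableLimit M v) (c : ℝ) :
    IsStableLimit M (c • v) := by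
  obtain ⟨v', h1, h2⟩ := hv
  exact ⟨fun ξ => c • v' ξ, h1.mono fun ξ h => h.smul c, h2.const_smul c⟩

/-- The smallest eigenvalue serves as `c`; for an empty index set any positive value does. -/
theorem PosDef.exists_le {Q : Matrix ι ι ℝ} (hQ : Q.PosDef) :
    ∃ c, 0 < c ∧ ∀ x, c * (x ⬝ᵥ x) ≤ x ⬝ᵥ (Q *ᵥ x) := by
  obtain ⟨X, d, -, h1, h2⟩ :=
    exists_simultaneous_diagonalization (PosDef.symm hQ) (Matrix.PosDef.one (n := ι) (R := ℝ))
  rw [Matrix.mul_one] at h1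
  have h1' : X * Xᵀ = 1 := mul_eq_one_comm.1 h1
  have hd : ∀ i, 0 < d i := by
    intro i
    have h3 : X *ᵥ Pi.single i 1 ≠ 0 := fun h => by
      have h4 := congrArg (fun v => (Xᵀ *ᵥ v) i) h
      simp only [Matrix.mulVec_mulVec, h1] at h4
      simp at h4
    have h4 := PosDef.pos hQ h3
    rw [← dotProduct_congr, h2] at h4
    simpa using h4
  obtain ⟨c, hc, hcd⟩ : ∃ c, 0 < c ∧ ∀ i, c ≤ d i := by
    cases isEmpty_or_nonempty ι
    · exact ⟨1, one_pos, fun i => isEmptyElim i⟩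
    · obtain ⟨i, hi⟩ := Finite.exists_min d
      exact ⟨d i, hd i, hi⟩
  refine ⟨c, hc, fun x => ?_⟩
  obtain ⟨y, rfl⟩ : ∃ y, x = X *ᵥ y := ⟨Xᵀ *ᵥ x, by rw [Matrix.mulVec_mulVec, h1', Matrix.one_mulVec]⟩
  have h3 := dotProduct_congr (1 : Matrix ι ι ℝ) X y y
  rw [Matrix.mul_one, h1, Matrix.one_mulVec, Matrix.one_mulVec] at h3
  rw [← h3, ← dotProduct_congr, h2, dotProduct, dotProduct, Finset.mul_sum]
  refine Finset.sum_le_sum fun i _ => ?_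
  rw [Matrix.mulVec_diagonal]
  nlinarith [hcd i, mul_self_nonneg (y i)]

/-- Membership in a span of real eigenvectors is the form in which `ModifiedGKC.injective` takes its
vectors, since stable limits are closed under linear combinations. -/
theorem mem_span_eigenvectors {M X : Matrix ι ι ℝ} {e : ι → ℝ} (hX : IsUnit X)
    (h : M * X = X * Matrix.diagonal e) {P : ℝ → Prop} {x : ι → ℝ}
    (hx : ∀ i, ¬ P (e i) → (X⁻¹ *ᵥ x) i = 0) :
    x ∈ Submodule.span ℝ {x | ∃ z, P z ∧ M *ᵥ x = z • x} := by
  have hX' := (Matrix.isUnit_iff_isUnit_det _).1 hX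
  have h1 : x = ∑ i, (X⁻¹ *ᵥ x) i • (X *ᵥ Pi.single i 1) := by
    conv_lhs => rw [← Matrix.one_mulVec x, ← Matrix.mul_nonsing_inv _ hX', ← Matrix.mulVec_mulVec]
    rw [Matrix.mulVec_eq_sum]
    refine Finset.sum_congr rfl fun i _ => ?_
    rw [Matrix.mulVec_single_one]
    ext j
    simp [mul_comm]
  rw [h1]
  refine Submodule.sum_mem _ fun i _ => ?_
  by_cases hi : P (e i)
  · refine Submodule.smul_mem _ _ (Submodule.subset_span ⟨e i, hi, ?_⟩)
    rw [Matrix.mulVec_mulVec, h, ← Matrix.mulVec_mulVec, ← Matrix.mulVec_smul]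
    congr 1
    ext j
    rw [Matrix.mulVec_diagonal]
    by_cases hj : j = i
    · subst hj; simp
    · simp [hj]
  · rw [hx i hi, zero_smul]
    exact Submodule.zero_mem _

theorem toC_fromBlocks {α β γ δ : Type*} (A : Matrix α γ ℝ) (B : Matrix α δ ℝ) (C : Matrix β γ ℝ)
    (D : Matrix β δ ℝ) : toC (Matrix.fromBlocks A B C D) =
      Matrix.fromBlocks (toC A) (toC B) (toC C) (toC D) :=
  Matrix.fromBlocks_map _ _ _ _ _

end

theorem dotProduct_fromBlocks_diag {α β : Type*} [Fintype α] [Fintype β] (A : Matrix α α ℝ)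
    (D : Matrix β β ℝ) (x : α ⊕ β → ℝ) : x ⬝ᵥ (Matrix.fromBlocks A 0 0 D *ᵥ x) =
      (x ∘ Sum.inl) ⬝ᵥ (A *ᵥ (x ∘ Sum.inl)) + (x ∘ Sum.inr) ⬝ᵥ (D *ᵥ (x ∘ Sum.inr)) := by
  rw [Matrix.fromBlocks_mulVec, Matrix.zero_mulVec, Matrix.zero_mulVec, add_zero, zero_add]
  exact Fintype.sum_sum_type _

namespace LinearProblem

variable {m r p k n₀ : ℕ}

/-- Symmetry and definiteness of the coefficients of a linear problem. -/
structure IsRegular (L : LinearProblem m r p) : Prop where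
  posDef_A01 : L.A01.PosDef
  posDef_A02 : L.A02.PosDef
  symm_A11 : L.A11ᵀ = L.A11
  isUnit_A11 : IsUnit L.A11
  symm_A22 : L.A22ᵀ = L.A22
  negDef_S : (-L.S).PosDef

/-! ### The resolvent matrix for real parameters near zero -/

section Resolvent

variable (L : LinearProblem m r p) (P₂ : Matrix (Fin r) (Fin k) ℝ) (P₀ : Matrix (Fin r) (Fin n₀) ℝ)

/-- Minus the matrix `η S - ξ A₀₂` at `η = 1`, with the sign that makes it positive definite. -/
noncomputable def damping (ξ : ℝ) : Matrix (Fin r) (Fin r) ℝ := ξ • L.A02 - L.S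

noncomputable def damping₀₀Inv (ξ : ℝ) : Matrix (Fin n₀) (Fin n₀) ℝ := (P₀ᵀ * L.damping ξ * P₀)⁻¹

/-- Eliminates the kernel component: to the coordinates `y` it assigns the vector of the form `P₂ y
+ P₀ c` which is orthogonal to the columns of `P₀` with respect to `damping`. -/
noncomputable def lift (ξ : ℝ) : Matrix (Fin r) (Fin k) ℝ :=
  P₂ - P₀ * L.damping₀₀Inv P₀ ξ * (P₀ᵀ * L.damping ξ * P₂)

/-- The Schur complement of `damping` in the frame `(P₂, P₀)`, which is also `damping` restricted to
lifted vectors. -/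
noncomputable def liftedDamping (ξ : ℝ) : Matrix (Fin k) (Fin k) ℝ :=
  P₂ᵀ * L.damping ξ * L.lift P₂ P₀ ξ

/-- In the limit `ξ → 0`, a fast mode `y` carries the slow component `-coupling y`. -/
noncomputable def coupling (ξ : ℝ) : Matrix (Fin m) (Fin k) ℝ :=
  L.A11⁻¹ * L.A12 * L.lift P₂ P₀ ξ

noncomputable def slowCorrection (ξ : ℝ) : Matrix (Fin m) (Fin m) ℝ :=
  L.A11⁻¹ * L.A12 * P₀ * L.damping₀₀Inv P₀ ξ * (P₀ᵀ * L.A12ᵀ * L.A11⁻¹ * L.A01)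

/-- The left factor of the resolvent system is kept separate, so that eigenvector residuals can be
computed without inverting it. -/
noncomputable def resolventLeft (ξ : ℝ) : Matrix (Fin m ⊕ Fin k) (Fin m ⊕ Fin k) ℝ :=
  Matrix.fromBlocks (1 + ξ • L.slowCorrection P₀ ξ) (L.coupling P₂ P₀ ξ) 0 1

noncomputable def resolventRight (ξ : ℝ) : Matrix (Fin m ⊕ Fin k) (Fin m ⊕ Fin k) ℝ :=
  Matrix.fromBlocks (-(ξ • (L.A11⁻¹ * L.A01))) 0
    (ξ • ((L.Lam2 P₂)⁻¹ * ((L.lift P₂ P₀ ξ)ᵀ * L.A12ᵀ * L.A11⁻¹ * L.A01)))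
    (-((L.Lam2 P₂)⁻¹ * L.liftedDamping P₂ P₀ ξ))

noncomputable def resolvent (ξ : ℝ) : Matrix (Fin m ⊕ Fin k) (Fin m ⊕ Fin k) ℝ :=
  (L.resolventLeft P₂ P₀ ξ)⁻¹ * L.resolventRight P₂ P₀ ξ

noncomputable def realTrace (ξ : ℝ) : Matrix (Fin m ⊕ Fin r) (Fin m ⊕ Fin k) ℝ :=
  Matrix.fromBlocks 1 0
    (ξ • (P₀ * L.damping₀₀Inv P₀ ξ * (P₀ᵀ * L.A12ᵀ * L.A11⁻¹ * L.A01))) (L.lift P₂ P₀ ξ)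

variable {L P₂ P₀}

theorem Sij_ofReal {a b : ℕ} (Pi : Matrix (Fin r) (Fin a) ℝ) (Pj : Matrix (Fin r) (Fin b) ℝ)
    (ξ : ℝ) : L.Sij Pi Pj (ξ : ℂ) 1 = -toC (Piᵀ * L.damping ξ * Pj) := by
  rw [Sij, damping, toC_mul, toC_mul, toC_sub, toC_smul, Complex.ofReal_one, one_smul,
    ← Matrix.neg_mul, ← Matrix.mul_neg, neg_sub]

theorem inv_neg_matrix {K ι : Type*} [Field K] [Fintype ι] [DecidableEq ι] (A : Matrix ι ι K) :
    (-A)⁻¹ = -A⁻¹ := by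
  by_cases h : IsUnit A.det
  · refine Matrix.inv_eq_right_inv ?_
    rw [neg_mul_neg, Matrix.mul_nonsing_inv _ h]
  · rw [Matrix.nonsing_inv_apply_not_isUnit _ h, Matrix.nonsing_inv_apply_not_isUnit, neg_zero]
    rw [← Matrix.isUnit_iff_isUnit_det] at h ⊢
    rwa [IsUnit.neg_iff]

theorem N5_ofReal (ξ : ℝ) : L.N5 P₂ P₀ (ξ : ℂ) 1 = toC (L.lift P₂ P₀ ξ) := by
  rw [N5, Sij_ofReal, Sij_ofReal, inv_neg_matrix, lift, damping₀₀Inv]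
  simp only [toC_sub, toC_mul, toC_inv, Matrix.mul_neg, Matrix.neg_mul, neg_neg]

theorem traceMat_ofReal (ξ : ℝ) :
    L.traceMat P₂ P₀ (ξ : ℂ) 1 = toC (L.realTrace P₂ P₀ ξ) := by
  rw [traceMat, realTrace, toC_fromBlocks, N5_ofReal, N6, Sij_ofReal, inv_neg_matrix, damping₀₀Inv]
  simp only [toC_mul, toC_inv, toC_smul, toC_one, toC_zero, Matrix.mul_neg, Matrix.neg_mul,
    smul_neg, neg_neg]

theorem damping_transpose (hS : (-L.S).PosDef) (hA02 : L.A02ᵀ = L.A02) (ξ : ℝ) :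
    (L.damping ξ)ᵀ = L.damping ξ := by
  have h1 := PosDef.symm hS
  rw [Matrix.transpose_neg, neg_inj] at h1
  rw [damping, Matrix.transpose_sub, Matrix.transpose_smul, hA02, h1]

/-- For `η = 1` and real `ξ` all matrices of the Kreiss condition are real. Symmetry of `S` and
`A₀₂` identifies `P₂ᵀ - S₂₀ S₀₀⁻¹ P₀ᵀ` with the transpose of `lift`. -/
theorem M_ofReal (hS : (-L.S).PosDef) (hA02 : L.A02ᵀ = L.A02) (ξ : ℝ) :
    L.M P₂ P₀ (ξ : ℂ) 1 = toC (L.resolvent P₂ P₀ ξ) := by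
  have hT := damping_transpose (L := L) hS hA02 ξ
  have h5 : (L.lift P₂ P₀ ξ)ᵀ =
      P₂ᵀ - P₂ᵀ * L.damping ξ * P₀ * L.damping₀₀Inv P₀ ξ * P₀ᵀ := by
    simp only [lift, damping₀₀Inv, Matrix.transpose_sub, Matrix.transpose_mul,
      Matrix.transpose_nonsing_inv, hT, Matrix.transpose_transpose, Matrix.mul_assoc]
  rw [M, resolvent, toC_mul (L.resolventLeft P₂ P₀ ξ)⁻¹, toC_inv (L.resolventLeft P₂ P₀ ξ),
    resolventLeft, resolventRight, toC_fromBlocks, toC_fromBlocks]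
  congr 3
  · rw [toC_add, toC_one, N1, Sij_ofReal, inv_neg_matrix, slowCorrection, damping₀₀Inv]
    simp only [toC_mul, toC_inv, toC_smul, Matrix.mul_neg, Matrix.neg_mul, smul_neg, neg_neg]
  · rw [coupling, toC_mul, ← N5_ofReal]
    rfl
  · rw [toC_one]
  · rw [toC_neg, toC_smul]
  · rw [N3, Sij_ofReal, Sij_ofReal, inv_neg_matrix, h5, damping₀₀Inv]
    simp only [toC_mul, toC_inv, toC_smul, toC_sub, Matrix.mul_assoc, Matrix.mul_neg,
      Matrix.neg_mul, neg_neg]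
  · rw [N4, Sij_ofReal, Sij_ofReal, Sij_ofReal, Sij_ofReal, inv_neg_matrix, liftedDamping, lift,
      damping₀₀Inv]
    simp only [toC_mul, toC_inv, toC_sub, toC_neg, Matrix.mul_sub, Matrix.mul_neg, Matrix.neg_mul,
      neg_neg, Matrix.mul_assoc, sub_neg_eq_add, neg_sub]
    rw [neg_add_eq_sub, Matrix.mul_sub]

/-- `lift` differs from `P₂` by a matrix with columns in the range of `P₀`, chosen so that `damping`
annihilates the pairing with `P₀`. The left factor `P₂ᵀ` in `liftedDamping` may therefore be
replaced by the transposed lift, which makes the form symmetric and definite. -/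
theorem lift_spec (hL : L.IsRegular) (hP : L.IsSpectralFrame P₂ P₀) {ξ : ℝ} (hξ : 0 ≤ ξ) :
    (L.damping ξ).PosDef ∧ (P₀ᵀ * L.damping ξ * P₀).PosDef ∧
      P₀ᵀ * L.damping ξ * L.lift P₂ P₀ ξ = 0 ∧ P₂ᵀ * L.lift P₂ P₀ ξ = 1 ∧
      (L.liftedDamping P₂ P₀ ξ) = (L.lift P₂ P₀ ξ)ᵀ * L.damping ξ * L.lift P₂ P₀ ξ := by
  have hT : (L.damping ξ).PosDef := by
    rw [damping, sub_eq_add_neg]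
    exact Matrix.PosDef.posSemidef_add (hL.posDef_A02.posSemidef.smul hξ) hL.negDef_S
  have h0 : (P₀ᵀ * L.damping ξ * P₀).PosDef := PosDef.congr hT fun x hx => by
    rw [← Matrix.one_mulVec x, ← hP.orth₀, ← Matrix.mulVec_mulVec, hx, Matrix.mulVec_zero]
  have h0' := (Matrix.isUnit_iff_isUnit_det _).1 h0.isUnit
  have h1 : P₀ᵀ * L.damping ξ * L.lift P₂ P₀ ξ = 0 := by
    have : P₀ᵀ * L.damping ξ * L.lift P₂ P₀ ξ = P₀ᵀ * L.damping ξ * P₂ -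
        P₀ᵀ * L.damping ξ * P₀ * (P₀ᵀ * L.damping ξ * P₀)⁻¹ * (P₀ᵀ * L.damping ξ * P₂) := by
      simp only [lift, damping₀₀Inv, Matrix.mul_sub, Matrix.mul_assoc]
    rw [this, Matrix.mul_nonsing_inv _ h0', Matrix.one_mul, sub_self]
  refine ⟨hT, h0, h1, ?_, ?_⟩
  · have : P₂ᵀ * L.lift P₂ P₀ ξ = P₂ᵀ * P₂ -
        P₂ᵀ * P₀ * (L.damping₀₀Inv P₀ ξ * (P₀ᵀ * L.damping ξ * P₂)) := by
      simp only [lift, Matrix.mul_sub, Matrix.mul_assoc]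
    rw [this, hP.orth₂, hP.orth₂₀, Matrix.zero_mul, sub_zero]
  · rw [liftedDamping]
    have h2 : (P₀ * L.damping₀₀Inv P₀ ξ * (P₀ᵀ * L.damping ξ * P₂))ᵀ * L.damping ξ *
        L.lift P₂ P₀ ξ = (L.damping₀₀Inv P₀ ξ * (P₀ᵀ * L.damping ξ * P₂))ᵀ *
          (P₀ᵀ * L.damping ξ * L.lift P₂ P₀ ξ) := by
      rw [Matrix.mul_assoc P₀, Matrix.transpose_mul P₀]
      simp only [Matrix.mul_assoc]
    have h3 : (L.lift P₂ P₀ ξ)ᵀ = P₂ᵀ -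
        (P₀ * L.damping₀₀Inv P₀ ξ * (P₀ᵀ * L.damping ξ * P₂))ᵀ := by
      rw [lift, Matrix.transpose_sub]
    rw [h3, Matrix.sub_mul, Matrix.sub_mul, h2, h1, Matrix.mul_zero, sub_zero]

theorem isUnit_Lam2 (hP : L.IsSpectralFrame P₂ P₀) : IsUnit (L.Lam2 P₂) := by
  obtain ⟨d, hd, h⟩ := hP.diag
  rw [Lam2, h, Matrix.isUnit_iff_isUnit_det, Matrix.det_diagonal, isUnit_iff_ne_zero,
    Finset.prod_ne_zero_iff]
  exact fun i _ => hd i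

theorem Lam2_transpose (hP : L.IsSpectralFrame P₂ P₀) : (L.Lam2 P₂)ᵀ = L.Lam2 P₂ := by
  obtain ⟨d, hd, h⟩ := hP.diag
  rw [Lam2, h, Matrix.diagonal_transpose]

theorem A11_inv_transpose (hL : L.IsRegular) : (L.A11⁻¹)ᵀ = L.A11⁻¹ := by
  rw [Matrix.transpose_nonsing_inv, hL.symm_A11]

/-- `A₀₁ * slowCorrection` is a congruence transform of the positive definite matrix `(P₀ᵀ damping
P₀)⁻¹`, so it only adds a nonnegative form. -/
theorem slowCorrection_spec (hL : L.IsRegular) (hP : L.IsSpectralFrame P₂ P₀) {ξ : ℝ} (hξ : 0 ≤ ξ) :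
    (L.A01 * (1 + ξ • L.slowCorrection P₀ ξ)).PosDef ∧
      ∀ x, x ⬝ᵥ (L.A01 *ᵥ x) ≤ x ⬝ᵥ ((L.A01 * (1 + ξ • L.slowCorrection P₀ ξ)) *ᵥ x) := by
  obtain ⟨hT, h0, -⟩ := lift_spec hL hP hξ
  have h1 : L.A01 * (1 + ξ • L.slowCorrection P₀ ξ) = L.A01 + ξ •
      ((P₀ᵀ * L.A12ᵀ * L.A11⁻¹ * L.A01)ᵀ * (P₀ᵀ * L.damping ξ * P₀)⁻¹ *
        (P₀ᵀ * L.A12ᵀ * L.A11⁻¹ * L.A01)) := by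
    rw [Matrix.mul_add, Matrix.mul_one, Matrix.mul_smul, slowCorrection, damping₀₀Inv]
    simp only [Matrix.transpose_mul, Matrix.transpose_transpose, A11_inv_transpose hL,
      PosDef.symm hL.posDef_A01, Matrix.mul_assoc]
  have h2 : (ξ • ((P₀ᵀ * L.A12ᵀ * L.A11⁻¹ * L.A01)ᵀ * (P₀ᵀ * L.damping ξ * P₀)⁻¹ *
        (P₀ᵀ * L.A12ᵀ * L.A11⁻¹ * L.A01))).PosSemidef := by
    refine Matrix.PosSemidef.smul ?_ hξ
    have := h0.inv.posSemidef.conjTranspose_mul_mul_same (P₀ᵀ * L.A12ᵀ * L.A11⁻¹ * L.A01)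
    rwa [Matrix.conjTranspose_eq_transpose_of_trivial] at this
  rw [h1]
  refine ⟨hL.posDef_A01.add_posSemidef h2, fun x => ?_⟩
  rw [Matrix.add_mulVec, dotProduct_add]
  have := h2.dotProduct_mulVec_nonneg x
  rw [star_trivial] at this
  linarith

theorem isUnit_resolventLeft (hL : L.IsRegular) (hP : L.IsSpectralFrame P₂ P₀) {ξ : ℝ}
    (hξ : 0 ≤ ξ) : IsUnit (L.resolventLeft P₂ P₀ ξ) := by
  rw [resolventLeft, Matrix.isUnit_fromBlocks_zero₂₁]
  refine ⟨isUnit_of_mulVec_eq_zero fun x hx => ?_, isUnit_one⟩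
  refine eq_zero_of_isUnit_mulVec (slowCorrection_spec hL hP hξ).1.isUnit ?_
  rw [← Matrix.mulVec_mulVec, hx, Matrix.mulVec_zero]

/-- The positive definite matrix `Q` with `A M = -Q`. -/
noncomputable def resolventForm (L : LinearProblem m r p) (P₂ : Matrix (Fin r) (Fin k) ℝ)
    (P₀ : Matrix (Fin r) (Fin n₀) ℝ) (ξ : ℝ) : Matrix (Fin m ⊕ Fin k) (Fin m ⊕ Fin k) ℝ :=
  Matrix.fromBlocks (ξ • (L.A01 * (1 + ξ • L.slowCorrection P₀ ξ))) 0 0 (L.liftedDamping P₂ P₀ ξ)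

/-- The symmetrizer of the resolvent matrix. -/
noncomputable def resolventSymm (L : LinearProblem m r p) (P₂ : Matrix (Fin r) (Fin k) ℝ)
    (P₀ : Matrix (Fin r) (Fin n₀) ℝ) (ξ : ℝ) : Matrix (Fin m ⊕ Fin k) (Fin m ⊕ Fin k) ℝ :=
  (L.resolventLeft P₂ P₀ ξ)ᵀ * Matrix.fromBlocks L.A11 0 0 (L.Lam2 P₂) * L.resolventLeft P₂ P₀ ξ

/-- Uniformity in `ξ`: the term `ξ A₀₂` only helps, and lifting does not shorten vectors because
`P₂ᵀ * lift = 1` and the frame is orthonormal. -/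
theorem liftedDamping_ge (hL : L.IsRegular) (hP : L.IsSpectralFrame P₂ P₀) :
    ∃ c, 0 < c ∧ ∀ ξ, 0 ≤ ξ → (L.liftedDamping P₂ P₀ ξ).PosDef ∧
      ∀ y, c * (y ⬝ᵥ y) ≤ y ⬝ᵥ (L.liftedDamping P₂ P₀ ξ *ᵥ y) := by
  obtain ⟨c, hc, hcS⟩ := PosDef.exists_le hL.negDef_S
  refine ⟨c, hc, fun ξ hξ => ?_⟩
  obtain ⟨hT, h0, h1, h2, h3⟩ := lift_spec hL hP hξ
  rw [h3]
  refine ⟨PosDef.congr hT fun x hx => ?_, fun y => ?_⟩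
  · rw [← Matrix.one_mulVec x, ← h2, ← Matrix.mulVec_mulVec, hx, Matrix.mulVec_zero]
  · rw [dotProduct_congr]
    set w := L.lift P₂ P₀ ξ *ᵥ y with hw
    have h4 : y = P₂ᵀ *ᵥ w := by rw [hw, Matrix.mulVec_mulVec, h2, Matrix.one_mulVec]
    have h5 : w ⬝ᵥ w = y ⬝ᵥ y + (P₀ᵀ *ᵥ w) ⬝ᵥ (P₀ᵀ *ᵥ w) := by
      have h6 : w ⬝ᵥ w = w ⬝ᵥ ((P₂ * P₂ᵀ + P₀ * P₀ᵀ) *ᵥ w) := by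
        rw [hP.complete, Matrix.one_mulVec]
      rw [h6, Matrix.add_mulVec, dotProduct_add, ← Matrix.mulVec_mulVec, ← Matrix.mulVec_mulVec,
        ← h4, Matrix.dotProduct_mulVec, Matrix.dotProduct_mulVec, ← Matrix.mulVec_transpose,
        ← Matrix.mulVec_transpose, ← h4]
    have h6 : 0 ≤ (P₀ᵀ *ᵥ w) ⬝ᵥ (P₀ᵀ *ᵥ w) := Finset.sum_nonneg fun i _ => mul_self_nonneg _
    have h7 : w ⬝ᵥ (L.damping ξ *ᵥ w) = ξ * (w ⬝ᵥ (L.A02 *ᵥ w)) + w ⬝ᵥ ((-L.S) *ᵥ w) := by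
      rw [damping, sub_eq_add_neg, Matrix.add_mulVec, dotProduct_add, Matrix.smul_mulVec,
        dotProduct_smul, smul_eq_mul]
    have h8 := hL.posDef_A02.posSemidef.dotProduct_mulVec_nonneg w
    rw [star_trivial] at h8
    have h9 := hcS w
    have h10 := mul_nonneg hξ h8
    rw [h7]
    nlinarith [mul_nonneg hc.le h6]

/-- In `resolventSymm * resolvent` the inverse of the left factor drops out. The coupling block of
its transpose then cancels the lower left block of `resolventRight`, and minus a block diagonal
positive definite matrix remains. -/
theorem isSymmetrizedBy_resolvent (hL : L.IsRegular) (hP : L.IsSpectralFrame P₂ P₀) {ξ : ℝ}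
    (hξ : 0 < ξ) :
    IsSymmetrizedBy (L.resolvent P₂ P₀ ξ) (L.resolventSymm P₂ P₀ ξ) (L.resolventForm P₂ P₀ ξ) := by
  have hW := isUnit_resolventLeft hL hP hξ.le
  have hW' := (Matrix.isUnit_iff_isUnit_det _).1 hW
  obtain ⟨hs, -⟩ := slowCorrection_spec hL hP hξ.le
  obtain ⟨c, hc, hcg⟩ := liftedDamping_ge hL hP
  have hg := (hcg ξ hξ.le).1
  have hΛ := (Matrix.isUnit_iff_isUnit_det _).1 (isUnit_Lam2 hP)
  have hA11 := (Matrix.isUnit_iff_isUnit_det _).1 hL.isUnit_A11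
  refine ⟨?_, ?_, ?_, ?_⟩
  · simp only [resolventSymm, Matrix.transpose_mul, Matrix.transpose_transpose,
      Matrix.fromBlocks_transpose, hL.symm_A11, Lam2_transpose hP, Matrix.transpose_zero,
      Matrix.mul_assoc]
  · refine (((Matrix.isUnit_transpose _).2 hW).mul ?_).mul hW
    rw [Matrix.isUnit_fromBlocks_zero₂₁]
    exact ⟨hL.isUnit_A11, isUnit_Lam2 hP⟩
  · refine PosDef.of_pos ?_ fun x hx => ?_
    · rw [resolventForm, Matrix.fromBlocks_transpose, Matrix.transpose_smul, PosDef.symm hs,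
        PosDef.symm hg, Matrix.transpose_zero, Matrix.transpose_zero]
    · rw [resolventForm, dotProduct_fromBlocks_diag, Matrix.smul_mulVec, dotProduct_smul, smul_eq_mul]
      have h1 := hs.posSemidef.dotProduct_mulVec_nonneg (x ∘ Sum.inl)
      have h2 := hg.posSemidef.dotProduct_mulVec_nonneg (x ∘ Sum.inr)
      rw [star_trivial] at h1 h2
      by_cases h3 : x ∘ Sum.inl = 0
      · have h4 : x ∘ Sum.inr ≠ 0 := fun h4 => hx (by
          rw [← Sum.elim_comp_inl_inr x, h3, h4]
          ext (i | i) <;> rfl)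
        have := PosDef.pos hg h4
        have := mul_nonneg hξ.le h1
        linarith
      · have := PosDef.pos hs h3
        have := mul_pos hξ this
        linarith
  · rw [resolventSymm, resolvent, Matrix.mul_assoc, Matrix.mul_nonsing_inv_cancel_left _ _ hW',
      Matrix.mul_assoc, resolventRight, Matrix.fromBlocks_multiply, resolventLeft,
      Matrix.fromBlocks_transpose, Matrix.fromBlocks_multiply, resolventForm, Matrix.fromBlocks_neg]
    have h2 : (L.coupling P₂ P₀ ξ)ᵀ = (L.lift P₂ P₀ ξ)ᵀ * L.A12ᵀ * L.A11⁻¹ := by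
      simp only [coupling, Matrix.transpose_mul, A11_inv_transpose hL, Matrix.mul_assoc]
    have h3 : (1 + ξ • L.slowCorrection P₀ ξ)ᵀ * L.A01 =
        L.A01 * (1 + ξ • L.slowCorrection P₀ ξ) := by
      rw [← PosDef.symm hs, Matrix.transpose_mul, PosDef.symm hL.posDef_A01]
    rw [h2]
    have h4 : L.A11 * -(ξ • (L.A11⁻¹ * L.A01)) = -(ξ • L.A01) := by
      rw [Matrix.mul_neg, Matrix.mul_smul, Matrix.mul_nonsing_inv_cancel_left _ _ hA11]
    simp only [Matrix.zero_mul, Matrix.mul_zero, add_zero, zero_add, Matrix.transpose_zero,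
      Matrix.transpose_one, Matrix.one_mul, h4]
    congr 1
    · rw [Matrix.mul_neg, Matrix.mul_smul, h3]
    · exact neg_zero.symm
    · rw [Matrix.mul_smul, Matrix.mul_nonsing_inv_cancel_left _ _ hΛ, Matrix.mul_neg,
        Matrix.mul_smul, neg_add_cancel, neg_zero]
    · rw [Matrix.mul_neg, Matrix.mul_nonsing_inv_cancel_left _ _ hΛ]

/-- The slow block is of order `ξ` and the fast block is bounded below, so the common bound is
linear in `ξ`, the rate allowed by `isStableLimit_of_approx`. -/
theorem resolventForm_ge (hL : L.IsRegular) (hP : L.IsSpectralFrame P₂ P₀) :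
    ∃ c, 0 < c ∧ ∀ ξ, 0 < ξ → ξ ≤ 1 → ∀ x,
      c * ξ * (x ⬝ᵥ x) ≤ x ⬝ᵥ (L.resolventForm P₂ P₀ ξ *ᵥ x) := by
  obtain ⟨c₁, hc₁, h1⟩ := PosDef.exists_le hL.posDef_A01
  obtain ⟨c₂, hc₂, h2⟩ := liftedDamping_ge hL hP
  refine ⟨min c₁ c₂, lt_min hc₁ hc₂, fun ξ hξ hξ1 x => ?_⟩
  rw [resolventForm, dotProduct_fromBlocks_diag, Matrix.smul_mulVec, dotProduct_smul, smul_eq_mul]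
  have h3 := ((slowCorrection_spec hL hP hξ.le).2 (x ∘ Sum.inl))
  have h4 := h1 (x ∘ Sum.inl)
  have h5 := (h2 ξ hξ.le).2 (x ∘ Sum.inr)
  have h6 : x ⬝ᵥ x = (x ∘ Sum.inl) ⬝ᵥ (x ∘ Sum.inl) + (x ∘ Sum.inr) ⬝ᵥ (x ∘ Sum.inr) :=
    Fintype.sum_sum_type _
  have h7 : 0 ≤ (x ∘ Sum.inl) ⬝ᵥ (x ∘ Sum.inl) := Finset.sum_nonneg fun i _ => mul_self_nonneg _
  have h8 : 0 ≤ (x ∘ Sum.inr) ⬝ᵥ (x ∘ Sum.inr) := Finset.sum_nonneg fun i _ => mul_self_nonneg _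
  rw [h6, mul_add]
  refine add_le_add ?_ ?_
  · calc min c₁ c₂ * ξ * ((x ∘ Sum.inl) ⬝ᵥ (x ∘ Sum.inl))
        = ξ * (min c₁ c₂ * ((x ∘ Sum.inl) ⬝ᵥ (x ∘ Sum.inl))) := by ring
      _ ≤ _ := mul_le_mul_of_nonneg_left (((mul_le_mul_of_nonneg_right (min_le_left _ _) h7).trans
          h4).trans h3) hξ.le
  · refine le_trans (mul_le_mul_of_nonneg_right ?_ h8) h5
    calc min c₁ c₂ * ξ ≤ c₂ * 1 := mul_le_mul (min_le_right _ _) hξ1 hξ.le hc₂.le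
      _ = c₂ := mul_one _

end Resolvent

end LinearProblem


theorem continuousAt_inv_of_isUnit {X ι : Type*} [TopologicalSpace X] [Fintype ι] [DecidableEq ι]
    {f : X → Matrix ι ι ℝ} {x : X} (hf : ContinuousAt f x) (h : IsUnit (f x)) :
    ContinuousAt (fun y => (f y)⁻¹) x := by
  refine ContinuousAt.comp (g := Inv.inv) (continuousAt_matrix_inv _ ?_) hf
  rw [Ring.inverse_eq_inv']
  exact continuousAt_inv₀ ((Matrix.isUnit_iff_isUnit_det _).1 h).ne_zero

/-! ### Limits of the stable subspaces of the resolvent matrix as `ξ → 0+`. -/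

namespace LinearProblem

variable {m r p k n₀ : ℕ} {L : LinearProblem m r p} {P₂ : Matrix (Fin r) (Fin k) ℝ}
  {P₀ : Matrix (Fin r) (Fin n₀) ℝ}

theorem continuousAt_damping₀₀Inv (hL : L.IsRegular) (hP : L.IsSpectralFrame P₂ P₀) :
    ContinuousAt (L.damping₀₀Inv P₀) 0 := by
  refine continuousAt_inv_of_isUnit ?_ (lift_spec hL hP le_rfl).2.1.isUnit
  have : Continuous fun ξ => P₀ᵀ * L.damping ξ * P₀ := by
    unfold damping
    fun_prop
  exact this.continuousAt

theorem continuousAt_lift (hL : L.IsRegular) (hP : L.IsSpectralFrame P₂ P₀) :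
    ContinuousAt (L.lift P₂ P₀) 0 := by
  have : Continuous fun q : ℝ × Matrix (Fin n₀) (Fin n₀) ℝ =>
      P₂ - P₀ * q.2 * (P₀ᵀ * L.damping q.1 * P₂) := by
    unfold damping
    fun_prop
  exact this.continuousAt.comp (f := fun ξ => (ξ, L.damping₀₀Inv P₀ ξ))
    (continuousAt_id.prodMk (continuousAt_damping₀₀Inv hL hP))

theorem continuousAt_slowCorrection (hL : L.IsRegular) (hP : L.IsSpectralFrame P₂ P₀) :
    ContinuousAt (L.slowCorrection P₀) 0 := by
  have : Continuous fun q : Matrix (Fin n₀) (Fin n₀) ℝ =>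
      L.A11⁻¹ * L.A12 * P₀ * q * (P₀ᵀ * L.A12ᵀ * L.A11⁻¹ * L.A01) := by fun_prop
  exact this.continuousAt.comp (continuousAt_damping₀₀Inv hL hP)

theorem continuousAt_coupling (hL : L.IsRegular) (hP : L.IsSpectralFrame P₂ P₀) :
    ContinuousAt (L.coupling P₂ P₀) 0 := by
  have : Continuous fun q : Matrix (Fin r) (Fin k) ℝ => L.A11⁻¹ * L.A12 * q := by fun_prop
  exact this.continuousAt.comp (continuousAt_lift hL hP)

theorem continuousAt_liftedDamping (hL : L.IsRegular) (hP : L.IsSpectralFrame P₂ P₀) :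
    ContinuousAt (L.liftedDamping P₂ P₀) 0 := by
  have : Continuous fun q : ℝ × Matrix (Fin r) (Fin k) ℝ => P₂ᵀ * L.damping q.1 * q.2 := by
    unfold damping
    fun_prop
  exact this.continuousAt.comp (f := fun ξ => (ξ, L.lift P₂ P₀ ξ))
    (continuousAt_id.prodMk (continuousAt_lift hL hP))

theorem continuousAt_resolventLeft_inv (hL : L.IsRegular) (hP : L.IsSpectralFrame P₂ P₀) :
    ContinuousAt (fun ξ => (L.resolventLeft P₂ P₀ ξ)⁻¹) 0 := by
  refine continuousAt_inv_of_isUnit ?_ (isUnit_resolventLeft hL hP le_rfl)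
  have : Continuous fun q : ℝ × Matrix (Fin m) (Fin m) ℝ × Matrix (Fin m) (Fin k) ℝ =>
      Matrix.fromBlocks (1 + q.1 • q.2.1) q.2.2 (0 : Matrix (Fin k) (Fin m) ℝ)
        (1 : Matrix (Fin k) (Fin k) ℝ) := by fun_prop
  exact this.continuousAt.comp (f := fun ξ => (ξ, L.slowCorrection P₀ ξ, L.coupling P₂ P₀ ξ))
    (continuousAt_id.prodMk
      ((continuousAt_slowCorrection hL hP).prodMk (continuousAt_coupling hL hP)))

theorem continuousAt_resolventForm (hL : L.IsRegular) (hP : L.IsSpectralFrame P₂ P₀) :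
    ContinuousAt (L.resolventForm P₂ P₀) 0 := by
  have : Continuous fun q : ℝ × Matrix (Fin m) (Fin m) ℝ × Matrix (Fin k) (Fin k) ℝ =>
      Matrix.fromBlocks (q.1 • (L.A01 * (1 + q.1 • q.2.1))) (0 : Matrix (Fin m) (Fin k) ℝ)
        (0 : Matrix (Fin k) (Fin m) ℝ) q.2.2 := by fun_prop
  exact this.continuousAt.comp (f := fun ξ => (ξ, L.slowCorrection P₀ ξ, L.liftedDamping P₂ P₀ ξ))
    (continuousAt_id.prodMk
      ((continuousAt_slowCorrection hL hP).prodMk (continuousAt_liftedDamping hL hP)))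

theorem continuousAt_realTrace (hL : L.IsRegular) (hP : L.IsSpectralFrame P₂ P₀) :
    ContinuousAt (L.realTrace P₂ P₀) 0 := by
  have : Continuous fun q : ℝ × Matrix (Fin n₀) (Fin n₀) ℝ × Matrix (Fin r) (Fin k) ℝ =>
      Matrix.fromBlocks (1 : Matrix (Fin m) (Fin m) ℝ) (0 : Matrix (Fin m) (Fin k) ℝ)
        (q.1 • (P₀ * q.2.1 * (P₀ᵀ * L.A12ᵀ * L.A11⁻¹ * L.A01))) q.2.2 := by fun_prop
  exact this.continuousAt.comp (f := fun ξ => (ξ, L.damping₀₀Inv P₀ ξ, L.lift P₂ P₀ ξ))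
    (continuousAt_id.prodMk
      ((continuousAt_damping₀₀Inv hL hP).prodMk (continuousAt_lift hL hP)))

/-- Approximate eigenvectors are tested on the pencil `resolventRight - z • resolventLeft`. The
inverse of the left factor is continuous at zero, so the size of the residual is preserved. -/
theorem isStableLimit_of_residual (hL : L.IsRegular) (hP : L.IsSpectralFrame P₂ P₀)
    {v s : ℝ → Fin m ⊕ Fin k → ℝ} {z : ℝ → ℝ} (hv : ContinuousAt v 0) (hs : ContinuousAt s 0)
    (hz : ∀ ξ, 0 < ξ → z ξ < 0)
    (hvs : ∀ ξ, 0 < ξ → L.resolventRight P₂ P₀ ξ *ᵥ v ξ - z ξ • (L.resolventLeft P₂ P₀ ξ *ᵥ v ξ) =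
      (ξ * z ξ) • s ξ) : IsStableLimit (L.resolvent P₂ P₀) (v 0) := by
  obtain ⟨c, hc, hcQ⟩ := resolventForm_ge hL hP
  have hpos : ∀ᶠ ξ in 𝓝[>] (0 : ℝ), 0 < ξ := self_mem_nhdsWithin
  have hle : ∀ᶠ ξ in 𝓝[>] (0 : ℝ), ξ ≤ 1 :=
    nhdsWithin_le_nhds (Iic_mem_nhds one_pos)
  refine isStableLimit_of_approx (A := L.resolventSymm P₂ P₀) (Q := L.resolventForm P₂ P₀) hc
    ?_ (continuousAt_resolventForm hL hP) hv (s := fun ξ => (L.resolventLeft P₂ P₀ ξ)⁻¹ *ᵥ s ξ) ?_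
    (hpos.mono hz) ?_
  · filter_upwards [hpos, hle] with ξ h1 h2
    exact ⟨isSymmetrizedBy_resolvent hL hP h1, hcQ ξ h1 h2⟩
  · have : Continuous fun q : Matrix (Fin m ⊕ Fin k) (Fin m ⊕ Fin k) ℝ × (Fin m ⊕ Fin k → ℝ) =>
      q.1 *ᵥ q.2 := by fun_prop
    exact this.continuousAt.comp (f := fun ξ => ((L.resolventLeft P₂ P₀ ξ)⁻¹, s ξ))
      ((continuousAt_resolventLeft_inv hL hP).prodMk hs)
  · filter_upwards [hpos] with ξ hξ
    have hW := (Matrix.isUnit_iff_isUnit_det _).1 (isUnit_resolventLeft hL hP hξ.le)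
    rw [← Matrix.mulVec_smul, ← hvs ξ hξ, Matrix.mulVec_sub, Matrix.mulVec_smul, Matrix.mulVec_mulVec,
      Matrix.mulVec_mulVec, Matrix.nonsing_inv_mul _ hW, Matrix.one_mulVec, resolvent]

/-- Two lifts differ by columns in the range of `P₀`, to which `damping a * lift a` is orthogonal.
One of the two lifts in the form may thus be taken at the other parameter, and the difference
reduces to `damping ξ - damping 0 = ξ A₀₂`. -/
theorem liftedDamping_sub (hL : L.IsRegular) (hP : L.IsSpectralFrame P₂ P₀) {ξ : ℝ} (hξ : 0 ≤ ξ) :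
    L.liftedDamping P₂ P₀ ξ - L.liftedDamping P₂ P₀ 0 =
      ξ • ((L.lift P₂ P₀ ξ)ᵀ * L.A02 * L.lift P₂ P₀ 0) := by
  obtain ⟨hT, h0, h1, h2, h3⟩ := lift_spec hL hP hξ
  obtain ⟨hT', h0', h1', h2', h3'⟩ := lift_spec hL hP le_rfl
  have h4 : ∀ (a b : ℝ), P₀ᵀ * L.damping a * L.lift P₂ P₀ a = 0 →
      (L.lift P₂ P₀ b)ᵀ * L.damping a * L.lift P₂ P₀ a = L.liftedDamping P₂ P₀ a := by
    intro a b h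
    have h5 : (L.lift P₂ P₀ b)ᵀ * L.damping a * L.lift P₂ P₀ a = P₂ᵀ * L.damping a * L.lift P₂ P₀ a -
        (L.damping₀₀Inv P₀ b * (P₀ᵀ * L.damping b * P₂))ᵀ *
          (P₀ᵀ * L.damping a * L.lift P₂ P₀ a) := by
      have : (L.lift P₂ P₀ b)ᵀ = P₂ᵀ - (L.damping₀₀Inv P₀ b * (P₀ᵀ * L.damping b * P₂))ᵀ * P₀ᵀ := by
        rw [lift, Matrix.transpose_sub, Matrix.mul_assoc P₀, Matrix.transpose_mul P₀]
      rw [this, Matrix.sub_mul, Matrix.sub_mul]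
      simp only [Matrix.mul_assoc]
    rw [h5, h, Matrix.mul_zero, sub_zero]
    rfl
  have h5 : L.liftedDamping P₂ P₀ ξ = (L.lift P₂ P₀ ξ)ᵀ * L.damping ξ * L.lift P₂ P₀ 0 := by
    have h6 : (L.liftedDamping P₂ P₀ ξ)ᵀ = L.liftedDamping P₂ P₀ ξ := by
      rw [h3]
      simp only [Matrix.transpose_mul, Matrix.transpose_transpose, PosDef.symm hT, Matrix.mul_assoc]
    rw [← h6, ← h4 ξ 0 h1]
    simp only [Matrix.transpose_mul, Matrix.transpose_transpose, PosDef.symm hT, Matrix.mul_assoc]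
  rw [h5, ← h4 0 ξ h1', ← Matrix.sub_mul, ← Matrix.mul_sub, damping, damping, zero_smul, zero_sub,
    sub_neg_eq_add, sub_add_cancel, Matrix.mul_smul, Matrix.smul_mul]

theorem G2_eq : L.G2 P₂ P₀ = -L.liftedDamping P₂ P₀ 0 := by
  simp only [G2, liftedDamping, lift, damping₀₀Inv, damping, zero_smul, zero_sub, Matrix.mul_neg,
    Matrix.neg_mul, inv_neg_matrix, Matrix.mul_sub, neg_neg, neg_sub, Matrix.mul_assoc, sub_neg_eq_add]
  abel

/-- The eigenvalues of order one come from `Λ₂⁻¹ G₂`. The slow component `-coupling y` makes the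
first row of the left factor vanish up to order `ξ`, and `liftedDamping_sub` makes the second row
accurate to the same order. -/
theorem isStableLimit_fast (hL : L.IsRegular) (hP : L.IsSpectralFrame P₂ P₀) {y : Fin k → ℝ} {z : ℝ}
    (hz : z < 0) (hy : ((L.Lam2 P₂)⁻¹ * L.G2 P₂ P₀) *ᵥ y = z • y) :
    IsStableLimit (L.resolvent P₂ P₀) (Sum.elim (-(L.coupling P₂ P₀ 0 *ᵥ y)) y) := by
  have hy' : (L.Lam2 P₂)⁻¹ *ᵥ (L.liftedDamping P₂ P₀ 0 *ᵥ y) = -(z • y) := by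
    rw [← hy, G2_eq, Matrix.mul_neg, Matrix.neg_mulVec, neg_neg, Matrix.mulVec_mulVec]
  refine isStableLimit_of_residual hL hP (v := fun ξ => Sum.elim (-(L.coupling P₂ P₀ ξ *ᵥ y)) y)
    (s := fun ξ => Sum.elim
      (z⁻¹ • ((L.A11⁻¹ * L.A01) *ᵥ (L.coupling P₂ P₀ ξ *ᵥ y)) +
        L.slowCorrection P₀ ξ *ᵥ (L.coupling P₂ P₀ ξ *ᵥ y))
      (-(z⁻¹ • (((L.Lam2 P₂)⁻¹ * ((L.lift P₂ P₀ ξ)ᵀ * L.A12ᵀ * L.A11⁻¹ * L.A01)) *ᵥ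
        (L.coupling P₂ P₀ ξ *ᵥ y)) +
        z⁻¹ • ((L.Lam2 P₂)⁻¹ *ᵥ (((L.lift P₂ P₀ ξ)ᵀ * L.A02 * L.lift P₂ P₀ 0) *ᵥ y)))))
    (z := fun _ => z) ?_ ?_ (fun _ _ => hz) fun ξ hξ => ?_
  · have : Continuous fun q : Matrix (Fin m) (Fin k) ℝ =>
        (Sum.elim (-(q *ᵥ y)) y : Fin m ⊕ Fin k → ℝ) := by
      refine continuous_pi fun i => ?_
      rcases i with i | i <;> simp only [Sum.elim_inl, Sum.elim_inr] <;> fun_prop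
    exact this.continuousAt.comp (continuousAt_coupling hL hP)
  · have : Continuous fun q : Matrix (Fin m) (Fin k) ℝ × Matrix (Fin m) (Fin m) ℝ ×
        Matrix (Fin r) (Fin k) ℝ => (Sum.elim
      (z⁻¹ • ((L.A11⁻¹ * L.A01) *ᵥ (q.1 *ᵥ y)) + q.2.1 *ᵥ (q.1 *ᵥ y))
      (-(z⁻¹ • (((L.Lam2 P₂)⁻¹ * (q.2.2ᵀ * L.A12ᵀ * L.A11⁻¹ * L.A01)) *ᵥ (q.1 *ᵥ y)) +
        z⁻¹ • ((L.Lam2 P₂)⁻¹ *ᵥ ((q.2.2ᵀ * L.A02 * L.lift P₂ P₀ 0) *ᵥ y)))) :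
          Fin m ⊕ Fin k → ℝ) := by
      refine continuous_pi fun i => ?_
      rcases i with i | i <;> simp only [Sum.elim_inl, Sum.elim_inr] <;> fun_prop
    exact this.continuousAt.comp
      (f := fun ξ => (L.coupling P₂ P₀ ξ, L.slowCorrection P₀ ξ, L.lift P₂ P₀ ξ))
      ((continuousAt_coupling hL hP).prodMk
        ((continuousAt_slowCorrection hL hP).prodMk (continuousAt_lift hL hP)))
  · have h1 : L.liftedDamping P₂ P₀ ξ = L.liftedDamping P₂ P₀ 0 +
        ξ • ((L.lift P₂ P₀ ξ)ᵀ * L.A02 * L.lift P₂ P₀ 0) := by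
      rw [← liftedDamping_sub hL hP hξ.le, add_sub_cancel]
    have hz' := hz.ne
    rw [resolventLeft, resolventRight, Matrix.fromBlocks_mulVec, Matrix.fromBlocks_mulVec]
    simp only [Sum.elim_comp_inl, Sum.elim_comp_inr, Matrix.zero_mulVec, Matrix.one_mulVec,
      Matrix.neg_mulVec, Matrix.mulVec_neg, Matrix.add_mulVec, Matrix.smul_mulVec]
    rw [← Matrix.mulVec_mulVec y, h1]
    simp only [Matrix.add_mulVec, Matrix.smul_mulVec, Matrix.mulVec_add, Matrix.mulVec_smul, hy']
    ext (i | i)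
    · simp only [Pi.sub_apply, Pi.smul_apply, Sum.elim_inl, Pi.add_apply, Pi.neg_apply, smul_eq_mul,
        Pi.zero_apply]
      field_simp
      ring
    · simp only [Pi.sub_apply, Pi.smul_apply, Sum.elim_inr, Pi.add_apply, Pi.neg_apply, smul_eq_mul,
        Pi.zero_apply]
      field_simp
      ring

/-- The other eigenvalues are close to `-ξ σ`. The residual must then be of order `ξ ^ 2`, so the
fast component is corrected at order `ξ`: the vector `y ξ` is chosen to annihilate the second row of
`resolventRight` exactly. -/
theorem isStableLimit_slow (hL : L.IsRegular) (hP : L.IsSpectralFrame P₂ P₀) {x : Fin m → ℝ} {σ : ℝ}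
    (hσ : 0 < σ) (hx : (L.A11⁻¹ * L.A01) *ᵥ x = σ • x) :
    IsStableLimit (L.resolvent P₂ P₀) (Sum.elim x 0) := by
  obtain ⟨c, hc, hcg⟩ := liftedDamping_ge hL hP
  set y : ℝ → Fin k → ℝ := fun ξ => (L.liftedDamping P₂ P₀ ξ)⁻¹ *ᵥ
    (((L.lift P₂ P₀ ξ)ᵀ * L.A12ᵀ * L.A11⁻¹ * L.A01) *ᵥ x) with hy
  have hyc : ContinuousAt y 0 := by
    have : Continuous fun q : Matrix (Fin k) (Fin k) ℝ × Matrix (Fin r) (Fin k) ℝ =>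
      q.1 *ᵥ ((q.2ᵀ * L.A12ᵀ * L.A11⁻¹ * L.A01) *ᵥ x) := by fun_prop
    exact this.continuousAt.comp (f := fun ξ => ((L.liftedDamping P₂ P₀ ξ)⁻¹, L.lift P₂ P₀ ξ))
      ((continuousAt_inv_of_isUnit (continuousAt_liftedDamping hL hP) (hcg 0 le_rfl).1.isUnit).prodMk
        (continuousAt_lift hL hP))
  have h0 : (Sum.elim x 0 : Fin m ⊕ Fin k → ℝ) = Sum.elim x ((0 : ℝ) • y 0) := by rw [zero_smul]
  rw [h0]
  refine isStableLimit_of_residual hL hP (v := fun ξ => Sum.elim x (ξ • y ξ))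
    (s := fun ξ => Sum.elim
      (-(L.slowCorrection P₀ ξ *ᵥ x) - L.coupling P₂ P₀ ξ *ᵥ y ξ) (-y ξ))
    (z := fun ξ => -(ξ * σ)) ?_ ?_ (fun ξ hξ => by nlinarith) fun ξ hξ => ?_
  · have : Continuous fun q : ℝ × (Fin k → ℝ) =>
        (Sum.elim x (q.1 • q.2) : Fin m ⊕ Fin k → ℝ) := by
      refine continuous_pi fun i => ?_
      rcases i with i | i <;> simp only [Sum.elim_inl, Sum.elim_inr] <;> fun_prop
    exact this.continuousAt.comp (f := fun ξ => (ξ, y ξ)) (continuousAt_id.prodMk hyc)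
  · have : Continuous fun q : Matrix (Fin m) (Fin m) ℝ × Matrix (Fin m) (Fin k) ℝ × (Fin k → ℝ) =>
        (Sum.elim (-(q.1 *ᵥ x) - q.2.1 *ᵥ q.2.2) (-q.2.2) : Fin m ⊕ Fin k → ℝ) := by
      refine continuous_pi fun i => ?_
      rcases i with i | i <;> simp only [Sum.elim_inl, Sum.elim_inr] <;> fun_prop
    exact this.continuousAt.comp
      (f := fun ξ => (L.slowCorrection P₀ ξ, L.coupling P₂ P₀ ξ, y ξ))
      ((continuousAt_slowCorrection hL hP).prodMk ((continuousAt_coupling hL hP).prodMk hyc))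
  · have hg := (Matrix.isUnit_iff_isUnit_det _).1 (hcg ξ hξ.le).1.isUnit
    have h1 : L.liftedDamping P₂ P₀ ξ *ᵥ y ξ =
        ((L.lift P₂ P₀ ξ)ᵀ * L.A12ᵀ * L.A11⁻¹ * L.A01) *ᵥ x := by
      rw [hy, Matrix.mulVec_mulVec, Matrix.mul_nonsing_inv _ hg, Matrix.one_mulVec]
    rw [resolventLeft, resolventRight, Matrix.fromBlocks_mulVec, Matrix.fromBlocks_mulVec]
    simp only [Sum.elim_comp_inl, Sum.elim_comp_inr, Matrix.zero_mulVec, Matrix.one_mulVec,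
      Matrix.neg_mulVec, Matrix.add_mulVec, Matrix.smul_mulVec, Matrix.mulVec_smul, hx,
      ← Matrix.mulVec_mulVec _ (L.Lam2 P₂)⁻¹, h1]
    ext (i | i)
    · simp only [Pi.sub_apply, Pi.smul_apply, Sum.elim_inl, Pi.add_apply, Pi.neg_apply, smul_eq_mul,
        Pi.zero_apply]
      ring
    · simp only [Pi.sub_apply, Pi.smul_apply, Sum.elim_inr, Pi.add_apply, Pi.neg_apply, smul_eq_mul,
        Pi.zero_apply]
      ring

/-- The modified generalized Kreiss condition makes the boundary operator injective on the sum of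
the incoming directions of the equilibrium system and the stable boundary-layer directions. -/
theorem ModifiedGKC.injective (h : L.ModifiedGKC P₂ P₀) (hL : L.IsRegular)
    (hP : L.IsSpectralFrame P₂ P₀) (hp : numPosEig L.A11 + numPosEig (L.Lam2 P₂) = p)
    {x : Fin m → ℝ} {y : Fin k → ℝ}
    (hx : x ∈ Submodule.span ℝ {x | ∃ σ : ℝ, 0 < σ ∧ (L.A11⁻¹ * L.A01) *ᵥ x = σ • x})
    (hy : y ∈ Submodule.span ℝ {y | ∃ z : ℝ, z < 0 ∧ ((L.Lam2 P₂)⁻¹ * L.G2 P₂ P₀) *ᵥ y = z • y})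
    (h0 : L.B *ᵥ Sum.elim (x - L.coupling P₂ P₀ 0 *ᵥ y) (L.lift P₂ P₀ 0 *ᵥ y) = 0) :
    x = 0 ∧ y = 0 := by
  obtain ⟨c, hc, hK⟩ := h
  have hpos : ∀ᶠ ξ in 𝓝[>] (0 : ℝ), 0 < ξ := self_mem_nhdsWithin
  have hx' : IsStableLimit (L.resolvent P₂ P₀) (Sum.elim x 0) := by
    clear h0
    induction hx using Submodule.span_induction with
    | mem x hx =>
      obtain ⟨σ, hσ, hx⟩ := hx
      exact isStableLimit_slow hL hP hσ hx
    | zero =>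
      convert isStableLimit_zero (L.resolvent P₂ P₀) using 1
      ext (i | i) <;> rfl
    | add x x' _ _ hx hx' =>
      convert hx.add hx' using 1
      ext (i | i) <;> simp
    | smul a x _ hx =>
      convert hx.smul a using 1
      ext (i | i) <;> simp
  have hy' : IsStableLimit (L.resolvent P₂ P₀) (Sum.elim (-(L.coupling P₂ P₀ 0 *ᵥ y)) y) := by
    clear h0
    induction hy using Submodule.span_induction with
    | mem y hy =>
      obtain ⟨z, hz, hy⟩ := hy
      exact isStableLimit_fast hL hP hz hy
    | zero =>
      convert isStableLimit_zero (L.resolvent P₂ P₀) using 1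
      ext (i | i) <;> simp
    | add y y' _ _ hy hy' =>
      convert hy.add hy' using 1
      ext (i | i) <;> simp [Matrix.mulVec_add]
      ring
    | smul a y _ hy =>
      convert hy.smul a using 1
      ext (i | i) <;> simp [Matrix.mulVec_smul]
  have hv : IsStableLimit (L.resolvent P₂ P₀) (Sum.elim (x - L.coupling P₂ P₀ 0 *ᵥ y) y) := by
    convert hx'.add hy' using 1
    ext (i | i) <;> simp [sub_eq_add_neg]
  -- The inertia of the symmetrizer gives stable subspaces of dimension `p`. For a real orthonormal
  -- basis the Gram determinant is one, so the Kreiss inequality bounds the determinant itself.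
  have hz := hv.eq_zero (A := L.resolventSymm P₂ P₀) (Q := L.resolventForm P₂ P₀)
    (t := fun ξ => L.B * L.realTrace P₂ P₀ ξ) hc ?_ ?_ ?_ ?_
  · have h1 : y = 0 := funext fun i => congrFun hz (Sum.inr i)
    have h2 : x - L.coupling P₂ P₀ 0 *ᵥ y = 0 := funext fun i => congrFun hz (Sum.inl i)
    rw [h1, Matrix.mulVec_zero, sub_zero] at h2
    exact ⟨h2, h1⟩
  · filter_upwards [hpos] with ξ hξ
    refine ⟨isSymmetrizedBy_resolvent hL hP hξ, ?_⟩
    have hW := (Matrix.isUnit_iff_isUnit_det _).1 (isUnit_resolventLeft hL hP hξ.le)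
    rw [resolventSymm, ← numPosEig_congr (A := Matrix.fromBlocks L.A11 0 0 (L.Lam2 P₂)) ?_
      (Matrix.nonsing_inv_mul _ hW) (Matrix.mul_nonsing_inv _ hW) rfl,
      numPosEig_fromBlocks hL.symm_A11 (Lam2_transpose hP), hp]
    rw [Matrix.fromBlocks_transpose, hL.symm_A11, Lam2_transpose hP, Matrix.transpose_zero,
      Matrix.transpose_zero]
  · have : Continuous fun q : Matrix (Fin m ⊕ Fin r) (Fin m ⊕ Fin k) ℝ => L.B * q := by fun_prop
    exact this.continuousAt.comp (continuousAt_realTrace hL hP)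
  · filter_upwards [hpos] with ξ hξ R hR hst
    have h1 := hK 1 zero_le_one (ξ : ℂ) (by simpa using hξ) (toC R) (by
      rwa [M_ofReal hL.negDef_S (PosDef.symm hL.posDef_A02)])
    rw [traceMat_ofReal, ← toC_mul, ← toC_mul, toC_det, Complex.norm_real, Real.norm_eq_abs] at h1
    have h2 : (toC R)ᴴ * toC R = 1 := by
      have h3 : (toC R)ᴴ = toC Rᵀ := by
        ext i j
        simp [Matrix.conjTranspose_apply]
      rw [h3, ← toC_mul, hR, toC_one]
    rwa [h2, Matrix.det_one, Complex.one_re, Real.sqrt_one, mul_one] at h1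
  · rw [← Matrix.mulVec_mulVec, realTrace, Matrix.fromBlocks_mulVec, Sum.elim_comp_inl,
      Sum.elim_comp_inr, zero_smul, Matrix.zero_mulVec, Matrix.zero_mulVec, Matrix.one_mulVec,
      add_zero, zero_add, h0]

end LinearProblem


/-! ### Smooth matrix-valued functions -/

section SmoothMatrix

variable {E : Type*} [NormedAddCommGroup E] [NormedSpace ℝ E]
  {ι κ τ : Type*} [Fintype ι] [DecidableEq ι] [Fintype κ] [DecidableEq κ] [Fintype τ] [DecidableEq τ]
  {A B : E → Matrix ι κ ℝ} {x : E}

/-- A matrix-valued function all of whose entries are smooth at `x`. -/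
def SmAt {ι κ : Type*} (A : E → Matrix ι κ ℝ) (x : E) : Prop :=
  ∀ i j, ContDiffAt ℝ ∞ (fun y => A y i j) x

theorem smAt_const (M : Matrix ι κ ℝ) : SmAt (fun _ : E => M) x := fun _ _ => contDiffAt_const

theorem SmAt.add (hA : SmAt A x) (hB : SmAt B x) : SmAt (fun y => A y + B y) x :=
  fun i j => (hA i j).add (hB i j)

theorem SmAt.sub (hA : SmAt A x) (hB : SmAt B x) : SmAt (fun y => A y - B y) x :=
  fun i j => (hA i j).sub (hB i j)

theorem SmAt.transpose (hA : SmAt A x) : SmAt (fun y => (A y)ᵀ) x := fun i j => hA j i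

theorem SmAt.mul {C : E → Matrix κ τ ℝ} (hA : SmAt A x) (hC : SmAt C x) :
    SmAt (fun y => A y * C y) x := fun i j => by
  simp only [Matrix.mul_apply]
  exact ContDiffAt.sum fun l _ => (hA i l).mul (hC l j)

theorem SmAt.mulVec {v : E → κ → ℝ} (hA : SmAt A x) (hv : ContDiffAt ℝ ∞ v x) :
    ContDiffAt ℝ ∞ (fun y => A y *ᵥ v y) x := by
  refine contDiffAt_pi.2 fun i => ?_
  simp only [Matrix.mulVec, dotProduct]
  exact ContDiffAt.sum fun l _ => (hA i l).mul (contDiffAt_pi.1 hv l)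

theorem SmAt.det {A : E → Matrix ι ι ℝ} (hA : SmAt A x) : ContDiffAt ℝ ∞ (fun y => (A y).det) x := by
  simp only [Matrix.det_apply]
  exact ContDiffAt.sum fun σ _ => (contDiffAt_prod fun i _ => hA _ _).const_smul _

/-- Cramer's rule writes the entries of the inverse as quotients of determinants, so no norm on
matrices is needed. -/
theorem SmAt.inv {A : E → Matrix ι ι ℝ} (hA : SmAt A x) (hx : IsUnit (A x)) :
    SmAt (fun y => (A y)⁻¹) x := fun i j => by
  have h1 : ∀ y, (A y)⁻¹ i j = ((A y).det)⁻¹ * ((A y).updateRow j (Pi.single i 1)).det := by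
    intro y
    rw [Matrix.inv_def, Ring.inverse_eq_inv', Matrix.smul_apply, Matrix.adjugate_apply, smul_eq_mul]
  simp only [h1]
  refine (hA.det.inv ((Matrix.isUnit_iff_isUnit_det _).1 hx).ne_zero).mul (SmAt.det fun a b => ?_)
  by_cases h : a = j
  · subst h
    simp only [Matrix.updateRow_self]
    exact contDiffAt_const
  · simp only [Matrix.updateRow_ne h]
    exact hA a b

theorem SmAt.fromBlocks {α β γ δ : Type*} {A : E → Matrix α γ ℝ} {B : E → Matrix α δ ℝ}
    {C : E → Matrix β γ ℝ} {D : E → Matrix β δ ℝ} (hA : SmAt A x) (hB : SmAt B x) (hC : SmAt C x)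
    (hD : SmAt D x) : SmAt (fun y => Matrix.fromBlocks (A y) (B y) (C y) (D y)) x
  | Sum.inl i, Sum.inl j => hA i j
  | Sum.inl i, Sum.inr j => hB i j
  | Sum.inr i, Sum.inl j => hC i j
  | Sum.inr i, Sum.inr j => hD i j

theorem SmAt.comp {F : Type*} [NormedAddCommGroup F] [NormedSpace ℝ F] {g : F → E} {y : F}
    (hA : SmAt A (g y)) (hg : ContDiffAt ℝ ∞ g y) : SmAt (fun z => A (g z)) y :=
  fun i j => (hA i j).comp y hg

theorem SmAt.continuousAt (hA : SmAt A x) : ContinuousAt A x :=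
  continuousAt_pi.2 fun i => continuousAt_pi.2 fun j => (hA i j).continuousAt

theorem eventually_isUnit {X : Type*} [TopologicalSpace X] {A : X → Matrix ι ι ℝ} {x : X}
    (hA : ContinuousAt A x) (hx : IsUnit (A x)) : ∀ᶠ y in 𝓝 x, IsUnit (A y) := by
  have h1 : ContinuousAt (fun y => (A y).det) x :=
    (Continuous.matrix_det continuous_id).continuousAt.comp hA
  filter_upwards [h1.eventually_ne ((Matrix.isUnit_iff_isUnit_det _).1 hx).ne_zero] with y hy
  exact (Matrix.isUnit_iff_isUnit_det _).2 (isUnit_iff_ne_zero.2 hy)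

variable {a b c : ℕ}

theorem smAt_jac {F : (Fin a → ℝ) → (Fin c → ℝ)} {x : Fin a → ℝ} (hF : ContDiffAt ℝ ∞ F x) :
    SmAt (jac F) x := fun i j => by
  simp only [jac_apply]
  exact contDiffAt_pi.1 ((hF.fderiv_right (by simp)).clm_apply contDiffAt_const) i

theorem smAt_jac₁ {F : (Fin a → ℝ) × (Fin b → ℝ) → (Fin c → ℝ)} {x : (Fin a → ℝ) × (Fin b → ℝ)}
    (hF : ContDiffAt ℝ ∞ F x) : SmAt (jac₁ F) x := fun i j => by
  simp only [jac₁_apply]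
  exact contDiffAt_pi.1 ((hF.fderiv_right (by simp)).clm_apply contDiffAt_const) i

theorem smAt_jac₂ {F : (Fin a → ℝ) × (Fin b → ℝ) → (Fin c → ℝ)} {x : (Fin a → ℝ) × (Fin b → ℝ)}
    (hF : ContDiffAt ℝ ∞ F x) : SmAt (jac₂ F) x := fun i j => by
  simp only [jac₂_apply]
  exact contDiffAt_pi.1 ((hF.fderiv_right (by simp)).clm_apply contDiffAt_const) i

end SmoothMatrix

/-! ### Block congruence -/

section BlockCongruence

variable {ι κ τ σ : Type*} [Fintype ι] [DecidableEq ι] [Fintype κ] [DecidableEq κ] [Fintype τ]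
  [DecidableEq τ] [Fintype σ] [DecidableEq σ]

/-- Negative eigenvalues are counted as positive eigenvalues of `-A`, so the law of inertia is
needed for one sign only. -/
theorem numPosEig_add_neg {A : Matrix ι ι ℝ} (hA : Aᵀ = A) {X : Matrix ι κ ℝ} {Y : Matrix κ ι ℝ}
    (h : Y * X = 1) (h' : X * Y = 1) {d : κ → ℝ} (hX : Xᵀ * A * X = Matrix.diagonal d) :
    numPosEig A + numPosEig (-A) + Fintype.card {i // d i = 0} = Fintype.card κ := by
  have hX' : Xᵀ * (-A) * X = Matrix.diagonal fun i => -d i := by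
    rw [Matrix.mul_neg, Matrix.neg_mul, hX, Matrix.diagonal_neg]
  rw [numPosEig_of_congr hA h h' hX, numPosEig_of_congr (by rw [Matrix.transpose_neg, hA]) h h' hX']
  simp only [Fintype.card_subtype, Left.neg_pos_iff]
  rw [← Finset.card_univ, ← Finset.card_union_of_disjoint, ← Finset.card_union_of_disjoint]
  · congr 1
    ext i
    simp only [Finset.mem_union, Finset.mem_filter, Finset.mem_univ, true_and, iff_true]
    rcases lt_trichotomy (d i) 0 with h | h | h <;> simp [h]
  · rw [Finset.disjoint_left]
    intro i
    simp only [Finset.mem_union, Finset.mem_filter, Finset.mem_univ, true_and]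
    rintro (h | h) <;> simp [h.ne, h.ne']
  · rw [Finset.disjoint_left]
    intro i
    simp only [Finset.mem_filter, Finset.mem_univ, true_and]
    intro h
    simp [h.le]

theorem numPosEig_zero : numPosEig (0 : Matrix ι ι ℝ) = 0 := by
  rw [numPosEig_of_diag (X := 1) (e := 0) isUnit_one (by simp)]
  simp

theorem eq_zero_of_numPosEig {A : Matrix ι ι ℝ} (hA : Aᵀ = A)
    (h : numPosEig A + numPosEig (-A) = 0) : A = 0 := by
  obtain ⟨V, d, hV, hV', hd⟩ := exists_orthogonal_diagonalization hA
  have h1 := numPosEig_add_neg hA hV hV' hd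
  rw [h, zero_add] at h1
  have h2 : d = 0 := by
    by_contra h3
    obtain ⟨i, hi⟩ := Function.ne_iff.1 h3
    have := Fintype.card_subtype_lt (p := fun i => d i = 0) (x := i) hi
    omega
  have h3 : A = V * (Vᵀ * A * V) * Vᵀ := by
    simp only [Matrix.mul_assoc, hV', Matrix.mul_one]
    rw [← Matrix.mul_assoc, hV', Matrix.one_mul]
  rw [h3, hd, h2]
  simp

theorem isUnit_numPosEig {A : Matrix ι ι ℝ} (hA : Aᵀ = A) (hu : IsUnit A) :
    numPosEig A + numPosEig (-A) = Fintype.card ι := by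
  obtain ⟨V, d, hV, hV', hd⟩ := exists_orthogonal_diagonalization hA
  have h1 := numPosEig_add_neg hA hV hV' hd
  have h2 : ∀ i, d i ≠ 0 := by
    have hVu := (Matrix.isUnit_iff_isUnit_det _).2 (Matrix.isUnit_det_of_left_inverse hV)
    have h1 : IsUnit (Matrix.diagonal d) := by
      rw [← hd]
      exact (((Matrix.isUnit_transpose _).2 hVu).mul hu).mul hVu
    rw [Matrix.isUnit_iff_isUnit_det, Matrix.det_diagonal, isUnit_iff_ne_zero,
      Finset.prod_ne_zero_iff] at h1
    exact fun i => h1 i (Finset.mem_univ _)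
  have h3 : Fintype.card {i // d i = 0} = 0 :=
    Fintype.card_eq_zero_iff.2 ⟨fun i => h2 i i.2⟩
  omega

/-- The part of the approximate kernel frame which is orthogonal with respect to `Σ` to `P₂`. -/
noncomputable def kernelFrame (Sg : Matrix ι ι ℝ) (P₂ : Matrix ι κ ℝ) (P₀ : Matrix ι τ ℝ) :
    Matrix ι τ ℝ := P₀ - P₂ * (P₂ᵀ * Sg * P₂)⁻¹ * (P₂ᵀ * Sg * P₀)

theorem mul_kernelFrame {Sg : Matrix ι ι ℝ} {P₂ : Matrix ι κ ℝ} {P₀ : Matrix ι τ ℝ}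
    (hu : IsUnit (P₂ᵀ * Sg * P₂)) : P₂ᵀ * Sg * kernelFrame Sg P₂ P₀ = 0 := by
  have h1 : P₂ᵀ * Sg * kernelFrame Sg P₂ P₀ = P₂ᵀ * Sg * P₀ -
      P₂ᵀ * Sg * P₂ * (P₂ᵀ * Sg * P₂)⁻¹ * (P₂ᵀ * Sg * P₀) := by
    simp only [kernelFrame, Matrix.mul_sub, Matrix.mul_assoc]
  rw [h1, Matrix.mul_nonsing_inv _ ((Matrix.isUnit_iff_isUnit_det _).1 hu), Matrix.one_mul, sub_self]

/-- Two block eliminations: `A₁₁` is split off, leaving the Schur complement, and then `P₂ᵀ Σ P₂` is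
split off inside it. The inverse `Y` is exhibited because the index types differ. -/
theorem exists_block_congr {A₁₁ : Matrix σ σ ℝ} {A₁₂ : Matrix σ ι ℝ} {A₂₂ : Matrix ι ι ℝ}
    {P₂ : Matrix ι κ ℝ} {P₀ : Matrix ι τ ℝ} (h₁₁ : A₁₁ᵀ = A₁₁) (hu₁₁ : IsUnit A₁₁)
    (h₂₂ : A₂₂ᵀ = A₂₂) (hP₂ : P₂ᵀ * P₂ = 1) (hP₀ : P₀ᵀ * P₀ = 1) (hP₂₀ : P₂ᵀ * P₀ = 0)
    (hP : P₂ * P₂ᵀ + P₀ * P₀ᵀ = 1) {Sg : Matrix ι ι ℝ} (hSg : A₂₂ - A₁₂ᵀ * A₁₁⁻¹ * A₁₂ = Sg)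
    (hu : IsUnit (P₂ᵀ * Sg * P₂)) :
    ∃ (Z : Matrix (σ ⊕ ι) (σ ⊕ (κ ⊕ τ)) ℝ) (Y : Matrix (σ ⊕ (κ ⊕ τ)) (σ ⊕ ι) ℝ),
      Y * Z = 1 ∧ Z * Y = 1 ∧ Zᵀ * Matrix.fromBlocks A₁₁ A₁₂ A₁₂ᵀ A₂₂ * Z =
        Matrix.fromBlocks A₁₁ 0 0
          (Matrix.fromBlocks (P₂ᵀ * Sg * P₂) 0 0 (P₀ᵀ * Sg * kernelFrame Sg P₂ P₀)) := by
  set c := (P₂ᵀ * Sg * P₂)⁻¹ * (P₂ᵀ * Sg * P₀) with hc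
  have hSgt : Sgᵀ = Sg := by
    rw [← hSg]
    simp only [Matrix.transpose_sub, Matrix.transpose_mul, Matrix.transpose_transpose,
      Matrix.transpose_nonsing_inv, h₁₁, h₂₂, Matrix.mul_assoc]
  have hd₁₁ := (Matrix.isUnit_iff_isUnit_det _).1 hu₁₁
  have hK : kernelFrame Sg P₂ P₀ = P₀ - P₂ * c := by rw [kernelFrame, hc, Matrix.mul_assoc]
  have hPt : P₀ᵀ * P₂ = 0 := by
    rw [← Matrix.transpose_transpose P₂, ← Matrix.transpose_mul, hP₂₀, Matrix.transpose_zero]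
  set K := kernelFrame Sg P₂ P₀ with hKd
  have h1 : P₂ᵀ * Sg * K = 0 := mul_kernelFrame hu
  have h2 : Kᵀ * Sg * P₂ = 0 := by
    have h := congrArg Matrix.transpose h1
    rwa [Matrix.transpose_mul, Matrix.transpose_mul, hSgt, Matrix.transpose_transpose,
      Matrix.transpose_zero, ← Matrix.mul_assoc] at h
  have h3 : Kᵀ * Sg * K = P₀ᵀ * Sg * K := by
    conv_lhs => rw [hK, Matrix.transpose_sub, Matrix.sub_mul, Matrix.sub_mul, ← hK]
    rw [Matrix.transpose_mul, Matrix.mul_assoc cᵀ, Matrix.mul_assoc cᵀ, h1, Matrix.mul_zero, sub_zero]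
  set N : Matrix ι (κ ⊕ τ) ℝ := Matrix.fromCols P₂ K with hN
  set N' : Matrix (κ ⊕ τ) ι ℝ := Matrix.fromRows (P₂ᵀ + c * P₀ᵀ) P₀ᵀ with hN'
  have hNN : N * N' = 1 := by
    rw [hN, hN', Matrix.fromCols_mul_fromRows, hK, Matrix.mul_add, Matrix.sub_mul, ← hP,
      ← Matrix.mul_assoc P₂ c]
    abel
  have hNN' : N' * N = 1 := by
    rw [hN, hN', Matrix.fromRows_mul_fromCols, hK, ← Matrix.fromBlocks_one]
    congr 1
    · rw [Matrix.add_mul, Matrix.mul_assoc, hPt, hP₂, Matrix.mul_zero, add_zero]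
    · rw [Matrix.add_mul, Matrix.mul_sub, Matrix.mul_sub, ← Matrix.mul_assoc, hP₂, hP₂₀,
        Matrix.mul_assoc c, hP₀, Matrix.mul_assoc c, ← Matrix.mul_assoc P₀ᵀ, hPt]
      simp
    · rw [Matrix.mul_sub, hP₀, ← Matrix.mul_assoc, hPt, Matrix.zero_mul, sub_zero]
  have h4 : Nᵀ * Sg * N = Matrix.fromBlocks (P₂ᵀ * Sg * P₂) 0 0 (P₀ᵀ * Sg * K) := by
    rw [hN, Matrix.transpose_fromCols, Matrix.fromRows_mul, Matrix.fromRows_mul_fromCols, h1, h2, h3]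
  refine ⟨Matrix.fromBlocks 1 (-(A₁₁⁻¹ * A₁₂ * N)) 0 N, Matrix.fromBlocks 1 (A₁₁⁻¹ * A₁₂) 0 N',
    ?_, ?_, ?_⟩
  · simp [Matrix.fromBlocks_multiply, hNN']
  · simp [Matrix.fromBlocks_multiply, hNN, Matrix.mul_assoc]
  · rw [← h4, Matrix.fromBlocks_transpose, Matrix.fromBlocks_multiply, Matrix.fromBlocks_multiply]
    have h5 : (-(A₁₁⁻¹ * A₁₂ * N))ᵀ = -(Nᵀ * A₁₂ᵀ * A₁₁⁻¹) := by
      simp only [Matrix.transpose_neg, Matrix.transpose_mul, Matrix.transpose_nonsing_inv, h₁₁,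
        Matrix.mul_assoc]
    rw [h5]
    simp only [Matrix.transpose_one, Matrix.transpose_zero, Matrix.one_mul, Matrix.zero_mul,
      Matrix.mul_one, Matrix.mul_zero, add_zero]
    congr 1
    · rw [Matrix.mul_neg, Matrix.mul_assoc A₁₁⁻¹, Matrix.mul_nonsing_inv_cancel_left _ _ hd₁₁,
        neg_add_cancel]
    · rw [Matrix.neg_mul, Matrix.nonsing_inv_mul_cancel_right _ _ hd₁₁, neg_add_cancel]
    · rw [Matrix.neg_mul, Matrix.nonsing_inv_mul_cancel_right _ _ hd₁₁, neg_add_cancel,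
        Matrix.zero_mul, zero_add, ← hSg]
      simp only [Matrix.add_mul, Matrix.mul_sub, Matrix.sub_mul, Matrix.neg_mul, Matrix.mul_assoc]
      abel

end BlockCongruence


/-! ### Eventual forms of the properties of an implicit solution. -/

section ImplicitSolution

variable {X Y Z : Type*} [NormedAddCommGroup X] [NormedSpace ℝ X]
  [NormedAddCommGroup Y] [NormedSpace ℝ Y] [Zero Z] {Φ : Y → X → Z} {y₀ : Y} {x₀ : X} {ψ : X → Y}

theorem IsImplicitSolution.eventually_contDiffAt (h : IsImplicitSolution Φ y₀ x₀ ψ) :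
    ∀ᶠ x in 𝓝 x₀, ContDiffAt ℝ ∞ ψ x := by
  obtain ⟨-, O, V, hO, hx, -, -, hc, -⟩ := h
  filter_upwards [hO.mem_nhds hx] with x hx using hc.contDiffAt (hO.mem_nhds hx)

theorem IsImplicitSolution.continuousAt (h : IsImplicitSolution Φ y₀ x₀ ψ) : ContinuousAt ψ x₀ :=
  h.eventually_contDiffAt.self_of_nhds.continuousAt

theorem IsImplicitSolution.eventually_eq_zero (h : IsImplicitSolution Φ y₀ x₀ ψ) :
    ∀ᶠ x in 𝓝 x₀, Φ (ψ x) x = 0 := by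
  obtain ⟨-, O, V, hO, hx, -, -, -, hm, hi⟩ := h
  filter_upwards [hO.mem_nhds hx] with x hx using (hi x hx _ (hm hx)).2 rfl

theorem IsImplicitSolution.eventually_iff (h : IsImplicitSolution Φ y₀ x₀ ψ) :
    ∀ᶠ z : X × Y in 𝓝 (x₀, y₀), (Φ z.2 z.1 = 0 ↔ z.2 = ψ z.1) := by
  obtain ⟨-, O, V, hO, hx, hV, hy, -, -, hi⟩ := h
  filter_upwards [prod_mem_nhds (hO.mem_nhds hx) (hV.mem_nhds hy)] with z hz
  exact hi z.1 hz.1 z.2 hz.2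

end ImplicitSolution

/-- The continuous linear equivalence defined by an invertible matrix. -/
theorem exists_equiv_mulVec {ι κ : Type*} [Fintype ι] [DecidableEq ι] [Fintype κ] [DecidableEq κ]
    {A : Matrix ι κ ℝ} {B : Matrix κ ι ℝ} (h : A * B = 1) (h' : B * A = 1) :
    ∃ e : (κ → ℝ) ≃L[ℝ] (ι → ℝ), (e : (κ → ℝ) →L[ℝ] (ι → ℝ)) = mvL A ∧
      (e.symm : (ι → ℝ) →L[ℝ] (κ → ℝ)) = mvL B :=
  ⟨ContinuousLinearEquiv.equivOfInverse (mvL A) (mvL B)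
    (fun v => by rw [mvL_apply, mvL_apply, Matrix.mulVec_mulVec, h', Matrix.one_mulVec])
    (fun v => by rw [mvL_apply, mvL_apply, Matrix.mulVec_mulVec, h, Matrix.one_mulVec]), rfl, rfl⟩

/-! ### The equilibrium manifold and the symmetrized coefficients. -/

namespace RelaxationProblem

variable {m r p k n₀ : ℕ} {S : RelaxationProblem m r p}
  {A₀ : State m r → Matrix (Fin m ⊕ Fin r) (Fin m ⊕ Fin r) ℝ} {h : (Fin m → ℝ) → (Fin r → ℝ)}

theorem corner_mem_equil (hII : S.AssumptionII) : S.corner ∈ S.equil :=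
  ⟨S.init_mem 0 le_rfl, hII.init_equil 0 le_rfl⟩

theorem corner_eq (hI : S.AssumptionI A₀ h) (hII : S.AssumptionII) :
    (S.corner.1, h S.corner.1) = S.corner :=
  Prod.ext rfl (hI.equil_graph _ (corner_mem_equil hII).1 (corner_mem_equil hII).2).symm

/-- The equilibrium manifold is the graph of a smooth function near the corner state. -/
theorem eventually_equil (hI : S.AssumptionI A₀ h) (hII : S.AssumptionII) :
    ∀ᶠ u in 𝓝 S.corner.1, ContDiffAt ℝ ∞ h u ∧ (u, h u) ∈ S.equil := by
  have hc := corner_mem_equil hII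
  have hG : ∀ᶠ U in 𝓝 S.corner, U ∈ S.G := S.isOpen_G.mem_nhds hc.1
  have hq : ∀ᶠ U in 𝓝 S.corner, ContDiffAt ℝ ∞ S.q U :=
    hG.mono fun U hU => S.smooth_q.contDiffAt (S.isOpen_G.mem_nhds hU)
  have hu := (Matrix.isUnit_iff_isUnit_det _).1 (hI.qv_invertible _ hc.1)
  obtain ⟨e, he, -⟩ := exists_equiv_mulVec (Matrix.mul_nonsing_inv _ hu) (Matrix.nonsing_inv_mul _ hu)
  have hD : HasFDerivAt S.q ((mvL (jac₁ S.q S.corner)).coprod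
      (e : (Fin r → ℝ) →L[ℝ] (Fin r → ℝ))) (S.corner.1, S.corner.2) := by
    have h1 := (hq.self_of_nhds.differentiableAt (by simp)).hasFDerivAt
    have h2 : (mvL (jac₁ S.q S.corner)).coprod (e : (Fin r → ℝ) →L[ℝ] (Fin r → ℝ)) =
        fderiv ℝ S.q S.corner := ContinuousLinearMap.ext fun y => by
      rw [he, fderiv_eq_jac]
      rfl
    rw [h2]
    exact h1
  obtain ⟨ψ, hψ, -⟩ := exists_isImplicitSolution (Φ := fun v u => S.q (u, v)) (y₀ := S.corner.2)
    (x₀ := S.corner.1) (by simpa using hq) hc.2 hD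
  have hψG : ∀ᶠ u in 𝓝 S.corner.1, (u, ψ u) ∈ S.G := by
    have h1 : ContinuousAt (fun u => (u, ψ u)) S.corner.1 :=
      continuousAt_id.prodMk hψ.continuousAt
    refine h1.eventually ?_
    show ∀ᶠ U in 𝓝 (S.corner.1, ψ S.corner.1), U ∈ S.G
    rw [hψ.1]
    exact hG
  -- No regularity of `h` is assumed. Uniqueness of the equilibrium over `u` identifies it with the
  -- implicit function, and this is the source of its smoothness.
  have hev : ∀ᶠ u in 𝓝 S.corner.1, h u = ψ u := by
    filter_upwards [hψG, hψ.eventually_eq_zero] with u h1 h2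
    exact (hI.equil_graph _ h1 h2).symm
  filter_upwards [hev.eventually_nhds, hψ.eventually_contDiffAt, hψG, hψ.eventually_eq_zero]
    with u h1 h2 h3 h4
  refine ⟨h2.congr_of_eventuallyEq h1, ?_⟩
  rw [h1.self_of_nhds]
  exact ⟨h3, h4⟩

theorem PU_inv (U : State m r) :
    (PU h U)⁻¹ = Matrix.fromBlocks 1 0 (jac h U.1) 1 := by
  refine Matrix.inv_eq_right_inv ?_
  rw [PU, Matrix.fromBlocks_multiply, ← Matrix.fromBlocks_one]
  simp

theorem isUnit_PU (U : State m r) : IsUnit (PU h U) := by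
  rw [PU, Matrix.isUnit_fromBlocks_zero₁₂]
  exact ⟨isUnit_one, isUnit_one⟩

theorem isUnit_PU_inv (U : State m r) : IsUnit (PU h U)⁻¹ := by
  rw [PU_inv, Matrix.isUnit_fromBlocks_zero₁₂]
  exact ⟨isUnit_one, isUnit_one⟩

theorem tA0_posDef (hI : S.AssumptionI A₀ h) {U : State m r} (hU : U ∈ S.G) :
    (tA0 A₀ h U).PosDef :=
  PosDef.congr (hI.stability.posDef U hU) fun _ hx => eq_zero_of_isUnit_mulVec (isUnit_PU_inv U) hx

theorem A1_transpose (hI : S.AssumptionI A₀ h) {U : State m r} (hU : U ∈ S.G) :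
    (S.A1 A₀ h U)ᵀ = S.A1 A₀ h U := by
  have h1 := hI.stability.symmetrizer U hU
  have h2 := PosDef.symm (hI.stability.posDef U hU)
  rw [A1, Matrix.mul_assoc ((PU h U)⁻¹)ᵀ (A₀ U), Matrix.transpose_mul, Matrix.transpose_mul,
    Matrix.transpose_mul, Matrix.transpose_transpose, h2, h1, ← Matrix.mul_assoc]

theorem A1_fromBlocks (hI : S.AssumptionI A₀ h) {U : State m r} (hU : U ∈ S.G) :
    S.A1 A₀ h U = Matrix.fromBlocks (S.frozen A₀ h U).A11 (S.frozen A₀ h U).A12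
      (S.frozen A₀ h U).A12ᵀ (S.frozen A₀ h U).A22 := by
  conv_lhs => rw [← Matrix.fromBlocks_toBlocks (S.A1 A₀ h U)]
  congr 1
  conv_lhs => rw [← A1_transpose hI hU]
  rfl

theorem A11_transpose (hI : S.AssumptionI A₀ h) {U : State m r} (hU : U ∈ S.G) :
    (S.frozen A₀ h U).A11ᵀ = (S.frozen A₀ h U).A11 := by
  conv_rhs => rw [frozen, ← A1_transpose hI hU]
  rfl

theorem A22_transpose (hI : S.AssumptionI A₀ h) {U : State m r} (hU : U ∈ S.G) :
    (S.frozen A₀ h U).A22ᵀ = (S.frozen A₀ h U).A22 := by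
  conv_rhs => rw [frozen, ← A1_transpose hI hU]
  rfl

theorem schur_transpose (hI : S.AssumptionI A₀ h) {U : State m r} (hU : U ∈ S.G) :
    (S.frozen A₀ h U).schurᵀ = (S.frozen A₀ h U).schur := by
  simp only [LinearProblem.schur, Matrix.transpose_sub, Matrix.transpose_mul,
    Matrix.transpose_transpose, Matrix.transpose_nonsing_inv, A11_transpose hI hU,
    A22_transpose hI hU, Matrix.mul_assoc]

theorem tA0_fromBlocks (hI : S.AssumptionI A₀ h) {U : State m r} (hU : U ∈ S.G) :
    tA0 A₀ h U = Matrix.fromBlocks (S.frozen A₀ h U).A01 (tA0 A₀ h U).toBlocks₁₂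
      ((tA0 A₀ h U).toBlocks₁₂)ᵀ (S.frozen A₀ h U).A02 := by
  conv_lhs => rw [← Matrix.fromBlocks_toBlocks (tA0 A₀ h U)]
  congr 1
  conv_lhs => rw [← PosDef.symm (tA0_posDef hI hU)]
  rfl

theorem A01_posDef (hI : S.AssumptionI A₀ h) {U : State m r} (hU : U ∈ S.G) :
    (S.frozen A₀ h U).A01.PosDef :=
  (tA0_posDef hI hU).submatrix Sum.inl_injective

theorem A02_posDef (hI : S.AssumptionI A₀ h) {U : State m r} (hU : U ∈ S.G) :
    (S.frozen A₀ h U).A02.PosDef :=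
  (tA0_posDef hI hU).submatrix Sum.inr_injective

/-! ### The corner state -/

/-- Differentiation of `q (u, h u) = 0`. -/
theorem jac_q_corner (hI : S.AssumptionI A₀ h) (hII : S.AssumptionII) :
    jac₁ S.q S.corner + jac₂ S.q S.corner * jac h S.corner.1 = 0 := by
  have hc := corner_mem_equil hII
  have hev := eventually_equil hI hII
  have hq := (S.smooth_q.contDiffAt (S.isOpen_G.mem_nhds hc.1)).differentiableAt (by simp)
  have hh := (hev.self_of_nhds.1.differentiableAt (by simp)).hasFDerivAt
  have h1 : HasFDerivAt (fun u => S.q (u, h u)) _ S.corner.1 :=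
    HasFDerivAt.comp S.corner.1 (g := S.q) (by rw [corner_eq hI hII]; exact hq.hasFDerivAt)
      ((hasFDerivAt_id S.corner.1).prodMk hh)
  have h2 : HasFDerivAt (fun u => S.q (u, h u)) (0 : (Fin m → ℝ) →L[ℝ] (Fin r → ℝ)) S.corner.1 :=
    (hasFDerivAt_const (0 : Fin r → ℝ) S.corner.1).congr_of_eventuallyEq
      (hev.mono fun u hu => hu.2.2)
  refine matrix_eq_of_mulVec fun v => ?_
  have h3 := congrArg (fun D : (Fin m → ℝ) →L[ℝ] (Fin r → ℝ) => D v) (h1.unique h2)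
  simp only [ContinuousLinearMap.comp_apply, ContinuousLinearMap.prod_apply,
    ContinuousLinearMap.id_apply, fderiv_eq_jac, _root_.zero_apply] at h3
  rw [Matrix.add_mulVec, ← Matrix.mulVec_mulVec, Matrix.zero_mulVec, jac_mulVec, h3]

/-- By `jac_q_corner` the change of variables removes the `u`-derivative from the source and leaves
`diag(0, q_v)`. -/
theorem source_corner (hI : S.AssumptionI A₀ h) (hII : S.AssumptionII) :
    tA0 A₀ h S.corner * Matrix.fromBlocks 0 0 0 (jac₂ S.q S.corner) =
      ((PU h S.corner)⁻¹)ᵀ * (A₀ S.corner * S.QU S.corner) * (PU h S.corner)⁻¹ := by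
  have h1 : S.QU S.corner * (PU h S.corner)⁻¹ =
      Matrix.fromBlocks 0 0 0 (jac₂ S.q S.corner) := by
    rw [QU, PU_inv, Matrix.fromBlocks_multiply]
    simp [jac_q_corner hI hII]
  have h2 : (PU h S.corner)⁻¹ * Matrix.fromBlocks 0 0 0 (jac₂ S.q S.corner) =
      Matrix.fromBlocks 0 0 0 (jac₂ S.q S.corner) := by
    rw [PU_inv, Matrix.fromBlocks_multiply]
    simp
  rw [tA0, Matrix.mul_assoc, h2, Matrix.mul_assoc, Matrix.mul_assoc, Matrix.mul_assoc, h1]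

theorem source_corner_transpose (hI : S.AssumptionI A₀ h) (hII : S.AssumptionII) :
    (tA0 A₀ h S.corner * Matrix.fromBlocks 0 0 0 (jac₂ S.q S.corner))ᵀ =
      tA0 A₀ h S.corner * Matrix.fromBlocks 0 0 0 (jac₂ S.q S.corner) := by
  have hc := corner_mem_equil hII
  have h1 := hI.symm_source _ hc
  have h2 := PosDef.symm (hI.stability.posDef _ hc.1)
  rw [source_corner hI hII]
  simp only [Matrix.transpose_mul, Matrix.transpose_transpose, h2]
  rw [← h1]
  simp only [Matrix.mul_assoc]

/-- Symmetry of the transformed source forces its off-diagonal block `A₀₁₂ q_v` to vanish, and `q_v`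
is invertible. -/
theorem A012_corner (hI : S.AssumptionI A₀ h) (hII : S.AssumptionII) :
    (tA0 A₀ h S.corner).toBlocks₁₂ = 0 := by
  have hc := corner_mem_equil hII
  have h1 := source_corner_transpose hI hII
  rw [tA0_fromBlocks hI hc.1, Matrix.fromBlocks_multiply, Matrix.fromBlocks_transpose,
    Matrix.fromBlocks_inj] at h1
  have h2 := h1.2.1
  simp only [Matrix.mul_zero, zero_add, add_zero, Matrix.transpose_zero] at h2
  have hu := (Matrix.isUnit_iff_isUnit_det _).1 (hI.qv_invertible _ hc.1)
  rw [← Matrix.mul_nonsing_inv_cancel_right _ (tA0 A₀ h S.corner).toBlocks₁₂ hu, ← h2,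
    Matrix.zero_mul]

/-- The stability inequality, tested on vectors without slow component, gives semidefiniteness;
invertibility of `A₀₂` and `q_v` makes it strict. -/
theorem S_corner_negDef (hI : S.AssumptionI A₀ h) (hII : S.AssumptionII) :
    (-(S.frozen A₀ h S.corner).S).PosDef := by
  have hc := corner_mem_equil hII
  have hsym : (S.frozen A₀ h S.corner).Sᵀ = (S.frozen A₀ h S.corner).S := by
    have h1 := source_corner_transpose hI hII
    rw [tA0_fromBlocks hI hc.1, Matrix.fromBlocks_multiply, Matrix.fromBlocks_transpose,
      Matrix.fromBlocks_inj] at h1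
    have h2 := h1.2.2.2
    simp only [Matrix.mul_zero, zero_add] at h2
    exact h2
  have hunit : IsUnit (-(S.frozen A₀ h S.corner).S) :=
    ((A02_posDef hI hc.1).isUnit.mul (hI.qv_invertible _ hc.1)).neg
  refine (Matrix.PosSemidef.posDef_iff_isUnit ?_).2 hunit
  refine Matrix.PosSemidef.of_dotProduct_mulVec_nonneg ?_ fun y => ?_
  · rw [Matrix.IsHermitian, Matrix.conjTranspose_eq_transpose_of_trivial, Matrix.transpose_neg, hsym]
  · rw [star_trivial]
    obtain ⟨P, T, hPT⟩ := hI.stability.coupling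
    obtain ⟨-, -, -, hpsd⟩ := hPT _ hc
    set v : Fin m ⊕ Fin r → ℝ := (PU h S.corner)⁻¹ *ᵥ Sum.elim 0 y with hv
    have h1 := hpsd.dotProduct_mulVec_nonneg v
    rw [star_trivial, Matrix.sub_mulVec, dotProduct_sub, Matrix.neg_mulVec, dotProduct_neg,
      dotProduct_congr, dotProduct_fromBlocks_diag, ← hI.symm_source _ hc, ← two_smul ℝ,
      Matrix.smul_mulVec, dotProduct_smul, hv, ← dotProduct_congr, ← source_corner hI hII,
      tA0_fromBlocks hI hc.1, Matrix.fromBlocks_multiply] at h1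
    simp only [Matrix.mul_zero, add_zero, zero_add, A012_corner hI hII, Matrix.zero_mul] at h1
    rw [dotProduct_fromBlocks_diag, Matrix.zero_mulVec, Matrix.zero_mulVec, dotProduct_zero,
      dotProduct_zero, zero_add, zero_add, Matrix.one_mulVec, Sum.elim_comp_inr, smul_eq_mul] at h1
    have h2 : ∀ w : Fin r → ℝ, 0 ≤ w ⬝ᵥ w := fun w =>
      Finset.sum_nonneg fun i _ => mul_self_nonneg _
    have h3 := h2 ((P S.corner *ᵥ (PU h S.corner)⁻¹ *ᵥ Sum.elim 0 y) ∘ Sum.inr)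
    have h4 : (S.frozen A₀ h S.corner).S = (S.frozen A₀ h S.corner).A02 * jac₂ S.q S.corner := rfl
    rw [Matrix.neg_mulVec, dotProduct_neg, h4]
    linarith

/-- As `A₀₁₂ = 0` at the corner, the first block row of `A₁` is `A₀₁` times that of `P F_U P⁻¹`.
This ties `A₁₁` to the equilibrium system. -/
theorem A1_corner (hI : S.AssumptionI A₀ h) (hII : S.AssumptionII) :
    (S.frozen A₀ h S.corner).A11 = (S.frozen A₀ h S.corner).A01 * S.fuh h S.corner ∧
      (S.frozen A₀ h S.corner).A12 = (S.frozen A₀ h S.corner).A01 * jac₂ S.f S.corner := by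
  have hc := corner_mem_equil hII
  have h1 : S.A1 A₀ h S.corner = tA0 A₀ h S.corner *
      (PU h S.corner * (S.FU S.corner * (PU h S.corner)⁻¹)) := by
    have hu := (Matrix.isUnit_iff_isUnit_det _).1 (isUnit_PU (h := h) S.corner)
    rw [tA0, A1, Matrix.mul_assoc _ (PU h S.corner)⁻¹, Matrix.nonsing_inv_mul_cancel_left _ _ hu]
    simp only [Matrix.mul_assoc]
  rw [A1_fromBlocks hI hc.1, tA0_fromBlocks hI hc.1, A012_corner hI hII, PU_inv, PU, FU,
    Matrix.fromBlocks_multiply, Matrix.fromBlocks_multiply, Matrix.fromBlocks_multiply,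
    Matrix.fromBlocks_inj] at h1
  refine ⟨?_, ?_⟩
  · rw [h1.1, fuh]
    simp
  · rw [h1.2.1]
    simp

theorem frozen_isRegular (hI : S.AssumptionI A₀ h) (hII : S.AssumptionII)
    (hIII : S.AssumptionIII h n₀) : (S.frozen A₀ h S.corner).IsRegular where
  posDef_A01 := A01_posDef hI (corner_mem_equil hII).1
  posDef_A02 := A02_posDef hI (corner_mem_equil hII).1
  symm_A11 := A11_transpose hI (corner_mem_equil hII).1
  isUnit_A11 := by
    rw [(A1_corner hI hII).1]
    exact (A01_posDef hI (corner_mem_equil hII).1).isUnit.mul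
      (hIII.noncharacteristic _ (corner_mem_equil hII))
  symm_A22 := A22_transpose hI (corner_mem_equil hII).1
  negDef_S := S_corner_negDef hI hII

/-! ### Coefficients near the corner state -/

/-- The coefficients are smooth and regular at the state `U`. -/
structure IsSmoothState (S : RelaxationProblem m r p)
    (A₀ : State m r → Matrix (Fin m ⊕ Fin r) (Fin m ⊕ Fin r) ℝ)
    (h : (Fin m → ℝ) → (Fin r → ℝ)) (U : State m r) : Prop where
  mem : U ∈ S.G
  smooth_f : ContDiffAt ℝ ∞ S.f U
  smooth_g : ContDiffAt ℝ ∞ S.g U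
  smooth_q : ContDiffAt ℝ ∞ S.q U
  smooth_h : ContDiffAt ℝ ∞ h U.1
  smooth_tA0 : SmAt (tA0 A₀ h) U
  smooth_A1 : SmAt (S.A1 A₀ h) U
  isUnit_A11 : IsUnit (S.frozen A₀ h U).A11

theorem eventually_isSmoothState (hI : S.AssumptionI A₀ h) (hII : S.AssumptionII)
    (hIII : S.AssumptionIII h n₀) : ∀ᶠ U in 𝓝 S.corner, S.IsSmoothState A₀ h U := by
  have hc := corner_mem_equil hII
  have hG : ∀ᶠ U in 𝓝 S.corner, U ∈ S.G := S.isOpen_G.mem_nhds hc.1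
  have hh : ∀ᶠ U in 𝓝 S.corner, ContDiffAt ℝ ∞ h U.1 :=
    continuousAt_fst.eventually ((eventually_equil hI hII).mono fun u hu => hu.1)
  have hsm : ∀ U : State m r, U ∈ S.G → ContDiffAt ℝ ∞ h U.1 → ContDiffAt ℝ ∞ S.f U ∧
      ContDiffAt ℝ ∞ S.g U ∧ ContDiffAt ℝ ∞ S.q U ∧ SmAt (RelaxationProblem.tA0 A₀ h) U ∧
        SmAt (S.A1 A₀ h) U := by
    intro U hU hhU
    have hGU := S.isOpen_G.mem_nhds hU
    have hf := S.smooth_f.contDiffAt hGU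
    have hg := S.smooth_g.contDiffAt hGU
    have hP : SmAt (fun U : State m r => (PU h U)⁻¹) U := by
      simp only [PU_inv]
      exact SmAt.fromBlocks (smAt_const _) (smAt_const _) ((smAt_jac hhU).comp contDiffAt_fst)
        (smAt_const _)
    have hA : SmAt A₀ U := fun i j => (hI.stability.smooth i j).contDiffAt hGU
    have hF : SmAt S.FU U :=
      SmAt.fromBlocks (smAt_jac₁ hf) (smAt_jac₂ hf) (smAt_jac₁ hg) (smAt_jac₂ hg)
    exact ⟨hf, hg, S.smooth_q.contDiffAt hGU, (hP.transpose.mul hA).mul hP,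
      ((hP.transpose.mul hA).mul hF).mul hP⟩
  have hu : ∀ᶠ U in 𝓝 S.corner, IsUnit (S.frozen A₀ h U).A11 := by
    refine eventually_isUnit ?_ (frozen_isRegular hI hII hIII).isUnit_A11
    have h1 := (hsm _ hc.1 hh.self_of_nhds).2.2.2.2
    have h2 : SmAt (fun U => (S.frozen A₀ h U).A11) S.corner := fun i j => h1 _ _
    exact h2.continuousAt
  filter_upwards [hG, hh, hu] with U h1 h2 h3
  obtain ⟨h4, h5, h6, h7, h8⟩ := hsm U h1 h2
  exact ⟨h1, h4, h5, h6, h2, h7, h8, h3⟩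

theorem IsSmoothState.A11 {U : State m r} (hU : S.IsSmoothState A₀ h U) :
    SmAt (fun U => (S.frozen A₀ h U).A11) U := fun _ _ => hU.smooth_A1 _ _

theorem IsSmoothState.A12 {U : State m r} (hU : S.IsSmoothState A₀ h U) :
    SmAt (fun U => (S.frozen A₀ h U).A12) U := fun _ _ => hU.smooth_A1 _ _

theorem IsSmoothState.schur {U : State m r} (hU : S.IsSmoothState A₀ h U) :
    SmAt (fun U => (S.frozen A₀ h U).schur) U := by
  have h22 : SmAt (fun U => (S.frozen A₀ h U).A22) U := fun _ _ => hU.smooth_A1 _ _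
  exact h22.sub ((hU.A12.transpose.mul (hU.A11.inv hU.isUnit_A11)).mul hU.A12)

theorem eventually_isUnit_frame (hI : S.AssumptionI A₀ h) (hII : S.AssumptionII)
    (hIII : S.AssumptionIII h n₀) {P₂ : Matrix (Fin r) (Fin k) ℝ} {P₀ : Matrix (Fin r) (Fin n₀) ℝ}
    (hP : (S.frozen A₀ h S.corner).IsSpectralFrame P₂ P₀) :
    ∀ᶠ U in 𝓝 S.corner, IsUnit (P₂ᵀ * (S.frozen A₀ h U).schur * P₂) :=
  eventually_isUnit (((smAt_const _).mul
    (eventually_isSmoothState hI hII hIII).self_of_nhds.schur).mul (smAt_const _)).continuousAt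
    (LinearProblem.isUnit_Lam2 hP)

/-- The Schur complement has constant rank. -/
theorem schur_mul_kernelFrame (hI : S.AssumptionI A₀ h) (hIII : S.AssumptionIII h n₀) (hk : k + n₀ = r)
    {P₂ : Matrix (Fin r) (Fin k) ℝ} {P₀ : Matrix (Fin r) (Fin n₀) ℝ}
    (hP : (S.frozen A₀ h S.corner).IsSpectralFrame P₂ P₀) {U : State m r}
    (hU : S.IsSmoothState A₀ h U) (hu : IsUnit (P₂ᵀ * (S.frozen A₀ h U).schur * P₂)) :
    (S.frozen A₀ h U).schur * kernelFrame (S.frozen A₀ h U).schur P₂ P₀ = 0 := by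
  set Sg := (S.frozen A₀ h U).schur with hSg
  set K := kernelFrame Sg P₂ P₀ with hK
  have hSgt : Sgᵀ = Sg := schur_transpose hI hU.mem
  have hB : (P₂ᵀ * Sg * P₂)ᵀ = P₂ᵀ * Sg * P₂ := by
    simp only [Matrix.transpose_mul, Matrix.transpose_transpose, hSgt, Matrix.mul_assoc]
  have hE : (P₀ᵀ * Sg * K)ᵀ = P₀ᵀ * Sg * K := by
    rw [hK, kernelFrame, Matrix.mul_sub, Matrix.transpose_sub]
    simp only [Matrix.transpose_mul, Matrix.transpose_transpose, hSgt, Matrix.transpose_nonsing_inv,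
      Matrix.mul_assoc]
  -- `A₁` is congruent to a block diagonal matrix in which `A₁₁` and `P₂ᵀ Σ P₂` are invertible and
  -- account for `m + k` nonzero eigenvalues.
  obtain ⟨Z, Y, hYZ, hZY, hZ⟩ := exists_block_congr (A11_transpose hI hU.mem) hU.isUnit_A11
    (A22_transpose hI hU.mem) hP.orth₂ hP.orth₀ hP.orth₂₀ hP.complete hSg.symm hu
  rw [← A1_fromBlocks hI hU.mem] at hZ
  have hA1 := A1_transpose hI hU.mem
  have hZ' : Zᵀ * (-S.A1 A₀ h U) * Z = Matrix.fromBlocks (-(S.frozen A₀ h U).A11) 0 0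
      (Matrix.fromBlocks (-(P₂ᵀ * Sg * P₂)) 0 0 (-(P₀ᵀ * Sg * K))) := by
    rw [Matrix.mul_neg, Matrix.neg_mul, hZ, Matrix.fromBlocks_neg, Matrix.fromBlocks_neg]
    simp only [neg_zero]
    rfl
  have hsymm : ∀ (A : Matrix (Fin k) (Fin k) ℝ) (B : Matrix (Fin n₀) (Fin n₀) ℝ), Aᵀ = A → Bᵀ = B →
      (Matrix.fromBlocks A 0 0 B)ᵀ = Matrix.fromBlocks A 0 0 B := by
    intro A B hA hB
    rw [Matrix.fromBlocks_transpose, hA, hB, Matrix.transpose_zero, Matrix.transpose_zero]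
  have h11 := A11_transpose hI hU.mem
  have h1 := numPosEig_congr hA1 hYZ hZY hZ
  have h2 := numPosEig_congr (by rw [Matrix.transpose_neg, hA1]) hYZ hZY hZ'
  rw [numPosEig_fromBlocks h11 (hsymm _ _ hB hE), numPosEig_fromBlocks hB hE] at h1
  rw [numPosEig_fromBlocks (by rw [Matrix.transpose_neg, h11])
    (hsymm _ _ (by rw [Matrix.transpose_neg, hB]) (by rw [Matrix.transpose_neg, hE])),
    numPosEig_fromBlocks (by rw [Matrix.transpose_neg, hB]) (by rw [Matrix.transpose_neg, hE])] at h2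
  have h3 := isUnit_numPosEig h11 hU.isUnit_A11
  have h4 := isUnit_numPosEig hB hu
  -- Diagonalization relative to `A₀` relates the eigenvalues of the non-symmetric `F_U` to the
  -- inertia of `A₀ F_U`: both have `n₀` zeros.
  obtain ⟨X, d, hX, hXQ, hXA⟩ := exists_simultaneous_diagonalization
    (A := A₀ U * S.FU U) (by
      rw [Matrix.transpose_mul, PosDef.symm (hI.stability.posDef U hU.mem),
        ← hI.stability.symmetrizer U hU.mem]) (hI.stability.posDef U hU.mem)
  have hX' := (Matrix.isUnit_iff_isUnit_det _).1 hX
  have hFX : S.FU U * X = X * Matrix.diagonal d := by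
    have h5 : IsUnit (Xᵀ * A₀ U) :=
      ((Matrix.isUnit_transpose _).2 hX).mul (hI.stability.posDef U hU.mem).isUnit
    refine h5.mul_left_cancel ?_
    rw [← Matrix.mul_assoc, Matrix.mul_assoc Xᵀ, hXA, ← Matrix.mul_assoc, hXQ, Matrix.one_mul]
  have h5 := numZeroEig_of_diag hX hFX
  rw [hIII.multiplicity U hU.mem] at h5
  have hPu := (Matrix.isUnit_iff_isUnit_det _).1 (isUnit_PU (h := h) U)
  have h6 := numPosEig_add_neg hA1 (X := PU h U * X) (Y := X⁻¹ * (PU h U)⁻¹) (d := d)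
    (by rw [Matrix.mul_assoc, Matrix.nonsing_inv_mul_cancel_left _ _ hPu, Matrix.nonsing_inv_mul _ hX'])
    (by rw [Matrix.mul_assoc, Matrix.mul_nonsing_inv_cancel_left _ _ hX', Matrix.mul_nonsing_inv _ hPu])
    (by
      have h7 : ((PU h U)⁻¹ * PU h U)ᵀ = 1 := by
        rw [Matrix.nonsing_inv_mul _ hPu, Matrix.transpose_one]
      rw [Matrix.transpose_mul] at h7
      rw [← hXA, RelaxationProblem.A1, Matrix.transpose_mul]
      calc _ = Xᵀ * ((PU h U)ᵀ * ((PU h U)⁻¹)ᵀ) * (A₀ U * S.FU U) *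
            ((PU h U)⁻¹ * PU h U) * X := by simp only [Matrix.mul_assoc]
        _ = _ := by rw [h7, Matrix.nonsing_inv_mul _ hPu, Matrix.mul_one, Matrix.mul_one])
  simp only [Fintype.card_sum, Fintype.card_fin] at h3 h4 h6
  -- Since `m + k + n₀ = m + r`, no nonzero eigenvalue is left for the last block.
  have hE0 : P₀ᵀ * Sg * K = 0 := eq_zero_of_numPosEig hE (by omega)
  have hE2 : P₂ᵀ * Sg * K = 0 := mul_kernelFrame hu
  calc Sg * K = (P₂ * P₂ᵀ + P₀ * P₀ᵀ) * (Sg * K) := by rw [hP.complete, Matrix.one_mul]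
    _ = P₂ * (P₂ᵀ * Sg * K) + P₀ * (P₀ᵀ * Sg * K) := by
        simp only [Matrix.add_mul, Matrix.mul_assoc]
    _ = 0 := by rw [hE0, hE2, Matrix.mul_zero, Matrix.mul_zero, add_zero]

/-- The number of positive eigenvalues of `A₁` at the corner state. -/
theorem numPosEig_corner (hI : S.AssumptionI A₀ h) (hII : S.AssumptionII)
    (hIII : S.AssumptionIII h n₀)
    {P₂ : Matrix (Fin r) (Fin k) ℝ} {P₀ : Matrix (Fin r) (Fin n₀) ℝ}
    (hP : (S.frozen A₀ h S.corner).IsSpectralFrame P₂ P₀) :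
    numPosEig (S.frozen A₀ h S.corner).A11 + numPosEig ((S.frozen A₀ h S.corner).Lam2 P₂) =
      numPosEig (S.A1 A₀ h S.corner) := by
  have hc := (corner_mem_equil hII).1
  have hreg := frozen_isRegular hI hII hIII
  obtain ⟨Z, Y, hYZ, hZY, hZ⟩ := exists_block_congr hreg.symm_A11 hreg.isUnit_A11
    hreg.symm_A22 hP.orth₂ hP.orth₀ hP.orth₂₀ hP.complete
    (show _ = (S.frozen A₀ h S.corner).schur from rfl) (LinearProblem.isUnit_Lam2 hP)
  have h1 : kernelFrame (S.frozen A₀ h S.corner).schur P₂ P₀ = P₀ := by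
    rw [kernelFrame, Matrix.mul_assoc P₂ᵀ _ P₀, hP.kernel, Matrix.mul_zero, Matrix.mul_zero, sub_zero]
  rw [← A1_fromBlocks hI hc, h1, Matrix.mul_assoc P₀ᵀ, hP.kernel, Matrix.mul_zero] at hZ
  have h2 := LinearProblem.Lam2_transpose hP
  rw [LinearProblem.Lam2] at h2 ⊢
  rw [numPosEig_congr (A1_transpose hI hc) hYZ hZY hZ, numPosEig_fromBlocks hreg.symm_A11,
    numPosEig_fromBlocks h2 Matrix.transpose_zero, numPosEig_zero, add_zero]
  rw [Matrix.fromBlocks_transpose, h2, Matrix.transpose_zero, Matrix.transpose_zero,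
    Matrix.transpose_zero]

end RelaxationProblem


/-! ### Smooth orthonormal frames -/

section InverseSquareRoot

attribute [local instance] Matrix.linftyOpNormedRing Matrix.linftyOpNormedAlgebra

variable {n : ℕ} {E : Type*} [NormedAddCommGroup E] [NormedSpace ℝ E]

theorem contDiffAt_matrix_iff {A : E → Matrix (Fin n) (Fin n) ℝ} {x : E} :
    ContDiffAt ℝ ∞ A x ↔ SmAt A x := by
  constructor
  · intro h i j
    exact (LinearMap.toContinuousLinearMap
      (Matrix.entryLinearMap ℝ ℝ i j)).contDiff.contDiffAt.comp x h
  · intro h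
    have h1 : A = fun y => ∑ i, ∑ j, A y i j • Matrix.single i j (1 : ℝ) := by
      ext y
      conv_lhs => rw [Matrix.matrix_eq_sum_single (A y)]
      simp [Matrix.smul_single]
    rw [h1]
    exact ContDiffAt.sum fun i _ => ContDiffAt.sum fun j _ => (h i j).smul contDiffAt_const

/-- Smooth inverse square roots of symmetric matrices near the identity. -/
theorem exists_smooth_inv_sqrt {A : E → Matrix (Fin n) (Fin n) ℝ} {x₀ : E}
    (hA : ∀ᶠ x in 𝓝 x₀, SmAt A x) (h0 : A x₀ = 1) (hsym : ∀ᶠ x in 𝓝 x₀, (A x)ᵀ = A x) :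
    ∃ Y : E → Matrix (Fin n) (Fin n) ℝ, Y x₀ = 1 ∧ (∀ᶠ x in 𝓝 x₀, SmAt Y x) ∧
      ∀ᶠ x in 𝓝 x₀, (Y x)ᵀ * A x * Y x = 1 := by
  have hs : ContDiff ℝ ∞ fun p : Matrix (Fin n) (Fin n) ℝ × Matrix (Fin n) (Fin n) ℝ =>
      p.2 * p.2 * p.1 - 1 := by fun_prop
  -- The derivative of `Y * Y * G` in `Y` at the identity is multiplication by two.
  let e : Matrix (Fin n) (Fin n) ℝ ≃L[ℝ] Matrix (Fin n) (Fin n) ℝ :=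
    ContinuousLinearEquiv.smulLeft (Units.mk0 (2 : ℝ) two_ne_zero)
  have hD : HasFDerivAt (fun p : Matrix (Fin n) (Fin n) ℝ × Matrix (Fin n) (Fin n) ℝ =>
      p.2 * p.2 * p.1 - 1) ((ContinuousLinearMap.id ℝ (Matrix (Fin n) (Fin n) ℝ)).coprod
        (e : Matrix (Fin n) (Fin n) ℝ →L[ℝ] Matrix (Fin n) (Fin n) ℝ)) (1, 1) := by
    have h1 := (((hasFDerivAt_snd (𝕜 := ℝ) (p := ((1 : Matrix (Fin n) (Fin n) ℝ),
      (1 : Matrix (Fin n) (Fin n) ℝ)))).mul' hasFDerivAt_snd).mul' hasFDerivAt_fst).sub_const 1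
    refine h1.congr_fderiv (ContinuousLinearMap.ext fun p => ?_)
    simp only [e, ContinuousLinearMap.coprod_apply]
    simp [two_smul]
    rw [← two_smul ℝ]
    rfl
  obtain ⟨ψ, hψ, -⟩ := exists_isImplicitSolution
    (Φ := fun Y G : Matrix (Fin n) (Fin n) ℝ => Y * Y * G - 1) (y₀ := 1) (x₀ := 1)
    (Eventually.of_forall fun p => hs.contDiffAt) (by simp) hD
  have hAc : ContinuousAt A x₀ := (contDiffAt_matrix_iff.2 hA.self_of_nhds).continuousAt
  have hA1 : Tendsto A (𝓝 x₀) (𝓝 1) := by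
    have := hAc.tendsto
    rwa [h0] at this
  have hψ1 : Tendsto (fun x => ψ (A x)) (𝓝 x₀) (𝓝 1) := by
    have := hψ.continuousAt.tendsto.comp hA1
    rwa [hψ.1] at this
  have htr : Tendsto (fun x => (ψ (A x))ᵀ) (𝓝 x₀) (𝓝 1) := by
    have h1 := (LinearMap.toContinuousLinearMap
      (Matrix.transposeLinearEquiv (Fin n) (Fin n) ℝ ℝ).toLinearMap).continuous.tendsto 1
    have h2 := h1.comp hψ1
    simpa [Function.comp_def] using h2
  refine ⟨fun x => ψ (A x), by show ψ (A x₀) = 1; rw [h0, hψ.1], ?_, ?_⟩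
  · filter_upwards [hA, hA1.eventually hψ.eventually_contDiffAt] with x h1 h2
    exact contDiffAt_matrix_iff.1 (h2.comp x (contDiffAt_matrix_iff.2 h1))
  · filter_upwards [hsym, hA1.eventually hψ.eventually_eq_zero,
      (hA1.prodMk_nhds htr).eventually hψ.eventually_iff] with x h1 h2 h3
    set Y := ψ (A x) with hY
    have h4 : Y * Y * A x = 1 := sub_eq_zero.1 h2
    have h5 : A x * (Y * Y) = 1 := mul_eq_one_comm.1 h4
    -- The transpose solves the same equation and is also close to the identity, so local uniqueness
    -- gives symmetry.
    have h6 : Yᵀ = Y := by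
      refine h3.1 ?_
      have h7 := congrArg Matrix.transpose h5
      rw [Matrix.transpose_mul, Matrix.transpose_mul, h1, Matrix.transpose_one] at h7
      exact sub_eq_zero.2 h7
    rw [h6]
    exact mul_eq_one_comm.1 ((Matrix.mul_assoc _ _ _).symm.trans h4 : Y * (Y * A x) = 1)

end InverseSquareRoot

namespace RelaxationProblem

variable {m r p k n₀ : ℕ} {S : RelaxationProblem m r p}
  {A₀ : State m r → Matrix (Fin m ⊕ Fin r) (Fin m ⊕ Fin r) ℝ} {h : (Fin m → ℝ) → (Fin r → ℝ)}

/-- By constant rank, `kernelFrame` is a smooth frame of the kernel of the Schur complement. Inverse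
square roots of Gram matrices orthonormalize it and the projection of `P₂` to its orthogonal
complement. At the corner both Gram matrices are the identity, so the prescribed values are
attained. -/
theorem exists_isLocalFrame (hI : S.AssumptionI A₀ h) (hII : S.AssumptionII)
    (hIII : S.AssumptionIII h n₀) (hk : k + n₀ = r)
    {P₂ : Matrix (Fin r) (Fin k) ℝ} {P₀ : Matrix (Fin r) (Fin n₀) ℝ}
    (hP : (S.frozen A₀ h S.corner).IsSpectralFrame P₂ P₀) :
    ∃ Q₂ Q₀, S.IsLocalFrame A₀ h P₂ P₀ Q₂ Q₀ := by
  set Sg : State m r → Matrix (Fin r) (Fin r) ℝ := fun U => (S.frozen A₀ h U).schur with hSg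
  set K : State m r → Matrix (Fin r) (Fin n₀) ℝ := fun U => kernelFrame (Sg U) P₂ P₀ with hK
  have hst := eventually_isSmoothState hI hII hIII
  have hun := eventually_isUnit_frame hI hII hIII hP
  have hKs : ∀ᶠ U in 𝓝 S.corner, SmAt K U := by
    filter_upwards [hst, hun] with U h1 h2
    have h3 := h1.schur
    have h4 := (smAt_const P₂ᵀ).mul h3
    exact (smAt_const P₀).sub (((smAt_const P₂).mul ((h4.mul (smAt_const P₂)).inv h2)).mul
      (h4.mul (smAt_const P₀)))
  have hKc : K S.corner = P₀ := by
    rw [hK]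
    show kernelFrame (S.frozen A₀ h S.corner).schur P₂ P₀ = P₀
    rw [kernelFrame, Matrix.mul_assoc P₂ᵀ _ P₀, hP.kernel, Matrix.mul_zero, Matrix.mul_zero, sub_zero]
  have hPt : P₀ᵀ * P₂ = 0 := by
    rw [← Matrix.transpose_transpose P₂, ← Matrix.transpose_mul, hP.orth₂₀, Matrix.transpose_zero]
  obtain ⟨Y, hYc, hYs, hY⟩ := exists_smooth_inv_sqrt (A := fun U => (K U)ᵀ * K U) (x₀ := S.corner)
    (hKs.mono fun U hU => hU.transpose.mul hU) (by rw [hKc, hP.orth₀])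
    (Eventually.of_forall fun U => by rw [Matrix.transpose_mul, Matrix.transpose_transpose])
  set Q₀ : State m r → Matrix (Fin r) (Fin n₀) ℝ := fun U => K U * Y U with hQ₀
  have hQ₀s : ∀ᶠ U in 𝓝 S.corner, SmAt Q₀ U := by
    filter_upwards [hKs, hYs] with U h1 h2 using h1.mul h2
  have hQ₀c : Q₀ S.corner = P₀ := by
    show K S.corner * Y S.corner = P₀
    rw [hKc, hYc, Matrix.mul_one]
  set R : State m r → Matrix (Fin r) (Fin k) ℝ := fun U => P₂ - Q₀ U * ((Q₀ U)ᵀ * P₂) with hR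
  have hRs : ∀ᶠ U in 𝓝 S.corner, SmAt R U := by
    filter_upwards [hQ₀s] with U h1
    exact (smAt_const P₂).sub (h1.mul (h1.transpose.mul (smAt_const P₂)))
  have hRc : R S.corner = P₂ := by
    show P₂ - Q₀ S.corner * ((Q₀ S.corner)ᵀ * P₂) = P₂
    rw [hQ₀c, hPt, Matrix.mul_zero, sub_zero]
  obtain ⟨Z, hZc, hZs, hZ⟩ := exists_smooth_inv_sqrt (A := fun U => (R U)ᵀ * R U) (x₀ := S.corner)
    (hRs.mono fun U hU => hU.transpose.mul hU) (by rw [hRc, hP.orth₂])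
    (Eventually.of_forall fun U => by rw [Matrix.transpose_mul, Matrix.transpose_transpose])
  set Q₂ : State m r → Matrix (Fin r) (Fin k) ℝ := fun U => R U * Z U with hQ₂
  have hQ₂s : ∀ᶠ U in 𝓝 S.corner, SmAt Q₂ U := by
    filter_upwards [hRs, hZs] with U h1 h2 using h1.mul h2
  have hQ₂c : Q₂ S.corner = P₂ := by
    show R S.corner * Z S.corner = P₂
    rw [hRc, hZc, Matrix.mul_one]
  have hQu : ∀ᶠ U in 𝓝 S.corner, IsUnit ((Q₂ U)ᵀ * Sg U * Q₂ U) := by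
    refine eventually_isUnit ((hQ₂s.self_of_nhds.transpose.mul
      hst.self_of_nhds.schur).mul hQ₂s.self_of_nhds).continuousAt ?_
    rw [hQ₂c]
    exact LinearProblem.isUnit_Lam2 hP
  have hall := (hst.and hun).and ((hQ₀s.and hQ₂s).and ((hY.and hZ).and hQu))
  obtain ⟨O, hO, hOo, hOc⟩ := eventually_nhds_iff.1 hall
  refine ⟨Q₂, Q₀, hQ₂c, hQ₀c, O, hOo, hOc, fun U hU => (hO U hU).1.1.mem,
    fun i j U hU => ((hO U hU).2.1.2 i j).contDiffWithinAt,
    fun i j U hU => ((hO U hU).2.1.1 i j).contDiffWithinAt, fun U hU => ?_⟩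
  obtain ⟨⟨h1, h2⟩, -, ⟨h3, h4⟩, h5⟩ := hO U hU
  have h6 : (Q₀ U)ᵀ * Q₀ U = 1 := by
    rw [← h3]
    simp only [hQ₀, Matrix.transpose_mul, Matrix.mul_assoc]
  have h7 : (R U)ᵀ * Q₀ U = 0 := by
    simp only [hR, Matrix.transpose_sub, Matrix.transpose_mul, Matrix.transpose_transpose,
      Matrix.sub_mul]
    rw [Matrix.mul_assoc, h6, Matrix.mul_one, sub_self]
  refine ⟨h1.isUnit_A11, ?_, h5, h6, ?_, ?_⟩
  · have h8 := congrArg Matrix.transpose (schur_mul_kernelFrame hI hIII hk hP h1 h2)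
    rw [Matrix.transpose_mul, schur_transpose hI h1.mem, Matrix.transpose_zero] at h8
    simp only [hQ₀, hK, Matrix.transpose_mul]
    rw [Matrix.mul_assoc, h8, Matrix.mul_zero]
  · rw [← h4]
    simp only [hQ₂, Matrix.transpose_mul, Matrix.mul_assoc]
  · simp only [hQ₂, Matrix.transpose_mul]
    rw [Matrix.mul_assoc, h7, Matrix.mul_zero]

end RelaxationProblem


/-- In the product rule, the term with the derivative of `M` carries the factor `v x = 0`. -/
theorem SmAt.hasFDerivAt_mulVec_of_eq_zero {E ι κ : Type*} [NormedAddCommGroup E] [NormedSpace ℝ E]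
    [Fintype ι] [DecidableEq ι] [Fintype κ] [DecidableEq κ] {M : E → Matrix ι κ ℝ} {v : E → κ → ℝ}
    {x : E} {v' : E →L[ℝ] (κ → ℝ)} (hM : SmAt M x) (hv : HasFDerivAt v v' x) (h0 : v x = 0) :
    HasFDerivAt (fun y => M y *ᵥ v y) (mvL (M x) ∘L v') x := by
  refine hasFDerivAt_pi'.2 fun i => ?_
  simp only [Matrix.mulVec, dotProduct]
  have h1 : ∀ j ∈ Finset.univ, HasFDerivAt (fun y => M y i j * v y j) _ x := fun j _ =>
    ((hM i j).differentiableAt (by simp)).hasFDerivAt.mul (hasFDerivAt_pi'.1 hv j)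
  refine (HasFDerivAt.fun_sum h1).congr_fderiv (ContinuousLinearMap.ext fun y => ?_)
  simp [h0, Matrix.mulVec, dotProduct]

namespace RelaxationProblem

variable {m r p k n₀ : ℕ} {S : RelaxationProblem m r p}
  {A₀ : State m r → Matrix (Fin m ⊕ Fin r) (Fin m ⊕ Fin r) ℝ} {h : (Fin m → ℝ) → (Fin r → ℝ)}
  {E : Type*} [NormedAddCommGroup E] [NormedSpace ℝ E]

/-! ### The slow variable -/

theorem contDiffAt_layerState {μ u : E → Fin m → ℝ} {ν : E → Fin r → ℝ} {x : E}
    (hμ : ContDiffAt ℝ ∞ μ x) (hν : ContDiffAt ℝ ∞ ν x) (hu : ContDiffAt ℝ ∞ u x)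
    (hh : ContDiffAt ℝ ∞ h (layerState h (μ x) (ν x) (u x)).1) :
    ContDiffAt ℝ ∞ (fun y => layerState h (μ y) (ν y) (u y)) x := by
  have h1 : ContDiffAt ℝ ∞ (fun y => μ y + u y) x := hμ.add hu
  exact h1.prodMk (hν.add (ContDiffAt.comp x (g := h) hh h1))

theorem hasFDerivAt_layerState {μ u : E → Fin m → ℝ} {ν : E → Fin r → ℝ} {x : E}
    {μ' u' : E →L[ℝ] (Fin m → ℝ)} {ν' : E →L[ℝ] (Fin r → ℝ)}
    (hμ : HasFDerivAt μ μ' x) (hν : HasFDerivAt ν ν' x) (hu : HasFDerivAt u u' x)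
    (hh : DifferentiableAt ℝ h (layerState h (μ x) (ν x) (u x)).1) :
    HasFDerivAt (fun y => layerState h (μ y) (ν y) (u y))
      ((μ' + u').prod (ν' + fderiv ℝ h (layerState h (μ x) (ν x) (u x)).1 ∘L (μ' + u'))) x := by
  have h1 : HasFDerivAt (fun y => μ y + u y) (μ' + u') x := hμ.add hu
  exact h1.prodMk (hν.add (HasFDerivAt.comp x (g := h) hh.hasFDerivAt h1))

/-- Increments are written as `(a, b + h' a)`, so that `b` is the increment of the fast variable `v
- h(u)`. -/
theorem fderiv_f_corner (a : Fin m → ℝ) (b : Fin r → ℝ) :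
    fderiv ℝ S.f S.corner (a, b + fderiv ℝ h S.corner.1 a) =
      S.fuh h S.corner *ᵥ a + jac₂ S.f S.corner *ᵥ b := by
  rw [fderiv_eq_jac, fuh, Matrix.add_mulVec, ← Matrix.mulVec_mulVec, jac_mulVec, Matrix.mulVec_add]
  abel

theorem fderiv_q_corner (hI : S.AssumptionI A₀ h) (hII : S.AssumptionII)
    (a : Fin m → ℝ) (b : Fin r → ℝ) :
    fderiv ℝ S.q S.corner (a, b + fderiv ℝ h S.corner.1 a) = jac₂ S.q S.corner *ᵥ b := by
  have h1 : (jac₁ S.q S.corner + jac₂ S.q S.corner * jac h S.corner.1) *ᵥ a = 0 := by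
    rw [jac_q_corner hI hII, Matrix.zero_mulVec]
  rw [Matrix.add_mulVec, ← Matrix.mulVec_mulVec, jac_mulVec] at h1
  rw [fderiv_eq_jac, Matrix.mulVec_add, add_comm (jac₂ S.q S.corner *ᵥ b), ← add_assoc, h1, zero_add]

theorem layerState_base (hI : S.AssumptionI A₀ h) (hII : S.AssumptionII) :
    layerState h 0 0 S.corner.1 = S.corner := by
  rw [layerState, zero_add, zero_add, corner_eq hI hII]

theorem continuousAt_layerState (hI : S.AssumptionI A₀ h) (hII : S.AssumptionII)
    {X : Type*} [TopologicalSpace X] {μ u : X → Fin m → ℝ} {ν : X → Fin r → ℝ} {x : X}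
    (hμ : ContinuousAt μ x) (hν : ContinuousAt ν x) (hu : ContinuousAt u x)
    (hx : μ x + u x = S.corner.1) :
    ContinuousAt (fun y => layerState h (μ y) (ν y) (u y)) x := by
  have h1 : ContinuousAt (fun y => μ y + u y) x := hμ.add hu
  have h2 : ContinuousAt h (μ x + u x) := by
    rw [hx]
    exact (eventually_equil hI hII).self_of_nhds.1.continuousAt
  exact h1.prodMk (hν.add (ContinuousAt.comp (f := fun y => μ y + u y) h2 h1))

theorem tendsto_layerState (hI : S.AssumptionI A₀ h) (hII : S.AssumptionII) :
    Tendsto (fun z : ((Fin r → ℝ) × (Fin m → ℝ)) × (Fin m → ℝ) => layerState h z.2 z.1.1 z.1.2)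
      (𝓝 ((0, S.corner.1), 0)) (𝓝 S.corner) := by
  have h1 := continuousAt_layerState hI hII (x := (((0, S.corner.1), 0) :
    ((Fin r → ℝ) × (Fin m → ℝ)) × (Fin m → ℝ))) (μ := fun z => z.2) (ν := fun z => z.1.1)
    (u := fun z => z.1.2) continuousAt_snd (by fun_prop) (by fun_prop) (zero_add _)
  have h2 := h1.tendsto
  simp only [layerState_base hI hII] at h2
  exact h2

/-- The derivative in `μ` at the corner is `f_u + f_v h_u`, invertible by the noncharacteristic
assumption; the two contributions of `u∞` cancel. -/
theorem exists_psi1 (hI : S.AssumptionI A₀ h) (hII : S.AssumptionII) (hIII : S.AssumptionIII h n₀) :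
    ∃ ψ₁ : (Fin r → ℝ) × (Fin m → ℝ) → (Fin m → ℝ),
      IsImplicitSolution (S.phi1 h) 0 (0, S.corner.1) ψ₁ ∧
      HasFDerivAt ψ₁ (-(mvL ((S.fuh h S.corner)⁻¹ * jac₂ S.f S.corner) ∘L
        ContinuousLinearMap.fst ℝ (Fin r → ℝ) (Fin m → ℝ))) (0, S.corner.1) := by
  have hu := (Matrix.isUnit_iff_isUnit_det _).1
    (hIII.noncharacteristic _ (corner_mem_equil hII))
  obtain ⟨e, he, he'⟩ := exists_equiv_mulVec (Matrix.mul_nonsing_inv _ hu)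
    (Matrix.nonsing_inv_mul _ hu)
  have hst := eventually_isSmoothState hI hII hIII
  have heq := eventually_equil hI hII
  have hls := tendsto_layerState hI hII
  have hu1 : Tendsto (fun z : ((Fin r → ℝ) × (Fin m → ℝ)) × (Fin m → ℝ) => z.1.2)
      (𝓝 ((0, S.corner.1), 0)) (𝓝 S.corner.1) := by
    have : Continuous fun z : ((Fin r → ℝ) × (Fin m → ℝ)) × (Fin m → ℝ) => z.1.2 := by fun_prop
    exact this.tendsto _
  have hu2 : Tendsto (fun u : Fin m → ℝ => (u, h u)) (𝓝 S.corner.1) (𝓝 S.corner) := by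
    have h1 : ContinuousAt (fun u : Fin m → ℝ => (u, h u)) S.corner.1 :=
      continuousAt_id.prodMk heq.self_of_nhds.1.continuousAt
    have h2 := h1.tendsto
    rwa [corner_eq hI hII] at h2
  have hsm : ∀ᶠ z : ((Fin r → ℝ) × (Fin m → ℝ)) × (Fin m → ℝ) in 𝓝 ((0, S.corner.1), 0),
      ContDiffAt ℝ ∞ (fun z : ((Fin r → ℝ) × (Fin m → ℝ)) × (Fin m → ℝ) => S.phi1 h z.2 z.1) z := by
    filter_upwards [hls.eventually hst, hu1.eventually heq, hu1.eventually (hu2.eventually hst)]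
      with z h1 h2 h3
    have h4 := contDiffAt_layerState (μ := fun z : ((Fin r → ℝ) × (Fin m → ℝ)) × (Fin m → ℝ) => z.2)
      (ν := fun z => z.1.1) (u := fun z => z.1.2) (x := z) (h := h) contDiffAt_snd (by fun_prop)
      (by fun_prop) h1.smooth_h
    have h5 : ContDiffAt ℝ ∞ (fun z : ((Fin r → ℝ) × (Fin m → ℝ)) × (Fin m → ℝ) =>
        (z.1.2, h z.1.2)) z := by
      have h6 : ContDiffAt ℝ ∞ (fun z : ((Fin r → ℝ) × (Fin m → ℝ)) × (Fin m → ℝ) => z.1.2) z := by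
        fun_prop
      exact h6.prodMk (ContDiffAt.comp z (g := h) h2.1 h6)
    exact (ContDiffAt.comp z (g := S.f) h1.smooth_f h4).sub (ContDiffAt.comp z (g := S.f) h3.smooth_f h5)
  have hf := hst.self_of_nhds.smooth_f.differentiableAt (by simp)
  have hh := heq.self_of_nhds.1.differentiableAt (by simp)
  have hD : HasFDerivAt (fun z : ((Fin r → ℝ) × (Fin m → ℝ)) × (Fin m → ℝ) => S.phi1 h z.2 z.1)
      ((mvL (jac₂ S.f S.corner) ∘L ContinuousLinearMap.fst ℝ (Fin r → ℝ) (Fin m → ℝ)).coprod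
        (e : (Fin m → ℝ) →L[ℝ] (Fin m → ℝ))) ((0, S.corner.1), 0) := by
    have hν : HasFDerivAt (fun z : ((Fin r → ℝ) × (Fin m → ℝ)) × (Fin m → ℝ) => z.1.1) _
        ((0, S.corner.1), 0) := ((ContinuousLinearMap.fst ℝ (Fin r → ℝ) (Fin m → ℝ)) ∘L
        (ContinuousLinearMap.fst ℝ ((Fin r → ℝ) × (Fin m → ℝ)) (Fin m → ℝ))).hasFDerivAt
    have hu' : HasFDerivAt (fun z : ((Fin r → ℝ) × (Fin m → ℝ)) × (Fin m → ℝ) => z.1.2) _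
        ((0, S.corner.1), 0) := ((ContinuousLinearMap.snd ℝ (Fin r → ℝ) (Fin m → ℝ)) ∘L
        (ContinuousLinearMap.fst ℝ ((Fin r → ℝ) × (Fin m → ℝ)) (Fin m → ℝ))).hasFDerivAt
    have h4 := hasFDerivAt_layerState (μ := fun z : ((Fin r → ℝ) × (Fin m → ℝ)) × (Fin m → ℝ) => z.2)
      (ν := fun z => z.1.1) (u := fun z => z.1.2) (x := ((0, S.corner.1), 0)) (h := h)
      hasFDerivAt_snd hν hu'
      (by rw [layerState_base hI hII]; exact hh)
    have h5 : HasFDerivAt (fun u : Fin m → ℝ => (u, h u)) _ S.corner.1 :=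
      (hasFDerivAt_id S.corner.1).prodMk hh.hasFDerivAt
    have h6 := h5.comp (((0, S.corner.1), 0) : ((Fin r → ℝ) × (Fin m → ℝ)) × (Fin m → ℝ))
      hu'
    have h7 := (HasFDerivAt.comp (((0, S.corner.1), 0) : ((Fin r → ℝ) × (Fin m → ℝ)) × (Fin m → ℝ))
      (g := S.f) (by rw [layerState_base hI hII]; exact hf.hasFDerivAt) h4).sub
      (HasFDerivAt.comp (((0, S.corner.1), 0) : ((Fin r → ℝ) × (Fin m → ℝ)) × (Fin m → ℝ))
      (g := S.f) (by simp only [Function.comp_apply]; rw [corner_eq hI hII]; exact hf.hasFDerivAt) h6)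
    refine h7.congr_fderiv (ContinuousLinearMap.ext fun y => ?_)
    obtain ⟨⟨a, b⟩, c⟩ := y
    have h8 := fderiv_f_corner (S := S) (h := h) b 0
    rw [zero_add] at h8
    have h9 := fderiv_f_corner (S := S) (h := h) (c + b) a
    simp only [layerState_base hI hII, _root_.sub_apply, ContinuousLinearMap.comp_apply,
      ContinuousLinearMap.prod_apply, _root_.add_apply, ContinuousLinearMap.coe_fst',
      ContinuousLinearMap.coe_snd', ContinuousLinearMap.id_apply, ContinuousLinearMap.coprod_apply,
      he, mvL_apply]
    rw [h8, h9, Matrix.mulVec_add, Matrix.mulVec_zero]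
    abel
  obtain ⟨ψ, h1, h2⟩ := exists_isImplicitSolution hsm (by
    rw [phi1, layerState_base hI hII, corner_eq hI hII, sub_self]) hD
  refine ⟨ψ, h1, h2.congr_fderiv ?_⟩
  rw [he']
  refine ContinuousLinearMap.ext fun y => ?_
  show -((S.fuh h S.corner)⁻¹ *ᵥ (jac₂ S.f S.corner *ᵥ y.1)) =
    -(((S.fuh h S.corner)⁻¹ * jac₂ S.f S.corner) *ᵥ y.1)
  rw [Matrix.mulVec_mulVec]

theorem psi1_zero {ψ₁ : (Fin r → ℝ) × (Fin m → ℝ) → (Fin m → ℝ)}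
    (hψ : IsImplicitSolution (S.phi1 h) 0 (0, S.corner.1) ψ₁) :
    ∀ᶠ u in 𝓝 S.corner.1, ψ₁ (0, u) = 0 := by
  have h1 : Tendsto (fun u : Fin m → ℝ => (((0 : Fin r → ℝ), u), (0 : Fin m → ℝ))) (𝓝 S.corner.1)
      (𝓝 ((0, S.corner.1), 0)) := by
    have : Continuous fun u : Fin m → ℝ => (((0 : Fin r → ℝ), u), (0 : Fin m → ℝ)) := by fun_prop
    exact this.tendsto _
  filter_upwards [h1.eventually hψ.eventually_iff] with u hu
  exact (hu.1 (by simp [phi1, layerState])).symm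

end RelaxationProblem


namespace RelaxationProblem

variable {m r p k n₀ : ℕ} {S : RelaxationProblem m r p}
  {A₀ : State m r → Matrix (Fin m ⊕ Fin r) (Fin m ⊕ Fin r) ℝ} {h : (Fin m → ℝ) → (Fin r → ℝ)}
  {E : Type*} [NormedAddCommGroup E] [NormedSpace ℝ E]

/-! ### The source term -/

/-- The coefficient `A₀₂ - A₁₂ᵀ A₁₁⁻¹ A₀₁₂` of the source term. -/
noncomputable def sourceCoef (S : RelaxationProblem m r p)
    (A₀ : State m r → Matrix (Fin m ⊕ Fin r) (Fin m ⊕ Fin r) ℝ)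
    (h : (Fin m → ℝ) → (Fin r → ℝ)) (U : State m r) : Matrix (Fin r) (Fin r) ℝ :=
  (S.frozen A₀ h U).A02 -
    (S.frozen A₀ h U).A12ᵀ * (S.frozen A₀ h U).A11⁻¹ * (tA0 A₀ h U).toBlocks₁₂

/-- The source term of the reduced equations. -/
noncomputable def reducedSource (S : RelaxationProblem m r p)
    (A₀ : State m r → Matrix (Fin m ⊕ Fin r) (Fin m ⊕ Fin r) ℝ)
    (h : (Fin m → ℝ) → (Fin r → ℝ)) (U : State m r) : Fin r → ℝ :=
  S.sourceCoef A₀ h U *ᵥ S.q U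

theorem IsSmoothState.sourceCoef {U : State m r} (hU : S.IsSmoothState A₀ h U) :
    SmAt (S.sourceCoef A₀ h) U := by
  have h1 : SmAt (fun U => (S.frozen A₀ h U).A02) U := fun _ _ => hU.smooth_tA0 _ _
  have h2 : SmAt (fun U => (RelaxationProblem.tA0 A₀ h U).toBlocks₁₂) U :=
    fun _ _ => hU.smooth_tA0 _ _
  exact h1.sub ((hU.A12.transpose.mul (hU.A11.inv hU.isUnit_A11)).mul h2)

theorem IsSmoothState.reducedSource {U : State m r} (hU : S.IsSmoothState A₀ h U) :
    ContDiffAt ℝ ∞ (S.reducedSource A₀ h) U :=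
  hU.sourceCoef.mulVec hU.smooth_q

/-- The fundamental theorem of calculus along the segment from the equilibrium state. It replaces `Ŝ
ν` by `q`, whose smoothness is known, so no parameter integral has to be differentiated. -/
theorem hatS_mulVec {μ uinf : Fin m → ℝ} {ν : Fin r → ℝ}
    (hG : ∀ θ ∈ Icc (0 : ℝ) 1, layerState h μ (θ • ν) uinf ∈ S.G)
    (h0 : S.q (layerState h μ 0 uinf) = 0) :
    S.hatS h μ ν uinf *ᵥ ν = S.q (layerState h μ ν uinf) := by
  have hd : ∀ θ ∈ Icc (0 : ℝ) 1, HasDerivAt (fun θ : ℝ => S.q (layerState h μ (θ • ν) uinf))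
      (jac₂ S.q (layerState h μ (θ • ν) uinf) *ᵥ ν) θ := by
    intro θ hθ
    have h1 := ((S.smooth_q.contDiffAt (S.isOpen_G.mem_nhds (hG θ hθ))).differentiableAt
      (by simp)).hasFDerivAt
    have h2 : HasDerivAt (fun θ : ℝ => layerState h μ (θ • ν) uinf) (0, ν) θ := by
      refine (hasDerivAt_const θ _).prodMk ?_
      have := ((hasDerivAt_id θ).smul_const ν).add_const (h (μ + uinf))
      simpa using this
    rw [jac₂_mulVec]
    exact h1.comp_hasDerivAt θ h2
  have hc : ContinuousOn (fun θ : ℝ => jac₂ S.q (layerState h μ (θ • ν) uinf)) (Icc 0 1) := by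
    intro θ hθ
    have h1 := (smAt_jac₂ (S.smooth_q.contDiffAt (S.isOpen_G.mem_nhds (hG θ hθ)))).continuousAt
    have h2 : Continuous fun θ : ℝ => layerState h μ (θ • ν) uinf := by
      unfold layerState
      fun_prop
    exact (ContinuousAt.comp (f := fun θ : ℝ => layerState h μ (θ • ν) uinf) h1
      h2.continuousAt).continuousWithinAt
  have hci : ∀ i j, IntervalIntegrable (fun θ : ℝ => jac₂ S.q (layerState h μ (θ • ν) uinf) i j)
      MeasureTheory.volume 0 1 := fun i j => by
    refine ContinuousOn.intervalIntegrable ?_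
    rw [uIcc_of_le zero_le_one]
    exact continuousOn_pi.1 (continuousOn_pi.1 hc i) j
  ext i
  have h1 : ∫ θ in (0 : ℝ)..1, (jac₂ S.q (layerState h μ (θ • ν) uinf) *ᵥ ν) i =
      S.q (layerState h μ ((1 : ℝ) • ν) uinf) i - S.q (layerState h μ ((0 : ℝ) • ν) uinf) i := by
    refine intervalIntegral.integral_eq_sub_of_hasDerivAt
      (f := fun θ : ℝ => S.q (layerState h μ (θ • ν) uinf) i) (fun θ hθ => ?_) ?_
    · rw [uIcc_of_le zero_le_one] at hθ
      exact hasDerivAt_pi.1 (hd θ hθ) i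
    · simp only [Matrix.mulVec, dotProduct]
      have := IntervalIntegrable.sum Finset.univ (fun j _ => (hci i j).mul_const (ν j))
      simpa [Finset.sum_fn] using this
  rw [one_smul, zero_smul, h0, Pi.zero_apply, sub_zero] at h1
  rw [← h1]
  simp only [Matrix.mulVec, dotProduct, hatS, Matrix.of_apply]
  rw [intervalIntegral.integral_finsetSum fun j _ => (hci i j).mul_const (ν j)]
  exact Finset.sum_congr rfl fun j _ => (intervalIntegral.integral_mul_const _ _).symm

theorem eventually_rhsCoef (hI : S.AssumptionI A₀ h) (hII : S.AssumptionII) :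
    ∀ᶠ z : ((Fin r → ℝ) × (Fin m → ℝ)) × (Fin m → ℝ) in 𝓝 ((0, S.corner.1), 0),
      S.rhsCoef A₀ h z.2 z.1.1 z.1.2 *ᵥ z.1.1 =
        S.reducedSource A₀ h (layerState h z.2 z.1.1 z.1.2) := by
  have h1 : ∀ᶠ z : ((Fin r → ℝ) × (Fin m → ℝ)) × (Fin m → ℝ) in 𝓝 ((0, S.corner.1), 0),
      ∀ θ ∈ Icc (0 : ℝ) 1, layerState h z.2 (θ • z.1.1) z.1.2 ∈ S.G := by
    -- Compactness of the segment makes the neighbourhood uniform in `θ`.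
    refine isCompact_Icc.eventually_forall_of_forall_eventually fun θ _ => ?_
    have h2 := continuousAt_layerState hI hII
      (x := ((((0, S.corner.1), 0), θ) : (((Fin r → ℝ) × (Fin m → ℝ)) × (Fin m → ℝ)) × ℝ))
      (μ := fun z => z.1.2) (ν := fun z => z.2 • z.1.1.1) (u := fun z => z.1.1.2)
      (by fun_prop) (by fun_prop) (by fun_prop) (zero_add _)
    refine h2.eventually ?_
    simp only [smul_zero]
    rw [layerState_base hI hII]
    exact S.isOpen_G.mem_nhds (corner_mem_equil hII).1
  have h2 : ∀ᶠ z : ((Fin r → ℝ) × (Fin m → ℝ)) × (Fin m → ℝ) in 𝓝 ((0, S.corner.1), 0),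
      S.q (layerState h z.2 0 z.1.2) = 0 := by
    have h3 : Tendsto (fun z : ((Fin r → ℝ) × (Fin m → ℝ)) × (Fin m → ℝ) => z.2 + z.1.2)
        (𝓝 ((0, S.corner.1), 0)) (𝓝 S.corner.1) := by
      have h4 : Continuous fun z : ((Fin r → ℝ) × (Fin m → ℝ)) × (Fin m → ℝ) => z.2 + z.1.2 := by
        fun_prop
      have h5 := h4.tendsto ((0, S.corner.1), 0)
      simpa using h5
    filter_upwards [h3.eventually (eventually_equil hI hII)] with z hz
    rw [layerState, zero_add]
    exact hz.2.2
  filter_upwards [h1, h2] with z h3 h4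
  have h5 : S.rhsCoef A₀ h z.2 z.1.1 z.1.2 =
      S.sourceCoef A₀ h (layerState h z.2 z.1.1 z.1.2) * S.hatS h z.2 z.1.1 z.1.2 := by
    rw [sourceCoef, Matrix.sub_mul]
    rfl
  rw [h5, ← Matrix.mulVec_mulVec, hatS_mulVec h3 h4, reducedSource]

/-- As `q` vanishes at the corner, only its derivative contributes, and along `(a, b + h' a)` this
is `q_v b`. The coefficient there is `A₀₂` because `A₀₁₂ = 0`. -/
theorem hasFDerivAt_reducedSource (hI : S.AssumptionI A₀ h) (hII : S.AssumptionII)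
    (hIII : S.AssumptionIII h n₀) {V : E → State m r} {D : E →L[ℝ] State m r} {x : E}
    {a : E →L[ℝ] (Fin m → ℝ)} {b : E →L[ℝ] (Fin r → ℝ)} (hV : HasFDerivAt V D x)
    (hx : V x = S.corner) (hD : ∀ y, D y = (a y, b y + fderiv ℝ h S.corner.1 (a y))) :
    HasFDerivAt (fun y => S.reducedSource A₀ h (V y)) (mvL (S.frozen A₀ h S.corner).S ∘L b) x := by
  have hst := (eventually_isSmoothState hI hII hIII).self_of_nhds
  have h1 := hst.sourceCoef.hasFDerivAt_mulVec_of_eq_zero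
    (hst.smooth_q.differentiableAt (by simp)).hasFDerivAt (corner_mem_equil hII).2
  have h2 := HasFDerivAt.comp x (g := S.reducedSource A₀ h) (by rw [hx]; exact h1) hV
  refine h2.congr_fderiv (ContinuousLinearMap.ext fun y => ?_)
  rw [ContinuousLinearMap.comp_apply, hD, ContinuousLinearMap.comp_apply, fderiv_q_corner hI hII,
    mvL_apply, sourceCoef, A012_corner hI hII, Matrix.mul_zero, sub_zero, Matrix.mulVec_mulVec]
  rfl

/-! ### The inner state as a function of `(ν, u∞)` -/

/-- The state `U_ν` with `μ = ψ₁(ν, u∞)`. -/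
def innerState (h : (Fin m → ℝ) → (Fin r → ℝ)) (ψ₁ : (Fin r → ℝ) × (Fin m → ℝ) → (Fin m → ℝ))
    (y : (Fin r → ℝ) × (Fin m → ℝ)) : State m r :=
  layerState h (ψ₁ y) y.1 y.2

section

variable {ψ₁ : (Fin r → ℝ) × (Fin m → ℝ) → (Fin m → ℝ)}

theorem innerState_base (hI : S.AssumptionI A₀ h) (hII : S.AssumptionII)
    (hψ : ψ₁ (0, S.corner.1) = 0) : innerState h ψ₁ (0, S.corner.1) = S.corner := by
  rw [innerState, hψ, layerState_base hI hII]

theorem tendsto_graph_psi1 (hψ : IsImplicitSolution (S.phi1 h) 0 (0, S.corner.1) ψ₁) :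
    Tendsto (fun y => (y, ψ₁ y)) (𝓝 (0, S.corner.1)) (𝓝 ((0, S.corner.1), 0)) := by
  have h1 := (continuousAt_id.prodMk hψ.continuousAt).tendsto
  simp only [id_eq, hψ.1] at h1
  exact h1

theorem tendsto_innerState (hI : S.AssumptionI A₀ h) (hII : S.AssumptionII)
    (hψ : IsImplicitSolution (S.phi1 h) 0 (0, S.corner.1) ψ₁) :
    Tendsto (innerState h ψ₁) (𝓝 (0, S.corner.1)) (𝓝 S.corner) :=
  (tendsto_layerState hI hII).comp (tendsto_graph_psi1 hψ)

theorem eventually_innerState (hI : S.AssumptionI A₀ h) (hII : S.AssumptionII)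
    (hIII : S.AssumptionIII h n₀) (hψ : IsImplicitSolution (S.phi1 h) 0 (0, S.corner.1) ψ₁) :
    ∀ᶠ y in 𝓝 ((0 : Fin r → ℝ), S.corner.1), ContDiffAt ℝ ∞ (innerState h ψ₁) y ∧
      S.IsSmoothState A₀ h (innerState h ψ₁ y) ∧
      S.rhsCoef A₀ h (ψ₁ y) y.1 y.2 *ᵥ y.1 = S.reducedSource A₀ h (innerState h ψ₁ y) := by
  filter_upwards [hψ.eventually_contDiffAt,
    (tendsto_innerState hI hII hψ).eventually (eventually_isSmoothState hI hII hIII),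
    (tendsto_graph_psi1 hψ).eventually (eventually_rhsCoef hI hII)] with y h1 h2 h3
  exact ⟨contDiffAt_layerState h1 contDiffAt_fst contDiffAt_snd h2.smooth_h, h2, h3⟩

theorem hasFDerivAt_innerState (hI : S.AssumptionI A₀ h) (hII : S.AssumptionII)
    (hψ : ψ₁ (0, S.corner.1) = 0) {D : (Fin r → ℝ) × (Fin m → ℝ) →L[ℝ] (Fin m → ℝ)}
    (hD : HasFDerivAt ψ₁ D (0, S.corner.1)) :
    HasFDerivAt (innerState h ψ₁)
      ((D + ContinuousLinearMap.snd ℝ _ _).prod (ContinuousLinearMap.fst ℝ _ _ +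
        fderiv ℝ h S.corner.1 ∘L (D + ContinuousLinearMap.snd ℝ _ _))) (0, S.corner.1) := by
  have h1 := hasFDerivAt_layerState (h := h) hD (hasFDerivAt_fst (𝕜 := ℝ)) (hasFDerivAt_snd (𝕜 := ℝ))
    (by
      rw [hψ, layerState_base hI hII]
      exact (eventually_equil hI hII).self_of_nhds.1.differentiableAt (by simp))
  rw [hψ, layerState_base hI hII] at h1
  exact h1

theorem hasFDerivAt_reducedSource_innerState (hI : S.AssumptionI A₀ h) (hII : S.AssumptionII)
    (hIII : S.AssumptionIII h n₀) (hψ : IsImplicitSolution (S.phi1 h) 0 (0, S.corner.1) ψ₁) :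
    HasFDerivAt (fun y => S.reducedSource A₀ h (innerState h ψ₁ y))
      (mvL (S.frozen A₀ h S.corner).S ∘L ContinuousLinearMap.fst ℝ _ _) (0, S.corner.1) := by
  have h1 := (hψ.eventually_contDiffAt.self_of_nhds.differentiableAt (by simp)).hasFDerivAt
  exact hasFDerivAt_reducedSource hI hII hIII (hasFDerivAt_innerState hI hII hψ.1 h1)
    (innerState_base hI hII hψ.1) fun y => rfl

theorem innerState_zero (hI : S.AssumptionI A₀ h) (hII : S.AssumptionII)
    (hψ : IsImplicitSolution (S.phi1 h) 0 (0, S.corner.1) ψ₁) :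
    ∀ᶠ u in 𝓝 S.corner.1, innerState h ψ₁ (0, u) = (u, h u) := by
  filter_upwards [psi1_zero hψ] with u hu
  rw [innerState, hu, layerState, zero_add, zero_add]

end

end RelaxationProblem


namespace RelaxationProblem

variable {m r p k n₀ : ℕ} {S : RelaxationProblem m r p}
  {A₀ : State m r → Matrix (Fin m ⊕ Fin r) (Fin m ⊕ Fin r) ℝ} {h : (Fin m → ℝ) → (Fin r → ℝ)}
  {P₂ : Matrix (Fin r) (Fin k) ℝ} {P₀ : Matrix (Fin r) (Fin n₀) ℝ}
  {Q₂ : State m r → Matrix (Fin r) (Fin k) ℝ} {Q₀ : State m r → Matrix (Fin r) (Fin n₀) ℝ}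
  {ψ₁ : (Fin r → ℝ) × (Fin m → ℝ) → (Fin m → ℝ)}
  {ψ₂ : (Fin k → ℝ) × (Fin m → ℝ) → (Fin n₀ → ℝ)}

/-! ### The kernel component of the fast variable -/

/-- The properties of a local frame at a single state. -/
theorem IsLocalFrame.eventually (hQ : S.IsLocalFrame A₀ h P₂ P₀ Q₂ Q₀) :
    ∀ᶠ U in 𝓝 S.corner, SmAt Q₂ U ∧ SmAt Q₀ U ∧ (Q₀ U)ᵀ * (S.frozen A₀ h U).schur = 0 := by
  obtain ⟨-, -, O, hO, hc, -, h2, h0, h⟩ := hQ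
  filter_upwards [hO.mem_nhds hc] with U hU
  exact ⟨fun i j => (h2 i j).contDiffAt (hO.mem_nhds hU),
    fun i j => (h0 i j).contDiffAt (hO.mem_nhds hU), (h U hU).2.1⟩

theorem isUnit_S00 (hI : S.AssumptionI A₀ h) (hII : S.AssumptionII)
    (hP : (S.frozen A₀ h S.corner).IsSpectralFrame P₂ P₀) :
    IsUnit (P₀ᵀ * (S.frozen A₀ h S.corner).S * P₀) := by
  have h1 : (P₀ᵀ * (-(S.frozen A₀ h S.corner).S) * P₀).PosDef :=
    PosDef.congr (S_corner_negDef hI hII) fun x hx => by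
      rw [← Matrix.one_mulVec x, ← hP.orth₀, ← Matrix.mulVec_mulVec, hx, Matrix.mulVec_zero]
  have h2 := h1.isUnit.neg
  rwa [Matrix.mul_neg, Matrix.neg_mul, neg_neg] at h2

/-- Near the base point the equation is `Q₀ᵀ` applied to the reduced source. Its derivative in `w₀`
is `P₀ᵀ S P₀`, invertible since `S` is negative definite. -/
theorem exists_psi2 (hI : S.AssumptionI A₀ h) (hII : S.AssumptionII) (hIII : S.AssumptionIII h n₀)
    (hP : (S.frozen A₀ h S.corner).IsSpectralFrame P₂ P₀)
    (hψ : IsImplicitSolution (S.phi1 h) 0 (0, S.corner.1) ψ₁)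
    (hQ : S.IsLocalFrame A₀ h P₂ P₀ Q₂ Q₀) :
    ∃ ψ₂ : (Fin k → ℝ) × (Fin m → ℝ) → (Fin n₀ → ℝ),
      IsImplicitSolution (S.phi2 A₀ h P₂ P₀ Q₀ ψ₁) 0 (0, S.corner.1) ψ₂ ∧
      HasFDerivAt ψ₂ (-(mvL ((P₀ᵀ * (S.frozen A₀ h S.corner).S * P₀)⁻¹ *
        (P₀ᵀ * (S.frozen A₀ h S.corner).S * P₂)) ∘L
        ContinuousLinearMap.fst ℝ (Fin k → ℝ) (Fin m → ℝ))) (0, S.corner.1) := by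
  have hu := (Matrix.isUnit_iff_isUnit_det _).1 (isUnit_S00 hI hII hP)
  obtain ⟨e, he, he'⟩ := exists_equiv_mulVec (Matrix.mul_nonsing_inv _ hu)
    (Matrix.nonsing_inv_mul _ hu)
  set Y : ((Fin k → ℝ) × (Fin m → ℝ)) × (Fin n₀ → ℝ) →L[ℝ] (Fin r → ℝ) × (Fin m → ℝ) :=
    (mvL P₂ ∘L ContinuousLinearMap.fst ℝ _ _ ∘L ContinuousLinearMap.fst ℝ _ _ +
      mvL P₀ ∘L ContinuousLinearMap.snd ℝ _ _).prod
      (ContinuousLinearMap.snd ℝ _ _ ∘L ContinuousLinearMap.fst ℝ _ _) with hY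
  have hY0 : Y ((0, S.corner.1), 0) = (0, S.corner.1) := by simp [hY]
  have hYt : Tendsto Y (𝓝 ((0, S.corner.1), 0)) (𝓝 (0, S.corner.1)) := by
    have h1 := Y.continuous.tendsto ((0, S.corner.1), 0)
    rwa [hY0] at h1
  have hin := hYt.eventually (eventually_innerState hI hII hIII hψ)
  have hQin := ((tendsto_innerState hI hII hψ).comp hYt).eventually hQ.eventually
  have heq : ∀ᶠ z in 𝓝 (((0, S.corner.1), 0) : ((Fin k → ℝ) × (Fin m → ℝ)) × (Fin n₀ → ℝ)),
      S.phi2 A₀ h P₂ P₀ Q₀ ψ₁ z.2 z.1 =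
        (Q₀ (innerState h ψ₁ (Y z)))ᵀ *ᵥ S.reducedSource A₀ h (innerState h ψ₁ (Y z)) := by
    filter_upwards [hin] with z hz
    rw [← hz.2.2, Matrix.mulVec_mulVec]
    rfl
  have hsmq : ∀ᶠ z in 𝓝 (((0, S.corner.1), 0) : ((Fin k → ℝ) × (Fin m → ℝ)) × (Fin n₀ → ℝ)),
      SmAt (fun z => (Q₀ (innerState h ψ₁ (Y z)))ᵀ) z := by
    filter_upwards [hin, hQin] with z h1 h2
    have h3 : ContDiffAt ℝ ∞ (fun z => innerState h ψ₁ (Y z)) z :=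
      ContDiffAt.comp z h1.1 Y.contDiff.contDiffAt
    exact (SmAt.comp (g := fun z => innerState h ψ₁ (Y z)) h2.2.1 h3).transpose
  have hsm : ∀ᶠ z in 𝓝 (((0, S.corner.1), 0) : ((Fin k → ℝ) × (Fin m → ℝ)) × (Fin n₀ → ℝ)),
      ContDiffAt ℝ ∞ (fun z : ((Fin k → ℝ) × (Fin m → ℝ)) × (Fin n₀ → ℝ) =>
        S.phi2 A₀ h P₂ P₀ Q₀ ψ₁ z.2 z.1) z := by
    filter_upwards [heq.eventually_nhds, hin, hsmq] with z h1 h2 h3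
    have h4 : ContDiffAt ℝ ∞ (fun z => innerState h ψ₁ (Y z)) z :=
      ContDiffAt.comp z h2.1 Y.contDiff.contDiffAt
    refine ContDiffAt.congr_of_eventuallyEq ?_ h1
    exact h3.mulVec (ContDiffAt.comp z (g := S.reducedSource A₀ h) h2.2.1.reducedSource h4)
  have hD : HasFDerivAt (fun z : ((Fin k → ℝ) × (Fin m → ℝ)) × (Fin n₀ → ℝ) =>
        S.phi2 A₀ h P₂ P₀ Q₀ ψ₁ z.2 z.1)
      ((mvL (P₀ᵀ * (S.frozen A₀ h S.corner).S * P₂) ∘L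
        ContinuousLinearMap.fst ℝ (Fin k → ℝ) (Fin m → ℝ)).coprod
        (e : (Fin n₀ → ℝ) →L[ℝ] (Fin n₀ → ℝ))) ((0, S.corner.1), 0) := by
    have h1 := HasFDerivAt.comp (((0, S.corner.1), 0) : ((Fin k → ℝ) × (Fin m → ℝ)) × (Fin n₀ → ℝ))
      (by rw [hY0]; exact hasFDerivAt_reducedSource_innerState hI hII hIII hψ) Y.hasFDerivAt
    have h2 := hsmq.self_of_nhds.hasFDerivAt_mulVec_of_eq_zero h1 (by
      rw [Function.comp_apply, hY0, innerState_base hI hII hψ.1, reducedSource,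
        (corner_mem_equil hII).2, Matrix.mulVec_zero])
    refine (h2.congr_of_eventuallyEq heq).congr_fderiv (ContinuousLinearMap.ext fun y => ?_)
    obtain ⟨⟨a, b⟩, c⟩ := y
    rw [hY0, innerState_base hI hII hψ.1, hQ.2.1, he]
    show P₀ᵀ *ᵥ ((S.frozen A₀ h S.corner).S *ᵥ (P₂ *ᵥ a + P₀ *ᵥ c)) =
      (P₀ᵀ * (S.frozen A₀ h S.corner).S * P₂) *ᵥ a + (P₀ᵀ * (S.frozen A₀ h S.corner).S * P₀) *ᵥ c
    simp only [Matrix.mulVec_add, Matrix.mulVec_mulVec, Matrix.mul_assoc]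
  obtain ⟨ψ, h1, h2⟩ := exists_isImplicitSolution hsm (by
    simp [phi2]) hD
  refine ⟨ψ, h1, h2.congr_fderiv ?_⟩
  rw [he']
  refine ContinuousLinearMap.ext fun y => ?_
  show -((P₀ᵀ * (S.frozen A₀ h S.corner).S * P₀)⁻¹ *ᵥ
      ((P₀ᵀ * (S.frozen A₀ h S.corner).S * P₂) *ᵥ y.1)) =
    -(((P₀ᵀ * (S.frozen A₀ h S.corner).S * P₀)⁻¹ * (P₀ᵀ * (S.frozen A₀ h S.corner).S * P₂)) *ᵥ y.1)
  rw [Matrix.mulVec_mulVec]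

theorem psi2_zero (hψ₂ : IsImplicitSolution (S.phi2 A₀ h P₂ P₀ Q₀ ψ₁) 0 (0, S.corner.1) ψ₂) :
    ∀ᶠ u in 𝓝 S.corner.1, ψ₂ (0, u) = 0 := by
  have h1 : Tendsto (fun u : Fin m → ℝ => (((0 : Fin k → ℝ), u), (0 : Fin n₀ → ℝ))) (𝓝 S.corner.1)
      (𝓝 ((0, S.corner.1), 0)) := by
    have : Continuous fun u : Fin m → ℝ => (((0 : Fin k → ℝ), u), (0 : Fin n₀ → ℝ)) := by fun_prop
    exact this.tendsto _
  filter_upwards [h1.eventually hψ₂.eventually_iff] with u hu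
  exact (hu.1 (by simp [phi2])).symm

/-! ### The reduced vector field -/

/-- The argument `(ν, u∞)` of the inner state. -/
def nuPair (P₂ : Matrix (Fin r) (Fin k) ℝ) (P₀ : Matrix (Fin r) (Fin n₀) ℝ)
    (ψ₂ : (Fin k → ℝ) × (Fin m → ℝ) → (Fin n₀ → ℝ)) (x : (Fin k → ℝ) × (Fin m → ℝ)) :
    (Fin r → ℝ) × (Fin m → ℝ) := (nuOf P₂ P₀ ψ₂ x, x.2)

theorem profileState_eq (x : (Fin k → ℝ) × (Fin m → ℝ)) :
    profileState h P₂ P₀ ψ₁ ψ₂ x = innerState h ψ₁ (nuPair P₂ P₀ ψ₂ x) := rfl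

theorem nuPair_zero {u : Fin m → ℝ} (hu : ψ₂ (0, u) = 0) : nuPair P₂ P₀ ψ₂ (0, u) = (0, u) := by
  rw [nuPair, nuOf, hu, Matrix.mulVec_zero, Matrix.mulVec_zero, add_zero]

theorem contDiffAt_nuPair {x : (Fin k → ℝ) × (Fin m → ℝ)} (hψ₂ : ContDiffAt ℝ ∞ ψ₂ x) :
    ContDiffAt ℝ ∞ (nuPair P₂ P₀ ψ₂) x :=
  (((smAt_const P₂).mulVec contDiffAt_fst).add ((smAt_const P₀).mulVec hψ₂)).prodMk contDiffAt_snd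

theorem tendsto_nuPair (hψ₂ : IsImplicitSolution (S.phi2 A₀ h P₂ P₀ Q₀ ψ₁) 0 (0, S.corner.1) ψ₂) :
    Tendsto (nuPair P₂ P₀ ψ₂) (𝓝 (0, S.corner.1)) (𝓝 (0, S.corner.1)) := by
  have h1 := (contDiffAt_nuPair (P₂ := P₂) (P₀ := P₀)
    hψ₂.eventually_contDiffAt.self_of_nhds).continuousAt.tendsto
  rwa [nuPair_zero hψ₂.1] at h1

theorem tendsto_profileState (hI : S.AssumptionI A₀ h) (hII : S.AssumptionII)
    (hψ : IsImplicitSolution (S.phi1 h) 0 (0, S.corner.1) ψ₁)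
    (hψ₂ : IsImplicitSolution (S.phi2 A₀ h P₂ P₀ Q₀ ψ₁) 0 (0, S.corner.1) ψ₂) :
    Tendsto (profileState h P₂ P₀ ψ₁ ψ₂) (𝓝 (0, S.corner.1)) (𝓝 S.corner) :=
  (tendsto_innerState hI hII hψ).comp (tendsto_nuPair hψ₂)

theorem hasFDerivAt_nuPair {D : (Fin k → ℝ) × (Fin m → ℝ) →L[ℝ] (Fin n₀ → ℝ)}
    {x : (Fin k → ℝ) × (Fin m → ℝ)} (hD : HasFDerivAt ψ₂ D x) :
    HasFDerivAt (nuPair P₂ P₀ ψ₂)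
      ((mvL P₂ ∘L ContinuousLinearMap.fst ℝ _ _ + mvL P₀ ∘L D).prod
        (ContinuousLinearMap.snd ℝ _ _)) x :=
  (((mvL P₂ ∘L ContinuousLinearMap.fst ℝ _ _).hasFDerivAt).add
    ((mvL P₀).hasFDerivAt.comp x hD)).prodMk hasFDerivAt_snd

/-- The derivative of `ν` in `w₂` is `lift` at `ξ = 0`; this links the nonlinear reduction to the
limit of the resolvent problem. -/
theorem nuPair_deriv_eq (a : Fin k → ℝ) :
    P₂ *ᵥ a + P₀ *ᵥ -(((P₀ᵀ * (S.frozen A₀ h S.corner).S * P₀)⁻¹ *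
      (P₀ᵀ * (S.frozen A₀ h S.corner).S * P₂)) *ᵥ a) =
      (S.frozen A₀ h S.corner).lift P₂ P₀ 0 *ᵥ a := by
  rw [LinearProblem.lift, LinearProblem.damping₀₀Inv, LinearProblem.damping, zero_smul, zero_sub,
    Matrix.mul_neg, Matrix.neg_mul, Matrix.neg_mul, LinearProblem.inv_neg_matrix, Matrix.mul_neg, Matrix.mul_neg,
    Matrix.neg_mul, neg_neg, Matrix.sub_mulVec, Matrix.mulVec_neg, Matrix.mulVec_mulVec,
    ← Matrix.mul_assoc, ← sub_eq_add_neg]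

/-- Regularity of the reduced equations at the point `x`. -/
structure IsRegularPoint (S : RelaxationProblem m r p)
    (A₀ : State m r → Matrix (Fin m ⊕ Fin r) (Fin m ⊕ Fin r) ℝ)
    (h : (Fin m → ℝ) → (Fin r → ℝ))
    (P₂ : Matrix (Fin r) (Fin k) ℝ) (P₀ : Matrix (Fin r) (Fin n₀) ℝ)
    (ψ₁ : (Fin r → ℝ) × (Fin m → ℝ) → (Fin m → ℝ))
    (ψ₂ : (Fin k → ℝ) × (Fin m → ℝ) → (Fin n₀ → ℝ)) (x : (Fin k → ℝ) × (Fin m → ℝ)) : Prop where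
  smooth_psi2 : ContDiffAt ℝ ∞ ψ₂ x
  smooth_inner : ContDiffAt ℝ ∞ (innerState h ψ₁) (nuPair P₂ P₀ ψ₂ x)
  state : S.IsSmoothState A₀ h (profileState h P₂ P₀ ψ₁ ψ₂ x)
  rhs_eq : S.rhsCoef A₀ h (ψ₁ (nuPair P₂ P₀ ψ₂ x)) (nuOf P₂ P₀ ψ₂ x) x.2 *ᵥ nuOf P₂ P₀ ψ₂ x =
    S.reducedSource A₀ h (profileState h P₂ P₀ ψ₁ ψ₂ x)

theorem IsRegularPoint.smooth_profile {x : (Fin k → ℝ) × (Fin m → ℝ)}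
    (hx : S.IsRegularPoint A₀ h P₂ P₀ ψ₁ ψ₂ x) :
    ContDiffAt ℝ ∞ (profileState h P₂ P₀ ψ₁ ψ₂) x :=
  ContDiffAt.comp x hx.smooth_inner (contDiffAt_nuPair hx.smooth_psi2)

theorem IsRegularPoint.smooth_Kmat {x : (Fin k → ℝ) × (Fin m → ℝ)}
    (hx : S.IsRegularPoint A₀ h P₂ P₀ ψ₁ ψ₂ x) : SmAt (S.Kmat A₀ h P₂ P₀ ψ₁ ψ₂) x :=
  ((smAt_const _).mul (SmAt.comp (g := profileState h P₂ P₀ ψ₁ ψ₂) hx.state.schur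
    hx.smooth_profile)).mul ((smAt_const _).add ((smAt_const _).mul (smAt_jac₁ hx.smooth_psi2)))

theorem IsRegularPoint.Hfield_eq {x : (Fin k → ℝ) × (Fin m → ℝ)}
    (hx : S.IsRegularPoint A₀ h P₂ P₀ ψ₁ ψ₂ x) :
    S.Hfield A₀ h P₂ P₀ ψ₁ ψ₂ x = ((S.Kmat A₀ h P₂ P₀ ψ₁ ψ₂ x)⁻¹ * P₂ᵀ) *ᵥ
      S.reducedSource A₀ h (profileState h P₂ P₀ ψ₁ ψ₂ x) := by
  rw [← hx.rhs_eq, Matrix.mulVec_mulVec]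
  rfl

theorem eventually_isRegularPoint (hI : S.AssumptionI A₀ h) (hII : S.AssumptionII)
    (hIII : S.AssumptionIII h n₀) (hψ : IsImplicitSolution (S.phi1 h) 0 (0, S.corner.1) ψ₁)
    (hψ₂ : IsImplicitSolution (S.phi2 A₀ h P₂ P₀ Q₀ ψ₁) 0 (0, S.corner.1) ψ₂) :
    ∀ᶠ x in 𝓝 ((0 : Fin k → ℝ), S.corner.1), S.IsRegularPoint A₀ h P₂ P₀ ψ₁ ψ₂ x := by
  filter_upwards [hψ₂.eventually_contDiffAt,
    (tendsto_nuPair hψ₂).eventually (eventually_innerState hI hII hIII hψ)] with x h1 h2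
  exact ⟨h1, h2.1, h2.2.1, h2.2.2⟩

theorem profileState_base (hI : S.AssumptionI A₀ h) (hII : S.AssumptionII)
    (hψ : ψ₁ (0, S.corner.1) = 0) (hψ₂ : ψ₂ (0, S.corner.1) = 0) :
    profileState h P₂ P₀ ψ₁ ψ₂ (0, S.corner.1) = S.corner := by
  rw [profileState_eq, nuPair_zero hψ₂, innerState_base hI hII hψ]

theorem profileState_zero (hI : S.AssumptionI A₀ h) (hII : S.AssumptionII)
    (hψ : IsImplicitSolution (S.phi1 h) 0 (0, S.corner.1) ψ₁)
    (hψ₂ : IsImplicitSolution (S.phi2 A₀ h P₂ P₀ Q₀ ψ₁) 0 (0, S.corner.1) ψ₂) :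
    ∀ᶠ u in 𝓝 S.corner.1, profileState h P₂ P₀ ψ₁ ψ₂ (0, u) = (u, h u) := by
  filter_upwards [psi2_zero hψ₂, innerState_zero hI hII hψ] with u h1 h2
  rw [profileState_eq, nuPair_zero h1, h2]

/-- The derivative of `ψ₂` drops out because `Σ P₀ = 0` at the corner. -/
theorem Kmat_base (hI : S.AssumptionI A₀ h) (hII : S.AssumptionII)
    (hP : (S.frozen A₀ h S.corner).IsSpectralFrame P₂ P₀)
    (hψ : ψ₁ (0, S.corner.1) = 0) (hψ₂ : ψ₂ (0, S.corner.1) = 0) :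
    S.Kmat A₀ h P₂ P₀ ψ₁ ψ₂ (0, S.corner.1) = (S.frozen A₀ h S.corner).Lam2 P₂ := by
  rw [Kmat, profileState_base hI hII hψ hψ₂, Matrix.mul_add, Matrix.mul_assoc P₂ᵀ _ (P₀ * _),
    ← Matrix.mul_assoc _ P₀, hP.kernel, Matrix.zero_mul, Matrix.mul_zero, add_zero,
    LinearProblem.Lam2]

theorem eventually_isUnit_Kmat (hI : S.AssumptionI A₀ h) (hII : S.AssumptionII)
    (hIII : S.AssumptionIII h n₀) (hP : (S.frozen A₀ h S.corner).IsSpectralFrame P₂ P₀)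
    (hψ : IsImplicitSolution (S.phi1 h) 0 (0, S.corner.1) ψ₁)
    (hψ₂ : IsImplicitSolution (S.phi2 A₀ h P₂ P₀ Q₀ ψ₁) 0 (0, S.corner.1) ψ₂) :
    ∀ᶠ x in 𝓝 ((0 : Fin k → ℝ), S.corner.1), IsUnit (S.Kmat A₀ h P₂ P₀ ψ₁ ψ₂ x) := by
  refine eventually_isUnit
    (eventually_isRegularPoint hI hII hIII hψ hψ₂).self_of_nhds.smooth_Kmat.continuousAt ?_
  rw [Kmat_base hI hII hP hψ.1 hψ₂.1]
  exact LinearProblem.isUnit_Lam2 hP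

theorem eventually_contDiffAt_Hfield (hI : S.AssumptionI A₀ h) (hII : S.AssumptionII)
    (hIII : S.AssumptionIII h n₀) (hP : (S.frozen A₀ h S.corner).IsSpectralFrame P₂ P₀)
    (hψ : IsImplicitSolution (S.phi1 h) 0 (0, S.corner.1) ψ₁)
    (hψ₂ : IsImplicitSolution (S.phi2 A₀ h P₂ P₀ Q₀ ψ₁) 0 (0, S.corner.1) ψ₂) :
    ∀ᶠ x in 𝓝 ((0 : Fin k → ℝ), S.corner.1), ContDiffAt ℝ ∞ (S.Hfield A₀ h P₂ P₀ ψ₁ ψ₂) x := by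
  have h0 := eventually_isRegularPoint hI hII hIII hψ hψ₂
  filter_upwards [h0, h0.eventually_nhds, eventually_isUnit_Kmat hI hII hIII hP hψ hψ₂]
    with x h1 h2 h3
  refine ContDiffAt.congr_of_eventuallyEq ?_ (h2.mono fun y hy => hy.Hfield_eq)
  exact ((h1.smooth_Kmat.inv h3).mul (smAt_const _)).mulVec
    (ContDiffAt.comp x h1.state.reducedSource h1.smooth_profile)

theorem Hfield_zero (hψ₂ : IsImplicitSolution (S.phi2 A₀ h P₂ P₀ Q₀ ψ₁) 0 (0, S.corner.1) ψ₂) :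
    ∀ᶠ u in 𝓝 S.corner.1, S.Hfield A₀ h P₂ P₀ ψ₁ ψ₂ (0, u) = 0 := by
  filter_upwards [psi2_zero hψ₂] with u hu
  have h1 : nuOf P₂ P₀ ψ₂ (0, u) = 0 := congrArg Prod.fst (nuPair_zero (P₂ := P₂) (P₀ := P₀) hu)
  simp only [Hfield, h1, Matrix.mulVec_zero]

theorem hasFDerivAt_profileState (hI : S.AssumptionI A₀ h) (hII : S.AssumptionII)
    (hψ : ψ₁ (0, S.corner.1) = 0) (hψ₂ : ψ₂ (0, S.corner.1) = 0)
    (hD₁ : HasFDerivAt ψ₁ (-(mvL ((S.fuh h S.corner)⁻¹ * jac₂ S.f S.corner) ∘L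
        ContinuousLinearMap.fst ℝ (Fin r → ℝ) (Fin m → ℝ))) (0, S.corner.1))
    (hD₂ : HasFDerivAt ψ₂ (-(mvL ((P₀ᵀ * (S.frozen A₀ h S.corner).S * P₀)⁻¹ *
        (P₀ᵀ * (S.frozen A₀ h S.corner).S * P₂)) ∘L
        ContinuousLinearMap.fst ℝ (Fin k → ℝ) (Fin m → ℝ))) (0, S.corner.1)) :
    ∃ D : (Fin k → ℝ) × (Fin m → ℝ) →L[ℝ] State m r, HasFDerivAt (profileState h P₂ P₀ ψ₁ ψ₂) D (0, S.corner.1) ∧ ∀ a b,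
      D (a, b) = (b - (S.fuh h S.corner)⁻¹ *ᵥ (jac₂ S.f S.corner *ᵥ
          ((S.frozen A₀ h S.corner).lift P₂ P₀ 0 *ᵥ a)),
        (S.frozen A₀ h S.corner).lift P₂ P₀ 0 *ᵥ a + fderiv ℝ h S.corner.1
          (b - (S.fuh h S.corner)⁻¹ *ᵥ (jac₂ S.f S.corner *ᵥ
            ((S.frozen A₀ h S.corner).lift P₂ P₀ 0 *ᵥ a)))) := by
  have h1 := hasFDerivAt_innerState hI hII hψ hD₁
  have h2 := hasFDerivAt_nuPair (P₂ := P₂) (P₀ := P₀) hD₂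
  rw [← nuPair_zero (P₂ := P₂) (P₀ := P₀) hψ₂] at h1
  refine ⟨_, HasFDerivAt.comp (0, S.corner.1) (g := innerState h ψ₁) h1 h2, fun a b => ?_⟩
  have h3 : ∀ v, (S.fuh h S.corner)⁻¹ *ᵥ (jac₂ S.f S.corner *ᵥ v) =
    ((S.fuh h S.corner)⁻¹ * jac₂ S.f S.corner) *ᵥ v := fun v => Matrix.mulVec_mulVec _ _ _
  rw [h3, ← nuPair_deriv_eq (S := S) (A₀ := A₀) (h := h) a, sub_eq_neg_add]
  rfl

/-- The reduced source vanishes at the base point, so only its derivative `S * lift` counts, and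
`P₂ᵀ * S * lift` is `G₂`. -/
theorem jac₁_Hfield (hI : S.AssumptionI A₀ h) (hII : S.AssumptionII)
    (hIII : S.AssumptionIII h n₀) (hP : (S.frozen A₀ h S.corner).IsSpectralFrame P₂ P₀)
    (hψ : IsImplicitSolution (S.phi1 h) 0 (0, S.corner.1) ψ₁)
    (hψ₂ : IsImplicitSolution (S.phi2 A₀ h P₂ P₀ Q₀ ψ₁) 0 (0, S.corner.1) ψ₂)
    (hD₁ : HasFDerivAt ψ₁ (-(mvL ((S.fuh h S.corner)⁻¹ * jac₂ S.f S.corner) ∘L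
        ContinuousLinearMap.fst ℝ (Fin r → ℝ) (Fin m → ℝ))) (0, S.corner.1))
    (hD₂ : HasFDerivAt ψ₂ (-(mvL ((P₀ᵀ * (S.frozen A₀ h S.corner).S * P₀)⁻¹ *
        (P₀ᵀ * (S.frozen A₀ h S.corner).S * P₂)) ∘L
        ContinuousLinearMap.fst ℝ (Fin k → ℝ) (Fin m → ℝ))) (0, S.corner.1)) :
    jac₁ (S.Hfield A₀ h P₂ P₀ ψ₁ ψ₂) (0, S.corner.1) =
      ((S.frozen A₀ h S.corner).Lam2 P₂)⁻¹ * (S.frozen A₀ h S.corner).G2 P₂ P₀ := by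
  have h0 := eventually_isRegularPoint hI hII hIII hψ hψ₂
  have hb := h0.self_of_nhds
  have hK := (eventually_isUnit_Kmat hI hII hIII hP hψ hψ₂).self_of_nhds
  obtain ⟨D, hD, hDv⟩ := hasFDerivAt_profileState hI hII hψ.1 hψ₂.1 hD₁ hD₂
  have h1 := hasFDerivAt_reducedSource hI hII hIII
    (a := ContinuousLinearMap.fst ℝ (Fin m → ℝ) (Fin r → ℝ) ∘L D)
    (b := mvL ((S.frozen A₀ h S.corner).lift P₂ P₀ 0) ∘L ContinuousLinearMap.fst ℝ _ _) hD
    (profileState_base hI hII hψ.1 hψ₂.1) fun y => by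
      rw [ContinuousLinearMap.comp_apply, hDv y.1 y.2]
      rfl
  have h2 := ((hb.smooth_Kmat.inv hK).mul (smAt_const P₂ᵀ)).hasFDerivAt_mulVec_of_eq_zero h1 (by
    rw [profileState_base hI hII hψ.1 hψ₂.1, reducedSource, (corner_mem_equil hII).2,
      Matrix.mulVec_zero])
  refine HasFDerivAt.jac₁_eq (h2.congr_of_eventuallyEq (h0.mono fun x hx => hx.Hfield_eq))
    fun v => ?_
  rw [Kmat_base hI hII hP hψ.1 hψ₂.1, LinearProblem.G2_eq, LinearProblem.liftedDamping,
    LinearProblem.damping, zero_smul, zero_sub]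
  show (((S.frozen A₀ h S.corner).Lam2 P₂)⁻¹ * P₂ᵀ) *ᵥ ((S.frozen A₀ h S.corner).S *ᵥ
    ((S.frozen A₀ h S.corner).lift P₂ P₀ 0 *ᵥ v)) = _
  simp only [Matrix.mulVec_mulVec, Matrix.mul_assoc, Matrix.mul_neg, Matrix.neg_mul, neg_neg]

end RelaxationProblem


/-! ### Spectral properties of the limiting systems -/

namespace LinearProblem

variable {m r p k n₀ : ℕ} {L : LinearProblem m r p}
  {P₂ : Matrix (Fin r) (Fin k) ℝ} {P₀ : Matrix (Fin r) (Fin n₀) ℝ}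

/-- The reduced linear system is diagonalizable over the reals, and its negative eigenvalues
correspond to the positive eigenvalues of `Λ₂`. -/
theorem exists_diag_reduced (hL : L.IsRegular) (hP : L.IsSpectralFrame P₂ P₀) :
    ∃ (X : Matrix (Fin k) (Fin k) ℝ) (e : Fin k → ℝ), IsUnit X ∧ (∀ i, e i ≠ 0) ∧
      ((L.Lam2 P₂)⁻¹ * L.G2 P₂ P₀) * X = X * Matrix.diagonal e ∧
      Fintype.card {i // e i < 0} = numPosEig (L.Lam2 P₂) := by
  have hu := (Matrix.isUnit_iff_isUnit_det _).1 (isUnit_Lam2 hP)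
  obtain ⟨c, -, hQ⟩ := liftedDamping_ge hL hP
  have hs : IsSymmetrizedBy ((L.Lam2 P₂)⁻¹ * L.G2 P₂ P₀) (L.Lam2 P₂) (L.liftedDamping P₂ P₀ 0) :=
    ⟨Lam2_transpose hP, isUnit_Lam2 hP, (hQ 0 le_rfl).1, by
      rw [Matrix.mul_nonsing_inv_cancel_left _ _ hu, G2_eq]⟩
  obtain ⟨X, d, hX, hd, -, hA, hM⟩ := hs.exists_diag
  have hX' := (Matrix.isUnit_iff_isUnit_det _).1 hX
  refine ⟨X, fun i => -(d i)⁻¹, hX, fun i => neg_ne_zero.2 (inv_ne_zero (hd i)), hM, ?_⟩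
  rw [numPosEig_of_congr hs.symm (Matrix.nonsing_inv_mul _ hX') (Matrix.mul_nonsing_inv _ hX') hA]
  exact Fintype.card_congr (Equiv.subtypeEquivRight fun i => by simp)

end LinearProblem

theorem card_pos_add_card_neg {ι : Type*} [Fintype ι] {e : ι → ℝ} (he : ∀ i, e i ≠ 0) :
    Fintype.card {i // 0 < e i} + Fintype.card {i // e i < 0} = Fintype.card ι := by
  classical
  simp only [Fintype.card_subtype]
  rw [← Finset.card_univ, ← Finset.card_union_of_disjoint]
  · congr 1
    ext i
    simp only [Finset.mem_union, Finset.mem_filter, Finset.mem_univ, true_and, iff_true]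
    exact (he i).lt_or_gt.symm
  · rw [Finset.disjoint_left]
    intro i
    simp only [Finset.mem_filter, Finset.mem_univ, true_and]
    exact fun h h' => lt_asymm h h'

section RightUnstable

variable {ι κ : Type*} [Fintype ι] [DecidableEq ι] [Fintype κ] [DecidableEq κ]

theorem IsRightUnstable.eq_zero {A : Matrix ι ι ℂ} {R : Matrix ι κ ℝ}
    (hR : IsRightUnstable A (toC R)) {α : κ → ℝ} (h : R *ᵥ α = 0) : α = 0 := by
  have h1 := Matrix.mulVec_injective_iff.2 hR.1
  have h2 : toC R *ᵥ (fun j => (α j : ℂ)) = toC R *ᵥ 0 := by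
    rw [toC_mulVec_ofReal, h, Matrix.mulVec_zero]
    ext i
    simp
  ext j
  exact Complex.ofReal_injective (by simpa using congrFun (h1 h2) j)

/-- The unstable subspace of a matrix which is symmetric in the inner product given by a positive
definite matrix is spanned by eigenvectors of its inverse. -/
theorem IsRightUnstable.mem_span {A Q F : Matrix ι ι ℝ} {R : Matrix ι κ ℝ} (hA : Aᵀ = A)
    (hu : IsUnit A) (hQ : Q.PosDef) (hF : A = Q * F) (hR : IsRightUnstable (toC F) (toC R))
    (α : κ → ℝ) :
    R *ᵥ α ∈ Submodule.span ℝ {x | ∃ σ : ℝ, 0 < σ ∧ (A⁻¹ * Q) *ᵥ x = σ • x} := by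
  obtain ⟨X, d, hX, hXQ, hXA⟩ := exists_simultaneous_diagonalization hA hQ
  have hXt := (Matrix.isUnit_transpose _).2 hX
  have hd : ∀ i, d i ≠ 0 := by
    have h1 : IsUnit (Matrix.diagonal d) := by
      rw [← hXA]
      exact (hXt.mul hu).mul hX
    rw [Matrix.isUnit_iff_isUnit_det, Matrix.det_diagonal, isUnit_iff_ne_zero,
      Finset.prod_ne_zero_iff] at h1
    exact fun i => h1 i (Finset.mem_univ _)
  have hFX : F * X = X * Matrix.diagonal d := by
    refine (hXt.mul hQ.isUnit).mul_left_cancel ?_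
    rw [← Matrix.mul_assoc, Matrix.mul_assoc Xᵀ, ← hF, hXA, ← Matrix.mul_assoc, hXQ, Matrix.one_mul]
  -- `F` and `A⁻¹ Q` share the eigenvectors `X` with reciprocal eigenvalues, so the signs agree.
  have hGX : (A⁻¹ * Q) * X = X * Matrix.diagonal fun i => (d i)⁻¹ := by
    refine (hXt.mul hu).mul_left_cancel ?_
    have hu' := (Matrix.isUnit_iff_isUnit_det _).1 hu
    calc Xᵀ * A * (A⁻¹ * Q * X) = Xᵀ * (A * (A⁻¹ * (Q * X))) := by simp only [Matrix.mul_assoc]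
      _ = 1 := by rw [Matrix.mul_nonsing_inv_cancel_left _ _ hu', ← Matrix.mul_assoc, hXQ]
      _ = Xᵀ * A * X * Matrix.diagonal fun i => (d i)⁻¹ := by
        rw [hXA, Matrix.diagonal_mul_diagonal, ← Matrix.diagonal_one]
        congr 1
        ext i
        simp [hd i]
      _ = _ := by rw [Matrix.mul_assoc]
  refine mem_span_eigenvectors hX hGX (P := fun σ => 0 < σ) fun i hi => ?_
  have h1 : (fun i => ((R *ᵥ α) i : ℂ)) ∈
      ⨆ z ∈ {z : ℂ | 0 < z.re}, Module.End.maxGenEigenspace (Matrix.toLin' (toC F)) z := by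
    rw [← hR.2, span_columns]
    exact ⟨fun j => (α j : ℂ), toC_mulVec_ofReal _ _⟩
  have h2 := (mem_iSup_maxGenEigenspace hX hFX _ _).1 h1 i (by simpa using hi)
  rw [toC_mulVec_ofReal] at h2
  exact Complex.ofReal_injective h2

end RightUnstable


/-- Solutions of smooth autonomous differential equations on a half-line are smooth. -/
theorem contDiffOn_of_hasDerivWithinAt {k : ℕ} {X : (Fin k → ℝ) → (Fin k → ℝ)}
    {W : ℝ → (Fin k → ℝ)} (hX : ∀ ξ, 0 ≤ ξ → ContDiffAt ℝ ∞ X (W ξ))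
    (hW : ∀ ξ, 0 ≤ ξ → HasDerivWithinAt W (X (W ξ)) (Ici 0) ξ) : ContDiffOn ℝ ∞ W (Ici 0) := by
  rw [contDiffOn_infty]
  intro n
  induction n with
  | zero =>
    rw [Nat.cast_zero, contDiffOn_zero]
    exact fun ξ hξ => (hW ξ hξ).continuousWithinAt
  | succ n ih =>
    rw [Nat.cast_succ, contDiffOn_succ_iff_derivWithin (uniqueDiffOn_Ici 0)]
    refine ⟨fun ξ hξ => (hW ξ hξ).differentiableWithinAt, fun h => by simp at h, ?_⟩
    -- Bootstrapping: a `C^n` solution has a `C^n` right-hand side, so it is `C^(n+1)`.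
    have h1 : ContDiffOn ℝ n (fun ξ => X (W ξ)) (Ici 0) := fun ξ hξ =>
      ((hX ξ hξ).of_le (by exact_mod_cast le_top)).comp_contDiffWithinAt ξ (ih ξ hξ)
    exact h1.congr fun ξ hξ => (hW ξ hξ).derivWithin (uniqueDiffOn_Ici 0 ξ hξ)

namespace RelaxationProblem

variable {m r p k n₀ : ℕ} {S : RelaxationProblem m r p}
  {A₀ : State m r → Matrix (Fin m ⊕ Fin r) (Fin m ⊕ Fin r) ℝ} {h : (Fin m → ℝ) → (Fin r → ℝ)}
  {P₂ : Matrix (Fin r) (Fin k) ℝ} {P₀ : Matrix (Fin r) (Fin n₀) ℝ}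
  {Q₂ : State m r → Matrix (Fin r) (Fin k) ℝ} {Q₀ : State m r → Matrix (Fin r) (Fin n₀) ℝ}
  {ψ₁ : (Fin r → ℝ) × (Fin m → ℝ) → (Fin m → ℝ)}
  {ψ₂ : (Fin k → ℝ) × (Fin m → ℝ) → (Fin n₀ → ℝ)}

/-! ### The inner equations and the reduced equations -/

/-- The inner equations, multiplied by the Schur complement. -/
theorem IsSmoothState.schur_mulVec (hI : S.AssumptionI A₀ h) {U : State m r}
    (hU : S.IsSmoothState A₀ h U) {a : Fin m → ℝ} {b : Fin r → ℝ}
    (hab : fderiv ℝ S.f U (a, b) = 0) :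
    (S.frozen A₀ h U).schur *ᵥ (b - fderiv ℝ h U.1 a) =
      S.sourceCoef A₀ h U *ᵥ fderiv ℝ S.g U (a, b) := by
  set y := fderiv ℝ S.g U (a, b) with hy
  set c := b - fderiv ℝ h U.1 a with hc
  have hPi : (PU h U)⁻¹ *ᵥ Sum.elim a c = Sum.elim a b := by
    rw [PU_inv, Matrix.fromBlocks_mulVec]
    simp [hc]
  have hF : S.FU U *ᵥ Sum.elim a b = Sum.elim (0 : Fin m → ℝ) y := by
    rw [FU, Matrix.fromBlocks_mulVec]
    simp only [Sum.elim_comp_inl, Sum.elim_comp_inr]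
    rw [← hab, hy, fderiv_eq_jac, fderiv_eq_jac]
  have hPy : (PU h U)⁻¹ *ᵥ Sum.elim (0 : Fin m → ℝ) y = Sum.elim (0 : Fin m → ℝ) y := by
    rw [PU_inv, Matrix.fromBlocks_mulVec]
    simp
  -- The symmetrized equations; the right-hand side has no slow component because `f' = 0`.
  have h1 : S.A1 A₀ h U *ᵥ Sum.elim a c = RelaxationProblem.tA0 A₀ h U *ᵥ Sum.elim (0 : Fin m → ℝ) y := by
    rw [RelaxationProblem.A1, RelaxationProblem.tA0, ← Matrix.mulVec_mulVec, hPi,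
      ← Matrix.mulVec_mulVec, hF, ← Matrix.mulVec_mulVec _ _ (PU h U)⁻¹, hPy]
  rw [A1_fromBlocks hI hU.mem, tA0_fromBlocks hI hU.mem, Matrix.fromBlocks_mulVec,
    Matrix.fromBlocks_mulVec] at h1
  simp only [Sum.elim_comp_inl, Sum.elim_comp_inr, Matrix.mulVec_zero, zero_add] at h1
  have h2 : (S.frozen A₀ h U).A11 *ᵥ a + (S.frozen A₀ h U).A12 *ᵥ c =
      (RelaxationProblem.tA0 A₀ h U).toBlocks₁₂ *ᵥ y := by
    have := congrArg (fun v => v ∘ Sum.inl) h1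
    simpa using this
  have h3 : (S.frozen A₀ h U).A12ᵀ *ᵥ a + (S.frozen A₀ h U).A22 *ᵥ c =
      (S.frozen A₀ h U).A02 *ᵥ y := by
    have := congrArg (fun v => v ∘ Sum.inr) h1
    simpa using this
  have hu := (Matrix.isUnit_iff_isUnit_det _).1 hU.isUnit_A11
  -- The first row determines `a`; substitution into the second produces the Schur complement and
  -- the source coefficient.
  have h4 : a = (S.frozen A₀ h U).A11⁻¹ *ᵥ ((RelaxationProblem.tA0 A₀ h U).toBlocks₁₂ *ᵥ y -
      (S.frozen A₀ h U).A12 *ᵥ c) := by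
    rw [← h2, add_sub_cancel_right, Matrix.mulVec_mulVec, Matrix.nonsing_inv_mul _ hu,
      Matrix.one_mulVec]
  rw [LinearProblem.schur, RelaxationProblem.sourceCoef, Matrix.sub_mulVec, Matrix.sub_mulVec, ← h3]
  nth_rewrite 1 [h4]
  simp only [Matrix.mulVec_sub, Matrix.mulVec_mulVec, Matrix.mul_assoc]
  abel

/-- States near the corner state, at which all the coefficients are regular. -/
structure IsGoodState (S : RelaxationProblem m r p)
    (A₀ : State m r → Matrix (Fin m ⊕ Fin r) (Fin m ⊕ Fin r) ℝ)
    (h : (Fin m → ℝ) → (Fin r → ℝ)) (P₂ : Matrix (Fin r) (Fin k) ℝ)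
    (Q₀ : State m r → Matrix (Fin r) (Fin n₀) ℝ) (U : State m r) : Prop
    extends S.IsSmoothState A₀ h U where
  kernel : (Q₀ U)ᵀ * (S.frozen A₀ h U).schur = 0
  separating : ∀ z, P₂ᵀ *ᵥ z = 0 → (Q₀ U)ᵀ *ᵥ z = 0 → z = 0
  isUnit_sourceCoef : IsUnit (S.sourceCoef A₀ h U)

theorem eventually_isGoodState (hI : S.AssumptionI A₀ h) (hII : S.AssumptionII)
    (hIII : S.AssumptionIII h n₀) (hP : (S.frozen A₀ h S.corner).IsSpectralFrame P₂ P₀)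
    (hQ : S.IsLocalFrame A₀ h P₂ P₀ Q₂ Q₀) :
    ∀ᶠ U in 𝓝 S.corner, S.IsGoodState A₀ h P₂ Q₀ U := by
  have hst := eventually_isSmoothState hI hII hIII
  have hQe := hQ.eventually
  have hC : ∀ᶠ U in 𝓝 S.corner, IsUnit (S.sourceCoef A₀ h U) := by
    refine eventually_isUnit hst.self_of_nhds.sourceCoef.continuousAt ?_
    rw [sourceCoef, A012_corner hI hII, Matrix.mul_zero, sub_zero]
    exact (A02_posDef hI (corner_mem_equil hII).1).isUnit
  -- By completeness this matrix is the identity at the corner. Its invertibility nearby shows that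
  -- `P₂ᵀ` and `Q₀ᵀ` together separate vectors.
  have hR : ∀ᶠ U in 𝓝 S.corner, IsUnit (P₂ * P₂ᵀ + P₀ * (Q₀ U)ᵀ) := by
    refine eventually_isUnit ((smAt_const _).add ((smAt_const _).mul
      hQe.self_of_nhds.2.1.transpose)).continuousAt ?_
    rw [hQ.2.1, hP.complete]
    exact isUnit_one
  filter_upwards [hst, hQe, hC, hR] with U h1 h2 h3 h4
  refine ⟨h1, h2.2.2, fun z hz hz' => eq_zero_of_isUnit_mulVec h4 ?_, h3⟩
  rw [Matrix.add_mulVec, ← Matrix.mulVec_mulVec, ← Matrix.mulVec_mulVec, hz, hz',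
    Matrix.mulVec_zero, Matrix.mulVec_zero, add_zero]

/-- Points near `(0, u₀)`, at which the reduced equations are equivalent to the inner equations. -/
structure IsGoodPoint (S : RelaxationProblem m r p)
    (A₀ : State m r → Matrix (Fin m ⊕ Fin r) (Fin m ⊕ Fin r) ℝ)
    (h : (Fin m → ℝ) → (Fin r → ℝ))
    (P₂ : Matrix (Fin r) (Fin k) ℝ) (P₀ : Matrix (Fin r) (Fin n₀) ℝ)
    (Q₀ : State m r → Matrix (Fin r) (Fin n₀) ℝ)
    (ψ₁ : (Fin r → ℝ) × (Fin m → ℝ) → (Fin m → ℝ))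
    (ψ₂ : (Fin k → ℝ) × (Fin m → ℝ) → (Fin n₀ → ℝ)) (x : (Fin k → ℝ) × (Fin m → ℝ)) : Prop
    extends S.IsRegularPoint A₀ h P₂ P₀ ψ₁ ψ₂ x where
  isUnit_Kmat : IsUnit (S.Kmat A₀ h P₂ P₀ ψ₁ ψ₂ x)
  smooth_H : ContDiffAt ℝ ∞ (S.Hfield A₀ h P₂ P₀ ψ₁ ψ₂) x
  good : S.IsGoodState A₀ h P₂ Q₀ (profileState h P₂ P₀ ψ₁ ψ₂ x)
  f_eq : S.f (profileState h P₂ P₀ ψ₁ ψ₂ x) = S.f (x.2, h x.2)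
  source_eq : (Q₀ (profileState h P₂ P₀ ψ₁ ψ₂ x))ᵀ *ᵥ
    S.reducedSource A₀ h (profileState h P₂ P₀ ψ₁ ψ₂ x) = 0

theorem eventually_isGoodPoint (hI : S.AssumptionI A₀ h) (hII : S.AssumptionII)
    (hIII : S.AssumptionIII h n₀) (hP : (S.frozen A₀ h S.corner).IsSpectralFrame P₂ P₀)
    (hQ : S.IsLocalFrame A₀ h P₂ P₀ Q₂ Q₀)
    (hψ : IsImplicitSolution (S.phi1 h) 0 (0, S.corner.1) ψ₁)
    (hψ₂ : IsImplicitSolution (S.phi2 A₀ h P₂ P₀ Q₀ ψ₁) 0 (0, S.corner.1) ψ₂) :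
    ∀ᶠ x in 𝓝 ((0 : Fin k → ℝ), S.corner.1), S.IsGoodPoint A₀ h P₂ P₀ Q₀ ψ₁ ψ₂ x := by
  filter_upwards [eventually_isRegularPoint hI hII hIII hψ hψ₂,
    eventually_isUnit_Kmat hI hII hIII hP hψ hψ₂,
    eventually_contDiffAt_Hfield hI hII hIII hP hψ hψ₂,
    (tendsto_profileState hI hII hψ hψ₂).eventually (eventually_isGoodState hI hII hIII hP hQ),
    (tendsto_nuPair hψ₂).eventually hψ.eventually_eq_zero, hψ₂.eventually_eq_zero]
    with x h1 h2 h3 h4 h5 h6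
  refine ⟨h1, h2, h3, h4, sub_eq_zero.1 h5, ?_⟩
  rw [← h1.rhs_eq, Matrix.mulVec_mulVec]
  exact h6

theorem hasDerivWithinAt_nuOf {W : ℝ → (Fin k → ℝ)} {u : Fin m → ℝ} {w' : Fin k → ℝ} {ξ : ℝ}
    (hx : ContDiffAt ℝ ∞ ψ₂ (W ξ, u)) (hW : HasDerivWithinAt W w' (Ici 0) ξ) :
    HasDerivWithinAt (fun s => nuOf P₂ P₀ ψ₂ (W s, u))
      ((P₂ + P₀ * jac₁ ψ₂ (W ξ, u)) *ᵥ w') (Ici 0) ξ := by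
  have h1 : HasDerivWithinAt (fun s => (W s, u)) (w', 0) (Ici 0) ξ :=
    hW.prodMk (hasDerivWithinAt_const ξ (Ici 0) u)
  have h2 := ((hx.differentiableAt (by simp)).hasFDerivAt).comp_hasDerivWithinAt ξ h1
  have h3 := (mvL P₂).hasFDerivAt.comp_hasDerivWithinAt ξ hW
  have h4 := (mvL P₀).hasFDerivAt.comp_hasDerivWithinAt ξ h2
  have h5 := h3.add h4
  rw [Matrix.add_mulVec, ← Matrix.mulVec_mulVec, jac₁_mulVec]
  exact h5

theorem hasDerivWithinAt_fastPart {U : ℝ → State m r} {a : Fin m → ℝ} {b : Fin r → ℝ} {ξ : ℝ}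
    (hU : HasDerivWithinAt U (a, b) (Ici 0) ξ) (hh : ContDiffAt ℝ ∞ h (U ξ).1) :
    HasDerivWithinAt (fun s => (U s).2 - h (U s).1) (b - fderiv ℝ h (U ξ).1 a) (Ici 0) ξ := by
  have h1 : HasDerivWithinAt (fun s => (U s).1) a (Ici 0) ξ :=
    (ContinuousLinearMap.fst ℝ (Fin m → ℝ) (Fin r → ℝ)).hasFDerivAt.comp_hasDerivWithinAt ξ hU
  have h2 : HasDerivWithinAt (fun s => (U s).2) b (Ici 0) ξ :=
    (ContinuousLinearMap.snd ℝ (Fin m → ℝ) (Fin r → ℝ)).hasFDerivAt.comp_hasDerivWithinAt ξ hU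
  exact h2.sub (((hh.differentiableAt (by simp)).hasFDerivAt).comp_hasDerivWithinAt ξ h1)

theorem profileState_fast (x : (Fin k → ℝ) × (Fin m → ℝ)) :
    (profileState h P₂ P₀ ψ₁ ψ₂ x).2 - h (profileState h P₂ P₀ ψ₁ ψ₂ x).1 = nuOf P₂ P₀ ψ₂ x :=
  add_sub_cancel_right _ _

/-- Orbits of the reduced system solve the inner equations. -/
theorem hasDerivWithinAt_g_profile (hI : S.AssumptionI A₀ h) {W : ℝ → (Fin k → ℝ)} {u : Fin m → ℝ}
    {ξ : ℝ} (hξ : 0 ≤ ξ) (hx : ∀ s, 0 ≤ s → S.IsGoodPoint A₀ h P₂ P₀ Q₀ ψ₁ ψ₂ (W s, u))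
    (hW : HasDerivWithinAt W (S.Hfield A₀ h P₂ P₀ ψ₁ ψ₂ (W ξ, u)) (Ici 0) ξ) :
    HasDerivWithinAt (fun s => S.g (profileState h P₂ P₀ ψ₁ ψ₂ (W s, u)))
      (S.q (profileState h P₂ P₀ ψ₁ ψ₂ (W ξ, u))) (Ici 0) ξ := by
  have hg := hx ξ hξ
  set U := profileState h P₂ P₀ ψ₁ ψ₂ (W ξ, u) with hU
  have hud : UniqueDiffWithinAt ℝ (Ici (0 : ℝ)) ξ := uniqueDiffOn_Ici 0 ξ hξ
  have h1 : HasDerivWithinAt (fun s => (W s, u)) (S.Hfield A₀ h P₂ P₀ ψ₁ ψ₂ (W ξ, u), 0) (Ici 0) ξ :=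
    hW.prodMk (hasDerivWithinAt_const ξ (Ici 0) u)
  have h2 := ((hg.smooth_profile.differentiableAt (by simp)).hasFDerivAt).comp_hasDerivWithinAt ξ h1
  obtain ⟨⟨a, b⟩, hab⟩ : ∃ y : State m r, HasDerivWithinAt
      (fun s => profileState h P₂ P₀ ψ₁ ψ₂ (W s, u)) y (Ici 0) ξ := ⟨_, h2⟩
  have h3 := ((hg.state.smooth_f.differentiableAt (by simp)).hasFDerivAt).comp_hasDerivWithinAt ξ hab
  have h4 : HasDerivWithinAt (fun s => S.f (profileState h P₂ P₀ ψ₁ ψ₂ (W s, u))) 0 (Ici 0) ξ :=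
    (hasDerivWithinAt_const ξ (Ici 0) (S.f (u, h u))).congr (fun s hs => (hx s hs).f_eq)
      (hx ξ hξ).f_eq
  have h5 : fderiv ℝ S.f U (a, b) = 0 := hud.eq_deriv _ h3 h4
  have h6 := hasDerivWithinAt_fastPart hab hg.state.smooth_h
  simp only [profileState_fast] at h6
  have h7 := hud.eq_deriv _ h6 (hasDerivWithinAt_nuOf hg.smooth_psi2 hW)
  have h8 := hg.state.schur_mulVec hI h5
  have hK := (Matrix.isUnit_iff_isUnit_det _).1 hg.isUnit_Kmat
  -- The `P₂` part of `Σ ν' = C q`: it is how `H` was defined, since `K w₂' = P₂ᵀ Σ ν'`.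
  have h9 : P₂ᵀ *ᵥ ((S.frozen A₀ h U).schur *ᵥ (b - fderiv ℝ h U.1 a)) =
      P₂ᵀ *ᵥ S.reducedSource A₀ h U := by
    rw [h7, hg.Hfield_eq, Matrix.mulVec_mulVec, Matrix.mulVec_mulVec, Matrix.mulVec_mulVec]
    have : P₂ᵀ * (S.frozen A₀ h U).schur * (P₂ + P₀ * jac₁ ψ₂ (W ξ, u)) =
      S.Kmat A₀ h P₂ P₀ ψ₁ ψ₂ (W ξ, u) := rfl
    rw [← Matrix.mul_assoc, this, Matrix.mul_nonsing_inv _ hK, Matrix.one_mul]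
  -- The kernel part holds by `Q₀ᵀ Σ = 0` and the equation for `ψ₂`. Cancelling the invertible `C`
  -- then recovers `g' = q`.
  have h10 : (S.frozen A₀ h U).schur *ᵥ (b - fderiv ℝ h U.1 a) - S.reducedSource A₀ h U = 0 := by
    refine hg.good.separating _ ?_ ?_
    · rw [Matrix.mulVec_sub, h9, sub_self]
    · rw [Matrix.mulVec_sub, Matrix.mulVec_mulVec, hg.good.kernel, Matrix.zero_mulVec, hg.source_eq,
        sub_zero]
  rw [h8, reducedSource, ← Matrix.mulVec_sub] at h10
  have h11 := sub_eq_zero.1 (eq_zero_of_isUnit_mulVec hg.good.isUnit_sourceCoef h10)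
  rw [← h11]
  exact ((hg.state.smooth_g.differentiableAt (by simp)).hasFDerivAt).comp_hasDerivWithinAt ξ hab

/-- Decaying orbits of the reduced system define boundary layers. -/
theorem isBoundaryLayer_profile (hI : S.AssumptionI A₀ h) {W : ℝ → (Fin k → ℝ)} {u : Fin m → ℝ}
    {V : Set (Fin k → ℝ)} {t : ℝ}
    (hx : ∀ w ∈ V, S.IsGoodPoint A₀ h P₂ P₀ Q₀ ψ₁ ψ₂ (w, u)) (h0 : (0 : Fin k → ℝ) ∈ V)
    (hW : IsDecayingOrbit (fun w' => S.Hfield A₀ h P₂ P₀ ψ₁ ψ₂ (w', u)) V W)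
    (hu : (u, h u) ∈ S.equil) (hp0 : profileState h P₂ P₀ ψ₁ ψ₂ (0, u) = (u, h u))
    (hB : S.B (profileState h P₂ P₀ ψ₁ ψ₂ (W 0, u), t) = 0) :
    S.IsBoundaryLayer h u t fun ξ => profileState h P₂ P₀ ψ₁ ψ₂ (W ξ, u) := by
  have hg : ∀ s, 0 ≤ s → S.IsGoodPoint A₀ h P₂ P₀ Q₀ ψ₁ ψ₂ (W s, u) := fun s hs =>
    hx _ (hW.1 s hs).1
  have hWs : ContDiffOn ℝ ∞ W (Ici 0) := by
    refine contDiffOn_of_hasDerivWithinAt (X := fun w' => S.Hfield A₀ h P₂ P₀ ψ₁ ψ₂ (w', u))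
      (fun ξ hξ => ?_) fun ξ hξ => (hW.1 ξ hξ).2
    exact ContDiffAt.comp (W ξ) (g := S.Hfield A₀ h P₂ P₀ ψ₁ ψ₂) (hg ξ hξ).smooth_H
      (contDiffAt_id.prodMk contDiffAt_const)
  refine ⟨fun ξ hξ => ?_, fun ξ hξ => (hg ξ hξ).state.mem, fun ξ hξ => ?_, fun ξ hξ =>
    hasDerivWithinAt_g_profile hI hξ hg (hW.1 ξ hξ).2, hu, ?_, hB⟩
  · exact ContDiffAt.comp_contDiffWithinAt ξ (g := profileState h P₂ P₀ ψ₁ ψ₂)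
      (hg ξ hξ).smooth_profile ((hWs ξ hξ).prodMk contDiffWithinAt_const)
  · exact (hasDerivWithinAt_const ξ (Ici 0) (S.f (u, h u))).congr (fun s hs => (hg s hs).f_eq)
      (hg ξ hξ).f_eq
  · have h1 := (hx 0 h0).smooth_profile.continuousAt.tendsto
    rw [hp0] at h1
    exact h1.comp (hW.2.prodMk_nhds tendsto_const_nhds)

end RelaxationProblem


namespace RelaxationProblem

variable {m r p k n₀ : ℕ} {S : RelaxationProblem m r p}
  {A₀ : State m r → Matrix (Fin m ⊕ Fin r) (Fin m ⊕ Fin r) ℝ} {h : (Fin m → ℝ) → (Fin r → ℝ)}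
  {P₂ : Matrix (Fin r) (Fin k) ℝ} {P₀ : Matrix (Fin r) (Fin n₀) ℝ}
  {Q₂ : State m r → Matrix (Fin r) (Fin k) ℝ} {Q₀ : State m r → Matrix (Fin r) (Fin n₀) ℝ}
  {ψ₁ : (Fin r → ℝ) × (Fin m → ℝ) → (Fin m → ℝ)}
  {ψ₂ : (Fin k → ℝ) × (Fin m → ℝ) → (Fin n₀ → ℝ)}

/-! ### Boundary layers are profiles -/

/-- The component `w₂ = P₂ᵀ (v - h(u))` of a state `(u, v)`. -/
def fastCoord (h : (Fin m → ℝ) → (Fin r → ℝ)) (P₂ : Matrix (Fin r) (Fin k) ℝ) (U : State m r) :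
    Fin k → ℝ := P₂ᵀ *ᵥ (U.2 - h U.1)

/-- States `U` and limits `u∞` for which the implicit functions are determined by the equations. -/
structure IsGoodPair (S : RelaxationProblem m r p)
    (A₀ : State m r → Matrix (Fin m ⊕ Fin r) (Fin m ⊕ Fin r) ℝ)
    (h : (Fin m → ℝ) → (Fin r → ℝ))
    (P₂ : Matrix (Fin r) (Fin k) ℝ) (P₀ : Matrix (Fin r) (Fin n₀) ℝ)
    (Q₀ : State m r → Matrix (Fin r) (Fin n₀) ℝ)
    (ψ₁ : (Fin r → ℝ) × (Fin m → ℝ) → (Fin m → ℝ))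
    (ψ₂ : (Fin k → ℝ) × (Fin m → ℝ) → (Fin n₀ → ℝ)) (U : State m r) (u : Fin m → ℝ) : Prop
    extends S.IsGoodState A₀ h P₂ Q₀ U where
  slow : S.phi1 h (U.1 - u) (U.2 - h U.1, u) = 0 → U.1 - u = ψ₁ (U.2 - h U.1, u)
  rhs : S.rhsCoef A₀ h (U.1 - u) (U.2 - h U.1) u *ᵥ (U.2 - h U.1) =
    S.reducedSource A₀ h (layerState h (U.1 - u) (U.2 - h U.1) u)
  fast : S.phi2 A₀ h P₂ P₀ Q₀ ψ₁ (P₀ᵀ *ᵥ (U.2 - h U.1)) (fastCoord h P₂ U, u) = 0 →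
    P₀ᵀ *ᵥ (U.2 - h U.1) = ψ₂ (fastCoord h P₂ U, u)
  point : S.IsGoodPoint A₀ h P₂ P₀ Q₀ ψ₁ ψ₂ (fastCoord h P₂ U, u)

theorem tendsto_fast (hI : S.AssumptionI A₀ h) (hII : S.AssumptionII) :
    Tendsto (fun U : State m r => U.2 - h U.1) (𝓝 S.corner) (𝓝 0) := by
  have h1 : ContinuousAt (fun U : State m r => U.2 - h U.1) S.corner :=
    continuousAt_snd.sub (ContinuousAt.comp (f := fun U : State m r => U.1)
      (eventually_equil hI hII).self_of_nhds.1.continuousAt continuousAt_fst)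
  have h2 := h1.tendsto
  have h3 : S.corner.2 - h S.corner.1 = 0 :=
    sub_eq_zero.2 (congrArg Prod.snd (corner_eq hI hII)).symm
  rwa [h3] at h2

theorem tendsto_mulVec_zero {ι κ X : Type*} [Fintype ι] [Fintype κ] {l : Filter X}
    (A : Matrix ι κ ℝ) {v : X → κ → ℝ} (hv : Tendsto v l (𝓝 0)) :
    Tendsto (fun x => A *ᵥ v x) l (𝓝 0) := by
  have h1 := ((mvL A).continuous.tendsto 0).comp hv
  rwa [map_zero] at h1

theorem tendsto_fastCoord (hI : S.AssumptionI A₀ h) (hII : S.AssumptionII)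
    (P₂ : Matrix (Fin r) (Fin k) ℝ) : Tendsto (fastCoord h P₂) (𝓝 S.corner) (𝓝 0) :=
  tendsto_mulVec_zero P₂ᵀ (tendsto_fast hI hII)

theorem eventually_isGoodPair (hI : S.AssumptionI A₀ h) (hII : S.AssumptionII)
    (hIII : S.AssumptionIII h n₀) (hP : (S.frozen A₀ h S.corner).IsSpectralFrame P₂ P₀)
    (hQ : S.IsLocalFrame A₀ h P₂ P₀ Q₂ Q₀)
    (hψ : IsImplicitSolution (S.phi1 h) 0 (0, S.corner.1) ψ₁)
    (hψ₂ : IsImplicitSolution (S.phi2 A₀ h P₂ P₀ Q₀ ψ₁) 0 (0, S.corner.1) ψ₂) :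
    ∀ᶠ y in 𝓝 (S.corner, S.corner.1), S.IsGoodPair A₀ h P₂ P₀ Q₀ ψ₁ ψ₂ y.1 y.2 := by
  have h1 : Tendsto (fun y : State m r × (Fin m → ℝ) => y.1) (𝓝 (S.corner, S.corner.1))
      (𝓝 S.corner) := continuous_fst.tendsto _
  have h2 : Tendsto (fun y : State m r × (Fin m → ℝ) => y.2) (𝓝 (S.corner, S.corner.1))
      (𝓝 S.corner.1) := continuous_snd.tendsto _
  have h3 := (tendsto_fast hI hII).comp h1
  have h4 : Tendsto (fun y : State m r × (Fin m → ℝ) => y.1.1 - y.2) (𝓝 (S.corner, S.corner.1))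
      (𝓝 0) := by
    have h5 : Continuous fun y : State m r × (Fin m → ℝ) => y.1.1 - y.2 := by fun_prop
    have h6 := h5.tendsto (S.corner, S.corner.1)
    simpa using h6
  have h5 := (h3.prodMk_nhds h2).prodMk_nhds h4
  have h6 := ((tendsto_fastCoord hI hII P₂).comp h1).prodMk_nhds h2
  have h7 := h6.prodMk_nhds (tendsto_mulVec_zero P₀ᵀ h3)
  filter_upwards [h1.eventually (eventually_isGoodState hI hII hIII hP hQ),
    h5.eventually hψ.eventually_iff, h5.eventually (eventually_rhsCoef hI hII),
    h7.eventually hψ₂.eventually_iff,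
    h6.eventually (eventually_isGoodPoint hI hII hIII hP hQ hψ hψ₂)] with y e1 e2 e3 e4 e5
  exact ⟨e1, e2.1, e3, e4.1, e5⟩

/-- A state with the limiting flux and no source in the kernel direction satisfies both implicit
equations, in the frame coordinates of `v - h(u)`. Local uniqueness makes it a profile. -/
theorem IsGoodPair.eq_profile (hP : (S.frozen A₀ h S.corner).IsSpectralFrame P₂ P₀)
    {U : State m r} {u : Fin m → ℝ} (hU : S.IsGoodPair A₀ h P₂ P₀ Q₀ ψ₁ ψ₂ U u)
    (hf : S.f U = S.f (u, h u)) (hs : (Q₀ U)ᵀ *ᵥ S.reducedSource A₀ h U = 0) :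
    nuOf P₂ P₀ ψ₂ (fastCoord h P₂ U, u) = U.2 - h U.1 ∧
      profileState h P₂ P₀ ψ₁ ψ₂ (fastCoord h P₂ U, u) = U := by
  have hl : layerState h (U.1 - u) (U.2 - h U.1) u = U := by
    rw [layerState, sub_add_cancel, sub_add_cancel]
  have h1 := hU.slow (by rw [phi1, hl, hf, sub_self])
  have h2 : P₂ *ᵥ fastCoord h P₂ U + P₀ *ᵥ (P₀ᵀ *ᵥ (U.2 - h U.1)) = U.2 - h U.1 := by
    rw [fastCoord, Matrix.mulVec_mulVec, Matrix.mulVec_mulVec, ← Matrix.add_mulVec, hP.complete,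
      Matrix.one_mulVec]
  have h3 := hU.fast (by
    simp only [phi2]
    rw [h2, ← h1, hl, ← Matrix.mulVec_mulVec, hU.rhs, hl, hs])
  have h4 : nuOf P₂ P₀ ψ₂ (fastCoord h P₂ U, u) = U.2 - h U.1 := by
    rw [nuOf, ← h3, h2]
  refine ⟨h4, ?_⟩
  rw [profileState, h4, ← h1, hl]

/-- A boundary layer whose values are close to the corner state is a profile. -/
theorem IsBoundaryLayer.exists_orbit (hI : S.AssumptionI A₀ h)
    (hP : (S.frozen A₀ h S.corner).IsSpectralFrame P₂ P₀) {u : Fin m → ℝ} {t : ℝ}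
    {U : ℝ → State m r} (hU : S.IsBoundaryLayer h u t U) (hh : ContinuousAt h u)
    (hg : ∀ ξ, 0 ≤ ξ → S.IsGoodPair A₀ h P₂ P₀ Q₀ ψ₁ ψ₂ (U ξ) u) {V : Set (Fin k → ℝ)}
    (hV : ∀ ξ, 0 ≤ ξ → fastCoord h P₂ (U ξ) ∈ V) :
    IsDecayingOrbit (fun w' => S.Hfield A₀ h P₂ P₀ ψ₁ ψ₂ (w', u)) V (fun ξ => fastCoord h P₂ (U ξ)) ∧
      profileState h P₂ P₀ ψ₁ ψ₂ (fastCoord h P₂ (U 0), u) = U 0 := by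
  -- The flux `f` is constant along the layer, and the limit at infinity identifies the constant.
  have hf : ∀ ξ, 0 ≤ ξ → S.f (U ξ) = S.f (u, h u) := by
    have h1 : ∀ ξ, 0 ≤ ξ → S.f (U ξ) = S.f (U 0) := fun ξ hξ => by
      have h2 := (convex_Ici (0 : ℝ)).norm_image_sub_le_of_norm_hasDerivWithin_le (C := 0)
        (f := fun s => S.f (U s)) hU.inner_f (fun x _ => by simp) self_mem_Ici
        (mem_Ici.2 hξ)
      rw [zero_mul, norm_le_zero_iff, sub_eq_zero] at h2
      exact h2
    have h3 : ContinuousAt S.f (u, h u) :=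
      (S.smooth_f.contDiffAt (S.isOpen_G.mem_nhds hU.limit_equil.1)).continuousAt
    have h4 : Tendsto (fun s => S.f (U s)) atTop (𝓝 (S.f (u, h u))) := h3.tendsto.comp hU.matching
    have h5 : Tendsto (fun s => S.f (U s)) atTop (𝓝 (S.f (U 0))) :=
      tendsto_const_nhds.congr' ((eventually_ge_atTop 0).mono fun s hs => (h1 s hs).symm)
    have h6 := tendsto_nhds_unique h4 h5
    exact fun ξ hξ => (h1 ξ hξ).trans h6.symm
  have hd : ∀ ξ, 0 ≤ ξ → ∃ a b, HasDerivWithinAt U (a, b) (Ici 0) ξ ∧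
      (S.frozen A₀ h (U ξ)).schur *ᵥ (b - fderiv ℝ h (U ξ).1 a) = S.reducedSource A₀ h (U ξ) := by
    intro ξ hξ
    have hud : UniqueDiffWithinAt ℝ (Ici (0 : ℝ)) ξ := uniqueDiffOn_Ici 0 ξ hξ
    have h1 : HasDerivWithinAt U _ (Ici 0) ξ :=
      ((hU.smooth ξ hξ).differentiableWithinAt (by simp)).hasDerivWithinAt
    obtain ⟨⟨a, b⟩, hab⟩ : ∃ y : State m r, HasDerivWithinAt U y (Ici 0) ξ := ⟨_, h1⟩
    have hs := (hg ξ hξ).toIsSmoothState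
    have h3 := ((hs.smooth_f.differentiableAt (by simp)).hasFDerivAt).comp_hasDerivWithinAt ξ hab
    have h4 := ((hs.smooth_g.differentiableAt (by simp)).hasFDerivAt).comp_hasDerivWithinAt ξ hab
    have h5 := hud.eq_deriv _ h3 (hU.inner_f ξ hξ)
    have h6 := hud.eq_deriv _ h4 (hU.inner_g ξ hξ)
    refine ⟨a, b, hab, ?_⟩
    rw [hs.schur_mulVec hI h5, h6]
    rfl
  have hp : ∀ ξ, 0 ≤ ξ → nuOf P₂ P₀ ψ₂ (fastCoord h P₂ (U ξ), u) = (U ξ).2 - h (U ξ).1 ∧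
      profileState h P₂ P₀ ψ₁ ψ₂ (fastCoord h P₂ (U ξ), u) = U ξ := by
    intro ξ hξ
    obtain ⟨a, b, -, hab⟩ := hd ξ hξ
    refine (hg ξ hξ).eq_profile hP (hf ξ hξ) ?_
    rw [← hab, Matrix.mulVec_mulVec, (hg ξ hξ).kernel, Matrix.zero_mulVec]
  refine ⟨⟨fun ξ hξ => ⟨hV ξ hξ, ?_⟩, ?_⟩, (hp 0 le_rfl).2⟩
  · have hud : UniqueDiffWithinAt ℝ (Ici (0 : ℝ)) ξ := uniqueDiffOn_Ici 0 ξ hξ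
    obtain ⟨a, b, hab, h1⟩ := hd ξ hξ
    have hgp := (hg ξ hξ).point
    have h2 := hasDerivWithinAt_fastPart hab (hg ξ hξ).smooth_h
    have h3 : HasDerivWithinAt (fun ξ => fastCoord h P₂ (U ξ)) _ (Ici 0) ξ :=
      (mvL P₂ᵀ).hasFDerivAt.comp_hasDerivWithinAt ξ h2
    have h4 := (hasDerivWithinAt_nuOf (P₂ := P₂) (P₀ := P₀) hgp.smooth_psi2 h3).congr
      (fun s hs => (hp s hs).1.symm) (hp ξ hξ).1.symm
    have h5 := hud.eq_deriv _ h2 h4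
    have hK := (Matrix.isUnit_iff_isUnit_det _).1 hgp.isUnit_Kmat
    refine h3.congr_deriv ?_
    set w' := mvL P₂ᵀ (b - fderiv ℝ h (U ξ).1 a) with hw
    -- Projection of `Σ ν' = C q` by `P₂ᵀ`, with `ν'` expressed by the chain rule through `w₂'`;
    -- inverting `K` gives the reduced equation.
    have h6 : S.Kmat A₀ h P₂ P₀ ψ₁ ψ₂ (fastCoord h P₂ (U ξ), u) *ᵥ w' =
        P₂ᵀ *ᵥ S.reducedSource A₀ h (U ξ) := by
      rw [← h1, h5, Kmat, (hp ξ hξ).2]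
      simp only [Matrix.mulVec_mulVec, Matrix.mul_assoc]
    show w' = S.Hfield A₀ h P₂ P₀ ψ₁ ψ₂ (fastCoord h P₂ (U ξ), u)
    rw [hgp.Hfield_eq, (hp ξ hξ).2, ← Matrix.mulVec_mulVec, ← h6, Matrix.mulVec_mulVec,
      Matrix.nonsing_inv_mul _ hK, Matrix.one_mulVec]
  · have h1 : ContinuousAt (fun U : State m r => U.2 - h U.1) (u, h u) :=
      continuousAt_snd.sub (ContinuousAt.comp (f := fun U : State m r => U.1) hh continuousAt_fst)
    have h2 := h1.tendsto.comp hU.matching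
    simp only [sub_self] at h2
    exact tendsto_mulVec_zero P₂ᵀ h2

end RelaxationProblem


namespace RelaxationProblem

variable {m r p k n₀ n₁ mS nu : ℕ} {S : RelaxationProblem m r p}
  {A₀ : State m r → Matrix (Fin m ⊕ Fin r) (Fin m ⊕ Fin r) ℝ} {h : (Fin m → ℝ) → (Fin r → ℝ)}
  {P₂ : Matrix (Fin r) (Fin k) ℝ} {P₀ : Matrix (Fin r) (Fin n₀) ℝ}
  {Q₂ : State m r → Matrix (Fin r) (Fin k) ℝ} {Q₀ : State m r → Matrix (Fin r) (Fin n₀) ℝ}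
  {ψ₁ : (Fin r → ℝ) × (Fin m → ℝ) → (Fin m → ℝ)}
  {ψ₂ : (Fin k → ℝ) × (Fin m → ℝ) → (Fin n₀ → ℝ)}

/-! ### The reduced boundary condition -/

theorem eventually_contDiffAt_B (hII : S.AssumptionII) :
    ∀ᶠ y in 𝓝 (S.corner, (0 : ℝ)), ContDiffAt ℝ ∞ S.B y := by
  obtain ⟨O, hO, hG, hB⟩ := S.smooth_B
  have h1 : (S.corner, (0 : ℝ)) ∈ O := hG ⟨(corner_mem_equil hII).1, mem_Ici.2 le_rfl⟩
  filter_upwards [hO.mem_nhds h1] with y hy using hB.contDiffAt (hO.mem_nhds hy)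

/-- The linearized boundary operator in the variables `P(U) U`. -/
theorem frozen_B_mulVec (hII : S.AssumptionII) (a : Fin m → ℝ) (c : Fin r → ℝ) :
    (S.frozen A₀ h S.corner).B *ᵥ Sum.elim a c =
      fderiv ℝ S.B (S.corner, 0) ((a, c + fderiv ℝ h S.corner.1 a), 0) := by
  have h1 : (PU h S.corner)⁻¹ *ᵥ Sum.elim a c = Sum.elim a (c + fderiv ℝ h S.corner.1 a) := by
    rw [PU_inv, Matrix.fromBlocks_mulVec]
    simp [add_comm]
  have hB := ((eventually_contDiffAt_B hII).self_of_nhds.differentiableAt (by simp)).hasFDerivAt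
  have h2 : HasFDerivAt (fun W => S.B (W, 0)) _ S.corner :=
    hB.comp S.corner (hasFDerivAt_prodMk_left S.corner (0 : ℝ))
  have h3 : (S.frozen A₀ h S.corner).B = S.BU S.corner * (PU h S.corner)⁻¹ := rfl
  rw [h3, ← Matrix.mulVec_mulVec, h1, BU, Matrix.fromCols_mulVec_sumElim, ← fderiv_eq_jac
    (fun W => S.B (W, 0)) S.corner (a, c + fderiv ℝ h S.corner.1 a), h2.fderiv]
  rfl

/-- The factor `A₀₁` cancels in `A₁₁⁻¹ A₁₂`. So `-coupling` is the derivative of `ψ₁` in `ν`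
composed with the lift, and the limit of the Kreiss condition speaks about the nonlinear problem. -/
theorem coupling_corner (hI : S.AssumptionI A₀ h) (hII : S.AssumptionII) (y : Fin k → ℝ) :
    (S.frozen A₀ h S.corner).coupling P₂ P₀ 0 *ᵥ y = (S.fuh h S.corner)⁻¹ *ᵥ
      (jac₂ S.f S.corner *ᵥ ((S.frozen A₀ h S.corner).lift P₂ P₀ 0 *ᵥ y)) := by
  have hc := corner_mem_equil hII
  have hu := (Matrix.isUnit_iff_isUnit_det _).1 (A01_posDef hI hc.1).isUnit
  rw [LinearProblem.coupling, (A1_corner hI hII).1, (A1_corner hI hII).2, Matrix.mul_inv_rev,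
    Matrix.mul_assoc (S.fuh h S.corner)⁻¹, Matrix.nonsing_inv_mul_cancel_left _ _ hu]
  simp only [Matrix.mulVec_mulVec, Matrix.mul_assoc]

/-- The arguments `(w₂, u∞)` of the reduced boundary condition. -/
noncomputable def layerArg (RU : Matrix (Fin m) (Fin n₁) ℝ) (RS : Matrix (Fin m) (Fin mS) ℝ) (k : ℕ) :
    ((Fin mS → ℝ) × ℝ) × ((Fin n₁ → ℝ) × (Fin k → ℝ)) →L[ℝ] (Fin k → ℝ) × (Fin m → ℝ) :=
  (ContinuousLinearMap.snd ℝ _ _ ∘L ContinuousLinearMap.snd ℝ _ _).prod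
    (mvL RU ∘L ContinuousLinearMap.fst ℝ _ _ ∘L ContinuousLinearMap.snd ℝ _ _ +
      mvL RS ∘L ContinuousLinearMap.fst ℝ _ _ ∘L ContinuousLinearMap.fst ℝ _ _)

theorem layerArg_apply (RU : Matrix (Fin m) (Fin n₁) ℝ) (RS : Matrix (Fin m) (Fin mS) ℝ)
    (z : ((Fin mS → ℝ) × ℝ) × ((Fin n₁ → ℝ) × (Fin k → ℝ))) :
    layerArg RU RS k z = (z.2.2, uInf RU RS z.2.1 z.1.1) := rfl

/-- The linearization in `(α, w₂)` acts between spaces of equal dimension by `hdim`. A kernel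
element consists of an unstable vector of `f_u + f_v h_u` and, by `hker`, a combination of decaying
fast modes, jointly annihilated by the boundary operator. It vanishes by `ModifiedGKC.injective`. -/
theorem exists_reduced_boundary_condition (hI : S.AssumptionI A₀ h) (hII : S.AssumptionII)
    (hIII : S.AssumptionIII h n₀) (hP : (S.frozen A₀ h S.corner).IsSpectralFrame P₂ P₀)
    (hGKC : (S.frozen A₀ h S.corner).ModifiedGKC P₂ P₀)
    (hp : numPosEig (S.frozen A₀ h S.corner).A11 +
      numPosEig ((S.frozen A₀ h S.corner).Lam2 P₂) = p) (hdim : n₁ + k = p + nu)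
    {RU : Matrix (Fin m) (Fin n₁) ℝ} {RS : Matrix (Fin m) (Fin mS) ℝ}
    (hRU : IsRightUnstable (toC (S.fuh h S.corner)) (toC RU)) {αo : Fin n₁ → ℝ} {βo : Fin mS → ℝ}
    (hαβ : S.corner.1 = uInf RU RS αo βo)
    (hψ : IsImplicitSolution (S.phi1 h) 0 (0, S.corner.1) ψ₁)
    (hψ₂ : IsImplicitSolution (S.phi2 A₀ h P₂ P₀ Q₀ ψ₁) 0 (0, S.corner.1) ψ₂)
    (hD₁ : HasFDerivAt ψ₁ (-(mvL ((S.fuh h S.corner)⁻¹ * jac₂ S.f S.corner) ∘L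
        ContinuousLinearMap.fst ℝ (Fin r → ℝ) (Fin m → ℝ))) (0, S.corner.1))
    (hD₂ : HasFDerivAt ψ₂ (-(mvL ((P₀ᵀ * (S.frozen A₀ h S.corner).S * P₀)⁻¹ *
        (P₀ᵀ * (S.frozen A₀ h S.corner).S * P₂)) ∘L
        ContinuousLinearMap.fst ℝ (Fin k → ℝ) (Fin m → ℝ))) (0, S.corner.1))
    {St : (Fin k → ℝ) × (Fin m → ℝ) → (Fin nu → ℝ)}
    (hSt : ∀ᶠ x in 𝓝 ((0 : Fin k → ℝ), S.corner.1), ContDiffAt ℝ ∞ St x)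
    (hSt0 : ∀ᶠ u in 𝓝 S.corner.1, St (0, u) = 0)
    (hker : ∀ y, jac₁ St (0, S.corner.1) *ᵥ y = 0 → y ∈ Submodule.span ℝ {y | ∃ z : ℝ, z < 0 ∧
      (((S.frozen A₀ h S.corner).Lam2 P₂)⁻¹ * (S.frozen A₀ h S.corner).G2 P₂ P₀) *ᵥ y = z • y}) :
    ∃ Ψ : (Fin mS → ℝ) × ℝ → (Fin n₁ → ℝ) × (Fin k → ℝ), IsImplicitSolution
      (fun (y : (Fin n₁ → ℝ) × (Fin k → ℝ)) (x : (Fin mS → ℝ) × ℝ) =>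
        (S.B (profileState h P₂ P₀ ψ₁ ψ₂ (y.2, uInf RU RS y.1 x.1), x.2),
          St (y.2, uInf RU RS y.1 x.1))) (αo, 0) (βo, 0) Ψ := by
  set z₀ : ((Fin mS → ℝ) × ℝ) × ((Fin n₁ → ℝ) × (Fin k → ℝ)) := ((βo, 0), (αo, 0)) with hz₀
  set ℓ := layerArg RU RS k with hℓ
  set τ : ((Fin mS → ℝ) × ℝ) × ((Fin n₁ → ℝ) × (Fin k → ℝ)) →L[ℝ] ℝ :=
    ContinuousLinearMap.snd ℝ _ _ ∘L ContinuousLinearMap.fst ℝ _ _ with hτ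
  have hℓ0 : ℓ z₀ = (0, S.corner.1) := by rw [hℓ, layerArg_apply, hαβ]
  have hℓt : Tendsto ℓ (𝓝 z₀) (𝓝 (0, S.corner.1)) := by
    have h1 := ℓ.continuous.tendsto z₀
    rwa [hℓ0] at h1
  have hτt : Tendsto τ (𝓝 z₀) (𝓝 0) := τ.continuous.tendsto z₀
  have hreg := hℓt.eventually (eventually_isRegularPoint hI hII hIII hψ hψ₂)
  have hpt := ((tendsto_profileState hI hII hψ hψ₂).comp hℓt).prodMk_nhds hτt
  have hp0 := profileState_base (P₂ := P₂) (P₀ := P₀) hI hII hψ.1 hψ₂.1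
  set F : ((Fin mS → ℝ) × ℝ) × ((Fin n₁ → ℝ) × (Fin k → ℝ)) → (Fin p → ℝ) × (Fin nu → ℝ) :=
    fun z => (S.B (profileState h P₂ P₀ ψ₁ ψ₂ (ℓ z), τ z), St (ℓ z)) with hF
  have hsm : ∀ᶠ z in 𝓝 z₀, ContDiffAt ℝ ∞ F z := by
    filter_upwards [hreg, hpt.eventually (eventually_contDiffAt_B hII), hℓt.eventually hSt]
      with z h1 h2 h3
    have h4 : ContDiffAt ℝ ∞ (fun z => (profileState h P₂ P₀ ψ₁ ψ₂ (ℓ z), τ z)) z :=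
      (ContDiffAt.comp z h1.smooth_profile ℓ.contDiff.contDiffAt).prodMk τ.contDiff.contDiffAt
    exact (ContDiffAt.comp z (g := S.B) h2 h4).prodMk (ContDiffAt.comp z h3 ℓ.contDiff.contDiffAt)
  obtain ⟨D, hD, hDv⟩ := hasFDerivAt_profileState (P₂ := P₂) (P₀ := P₀) hI hII hψ.1 hψ₂.1 hD₁ hD₂
  have hDB := ((eventually_contDiffAt_B hII).self_of_nhds.differentiableAt (by simp)).hasFDerivAt
  have hDS := (hSt.self_of_nhds.differentiableAt (by simp)).hasFDerivAt
  have hDF : HasFDerivAt F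
      ((fderiv ℝ S.B (S.corner, 0) ∘L ((D ∘L ℓ).prod τ)).prod
        (fderiv ℝ St (0, S.corner.1) ∘L ℓ)) z₀ := by
    have h1 : HasFDerivAt (fun z => profileState h P₂ P₀ ψ₁ ψ₂ (ℓ z)) (D ∘L ℓ) z₀ :=
      HasFDerivAt.comp z₀ (g := profileState h P₂ P₀ ψ₁ ψ₂) (by rw [hℓ0]; exact hD) ℓ.hasFDerivAt
    have h2 : HasFDerivAt (fun z => (profileState h P₂ P₀ ψ₁ ψ₂ (ℓ z), τ z)) ((D ∘L ℓ).prod τ) z₀ :=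
      h1.prodMk τ.hasFDerivAt
    refine HasFDerivAt.prodMk (HasFDerivAt.comp z₀ (g := S.B) ?_ h2)
      (HasFDerivAt.comp z₀ (g := St) (by rw [hℓ0]; exact hDS) ℓ.hasFDerivAt)
    rw [hℓ0, hp0]
    exact hDB
  set DF := (fderiv ℝ S.B (S.corner, 0) ∘L ((D ∘L ℓ).prod τ)).prod
    (fderiv ℝ St (0, S.corner.1) ∘L ℓ) with hDFd
  -- As `St` vanishes on `w₂ = 0`, variations of `u∞` do not enter its linearization.
  have hj₂ : jac₂ St (0, S.corner.1) = 0 :=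
    jac₂_eq_zero_of_eventually (hSt.self_of_nhds.differentiableAt (by simp)) hSt0
  have hinj : Function.Injective
      (DF ∘L ContinuousLinearMap.inr ℝ ((Fin mS → ℝ) × ℝ) ((Fin n₁ → ℝ) × (Fin k → ℝ))) := by
    rw [injective_iff_map_eq_zero]
    rintro ⟨α, y⟩ hy
    have h1 : fderiv ℝ S.B (S.corner, 0) (D (y, RU *ᵥ α + RS *ᵥ 0), 0) = 0 :=
      congrArg Prod.fst hy
    have h2 : fderiv ℝ St (0, S.corner.1) (y, RU *ᵥ α + RS *ᵥ 0) = 0 := congrArg Prod.snd hy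
    rw [fderiv_eq_jac, hj₂, Matrix.zero_mulVec, add_zero] at h2
    rw [Matrix.mulVec_zero, add_zero, hDv, ← frozen_B_mulVec (A₀ := A₀) hII,
      ← coupling_corner hI hII] at h1
    have hreg := frozen_isRegular hI hII hIII
    have h3 := hGKC.injective hreg hP hp
      (hRU.mem_span hreg.symm_A11 hreg.isUnit_A11 hreg.posDef_A01 (A1_corner hI hII).1 α)
      (hker y h2) h1
    rw [hRU.eq_zero h3.1, h3.2]
    rfl
  have hfin : Module.finrank ℝ ((Fin n₁ → ℝ) × (Fin k → ℝ)) =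
      Module.finrank ℝ ((Fin p → ℝ) × (Fin nu → ℝ)) := by
    simp [hdim]
  let e := (LinearMap.linearEquivOfInjective
    (DF ∘L ContinuousLinearMap.inr ℝ ((Fin mS → ℝ) × ℝ) ((Fin n₁ → ℝ) × (Fin k → ℝ))).toLinearMap
    hinj hfin).toContinuousLinearEquiv
  have hDF' : HasFDerivAt F ((DF ∘L ContinuousLinearMap.inl ℝ _ _).coprod
      (e : (Fin n₁ → ℝ) × (Fin k → ℝ) →L[ℝ] (Fin p → ℝ) × (Fin nu → ℝ))) z₀ := by
    refine hDF.congr_fderiv (ContinuousLinearMap.ext fun z => ?_)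
    show DF z = DF (z.1, 0) + DF (0, z.2)
    rw [← map_add, Prod.mk_add_mk, add_zero, zero_add]
  obtain ⟨Ψ, hΨ, -⟩ := exists_isImplicitSolution
    (Φ := fun (y : (Fin n₁ → ℝ) × (Fin k → ℝ)) (x : (Fin mS → ℝ) × ℝ) => F (x, y))
    (y₀ := (αo, 0)) (x₀ := (βo, 0)) hsm (by
      show (S.B (profileState h P₂ P₀ ψ₁ ψ₂ (ℓ z₀), τ z₀), St (ℓ z₀)) = 0
      rw [hℓ0, hp0, hSt0.self_of_nhds]
      exact Prod.ext hII.consistent rfl) hDF'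
  exact ⟨Ψ, hΨ⟩

end RelaxationProblem

end RelaxationLayer

/-! ### Assembly of the main theorem. -/

theorem mainTheorem4 {m r p k n₀ n₁ mS : ℕ}
    (S : RelaxationLayer.RelaxationProblem m r p)
    (A₀ : RelaxationLayer.State m r → Matrix (Fin m ⊕ Fin r) (Fin m ⊕ Fin r) ℝ)
    (h : (Fin m → ℝ) → (Fin r → ℝ))
    (hI : S.AssumptionI A₀ h) (hII : S.AssumptionII) (hIII : S.AssumptionIII h n₀)
    (hk : k + n₀ = r)
    (hp : RelaxationLayer.numPosEig (S.A1 A₀ h S.corner) = p)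
    (hn₁ : RelaxationLayer.numPosEig (S.A1 A₀ h S.corner).toBlocks₁₁ = n₁)
    (P₂ : Matrix (Fin r) (Fin k) ℝ) (P₀ : Matrix (Fin r) (Fin n₀) ℝ)
    (hP : (S.frozen A₀ h S.corner).IsSpectralFrame P₂ P₀)
    (hGKC : (S.frozen A₀ h S.corner).ModifiedGKC P₂ P₀)
    (RU : Matrix (Fin m) (Fin n₁) ℝ) (RS : Matrix (Fin m) (Fin mS) ℝ)
    (hRU : RelaxationLayer.IsRightUnstable
      (RelaxationLayer.toC (S.fuh h S.corner)) (RelaxationLayer.toC RU))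
    (hRS : RelaxationLayer.IsRightStable
      (RelaxationLayer.toC (S.fuh h S.corner)) (RelaxationLayer.toC RS))
    (αo : Fin n₁ → ℝ) (βo : Fin mS → ℝ)
    (hαβ : S.corner.1 = RelaxationLayer.RelaxationProblem.uInf RU RS αo βo) :
    (∃ Q₂ Q₀, S.IsLocalFrame A₀ h P₂ P₀ Q₂ Q₀) ∧
    ∃ ψ₁ : (Fin r → ℝ) × (Fin m → ℝ) → (Fin m → ℝ),
      RelaxationLayer.IsImplicitSolution (S.phi1 h) 0 (0, S.corner.1) ψ₁ ∧
      RelaxationLayer.jac₁ ψ₁ (0, S.corner.1) =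
        -((S.fuh h S.corner)⁻¹ * RelaxationLayer.jac₂ S.f S.corner) ∧
      RelaxationLayer.jac₂ ψ₁ (0, S.corner.1) = 0 ∧
      ∀ Q₂ Q₀, S.IsLocalFrame A₀ h P₂ P₀ Q₂ Q₀ →
        ∃ ψ₂ : (Fin k → ℝ) × (Fin m → ℝ) → (Fin n₀ → ℝ),
          RelaxationLayer.IsImplicitSolution (S.phi2 A₀ h P₂ P₀ Q₀ ψ₁) 0 (0, S.corner.1) ψ₂ ∧
          RelaxationLayer.jac₁ ψ₂ (0, S.corner.1) =
            -((P₀ᵀ * (S.frozen A₀ h S.corner).S * P₀)⁻¹ *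
              (P₀ᵀ * (S.frozen A₀ h S.corner).S * P₂)) ∧
          RelaxationLayer.jac₂ ψ₂ (0, S.corner.1) = 0 ∧
          -- the Jacobian of the reduced dynamical system at the critical point
          RelaxationLayer.jac₁ (S.Hfield A₀ h P₂ P₀ ψ₁ ψ₂) (0, S.corner.1) =
            ((S.frozen A₀ h S.corner).Lam2 P₂)⁻¹ * (S.frozen A₀ h S.corner).G2 P₂ P₀ ∧
          RelaxationLayer.numNegEig
            (RelaxationLayer.jac₁ (S.Hfield A₀ h P₂ P₀ ψ₁ ψ₂) (0, S.corner.1)) + n₁ = p ∧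
          ∃ nu : ℕ, nu + p = k + n₁ ∧
            RelaxationLayer.numPosEig
              (RelaxationLayer.jac₁ (S.Hfield A₀ h P₂ P₀ ψ₁ ψ₂) (0, S.corner.1)) = nu ∧
            ∃ (V : Set (Fin k → ℝ)) (N : Set (Fin m → ℝ))
              (St : (Fin k → ℝ) × (Fin m → ℝ) → (Fin nu → ℝ)),
              IsOpen V ∧ 0 ∈ V ∧ IsOpen N ∧ S.corner.1 ∈ N ∧
              (∀ x ∈ V ×ˢ N, IsUnit (S.Kmat A₀ h P₂ P₀ ψ₁ ψ₂ x)) ∧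
              ContDiffOn ℝ ∞ (S.Hfield A₀ h P₂ P₀ ψ₁ ψ₂) (V ×ˢ N) ∧
              ContDiffOn ℝ ∞ St (V ×ˢ N) ∧
              -- the stable manifold is the zero set of `St`
              (∀ uinf ∈ N,
                S.Hfield A₀ h P₂ P₀ ψ₁ ψ₂ (0, uinf) = 0 ∧ St (0, uinf) = 0 ∧
                RelaxationLayer.IsLeftUnstable
                  (RelaxationLayer.toC
                    (RelaxationLayer.jac₁ (S.Hfield A₀ h P₂ P₀ ψ₁ ψ₂) (0, uinf)))
                  (RelaxationLayer.toC (RelaxationLayer.jac₁ St (0, uinf))) ∧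
                ∀ w ∈ V, St (w, uinf) = 0 ↔
                  w ∈ RelaxationLayer.localStableSet
                    (fun w' => S.Hfield A₀ h P₂ P₀ ψ₁ ψ₂ (w', uinf)) V) ∧
              -- the reduced boundary condition `α = αt(β,t)` and the initial value `w2t(β,t)`
              ∃ (αt : (Fin mS → ℝ) × ℝ → (Fin n₁ → ℝ)) (w2t : (Fin mS → ℝ) × ℝ → (Fin k → ℝ)),
                RelaxationLayer.IsImplicitSolution
                  (fun (y : (Fin n₁ → ℝ) × (Fin k → ℝ)) (x : (Fin mS → ℝ) × ℝ) =>
                    (S.B (RelaxationLayer.RelaxationProblem.profileState h P₂ P₀ ψ₁ ψ₂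
                        (y.2, RelaxationLayer.RelaxationProblem.uInf RU RS y.1 x.1), x.2),
                      St (y.2, RelaxationLayer.RelaxationProblem.uInf RU RS y.1 x.1)))
                  (αo, 0) (βo, 0) (fun x => (αt x, w2t x)) ∧
                ∃ 𝒱 ∈ 𝓝 S.corner,
                  -- existence of the boundary-layer
                  (∀ᶠ x in 𝓝 (βo, (0 : ℝ)), ∃ W : ℝ → (Fin k → ℝ),
                    W 0 = w2t x ∧
                    RelaxationLayer.IsDecayingOrbit
                      (fun w' => S.Hfield A₀ h P₂ P₀ ψ₁ ψ₂
                        (w', RelaxationLayer.RelaxationProblem.uInf RU RS (αt x) x.1)) V W ∧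
                    S.IsBoundaryLayer h
                      (RelaxationLayer.RelaxationProblem.uInf RU RS (αt x) x.1) x.2
                      (fun ξ => RelaxationLayer.RelaxationProblem.profileState h P₂ P₀ ψ₁ ψ₂
                        (W ξ, RelaxationLayer.RelaxationProblem.uInf RU RS (αt x) x.1)) ∧
                    ∀ ξ, 0 ≤ ξ → RelaxationLayer.RelaxationProblem.profileState h P₂ P₀ ψ₁ ψ₂
                        (W ξ, RelaxationLayer.RelaxationProblem.uInf RU RS (αt x) x.1) ∈ 𝒱) ∧
                  -- necessity of the reduced boundary condition
                  (∀ᶠ z in 𝓝 ((βo, (0 : ℝ)), αo),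
                    (∃ U : ℝ → RelaxationLayer.State m r,
                      S.IsBoundaryLayer h
                        (RelaxationLayer.RelaxationProblem.uInf RU RS z.2 z.1.1) z.1.2 U ∧
                      ∀ ξ, 0 ≤ ξ → U ξ ∈ 𝒱) → z.2 = αt z.1) := by


  refine ⟨RelaxationLayer.RelaxationProblem.exists_isLocalFrame hI hII hIII hk hP, ?_⟩
  obtain ⟨ψ₁, hψ₁, hD₁⟩ := RelaxationLayer.RelaxationProblem.exists_psi1 hI hII hIII
  refine ⟨ψ₁, hψ₁, RelaxationLayer.HasFDerivAt.jac₁_eq hD₁ fun v => by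
      rw [Matrix.neg_mulVec]; rfl,
    RelaxationLayer.HasFDerivAt.jac₂_eq hD₁ fun v => ?_, fun Q₂ Q₀ hQ => ?_⟩
  · rw [Matrix.zero_mulVec]
    exact neg_eq_zero.2 (Matrix.mulVec_zero ((S.fuh h S.corner)⁻¹ * RelaxationLayer.jac₂ S.f S.corner))
  obtain ⟨ψ₂, hψ₂, hD₂⟩ := RelaxationLayer.RelaxationProblem.exists_psi2 hI hII hIII hP hψ₁ hQ
  have hreg := RelaxationLayer.RelaxationProblem.frozen_isRegular hI hII hIII
  -- The positive eigenvalues of `A₁` split into the `n₁` of `A₁₁` and those of `Λ₂`; the latter are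
  -- as many as the negative eigenvalues of the reduced linearization.
  have hcount := RelaxationLayer.RelaxationProblem.numPosEig_corner hI hII hIII hP
  rw [hp] at hcount
  have hJ := RelaxationLayer.RelaxationProblem.jac₁_Hfield hI hII hIII hP hψ₁ hψ₂ hD₁ hD₂
  obtain ⟨X, e, hX, he, hXe, hcard⟩ := RelaxationLayer.LinearProblem.exists_diag_reduced hreg hP
  have hXe' := hXe
  rw [← hJ] at hXe'
  have hneg := RelaxationLayer.numNegEig_of_diag hX hXe'
  have hpos := RelaxationLayer.numPosEig_of_diag hX hXe'
  have hsum := RelaxationLayer.card_pos_add_card_neg he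
  rw [Fintype.card_fin] at hsum
  have hn₁' : RelaxationLayer.numPosEig (S.frozen A₀ h S.corner).A11 = n₁ := hn₁
  refine ⟨ψ₂, hψ₂, RelaxationLayer.HasFDerivAt.jac₁_eq hD₂ fun v => by
      rw [Matrix.neg_mulVec]; rfl,
    RelaxationLayer.HasFDerivAt.jac₂_eq hD₂ fun v => ?_, hJ, by omega,
    Fintype.card {i // 0 < e i}, by omega, hpos, ?_⟩
  · rw [Matrix.zero_mulVec]
    exact neg_eq_zero.2 (Matrix.mulVec_zero ((P₀ᵀ * (S.frozen A₀ h S.corner).S * P₀)⁻¹ *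
      (P₀ᵀ * (S.frozen A₀ h S.corner).S * P₂)))
  have hu2 : Tendsto (fun x : (Fin k → ℝ) × (Fin m → ℝ) => x.2) (𝓝 (0, S.corner.1))
      (𝓝 S.corner.1) := continuous_snd.tendsto _
  -- The local properties are collected first, so that the neighbourhoods of the stable manifold can
  -- be chosen inside their domain of validity.
  have h𝒰 : ∀ᶠ x in 𝓝 ((0 : Fin k → ℝ), S.corner.1), S.IsGoodPoint A₀ h P₂ P₀ Q₀ ψ₁ ψ₂ x ∧
      (ContDiffAt ℝ ∞ h x.2 ∧ (x.2, h x.2) ∈ S.equil) ∧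
      RelaxationLayer.RelaxationProblem.profileState h P₂ P₀ ψ₁ ψ₂ (0, x.2) = (x.2, h x.2) ∧
      S.Hfield A₀ h P₂ P₀ ψ₁ ψ₂ (0, x.2) = 0 :=
    (RelaxationLayer.RelaxationProblem.eventually_isGoodPoint hI hII hIII hP hQ hψ₁ hψ₂).and
      ((hu2.eventually (RelaxationLayer.RelaxationProblem.eventually_equil hI hII)).and
        ((hu2.eventually
          (RelaxationLayer.RelaxationProblem.profileState_zero hI hII hψ₁ hψ₂)).and
          (hu2.eventually (RelaxationLayer.RelaxationProblem.Hfield_zero hψ₂))))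
  obtain ⟨V, N, St, C, hVo, hV0, hNo, hN0, hVN, hStc, hker, hSt⟩ :=
    RelaxationLayer.exists_local_stable_manifold
      (RelaxationLayer.RelaxationProblem.eventually_contDiffAt_Hfield hI hII hIII hP hψ₁ hψ₂)
      (RelaxationLayer.RelaxationProblem.Hfield_zero hψ₂) hX he hXe'
      (Fintype.equivFin {i // 0 < e i}).symm h𝒰
  have hgood : ∀ w ∈ V, ∀ u ∈ N, S.IsGoodPoint A₀ h P₂ P₀ Q₀ ψ₁ ψ₂ (w, u) := fun w hw u hu =>
    (hVN (mk_mem_prod hw hu)).1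
  have hN : ∀ u ∈ N, (ContDiffAt ℝ ∞ h u ∧ (u, h u) ∈ S.equil) ∧
      RelaxationLayer.RelaxationProblem.profileState h P₂ P₀ ψ₁ ψ₂ (0, u) = (u, h u) ∧
      S.Hfield A₀ h P₂ P₀ ψ₁ ψ₂ (0, u) = 0 := fun u hu => (hVN (mk_mem_prod hV0 hu)).2
  refine ⟨V, N, St, hVo, hV0, hNo, hN0, fun x hx => (hgood x.1 hx.1 x.2 hx.2).isUnit_Kmat,
    fun x hx => (hgood x.1 hx.1 x.2 hx.2).smooth_H.contDiffWithinAt, hStc,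
    fun u hu => ⟨(hN u hu).2.2, (hSt u hu).1, (hSt u hu).2.1, fun w hw => ((hSt u hu).2.2 w hw).1⟩, ?_⟩
  have hVN0 : V ×ˢ N ∈ 𝓝 ((0 : Fin k → ℝ), S.corner.1) :=
    prod_mem_nhds (hVo.mem_nhds hV0) (hNo.mem_nhds hN0)
  obtain ⟨Ψ, hΨ⟩ := RelaxationLayer.RelaxationProblem.exists_reduced_boundary_condition
    (nu := Fintype.card {i // 0 < e i}) hI hII hIII hP hGKC hcount (by omega) hRU hαβ hψ₁ hψ₂ hD₁ hD₂
    (St := St)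
    (by
      filter_upwards [(hVo.prod hNo).mem_nhds (mk_mem_prod hV0 hN0)] with x hx
      exact hStc.contDiffAt ((hVo.prod hNo).mem_nhds hx))
    (by filter_upwards [hNo.mem_nhds hN0] with u hu using (hSt u hu).1)
    (fun y hy => RelaxationLayer.mem_span_eigenvectors hX hXe (P := fun z => z < 0) fun i hi =>
      hker y hy i (lt_of_le_of_ne (not_lt.1 hi) (he i).symm))
  refine ⟨fun x => (Ψ x).1, fun x => (Ψ x).2, hΨ, ?_⟩
  -- a neighbourhood in which boundary layers are profiles
  have hα : Tendsto (fun y : RelaxationLayer.State m r × (((Fin mS → ℝ) × ℝ) × (Fin n₁ → ℝ)) =>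
      RelaxationLayer.RelaxationProblem.uInf RU RS y.2.2 y.2.1.1)
      (𝓝 (S.corner, ((βo, 0), αo))) (𝓝 S.corner.1) := by
    have h1 : Continuous fun y : RelaxationLayer.State m r × (((Fin mS → ℝ) × ℝ) × (Fin n₁ → ℝ)) =>
        RU *ᵥ y.2.2 + RS *ᵥ y.2.1.1 := by fun_prop
    have h2 := h1.tendsto (S.corner, ((βo, 0), αo))
    rw [hαβ]
    exact h2
  have hUt : Tendsto (fun y : RelaxationLayer.State m r × (((Fin mS → ℝ) × ℝ) × (Fin n₁ → ℝ)) => y.1)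
      (𝓝 (S.corner, ((βo, 0), αo))) (𝓝 S.corner) := continuous_fst.tendsto _
  have hwt := (RelaxationLayer.RelaxationProblem.tendsto_fastCoord hI hII P₂).comp hUt
  have hzt : Tendsto (fun y : RelaxationLayer.State m r × (((Fin mS → ℝ) × ℝ) × (Fin n₁ → ℝ)) =>
      (y.2.1, (y.2.2, RelaxationLayer.RelaxationProblem.fastCoord h P₂ y.1)))
      (𝓝 (S.corner, ((βo, 0), αo))) (𝓝 ((βo, 0), (αo, 0))) := by
    have h1 : Continuous fun y : RelaxationLayer.State m r × (((Fin mS → ℝ) × ℝ) × (Fin n₁ → ℝ)) =>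
        y.2.1 := by fun_prop
    have h2 : Continuous fun y : RelaxationLayer.State m r × (((Fin mS → ℝ) × ℝ) × (Fin n₁ → ℝ)) =>
        y.2.2 := by fun_prop
    exact (h1.tendsto _).prodMk_nhds ((h2.tendsto _).prodMk_nhds hwt)
  have hev := ((hUt.prodMk_nhds hα).eventually
    (RelaxationLayer.RelaxationProblem.eventually_isGoodPair hI hII hIII hP hQ hψ₁ hψ₂)).and
    ((hα.eventually (hNo.mem_nhds hN0)).and ((hwt.eventually (hVo.mem_nhds hV0)).and
      (hzt.eventually hΨ.eventually_iff)))
  -- A product neighbourhood, so that `𝒱` does not depend on `(β, t, α)`.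
  obtain ⟨𝒱, h𝒱, 𝒩, h𝒩, hsub⟩ := mem_nhds_prod_iff.1 hev
  refine ⟨𝒱, h𝒱, ?_, ?_⟩
  · have hΨt : Tendsto Ψ (𝓝 (βo, 0)) (𝓝 (αo, 0)) := by
      have h1 := hΨ.continuousAt.tendsto
      rwa [hΨ.1] at h1
    have hut : Tendsto (fun x : (Fin mS → ℝ) × ℝ =>
        RelaxationLayer.RelaxationProblem.uInf RU RS (Ψ x).1 x.1) (𝓝 (βo, 0)) (𝓝 S.corner.1) := by
      have h1 : Continuous fun y : ((Fin mS → ℝ) × ℝ) × ((Fin n₁ → ℝ) × (Fin k → ℝ)) =>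
          RU *ᵥ y.2.1 + RS *ᵥ y.1.1 := by fun_prop
      have h2 := (h1.tendsto ((βo, 0), (αo, 0))).comp (tendsto_id.prodMk_nhds hΨt)
      rw [hαβ]
      exact h2
    have hw2 : Tendsto (fun x => (Ψ x).2) (𝓝 (βo, 0)) (𝓝 0) :=
      (continuous_snd.tendsto _).comp hΨt
    -- `𝒱` is already fixed, so the profile has to be kept inside it: the orbit is bounded by `C`
    -- times its initial value, which tends to zero.
    obtain ⟨A, hA, A', hA', hAA⟩ := mem_nhds_prod_iff.1
      ((RelaxationLayer.RelaxationProblem.tendsto_profileState hI hII hψ₁ hψ₂) h𝒱)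
    obtain ⟨δ, hδ, hδA⟩ := Metric.mem_nhds_iff.1 hA
    have hCw : Tendsto (fun x => C * ‖(Ψ x).2‖) (𝓝 (βo, 0)) (𝓝 0) := by
      have h1 := hw2.norm.const_mul C
      rwa [norm_zero, mul_zero] at h1
    filter_upwards [hΨ.eventually_eq_zero, hut.eventually (hNo.mem_nhds hN0), hut.eventually hA',
      hw2.eventually (hVo.mem_nhds hV0), hCw.eventually_lt_const hδ] with x h1 h2 h3 h4 h5
    have h6 := congrArg Prod.fst h1
    obtain ⟨W, hW0, hW, hWC⟩ := ((hSt _ h2).2.2 _ h4).2 (congrArg Prod.snd h1)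
    refine ⟨W, hW0, hW, RelaxationLayer.RelaxationProblem.isBoundaryLayer_profile hI
      (fun w hw => hgood w hw _ h2) hV0 hW (hN _ h2).1.2 (hN _ h2).2.1 (by rw [hW0]; exact h6),
      fun ξ hξ => hAA (mk_mem_prod (hδA ?_) h3)⟩
    rw [mem_ball_zero_iff]
    refine (hWC ξ hξ).trans_lt ?_
    exact h5
  · filter_upwards [h𝒩] with z hz
    rintro ⟨U, hU, hU𝒱⟩
    have h1 := fun ξ (hξ : 0 ≤ ξ) => hsub (mk_mem_prod (hU𝒱 ξ hξ) hz)
    have h2 := h1 0 le_rfl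
    have huN := h2.2.1
    obtain ⟨hW, hW0⟩ := hU.exists_orbit hI hP (hN _ huN).1.1.continuousAt (fun ξ hξ => (h1 ξ hξ).1)
      (V := V) fun ξ hξ => (h1 ξ hξ).2.2.1
    -- The layer is a decaying orbit in `V`, so its initial value is on the stable manifold. With
    -- the boundary condition this is the reduced system, whose local uniqueness determines `α`.
    have h3 := ((hSt _ huN).2.2 _ h2.2.2.1).1.2 ⟨_, rfl, hW⟩
    have h4 := h2.2.2.2.1 (Prod.ext (by
      show S.B (RelaxationLayer.RelaxationProblem.profileState h P₂ P₀ ψ₁ ψ₂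
        (RelaxationLayer.RelaxationProblem.fastCoord h P₂ (U 0),
          RelaxationLayer.RelaxationProblem.uInf RU RS z.2 z.1.1), z.1.2) = 0
      rw [hW0, hU.boundary]) h3)
    exact congrArg Prod.fst h4
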